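/- **Setting.** All manifolds and maps are $C^\infty$. A *distribution* of rank $k$ is a rank-$k$ subbundle of the tangent bundle; $D^2=D+[D,D]$ and $D^3=D^2+[D,D^2]$. A rank-2 distribution $D$ on a 4-manifold $Q$ (possibly with boundary) is an *Engel structure* if $D^2$ is a distribution of rank 3 and $D^3=TQ$. Its *characteristic line field* $L\subset D$ is defined by $[L,D^2]\equiv 0 \bmod D^2$. An *Engel isomorphism* is a diffeomorphism taking one Engel structure to the other. Let $(M,\xi)$ be a contact 3-manifold without boundary (Hausdorff, second countable) whose contact plane field $\xi$ has a global frame. Let $S\xi\to M$ be the bundle of rays in the planes of $\xi$, so that $S\xi\cong M\times S^1$, with its canonical Engel structure $\mathcal D_0$: at a ray $r\subset\xi_m$, $\mathcal D_0$ is the preimage of the line spanned by $r$ under the differential of the projection $S\xi\to M$. A Legendrian direction field is a smooth section $V:M\to S\xi$. For nowhere collinear Legendrian direction fields $V_0,V_1$, the *standard Engel domain* $\Omega(V_0,V_1)\subset S\xi$ consists of all rays spanned by vectors $aV_0(m)+bV_1(m)$ with $a,b\ge 0$ not both zero; the image of $V_0$ is its *bottom*, the image of $V_1$ its *top*. For a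 diffeomorphism $\phi$ of $M$ preserving $\xi$ and a Legendrian direction field $V$, $\phi^*V$ is the direction field with $d\phi\,(\phi^*V(m))=V(\phi(m))$. **Theorem 1.** Fix $\Omega=\Omega(V_0,V_1)$ and let $\mathcal D_t$, $|t|<\varepsilon$, be a deformation of the canonical structure on $\Omega$: a smooth family of Engel structures on $\Omega$ with $\mathcal D_t|_{t=0}=\mathcal D_0$, constant in $t$ outside a compact subset of $\Omega$ (no condition if $M$ is compact). (1) There is $\delta>0$ and, for $|t|<\delta$, there are nowhere collinear Legendrian direction fields $V_{0t},V_{1t}$ and an Engel isomorphism $$\psi_t:(\Omega,\mathcal D_t)\to(\Omega(V_{0t},V_{1t}),\mathcal D_0),$$ all depending smoothly on $t$, with $V_{00}=V_0$, $V_{10}=V_1$ and $\psi_0=\mathrm{id}$. (2) Suppose in addition that $\mathcal D_t=\mathcal D_0$ for all $t$ on fixed neighborhoods of the top and the bottom of $\Omega$. Then there is $\delta>0$ such that for $|t|<\delta$ there is a diffeomorphism $\phi_t$ of $M$ preserving $\xi$, determined by the deformation as its *bottom-to-top map*: for all $m,m'\in M$, the bottom point $V_0(m)$ and the top point $V_1(m')$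 lie on the same leaf in $\Omega$ of the characteristic line field of $\mathcal D_t$ if and only if $m'=\phi_t(m)$. Moreover $V_0$ and $\phi_t^*V_1$ are nowhere collinear, and in (1) one may take $V_{0t}=V_0$ and $V_{1t}=\phi_t^*V_1$: there is an Engel isomorphism $\psi_t:(\Omega,\mathcal D_t)\to(\Omega(V_0,\phi_t^*V_1),\mathcal D_0)$. Here $\phi_t$, $\phi_t^*V_1$ and $\psi_t$ depend smoothly on $t$, with $\phi_0=\mathrm{id}$ and $\psi_0=\mathrm{id}$. -/

import Mathlib

open scoped Manifold ContDiff Topology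

noncomputable section

namespace Engel

section General

variable {E : Type*} [NormedAddCommGroup E] [NormedSpace ℝ E]
  {H : Type*} [TopologicalSpace H] (I : ModelWithCorners ℝ E H)
  {N : Type*} [TopologicalSpace N] [ChartedSpace H N] [IsManifold I ∞ N]

/-! Distributions (plane fields) on a subset `S` of a manifold `N`; in the applications `S` is either
all of `N` or a domain with smooth boundary in `N`. -/

/-- `X` is a smooth vector field on a neighbourhood of `q` in `S` with values in the plane field `D`:
a germ at `q` of a section of `D`. -/
def IsLocalSection (S : Set N) (D : ∀ q : N, Submodule ℝ (TangentSpace I q)) (q : N)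
    (X : ∀ q : N, TangentSpace I q) : Prop :=
  ∃ U ∈ 𝓝 q, ContMDiffOn I I.tangent ∞ (fun p => (⟨p, X p⟩ : TangentBundle I N)) (U ∩ S) ∧
    ∀ p ∈ U ∩ S, X p ∈ D p

/-- `D` is a smooth distribution of rank `k` on `S`: it has smooth local frames. -/
def IsDistribution (S : Set N) (k : ℕ) (D : ∀ q : N, Submodule ℝ (TangentSpace I q)) : Prop :=
  ∀ q ∈ S, ∃ U ∈ 𝓝 q, ∃ F : Fin k → ∀ p : N, TangentSpace I p,
    (∀ i, ContMDiffOn I I.tangent ∞ (fun p => (⟨p, F i p⟩ : TangentBundle I N)) (U ∩ S)) ∧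
    ∀ p ∈ U ∩ S, LinearIndependent ℝ (fun i => F i p) ∧
      D p = Submodule.span ℝ (Set.range fun i => F i p)

/-- `D t`, for `t` in `J`, is a family of distributions of rank `k` on `S` that is smooth in all
variables, the parameter included. -/
def IsSmoothFamily (J : Set ℝ) (S : Set N) (k : ℕ)
    (D : ℝ → ∀ q : N, Submodule ℝ (TangentSpace I q)) : Prop :=
  ∀ t ∈ J, ∀ q ∈ S, ∃ U ∈ 𝓝 (t, q), ∃ F : Fin k → ℝ → ∀ p : N, TangentSpace I p,
    (∀ i, ContMDiffOn (𝓘(ℝ, ℝ).prod I) I.tangent ∞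
      (fun x : ℝ × N => (⟨x.2, F i x.1 x.2⟩ : TangentBundle I N)) (U ∩ J ×ˢ S)) ∧
    ∀ x ∈ U ∩ J ×ˢ S, LinearIndependent ℝ (fun i => F i x.1 x.2) ∧
      D x.1 x.2 = Submodule.span ℝ (Set.range fun i => F i x.1 x.2)

/-- The values at `q` of `A + B + [A, B]`: the span of the values at `q` of the local sections of
`A` and of `B` and of all their Lie brackets. -/
def bracketSum (S : Set N) (A B : ∀ q : N, Submodule ℝ (TangentSpace I q)) (q : N) :
    Submodule ℝ (TangentSpace I q) :=
  A q ⊔ B q ⊔ Submodule.span ℝ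
    {v | ∃ X Y : ∀ p : N, TangentSpace I p, IsLocalSection I S A q X ∧ IsLocalSection I S B q Y ∧
      v = VectorField.mlieBracketWithin I X Y S q}

/-- `D² = D + [D, D]`. -/
def sq (S : Set N) (D : ∀ q : N, Submodule ℝ (TangentSpace I q)) :
    ∀ q : N, Submodule ℝ (TangentSpace I q) :=
  bracketSum I S D D

/-- `D³ = D² + [D, D²]`. -/
def cube (S : Set N) (D : ∀ q : N, Submodule ℝ (TangentSpace I q)) :
    ∀ q : N, Submodule ℝ (TangentSpace I q) :=
  bracketSum I S D (sq I S D)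

/-- An Engel structure on `S` (used when `N` has dimension four): `D` has rank 2, `D²` is a
distribution of rank 3, and `D³` is the whole tangent bundle. -/
structure IsEngel (S : Set N) (D : ∀ q : N, Submodule ℝ (TangentSpace I q)) : Prop where
  rank_two : IsDistribution I S 2 D
  sq_rank_three : IsDistribution I S 3 (sq I S D)
  cube_eq_top : ∀ q ∈ S, cube I S D q = ⊤

/-- The characteristic line field `L ⊂ D` of an Engel structure, `[L, D²] ≡ 0 mod D²`: the values
at `q` of those local sections `X` of `D` that satisfy `[X, Y] q ∈ D² q` for all local sections `Y`
of `D²`. -/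
def charLine (S : Set N) (D : ∀ q : N, Submodule ℝ (TangentSpace I q)) (q : N) :
    Set (TangentSpace I q) :=
  {v | ∃ X : ∀ p : N, TangentSpace I p, IsLocalSection I S D q X ∧ X q = v ∧
    ∀ Y : ∀ p : N, TangentSpace I p, IsLocalSection I S (sq I S D) q Y →
      VectorField.mlieBracketWithin I X Y S q ∈ sq I S D q}

/-- `p` and `q` lie on the same leaf in `S` of the characteristic line field of `D`: they are joined
by a smooth curve in `S` tangent to it. -/
def SameLeaf (S : Set N) (D : ∀ q : N, Submodule ℝ (TangentSpace I q)) (p q : N) : Prop :=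
  ∃ γ : ℝ → N, ContMDiffOn 𝓘(ℝ, ℝ) I ∞ γ (Set.Icc 0 1) ∧ γ 0 = p ∧ γ 1 = q ∧
    ∀ s ∈ Set.Icc (0 : ℝ) 1, γ s ∈ S ∧
      mfderivWithin 𝓘(ℝ, ℝ) I γ (Set.Icc 0 1) s (1 : ℝ) ∈ charLine I S D (γ s)

/-- `ψ` restricts to a diffeomorphism from `S` onto `S'` that takes the distribution `D` to `D'`. -/
structure IsDistIso (S : Set N) (D : ∀ q : N, Submodule ℝ (TangentSpace I q))
    (S' : Set N) (D' : ∀ q : N, Submodule ℝ (TangentSpace I q)) (ψ : N → N) : Prop where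
  mapsTo : Set.MapsTo ψ S S'
  smooth : ContMDiffOn I I ∞ ψ S
  exists_inverse : ∃ χ : N → N, Set.MapsTo χ S' S ∧ ContMDiffOn I I ∞ χ S' ∧
    (∀ q ∈ S, χ (ψ q) = q) ∧ ∀ q ∈ S', ψ (χ q) = q
  map_eq : ∀ q ∈ S,
    (D q).map (mfderivWithin I I ψ S q : TangentSpace I q →ₗ[ℝ] TangentSpace I (ψ q)) = D' (ψ q)

/-- A contact structure (used when `N` has dimension three): a 2-plane field `ξ` with
`ξ + [ξ, ξ] = TN`. -/
structure IsContact (ξ : ∀ q : N, Submodule ℝ (TangentSpace I q)) : Prop where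
  rank_two : IsDistribution I Set.univ 2 ξ
  sq_eq_top : ∀ q, sq I Set.univ ξ q = ⊤

end General

section Prolongation

variable {M : Type*} [TopologicalSpace M] [ChartedSpace (EuclideanSpace ℝ (Fin 3)) M]
  [IsManifold (𝓡 3) ∞ M]

/-! The oriented prolongation `Sξ` of a contact structure `ξ` on a three-manifold `M`, where `ξ` is
parallelized by two vector fields `X`, `Y`. The frame identifies `Sξ`, the bundle of rays in the
planes of `ξ`, with the manifold `M × Circle`: the point `(m, z)` is the ray spanned by
`Re z • X m + Im z • Y m`. Legendrian direction fields, that is sections of `Sξ`, are given by maps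
`M → Circle`. -/

/-- The model with corners of `M × Circle`. -/
abbrev SI : ModelWithCorners ℝ (EuclideanSpace ℝ (Fin 3) × EuclideanSpace ℝ (Fin 1))
    (ModelProd (EuclideanSpace ℝ (Fin 3)) (EuclideanSpace ℝ (Fin 1))) :=
  (𝓡 3).prod (𝓡 1)

/-- `X`, `Y` is a smooth global frame of `ξ`. -/
structure IsFrame (ξ : ∀ m : M, Submodule ℝ (TangentSpace (𝓡 3) m))
    (X Y : ∀ m : M, TangentSpace (𝓡 3) m) : Prop where
  smooth_left : ContMDiff (𝓡 3) (𝓡 3).tangent ∞ (fun m => (⟨m, X m⟩ : TangentBundle (𝓡 3) M))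
  smooth_right : ContMDiff (𝓡 3) (𝓡 3).tangent ∞ (fun m => (⟨m, Y m⟩ : TangentBundle (𝓡 3) M))
  linearIndependent : ∀ m, LinearIndependent ℝ ![X m, Y m]
  span_eq : ∀ m, ξ m = Submodule.span ℝ {X m, Y m}

/-- A vector that spans the ray `q = (m, z)` in `ξ m`. -/
def rayVec (X Y : ∀ m : M, TangentSpace (𝓡 3) m) (q : M × Circle) : TangentSpace (𝓡 3) q.1 :=
  (q.2 : ℂ).re • X q.1 + (q.2 : ℂ).im • Y q.1

/-- The rays in the plane `ξ m` correspond to the points of `Sξ` over `m`: a nonzero vector of `ξ m`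
is a positive multiple of `rayVec X Y (m, z)` for exactly one `z`. -/
theorem existsUnique_ray {ξ : ∀ m : M, Submodule ℝ (TangentSpace (𝓡 3) m)}
    {X Y : ∀ m : M, TangentSpace (𝓡 3) m} (h : IsFrame ξ X Y) (m : M)
    (v : TangentSpace (𝓡 3) m) (hv : v ∈ ξ m) (hv0 : v ≠ 0) :
    ∃! z : Circle, ∃ c : ℝ, 0 < c ∧ v = c • rayVec X Y (m, z) := by
  rw [h.span_eq, Submodule.mem_span_pair] at hv
  obtain ⟨a, b, rfl⟩ := hv
  have hli := LinearIndependent.pair_iff.1 (h.linearIndependent m)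
  set w : ℂ := ⟨a, b⟩ with hw
  have hw0 : w ≠ 0 := by
    intro h0
    have ha : a = 0 := congrArg Complex.re h0
    have hb : b = 0 := congrArg Complex.im h0
    exact hv0 (by rw [ha, hb]; simp)
  have hn : 0 < ‖w‖ := norm_pos_iff.2 hw0
  have key : ∀ (z : Circle) (c : ℝ),
      a • X m + b • Y m = c • rayVec X Y (m, z) ↔ w = c * (z : ℂ) := by
    intro z c
    constructor
    · intro hz
      have h2 : (a - c * (z : ℂ).re) • X m + (b - c * (z : ℂ).im) • Y m = 0 := by
        rw [sub_smul, sub_smul, mul_smul, mul_smul,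
          ← sub_eq_zero.2 hz, rayVec, smul_add]
        abel
      obtain ⟨h3, h4⟩ := hli _ _ h2
      apply Complex.ext <;> simp [hw] <;> linarith
    · intro hz
      have h3 : a = c * (z : ℂ).re := by simpa [hw] using congrArg Complex.re hz
      have h4 : b = c * (z : ℂ).im := by simpa [hw] using congrArg Complex.im hz
      rw [rayVec, smul_add, smul_smul, smul_smul, h3, h4]
  have hz0 : w = (‖w‖ : ℝ) * (Circle.exp w.arg : ℂ) := by
    rw [Circle.coe_exp, Complex.norm_mul_exp_arg_mul_I]
  refine ⟨Circle.exp w.arg, ⟨‖w‖, hn, (key _ _).2 hz0⟩, ?_⟩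
  rintro z ⟨c, hc, hz⟩
  have hz1 := (key z c).1 hz
  have hcw : ‖w‖ = c := by
    rw [hz1, norm_mul, Circle.norm_coe, mul_one, Complex.norm_real, Real.norm_of_nonneg hc.le]
  rw [hcw] at hz0
  have hc' : (c : ℂ) ≠ 0 := by exact_mod_cast hc.ne'
  exact Circle.ext (mul_left_cancel₀ hc' (hz1.symm.trans hz0))

/-- The canonical distribution on `Sξ`: at a ray it is the preimage, under the differential of the
projection to `M`, of the line through that ray. -/
def canonical (X Y : ∀ m : M, TangentSpace (𝓡 3) m) (q : M × Circle) :
    Submodule ℝ (TangentSpace SI q) :=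
  (Submodule.span ℝ {rayVec X Y q}).comap
    (mfderiv SI (𝓡 3) (Prod.fst : M × Circle → M) q :
      TangentSpace SI q →ₗ[ℝ] TangentSpace (𝓡 3) q.1)

/-- The direction fields `V₀`, `V₁` are nowhere collinear. -/
def NeverCollinear (V₀ V₁ : M → Circle) : Prop :=
  ∀ m, LinearIndependent ℝ ![(V₀ m : ℂ), (V₁ m : ℂ)]

/-- The standard Engel domain `Ω(V₀, V₁)`: all directions that lie between `V₀` and `V₁`. -/
def domain (V₀ V₁ : M → Circle) : Set (M × Circle) :=
  {q | ∃ a b : ℝ, 0 ≤ a ∧ 0 ≤ b ∧ (q.2 : ℂ) = a * (V₀ q.1 : ℂ) + b * (V₁ q.1 : ℂ)}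

/-- The direction field `V'` is the pull-back `φ^* V`: the differential of `φ` takes the direction
`V' m` to the direction `V (φ m)`. -/
def IsPullback (X Y : ∀ m : M, TangentSpace (𝓡 3) m) (φ : M → M) (V V' : M → Circle) : Prop :=
  ∀ m, ∃ c : ℝ, 0 < c ∧
    mfderiv (𝓡 3) (𝓡 3) φ m (rayVec X Y (m, V' m)) = c • rayVec X Y (φ m, V (φ m))

/-- `φ` is the bottom-to-top map of the Engel structure `D` on `Ω(V₀, V₁)`: the characteristic leaf
through the bottom point over `m` meets the top in the point over `φ m`, and nowhere else. -/
def IsBottomToTop (V₀ V₁ : M → Circle) (D : ∀ q : M × Circle, Submodule ℝ (TangentSpace SI q))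
    (φ : M → M) : Prop :=
  ∀ m m' : M, SameLeaf SI (domain V₀ V₁) D (m, V₀ m) (m', V₁ m') ↔ m' = φ m

/-- `D t`, for `|t| < ε`, is a deformation of the canonical Engel structure on `Ω(V₀, V₁)`: a smooth
family of Engel structures that starts at the canonical one and is constant in `t` outside of a
compact set (which is no condition when `M` is compact). -/
structure IsDeformation (X Y : ∀ m : M, TangentSpace (𝓡 3) m) (V₀ V₁ : M → Circle) (ε : ℝ)
    (D : ℝ → ∀ q : M × Circle, Submodule ℝ (TangentSpace SI q)) : Prop where
  smooth : IsSmoothFamily SI (Set.Ioo (-ε) ε) (domain V₀ V₁) 2 D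
  engel : ∀ t ∈ Set.Ioo (-ε) ε, IsEngel SI (domain V₀ V₁) (D t)
  zero : ∀ q ∈ domain V₀ V₁, D 0 q = canonical X Y q
  compact_support : ∃ K : Set (M × Circle), IsCompact K ∧
    ∀ t ∈ Set.Ioo (-ε) ε, ∀ q ∈ domain V₀ V₁, q ∉ K → D t q = canonical X Y q

end Prolongation

end Engel

end

set_option linter.unusedSectionVars false

open scoped Manifold ContDiff Topology

noncomputable section

namespace Engel

section SmoothDependence

open Set Filter Metric

theorem exists_dist_lt_of_continuousOn {A B G : Type*} [PseudoMetricSpace A] [PseudoMetricSpace B]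
    [PseudoMetricSpace G] {I : Set A} (hI : IsCompact I) {S : Set B} {f : A × B → G}
    (hf : ContinuousOn f (I ×ˢ S)) {z : A → B} (hz : ContinuousOn z I) (hzS : MapsTo z I S)
    {η : ℝ} (hη : 0 < η) :
    ∃ ρ > 0, ∀ r ∈ I, ∀ p ∈ S, dist p (z r) < ρ → dist (f (r, p)) (f (r, z r)) < η := by
  set g : ↥(I ×ˢ S) → G := (I ×ˢ S).domRestrict f
  have hg : Continuous g := hf.domRestrict
  let u : I → ↥(I ×ˢ S) := fun r => ⟨(r.1, z r.1), r.2, hzS r.2⟩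
  have hu : Continuous u := by
    refine Continuous.subtype_mk (continuous_subtype_val.prodMk ?_) _
    exact hz.domRestrict
  have : CompactSpace I := isCompact_iff_compactSpace.1 hI
  have hc : IsCompact (range u) := isCompact_range hu
  have := hc.uniformContinuousAt_of_continuousAt g (fun a _ => hg.continuousAt)
    (dist_mem_uniformity hη)
  obtain ⟨ρ, hρ, h⟩ := mem_uniformity_dist.1 this
  refine ⟨ρ, hρ, fun r hr p hp hd => ?_⟩
  have h1 : dist (⟨(r, z r), hr, hzS hr⟩ : ↥(I ×ˢ S)) ⟨(r, p), hr, hp⟩ < ρ := by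
    rw [Subtype.dist_eq, Prod.dist_eq]
    simpa [dist_comm, hρ] using hd
  have h2 := h h1 ⟨⟨r, hr⟩, rfl⟩
  rw [dist_comm]
  exact h2

variable {E : Type*} [NormedAddCommGroup E] [NormedSpace ℝ E]

theorem norm_le_of_norm_deriv_le {f f' : ℝ → E} {δ K ε : ℝ}
    (hf : ∀ r ∈ Icc (0 : ℝ) 1, HasDerivWithinAt f (f' r) (Icc 0 1) r)
    (h0 : ‖f 0‖ ≤ δ) (hK : 1 ≤ K) (hε : 0 ≤ ε)
    (hb : ∀ r ∈ Icc (0 : ℝ) 1, ‖f' r‖ ≤ K * ‖f r‖ + ε) :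
    ∀ r ∈ Icc (0 : ℝ) 1, ‖f r‖ ≤ (δ + ε) * Real.exp K := by
  intro r hr
  have hδ : 0 ≤ δ := (norm_nonneg _).trans h0
  have h1 := norm_le_gronwallBound_of_norm_deriv_right_le (f := f) (f' := f') (δ := δ) (K := K)
    (ε := ε) (a := 0) (b := 1) (fun x hx => (hf x hx).continuousWithinAt)
    (fun x hx => (hf x ⟨hx.1, hx.2.le⟩).mono_of_mem_nhdsWithin
      (Icc_mem_nhdsGE_of_mem hx)) h0
    (fun x hx => hb x ⟨hx.1, hx.2.le⟩) r hr
  refine h1.trans ?_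
  rw [gronwallBound_of_K_ne_0 (by linarith), sub_zero]
  have h2 : Real.exp (K * r) ≤ Real.exp K := Real.exp_le_exp.2 (by nlinarith [hr.1, hr.2])
  have h3 : ε / K ≤ ε := div_le_self hε hK
  have h4 : 0 ≤ ε / K := by positivity
  have h5 : 1 ≤ Real.exp (K * r) := Real.one_le_exp (by nlinarith [hr.1])
  have h6 := Real.exp_pos K
  have h7 : ε / K * (Real.exp (K * r) - 1) ≤ ε * Real.exp K := by
    apply mul_le_mul h3 (by linarith) (by linarith) hε
  nlinarith [mul_le_mul_of_nonneg_left h2 hδ]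

/-- The equation `γ' = g(r, y, γ)` on `[0, 1]`, with parameter `y ∈ Y` and initial value `x₀ y`,
together with solutions that depend continuously on the parameter, and such that the
linearized equations can be solved. -/
structure SolutionFamily {F : Type*} [NormedAddCommGroup F] [NormedSpace ℝ F] (Y : Set F)
    (O : Set E) (g : ℝ × F × E → E) (g' : ℝ × F × E → F × E →L[ℝ] E) (x₀ : F → E)
    (γ : F → ℝ → E) : Prop where
  convex : Convex ℝ O
  isOpen : IsOpen O
  smooth : ContDiffOn ℝ ∞ g (Icc 0 1 ×ˢ Y ×ˢ O)
  smooth' : ContDiffOn ℝ ∞ g' (Icc 0 1 ×ˢ Y ×ˢ O)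
  hasFDeriv : ∀ r ∈ Icc (0 : ℝ) 1, ∀ p ∈ Y ×ˢ O,
    HasFDerivWithinAt (fun p => g (r, p)) (g' (r, p)) (Y ×ˢ O) p
  smooth_init : ContDiffOn ℝ ∞ x₀ Y
  init : ∀ y ∈ Y, γ y 0 = x₀ y
  mem : ∀ y ∈ Y, ∀ r ∈ Icc (0 : ℝ) 1, γ y r ∈ O
  hasDeriv : ∀ y ∈ Y, ∀ r ∈ Icc (0 : ℝ) 1,
    HasDerivWithinAt (γ y) (g (r, y, γ y r)) (Icc 0 1) r
  tendsto : ∀ y₀ ∈ Y, ∀ η > 0, ∀ᶠ y in 𝓝[Y] y₀, ∀ r ∈ Icc (0 : ℝ) 1, ‖γ y r - γ y₀ r‖ < η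
  solve : ∀ y ∈ Y, ∀ N : ℝ → E, ContinuousOn N (Icc 0 1) → ∀ a : E, ∃ A : ℝ → E, A 0 = a ∧
    ∀ r ∈ Icc (0 : ℝ) 1, HasDerivWithinAt A (g' (r, y, γ y r) (0, A r) + N r) (Icc 0 1) r

namespace SolutionFamily

variable {F : Type*} [NormedAddCommGroup F] [NormedSpace ℝ F] {Y : Set F}
    {O : Set E} {g : ℝ × F × E → E} {g' : ℝ × F × E → F × E →L[ℝ] E} {x₀ : F → E}
    {γ : F → ℝ → E}

theorem continuousOn_solution (h : SolutionFamily Y O g g' x₀ γ) {y : F} (hy : y ∈ Y) :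
    ContinuousOn (γ y) (Icc 0 1) :=
  fun r hr => (h.hasDeriv y hy r hr).continuousWithinAt

theorem exists_close (h : SolutionFamily Y O g g' x₀ γ) {G : Type*} [NormedAddCommGroup G]
    {Ψ : ℝ × F × E → G} (hΨ : ContinuousOn Ψ (Icc 0 1 ×ˢ Y ×ˢ O)) {y₀ : F} (hy₀ : y₀ ∈ Y)
    {η : ℝ} (hη : 0 < η) :
    ∃ ρ > 0, ∀ r ∈ Icc (0 : ℝ) 1, ∀ p ∈ Y ×ˢ O, dist p (y₀, γ y₀ r) < ρ →
      ‖Ψ (r, p) - Ψ (r, y₀, γ y₀ r)‖ < η := by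
  obtain ⟨ρ, hρ, h1⟩ := exists_dist_lt_of_continuousOn (isCompact_Icc (a := (0 : ℝ)) (b := 1)) hΨ
    (z := fun r => (y₀, γ y₀ r)) (continuousOn_const.prodMk (h.continuousOn_solution hy₀))
    (fun r hr => ⟨hy₀, h.mem y₀ hy₀ r hr⟩) hη
  exact ⟨ρ, hρ, fun r hr p hp hd => by simpa [dist_eq_norm] using h1 r hr p hp hd⟩

theorem eventually_close (h : SolutionFamily Y O g g' x₀ γ) {y₀ : F} (hy₀ : y₀ ∈ Y)
    {η : ℝ} (hη : 0 < η) :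
    ∀ᶠ y in 𝓝[Y] y₀, y ∈ Y ∧ ∀ r ∈ Icc (0 : ℝ) 1, dist (y, γ y r) (y₀, γ y₀ r) < η := by
  filter_upwards [h.tendsto y₀ hy₀ η hη, self_mem_nhdsWithin,
    mem_nhdsWithin_of_mem_nhds (ball_mem_nhds y₀ hη)] with y hy hyY hyb
  refine ⟨hyY, fun r hr => ?_⟩
  rw [Prod.dist_eq]
  exact max_lt hyb (by simpa [dist_eq_norm] using hy r hr)

theorem exists_bound (h : SolutionFamily Y O g g' x₀ γ) {y₀ : F} (hy₀ : y₀ ∈ Y) :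
    ∃ K ≥ 1, ∀ r ∈ Icc (0 : ℝ) 1, ‖g' (r, y₀, γ y₀ r)‖ ≤ K := by
  have h1 : ContinuousOn (fun r => g' (r, y₀, γ y₀ r)) (Icc 0 1) :=
    h.smooth'.continuousOn.comp
      (continuousOn_id.prodMk (continuousOn_const.prodMk (h.continuousOn_solution hy₀)))
      (fun r hr => ⟨hr, hy₀, h.mem y₀ hy₀ r hr⟩)
  obtain ⟨K, hK⟩ := isCompact_Icc.exists_bound_of_continuousOn h1
  exact ⟨max K 1, le_max_right _ _, fun r hr => (hK r hr).trans (le_max_left _ _)⟩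

theorem exists_derivative [FiniteDimensional ℝ F] (h : SolutionFamily Y O g g' x₀ γ)
    {y₀ : F} (hy₀ : y₀ ∈ Y) (L : F →L[ℝ] E) :
    ∃ A : ℝ → F →L[ℝ] E, A 0 = L ∧ (∀ v, ∀ r ∈ Icc (0 : ℝ) 1,
      HasDerivWithinAt (fun r => A r v) (g' (r, y₀, γ y₀ r) (v, A r v)) (Icc 0 1) r) ∧
      ∃ C ≥ 0, ∀ r ∈ Icc (0 : ℝ) 1, ∀ v, ‖A r v‖ ≤ C * ‖v‖ := by
  obtain ⟨K, hK1, hK⟩ := h.exists_bound hy₀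
  have hN : ∀ v : F, ContinuousOn (fun r => g' (r, y₀, γ y₀ r) (v, (0 : E))) (Icc 0 1) := by
    intro v
    have h1 : ContinuousOn (fun r => g' (r, y₀, γ y₀ r)) (Icc 0 1) :=
      h.smooth'.continuousOn.comp
        (continuousOn_id.prodMk (continuousOn_const.prodMk (h.continuousOn_solution hy₀)))
        (fun r hr => ⟨hr, hy₀, h.mem y₀ hy₀ r hr⟩)
    exact h1.clm_apply continuousOn_const
  choose B hB0 hB using fun v => h.solve y₀ hy₀ _ (hN v) (L v)
  have hB' : ∀ v, ∀ r ∈ Icc (0 : ℝ) 1,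
      HasDerivWithinAt (B v) (g' (r, y₀, γ y₀ r) (v, B v r)) (Icc 0 1) r := by
    intro v r hr
    have := hB v r hr
    rwa [← map_add, Prod.mk_add_mk, zero_add, add_zero] at this
  have huniq : ∀ f : ℝ → E, f 0 = 0 → (∀ r ∈ Icc (0 : ℝ) 1,
      HasDerivWithinAt f (g' (r, y₀, γ y₀ r) (0, f r)) (Icc 0 1) r) →
      ∀ r ∈ Icc (0 : ℝ) 1, f r = 0 := by
    intro f hf0 hf r hr
    have := norm_le_of_norm_deriv_le (δ := 0) (ε := 0) hf (by simp [hf0]) hK1 le_rfl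
      (fun r hr => by
        refine ((g' (r, y₀, γ y₀ r)).le_opNorm _).trans ?_
        rw [add_zero]
        refine mul_le_mul (hK r hr) ?_ (norm_nonneg _) (by linarith)
        simp [Prod.norm_def]) r hr
    simpa using this
  have hadd : ∀ v w, ∀ r ∈ Icc (0 : ℝ) 1, B (v + w) r = B v r + B w r := by
    intro v w r hr
    have := huniq (fun r => B (v + w) r - (B v r + B w r)) (by simp [hB0]) (fun r hr => by
      have := (hB' (v + w) r hr).sub ((hB' v r hr).add (hB' w r hr))
      convert! this using 1
      rw [← map_add, ← map_sub]
      simp) r hr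
    exact sub_eq_zero.1 this
  have hsmul : ∀ (c : ℝ) v, ∀ r ∈ Icc (0 : ℝ) 1, B (c • v) r = c • B v r := by
    intro c v r hr
    have := huniq (fun r => B (c • v) r - c • B v r) (by simp [hB0]) (fun r hr => by
      have := (hB' (c • v) r hr).sub ((hB' v r hr).const_smul c)
      convert! this using 1
      rw [← map_smul, ← map_sub]
      simp) r hr
    exact sub_eq_zero.1 this
  have hbound : ∀ v, ∀ r ∈ Icc (0 : ℝ) 1, ‖B v r‖ ≤ ((‖L‖ + K) * Real.exp K) * ‖v‖ := by
    intro v r hr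
    have := norm_le_of_norm_deriv_le (δ := ‖L‖ * ‖v‖) (K := K) (ε := K * ‖v‖) (hB' v)
      (by rw [hB0]; exact L.le_opNorm v) hK1 (by positivity)
      (fun r hr => by
        refine ((g' (r, y₀, γ y₀ r)).le_opNorm _).trans ?_
        rw [← mul_add]
        refine mul_le_mul (hK r hr) ?_ (norm_nonneg _) (by linarith)
        rw [Prod.norm_def]
        exact max_le (by simp) (by simp)) r hr
    linarith
  let A : ℝ → F →L[ℝ] E := fun r => if hr : r ∈ Icc (0 : ℝ) 1 then
    LinearMap.toContinuousLinearMap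
      { toFun := fun v => B v r
        map_add' := fun v w => hadd v w r hr
        map_smul' := fun c v => hsmul c v r hr } else 0
  have hA : ∀ r ∈ Icc (0 : ℝ) 1, ∀ v, A r v = B v r := fun r hr v => by simp only [A, dif_pos hr]; rfl
  refine ⟨A, ?_, ?_, (‖L‖ + K) * Real.exp K, by positivity, ?_⟩
  · ext v
    rw [hA 0 (by simp), hB0]
  · intro v r hr
    rw [hA r hr]
    exact (hB' v r hr).congr_of_mem (fun r hr => hA r hr v) hr
  · intro r hr v
    rw [hA r hr]
    exact hbound v r hr

/-- The solutions are differentiable with respect to the parameter. -/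
theorem hasFDerivWithinAt [FiniteDimensional ℝ F] (h : SolutionFamily Y O g g' x₀ γ)
    (hY : Convex ℝ Y) {y₀ : F} (hy₀ : y₀ ∈ Y)
    {A : ℝ → F →L[ℝ] E} (hA0 : HasFDerivWithinAt x₀ (A 0) Y y₀)
    (hA : ∀ v, ∀ r ∈ Icc (0 : ℝ) 1,
      HasDerivWithinAt (fun r => A r v) (g' (r, y₀, γ y₀ r) (v, A r v)) (Icc 0 1) r)
    {C : ℝ} (hC : 0 ≤ C) (hAC : ∀ r ∈ Icc (0 : ℝ) 1, ∀ v, ‖A r v‖ ≤ C * ‖v‖) :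
    ∀ r ∈ Icc (0 : ℝ) 1, HasFDerivWithinAt (fun y => γ y r) (A r) Y y₀ := by
  obtain ⟨K, hK1, hK⟩ := h.exists_bound hy₀
  intro r hr
  rw [hasFDerivWithinAt_iff_isLittleO, Asymptotics.isLittleO_iff]
  intro c hc
  set M : ℝ := (2 + C) * Real.exp (K + 1) with hM
  have hMpos : 0 < M := by positivity
  set η : ℝ := min 1 (c / M) with hη'
  have hη : 0 < η := by positivity
  obtain ⟨ρ, hρ, hclose⟩ := h.exists_close h.smooth'.continuousOn hy₀ hη
  have h0 : ∀ᶠ y in 𝓝[Y] y₀, ‖x₀ y - x₀ y₀ - A 0 (y - y₀)‖ ≤ η * ‖y - y₀‖ := by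
    have := hasFDerivWithinAt_iff_isLittleO.1 hA0
    exact (Asymptotics.isLittleO_iff.1 this) hη
  filter_upwards [h0, h.eventually_close hy₀ hρ] with y hy0 hy1
  obtain ⟨hyY, hy1⟩ := hy1
  set v := y - y₀
  have key : ∀ s ∈ Icc (0 : ℝ) 1, ‖g (s, y, γ y s) - g (s, y₀, γ y₀ s) -
      g' (s, y₀, γ y₀ s) ((y, γ y s) - (y₀, γ y₀ s))‖ ≤ η * ‖(y, γ y s) - (y₀, γ y₀ s)‖ := by
    intro s hs
    have hconv : Convex ℝ ((Y ×ˢ O) ∩ ball (y₀, γ y₀ s) ρ) :=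
      (hY.prod h.convex).inter (convex_ball _ _)
    exact hconv.norm_image_sub_le_of_norm_hasFDerivWithin_le' (f := fun p => g (s, p))
      (f' := fun p => g' (s, p)) (φ := g' (s, y₀, γ y₀ s))
      (fun p hp => (h.hasFDeriv s hs p hp.1).mono inter_subset_left)
      (fun p hp => (hclose s hs p hp.1 hp.2).le)
      ⟨⟨hy₀, h.mem y₀ hy₀ s hs⟩, mem_ball_self hρ⟩ ⟨⟨hyY, h.mem y hyY s hs⟩, hy1 s hs⟩
  have hδ : ∀ s ∈ Icc (0 : ℝ) 1, HasDerivWithinAt (fun s => γ y s - γ y₀ s - A s v)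
      (g (s, y, γ y s) - g (s, y₀, γ y₀ s) - g' (s, y₀, γ y₀ s) (v, A s v)) (Icc 0 1) s :=
    fun s hs => ((h.hasDeriv y hyY s hs).sub (h.hasDeriv y₀ hy₀ s hs)).sub (hA v s hs)
  have := norm_le_of_norm_deriv_le (δ := η * ‖v‖) (K := K + 1) (ε := η * (1 + C) * ‖v‖) hδ
    (by simpa only [h.init y hyY, h.init y₀ hy₀] using hy0) (by linarith) (by positivity)
    (fun s hs => by
      set d := γ y s - γ y₀ s - A s v with hd
      have e1 : g (s, y, γ y s) - g (s, y₀, γ y₀ s) - g' (s, y₀, γ y₀ s) (v, A s v) =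
          (g (s, y, γ y s) - g (s, y₀, γ y₀ s) -
            g' (s, y₀, γ y₀ s) ((y, γ y s) - (y₀, γ y₀ s))) + g' (s, y₀, γ y₀ s) (0, d) := by
        have : ((y, γ y s) - (y₀, γ y₀ s) : F × E) = (v, A s v) + (0, d) := by
          simp [hd, v]
        rw [this, map_add]
        abel
      have e2 : ‖((y, γ y s) - (y₀, γ y₀ s) : F × E)‖ ≤ (1 + C) * ‖v‖ + ‖d‖ := by
        rw [Prod.mk_sub_mk, Prod.norm_def]
        refine max_le ?_ ?_
        · show ‖v‖ ≤ _
          nlinarith [norm_nonneg v, norm_nonneg d, mul_nonneg hC (norm_nonneg v)]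
        · have : γ y s - γ y₀ s = d + A s v := by simp [hd]
          show ‖γ y s - γ y₀ s‖ ≤ _
          rw [this]
          refine (norm_add_le _ _).trans ?_
          nlinarith [norm_nonneg v, hAC s hs v]
      have e3 : ‖g' (s, y₀, γ y₀ s) (0, d)‖ ≤ K * ‖d‖ := by
        refine ((g' (s, y₀, γ y₀ s)).le_opNorm _).trans ?_
        refine mul_le_mul (hK s hs) ?_ (norm_nonneg _) (by linarith)
        simp [Prod.norm_def]
      rw [e1]
      refine (norm_add_le _ _).trans ?_
      have e4 := key s hs
      have e5 : η ≤ 1 := min_le_left _ _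
      have e6 := mul_le_mul_of_nonneg_left e2 hη.le
      nlinarith [norm_nonneg d]) r hr
  refine this.trans ?_
  have h5 : η * M ≤ c := by
    have : η ≤ c / M := min_le_right _ _
    rwa [le_div_iff₀ hMpos] at this
  have h6 : (η * ‖v‖ + η * (1 + C) * ‖v‖) * Real.exp (K + 1) = (η * M) * ‖v‖ := by
    rw [hM]; ring
  rw [h6]
  exact mul_le_mul_of_nonneg_right h5 (norm_nonneg _)

theorem exists_partial_fderiv {G : Type*} [NormedAddCommGroup G] [NormedSpace ℝ G]
    {f : ℝ × F → G} (hY : UniqueDiffOn ℝ Y)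
    (hf : ContDiffOn ℝ ∞ f (Icc 0 1 ×ˢ Y)) :
    ∃ f' : ℝ × F → F →L[ℝ] G, ContDiffOn ℝ ∞ f' (Icc 0 1 ×ˢ Y) ∧
      ∀ r ∈ Icc (0 : ℝ) 1, ∀ p ∈ Y, HasFDerivWithinAt (fun p => f (r, p)) (f' (r, p)) Y p := by
  have hu : UniqueDiffOn ℝ ((Icc (0 : ℝ) 1) ×ˢ Y) := (uniqueDiffOn_Icc one_pos).prod hY
  refine ⟨fun p => (fderivWithin ℝ f (Icc 0 1 ×ˢ Y) p).comp (ContinuousLinearMap.inr ℝ ℝ F),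
    (hf.fderivWithin hu le_rfl).clm_comp contDiffOn_const, fun r hr p hp => ?_⟩
  have h1 : HasFDerivWithinAt f (fderivWithin ℝ f (Icc 0 1 ×ˢ Y) (r, p)) (Icc 0 1 ×ˢ Y) (r, p) :=
    ((hf.differentiableOn (by simp)) (r, p) ⟨hr, hp⟩).hasFDerivWithinAt
  exact h1.comp p (t := Icc 0 1 ×ˢ Y) (hasFDerivAt_prodMk_right r p).hasFDerivWithinAt (fun q hq => ⟨hr, hq⟩)

/-- The tangent system in the direction `v` of the parameter. -/
theorem tangent (h : SolutionFamily Y O g g' x₀ γ) (hYu : UniqueDiffOn ℝ Y)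
    {x₀' : F → F →L[ℝ] E} (hx₀' : ContDiffOn ℝ ∞ x₀' Y)
    {A : F → ℝ → F →L[ℝ] E} (hA0 : ∀ y ∈ Y, A y 0 = x₀' y)
    (hA : ∀ y ∈ Y, ∀ v, ∀ r ∈ Icc (0 : ℝ) 1,
      HasDerivWithinAt (fun r => A y r v) (g' (r, y, γ y r) (v, A y r v)) (Icc 0 1) r)
    (hAC : ∀ y ∈ Y, ∃ C ≥ 0, ∀ r ∈ Icc (0 : ℝ) 1, ∀ v, ‖A y r v‖ ≤ C * ‖v‖) (v : F) :
    ∃ G', SolutionFamily Y (O ×ˢ (univ : Set E))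
      (fun p : ℝ × F × E × E => (g (p.1, p.2.1, p.2.2.1), g' (p.1, p.2.1, p.2.2.1) (v, p.2.2.2)))
      G' (fun y => (x₀ y, x₀' y v)) (fun y r => (γ y r, A y r v)) := by
  have hYO : UniqueDiffOn ℝ (Y ×ˢ O) := hYu.prod h.isOpen.uniqueDiffOn
  obtain ⟨g'', hg'', hg'd⟩ := exists_partial_fderiv hYO h.smooth'
  let P : F × E × E →L[ℝ] F × E := (ContinuousLinearMap.fst ℝ F (E × E)).prod
    ((ContinuousLinearMap.fst ℝ E E).comp (ContinuousLinearMap.snd ℝ F (E × E)))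
  let Q : F × E × E →L[ℝ] E :=
    (ContinuousLinearMap.snd ℝ E E).comp (ContinuousLinearMap.snd ℝ F (E × E))
  let R : F × E × E →L[ℝ] F × E := (ContinuousLinearMap.inr ℝ F E).comp Q
  let G' : ℝ × F × E × E → F × E × E →L[ℝ] E × E := fun p =>
    ((g' (p.1, P p.2)).comp P).prod
      ((g' (p.1, P p.2)).comp R + ((g'' (p.1, P p.2)).comp P).flip (v, Q p.2))
  have hPmap : MapsTo (fun p : ℝ × F × E × E => (p.1, P p.2))
      (Icc 0 1 ×ˢ Y ×ˢ O ×ˢ (univ : Set E)) (Icc 0 1 ×ˢ Y ×ˢ O) :=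
    fun p hp => ⟨hp.1, hp.2.1, hp.2.2.1⟩
  have hPs : ContDiff ℝ ∞ (fun p : ℝ × F × E × E => (p.1, P p.2)) :=
    contDiff_fst.prodMk (P.contDiff.comp contDiff_snd)
  have hvQ : ContDiff ℝ ∞ (fun p : ℝ × F × E × E => (v, Q p.2)) :=
    contDiff_const.prodMk (Q.contDiff.comp contDiff_snd)
  have hgP := h.smooth'.comp hPs.contDiffOn hPmap
  refine ⟨G', ⟨h.convex.prod convex_univ, h.isOpen.prod isOpen_univ, ?_, ?_, ?_, ?_, ?_, ?_, ?_, ?_, ?_⟩⟩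
  · exact (h.smooth.comp hPs.contDiffOn hPmap).prodMk (hgP.clm_apply hvQ.contDiffOn)
  · have h1 : ContDiffOn ℝ ∞ (fun p : ℝ × F × E × E => (g' (p.1, P p.2)).comp P)
        (Icc 0 1 ×ˢ Y ×ˢ O ×ˢ (univ : Set E)) := hgP.clm_comp contDiffOn_const
    have h2 : ContDiffOn ℝ ∞ (fun p : ℝ × F × E × E => (g' (p.1, P p.2)).comp R)
        (Icc 0 1 ×ˢ Y ×ˢ O ×ˢ (univ : Set E)) := hgP.clm_comp contDiffOn_const
    have h3 : ContDiffOn ℝ ∞ (fun p : ℝ × F × E × E => (g'' (p.1, P p.2)).comp P)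
        (Icc 0 1 ×ˢ Y ×ˢ O ×ˢ (univ : Set E)) :=
      (hg''.comp hPs.contDiffOn hPmap).clm_comp contDiffOn_const
    have h4 : ContDiffOn ℝ ∞
        (fun p : ℝ × F × E × E => ((g'' (p.1, P p.2)).comp P).flip (v, Q p.2))
        (Icc 0 1 ×ˢ Y ×ˢ O ×ˢ (univ : Set E)) := by
      have h6 : ContDiffOn ℝ ∞ (fun p : ℝ × F × E × E =>
          (ContinuousLinearMap.id ℝ (F × E →L[ℝ] E)).flip (v, Q p.2))
          (Icc 0 1 ×ˢ Y ×ˢ O ×ˢ (univ : Set E)) := contDiffOn_const.clm_apply hvQ.contDiffOn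
      exact h6.clm_comp h3
    have h5 := h2.add h4
    exact (ContinuousLinearMap.prodₗᵢ ℝ).contDiff.comp_contDiffOn (h1.prodMk h5)
  · intro r hr p hp
    have hp' : P p ∈ Y ×ˢ O := ⟨hp.1, hp.2.1⟩
    have hm : MapsTo P (Y ×ˢ O ×ˢ (univ : Set E)) (Y ×ˢ O) := fun p hp => ⟨hp.1, hp.2.1⟩
    have h1 := (h.hasFDeriv r hr _ hp').comp p P.hasFDerivWithinAt hm
    have h2 := (hg'd r hr _ hp').comp p P.hasFDerivWithinAt hm
    have h3 : HasFDerivWithinAt (fun p : F × E × E => (v, Q p)) R (Y ×ˢ O ×ˢ (univ : Set E)) p := by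
      have := (hasFDerivWithinAt_const v p (Y ×ˢ O ×ˢ (univ : Set E))).prodMk
        (Q.hasFDerivWithinAt (s := Y ×ˢ O ×ˢ (univ : Set E)) (x := p))
      convert! this using 1
    exact h1.prodMk (h2.clm_apply h3)
  · exact h.smooth_init.prodMk (hx₀'.clm_apply contDiffOn_const)
  · intro y hy
    show (γ y 0, A y 0 v) = _
    rw [h.init y hy, hA0 y hy]
  · exact fun y hy r hr => ⟨h.mem y hy r hr, trivial⟩
  · exact fun y hy r hr => (h.hasDeriv y hy r hr).prodMk (hA y hy v r hr)
  · intro y₀ hy₀ η hη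
    obtain ⟨K, hK1, hK⟩ := h.exists_bound hy₀
    obtain ⟨C, hC, hAC⟩ := hAC y₀ hy₀
    set M : ℝ := (1 + (1 + C) * ‖v‖) * Real.exp (K + 1) with hM
    have hMpos : 0 < M := by positivity
    set κ : ℝ := min 1 (η / (2 * M)) with hκ'
    have hκ : 0 < κ := by positivity
    obtain ⟨ρ, hρ, hclose⟩ := h.exists_close h.smooth'.continuousOn hy₀ hκ
    have h0 : ∀ᶠ y in 𝓝[Y] y₀, ‖x₀' y v - x₀' y₀ v‖ < κ := by
      have : ContinuousWithinAt (fun y => x₀' y v) Y y₀ :=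
        (hx₀'.continuousOn y₀ hy₀).clm_apply continuousWithinAt_const
      simpa [dist_eq_norm] using Metric.tendsto_nhds.1 this κ hκ
    filter_upwards [h0, h.eventually_close hy₀ hρ, h.tendsto y₀ hy₀ η hη] with y hy0 hy1 hy2 r hr
    obtain ⟨hyY, hy1⟩ := hy1
    rw [Prod.mk_sub_mk, Prod.norm_def]
    refine max_lt (hy2 r hr) ?_
    have hd : ∀ s ∈ Icc (0 : ℝ) 1, HasDerivWithinAt (fun s => A y s v - A y₀ s v)
        (g' (s, y, γ y s) (v, A y s v) - g' (s, y₀, γ y₀ s) (v, A y₀ s v)) (Icc 0 1) s :=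
      fun s hs => (hA y hyY v s hs).sub (hA y₀ hy₀ v s hs)
    have := norm_le_of_norm_deriv_le (δ := κ) (K := K + 1) (ε := κ * ((1 + C) * ‖v‖)) hd
      (by rw [hA0 y hyY, hA0 y₀ hy₀]; exact hy0.le) (by linarith) (by positivity)
      (fun s hs => by
        set d := A y s v - A y₀ s v with hd
        have h1 := (hclose s hs (y, γ y s) ⟨hyY, h.mem y hyY s hs⟩ (hy1 s hs)).le
        have e1 : g' (s, y, γ y s) (v, A y s v) - g' (s, y₀, γ y₀ s) (v, A y₀ s v) =
            (g' (s, y, γ y s) - g' (s, y₀, γ y₀ s)) (v, A y₀ s v)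
              + g' (s, y, γ y s) (0, d) := by
          have : ((v, A y s v) : F × E) = (v, A y₀ s v) + (0, d) := by simp [hd]
          rw [this, map_add]
          simp only [sub_apply]
          abel
        have e2 : ‖g' (s, y, γ y s)‖ ≤ K + 1 := by
          have h2 : g' (s, y, γ y s) = (g' (s, y, γ y s) - g' (s, y₀, γ y₀ s))
            + g' (s, y₀, γ y₀ s) := by abel
          rw [h2]
          refine (norm_add_le _ _).trans ?_
          have := hK s hs
          have : κ ≤ 1 := min_le_left _ _
          linarith
        rw [e1]
        refine (norm_add_le _ _).trans ?_
        have e3 : ‖(g' (s, y, γ y s) - g' (s, y₀, γ y₀ s)) (v, A y₀ s v)‖ ≤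
            κ * ((1 + C) * ‖v‖) := by
          refine (ContinuousLinearMap.le_opNorm _ _).trans ?_
          refine mul_le_mul h1 ?_ (norm_nonneg _) hκ.le
          rw [Prod.norm_def]
          refine max_le ?_ ?_
          · show ‖v‖ ≤ _
            nlinarith [norm_nonneg v, mul_nonneg hC (norm_nonneg v)]
          · refine (hAC s hs v).trans ?_
            nlinarith [norm_nonneg v]
        have e4 : ‖g' (s, y, γ y s) (0, d)‖ ≤ (K + 1) * ‖d‖ := by
          refine (ContinuousLinearMap.le_opNorm _ _).trans ?_
          refine mul_le_mul e2 ?_ (norm_nonneg _) (by linarith)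
          simp [Prod.norm_def]
        linarith) r hr
    refine this.trans_lt ?_
    have h6 : (κ + κ * ((1 + C) * ‖v‖)) * Real.exp (K + 1) = κ * M := by rw [hM]; ring
    rw [h6]
    have : κ ≤ η / (2 * M) := min_le_right _ _
    rw [le_div_iff₀ (by positivity)] at this
    linarith
  · intro y hy N hN a
    have hγc := h.continuousOn_solution hy
    have hAc : ContinuousOn (fun r => A y r v) (Icc 0 1) :=
      fun r hr => (hA y hy v r hr).continuousWithinAt
    obtain ⟨A₁, hA₁0, hA₁⟩ := h.solve y hy (fun r => (N r).1) (continuous_fst.comp_continuousOn hN) a.1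
    have hc : ContinuousOn A₁ (Icc 0 1) := fun r hr => (hA₁ r hr).continuousWithinAt
    have hg''c : ContinuousOn (fun r => g'' (r, y, γ y r)) (Icc 0 1) :=
      hg''.continuousOn.comp (continuousOn_id.prodMk (continuousOn_const.prodMk hγc))
        (fun r hr => ⟨hr, hy, h.mem y hy r hr⟩)
    obtain ⟨A₂, hA₂0, hA₂⟩ := h.solve y hy
      (fun r => g'' (r, y, γ y r) (0, A₁ r) (v, A y r v) + (N r).2)
      (((hg''c.clm_apply (continuousOn_const.prodMk hc)).clm_apply
        (continuousOn_const.prodMk hAc)).add (continuous_snd.comp_continuousOn hN)) a.2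
    refine ⟨fun r => (A₁ r, A₂ r), by simp [hA₁0, hA₂0], fun r hr => ?_⟩
    convert! (hA₁ r hr).prodMk (hA₂ r hr) using 1
    simp [G', P, Q, R, Prod.ext_iff, add_assoc]

theorem contDiffOn_nat [FiniteDimensional ℝ F] (hY : Convex ℝ Y) (hYu : UniqueDiffOn ℝ Y) (k : ℕ) :
    ∀ {E : Type _} [NormedAddCommGroup E] [NormedSpace ℝ E]
    {O : Set E} {g : ℝ × F × E → E} {g' : ℝ × F × E → F × E →L[ℝ] E} {x₀ : F → E}
    {γ : F → ℝ → E} (_ : SolutionFamily Y O g g' x₀ γ),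
    ∀ r ∈ Icc (0 : ℝ) 1, ContDiffOn ℝ k (fun y => γ y r) Y := by
  induction k with
  | zero =>
    intro E _ _ O g g' x₀ γ h r hr
    rw [Nat.cast_zero, contDiffOn_zero]
    intro y hy
    refine Metric.tendsto_nhds.2 fun η hη => ?_
    filter_upwards [h.tendsto y hy η hη] with z hz
    rw [dist_eq_norm]
    exact hz r hr
  | succ k ih =>
    intro E _ _ O g g' x₀ γ h r hr
    have hx₀ : ContDiffOn ℝ ∞ (fderivWithin ℝ x₀ Y) Y := h.smooth_init.fderivWithin hYu le_rfl
    choose! A hA0 hA C hC hAC using fun y (hy : y ∈ Y) =>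
      h.exists_derivative hy (fderivWithin ℝ x₀ Y y)
    have hd : ∀ r ∈ Icc (0 : ℝ) 1, ∀ y ∈ Y,
        HasFDerivWithinAt (fun y => γ y r) (A y r) Y y := fun r hr y hy => by
      refine h.hasFDerivWithinAt hY hy ?_ (hA y hy) (hC y hy) (hAC y hy) r hr
      rw [hA0 y hy]
      exact (h.smooth_init.differentiableOn (by simp) y hy).hasFDerivWithinAt
    push_cast
    rw [contDiffOn_succ_iff_fderivWithin hYu]
    refine ⟨fun y hy => (hd r hr y hy).differentiableWithinAt, by simp, ?_⟩
    refine ContDiffOn.congr (f := fun y => A y r) ?_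
      (fun y hy => (hd r hr y hy).fderivWithin (hYu y hy))
    rw [contDiffOn_clm_apply]
    intro v
    obtain ⟨G', hG'⟩ := h.tangent hYu hx₀ hA0 hA (fun y hy => ⟨C y, hC y hy, hAC y hy⟩) v
    exact contDiff_snd.comp_contDiffOn (ih hG' r hr)

end SolutionFamily
end SmoothDependence
end Engel

namespace Engel

section LocalFlow

open Set Filter Metric
open scoped NNReal

variable {E : Type*} [NormedAddCommGroup E] [NormedSpace ℝ E]

theorem exists_solution_mem_closedBall [CompleteSpace E] {f : ℝ → E → E} {s₀ : ℝ}
    (hs₀ : s₀ ∈ Icc (0 : ℝ) 1) {x : E} {a : ℝ≥0}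
    {K : ℝ≥0} (hLip : ∀ s ∈ Icc (0 : ℝ) 1, LipschitzOnWith K (f s) (closedBall x a))
    (hcont : ∀ z ∈ closedBall x a, ContinuousOn (fun s => f s z) (Icc 0 1))
    (hbound : ∀ s ∈ Icc (0 : ℝ) 1, ∀ z ∈ closedBall x a, ‖f s z‖ ≤ a) :
    ∃ α : ℝ → E, α s₀ = x ∧ ∀ s ∈ Icc (0 : ℝ) 1, α s ∈ closedBall x a ∧
      HasDerivWithinAt α (f s (α s)) (Icc 0 1) s := by
  have hf : IsPicardLindelof f (⟨s₀, hs₀⟩ : Icc (0 : ℝ) 1) x a 0 a K :=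
    ⟨hLip, hcont, hbound, by
      have : max (1 - s₀) (s₀ - 0) ≤ 1 := max_le (by linarith [hs₀.1]) (by linarith [hs₀.2])
      have h2 := mul_le_mul_of_nonneg_left this a.2
      rw [mul_one] at h2
      show (a : ℝ) * max (1 - s₀) (s₀ - 0) ≤ (a : ℝ) - 0
      rwa [sub_zero (a : ℝ)]⟩
  obtain ⟨α, hα⟩ := ODE.FunSpace.exists_isFixedPt_next hf (mem_closedBall_self le_rfl)
  refine ⟨α.compProj, by
    rw [ODE.FunSpace.compProj_of_mem hs₀, ← hα, ODE.FunSpace.next_apply₀ hf], fun t ht ↦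
      ⟨α.compProj_mem_closedBall hf.mul_max_le, ?_⟩⟩
  apply ODE.hasDerivWithinAt_picard_Icc hs₀ hf.continuousOn_uncurry
    α.continuous_compProj.continuousOn (fun _ ht' ↦ α.compProj_mem_closedBall hf.mul_max_le)
    x ht |>.congr_of_mem _ ht
  intro t' ht'
  nth_rw 1 [← hα]
  rw [ODE.FunSpace.compProj_of_mem ht', ODE.FunSpace.next_apply]

theorem exists_linear_solution [CompleteSpace E] {M : ℝ → E →L[ℝ] E} {N : ℝ → E}
    (hM : ContinuousOn M (Icc 0 1)) (hN : ContinuousOn N (Icc 0 1))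
    (hM' : ∀ r ∈ Icc (0 : ℝ) 1, ‖M r‖ ≤ 1 / 2) (a : E) :
    ∃ A : ℝ → E, A 0 = a ∧ ∀ r ∈ Icc (0 : ℝ) 1,
      HasDerivWithinAt A (M r (A r) + N r) (Icc 0 1) r := by
  obtain ⟨n, hn⟩ := isCompact_Icc.exists_bound_of_continuousOn hN
  have hn0 : 0 ≤ n := (norm_nonneg _).trans (hn 0 (by simp))
  obtain ⟨A, hA0, hA⟩ := exists_solution_mem_closedBall (f := fun r z => M r z + N r) (s₀ := 0)
    (by simp) (x := a) (a := ⟨‖a‖ + 2 * n, by positivity⟩) (K := 1 / 2)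
    (fun r hr => by
      refine LipschitzWith.lipschitzOnWith (LipschitzWith.of_dist_le_mul fun x y => ?_)
      rw [dist_add_right, dist_eq_norm, dist_eq_norm, ← map_sub]
      refine ((M r).le_opNorm _).trans (mul_le_mul_of_nonneg_right ?_ (norm_nonneg _))
      simpa using hM' r hr)
    (fun z _ => (hM.clm_apply continuousOn_const).add hN)
    (fun r hr z hz => by
      have h1 : ‖z‖ ≤ ‖a‖ + (‖a‖ + 2 * n) := by
        have : z = a + (z - a) := by abel
        rw [this]
        rw [mem_closedBall, dist_eq_norm] at hz
        exact (norm_add_le _ _).trans (add_le_add_right hz _)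
      have h2 := (M r).le_opNorm z
      have h3 := mul_le_mul_of_nonneg_right (hM' r hr) (norm_nonneg z)
      refine (norm_add_le _ _).trans ?_
      have := hn r hr
      show _ ≤ ‖a‖ + 2 * n
      linarith)
  exact ⟨A, hA0, fun r hr => (hA r hr).2⟩

theorem exists_partial_fderiv_snd {T F G : Type*} [NormedAddCommGroup T] [NormedSpace ℝ T]
    [NormedAddCommGroup F] [NormedSpace ℝ F] [NormedAddCommGroup G] [NormedSpace ℝ G]
    {S : Set T} {Y : Set F} {f : T × F → G} (hS : UniqueDiffOn ℝ S) (hY : UniqueDiffOn ℝ Y)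
    (hf : ContDiffOn ℝ ∞ f (S ×ˢ Y)) :
    ∃ f' : T × F → F →L[ℝ] G, ContDiffOn ℝ ∞ f' (S ×ˢ Y) ∧
      ∀ r ∈ S, ∀ p ∈ Y, HasFDerivWithinAt (fun p => f (r, p)) (f' (r, p)) Y p := by
  have hu : UniqueDiffOn ℝ (S ×ˢ Y) := hS.prod hY
  refine ⟨fun p => (fderivWithin ℝ f (S ×ˢ Y) p).comp (ContinuousLinearMap.inr ℝ T F),
    (hf.fderivWithin hu le_rfl).clm_comp contDiffOn_const, fun r hr p hp => ?_⟩
  have h1 : HasFDerivWithinAt f (fderivWithin ℝ f (S ×ˢ Y) (r, p)) (S ×ˢ Y) (r, p) :=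
    ((hf.differentiableOn (by simp)) (r, p) ⟨hr, hp⟩).hasFDerivWithinAt
  exact h1.comp p (t := S ×ˢ Y) (hasFDerivAt_prodMk_right r p).hasFDerivWithinAt
    (fun q hq => ⟨hr, hq⟩)

/-- The local flow of a time-dependent vector field `u (t, s)`, with time `s ∈ [0, 1]` and a
parameter `t`, that vanishes for `t = 0`. -/
theorem exists_local_flow [FiniteDimensional ℝ E] {ε : ℝ} (hε : 0 < ε) {O : Set E} (hO : IsOpen O)
    {u : ℝ × ℝ → E → E}
    (hu : ContDiffOn ℝ ∞ (fun p : (ℝ × ℝ) × E => u p.1 p.2) ((Ioo (-ε) ε ×ˢ Icc 0 1) ×ˢ O))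
    (hu0 : ∀ s ∈ Icc (0 : ℝ) 1, ∀ x ∈ O, u (0, s) x = 0) {x₀ : E} (hx₀ : x₀ ∈ O) :
    ∃ δ > 0, δ ≤ ε ∧ ∃ ρ > 0, ball x₀ ρ ⊆ O ∧ ∃ ζ : ℝ → ℝ → E → ℝ → E,
      (∀ t ∈ Ioo (-δ) δ, ∀ s₀ ∈ Icc (0 : ℝ) 1, ∀ x ∈ ball x₀ ρ, ζ t s₀ x s₀ = x ∧
        ∀ s ∈ Icc (0 : ℝ) 1, ζ t s₀ x s ∈ O ∧
          HasDerivWithinAt (ζ t s₀ x) (u (t, s) (ζ t s₀ x s)) (Icc 0 1) s) ∧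
      ContDiffOn ℝ ∞ (fun p : (ℝ × ℝ × ℝ) × E => ζ p.1.1 p.1.2.1 p.2 p.1.2.2)
        ((Ioo (-δ) δ ×ˢ Icc 0 1 ×ˢ Icc 0 1) ×ˢ ball x₀ ρ) ∧
      ∀ t ∈ Ioo (-δ) δ, ∀ x ∈ ball x₀ ρ, ∃ A : ℝ → E →L[ℝ] E, A 0 = ContinuousLinearMap.id ℝ E ∧
        (∀ s ∈ Icc (0 : ℝ) 1, HasFDerivAt (fun x => ζ t 0 x s) (A s) x) ∧
        ∀ s ∈ Icc (0 : ℝ) 1, ∀ v, HasDerivWithinAt (fun s => A s v)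
          (fderiv ℝ (u (t, s)) (ζ t 0 x s) (A s v)) (Icc 0 1) s := by
  obtain ⟨R, hR, hRO⟩ := Metric.isOpen_iff.1 hO x₀ hx₀
  set ρ : ℝ := R / 3 with hρdef
  have hρ : 0 < ρ := by positivity
  have hcb : closedBall x₀ (2 * ρ) ⊆ O := (closedBall_subset_ball (by linarith)).trans hRO
  have hSu : UniqueDiffOn ℝ (Ioo (-ε) ε ×ˢ Icc (0 : ℝ) 1) :=
    isOpen_Ioo.uniqueDiffOn.prod (uniqueDiffOn_Icc one_pos)
  obtain ⟨u', hu's, hu'⟩ := exists_partial_fderiv_snd hSu hO.uniqueDiffOn hu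
  have hu'd : ∀ r ∈ Ioo (-ε) ε ×ˢ Icc (0 : ℝ) 1, ∀ z ∈ O, HasFDerivAt (u r) (u' (r, z)) z :=
    fun r hr z hz => (hu' r hr z hz).hasFDerivAt (hO.mem_nhds hz)
  have h0mem : (0 : ℝ) ∈ Ioo (-ε) ε := ⟨by linarith, hε⟩
  have hu'0 : ∀ s ∈ Icc (0 : ℝ) 1, ∀ z ∈ O, u' ((0, s), z) = 0 := by
    intro s hs z hz
    refine (hu'd (0, s) ⟨h0mem, hs⟩ z hz).unique ?_
    refine (hasFDerivAt_const (0 : E) z).congr_of_eventuallyEq ?_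
    filter_upwards [hO.mem_nhds hz] with w hw using hu0 s hs w hw
  have hI : IsCompact (Icc (0 : ℝ) 1 ×ˢ closedBall x₀ (2 * ρ)) :=
    isCompact_Icc.prod (isCompact_closedBall _ _)
  have hmap : MapsTo (fun q : (ℝ × E) × ℝ => ((q.2, q.1.1), q.1.2))
      ((Icc (0 : ℝ) 1 ×ˢ closedBall x₀ (2 * ρ)) ×ˢ Ioo (-ε) ε) ((Ioo (-ε) ε ×ˢ Icc 0 1) ×ˢ O) :=
    fun q hq => ⟨⟨hq.2, hq.1.1⟩, hcb hq.1.2⟩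
  have hmapc : Continuous (fun q : (ℝ × E) × ℝ => ((q.2, q.1.1), q.1.2)) := by fun_prop
  obtain ⟨δ₁, hδ₁, h1⟩ := exists_dist_lt_of_continuousOn hI
    (hu.continuousOn.comp hmapc.continuousOn hmap) (z := fun _ => 0) continuousOn_const
    (fun _ _ => h0mem) (half_pos hρ)
  obtain ⟨δ₂, hδ₂, h2⟩ := exists_dist_lt_of_continuousOn hI
    (hu's.continuousOn.comp hmapc.continuousOn hmap) (z := fun _ => 0) continuousOn_const
    (fun _ _ => h0mem) (half_pos one_pos)
  set δ := min ε (min δ₁ δ₂) with hδdef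
  have hδ : 0 < δ := by positivity
  have hδε : Ioo (-δ) δ ⊆ Ioo (-ε) ε :=
    Ioo_subset_Ioo (neg_le_neg (min_le_left _ _)) (min_le_left _ _)
  have hub : ∀ t ∈ Ioo (-δ) δ, ∀ s ∈ Icc (0 : ℝ) 1, ∀ z ∈ closedBall x₀ (2 * ρ),
      ‖u (t, s) z‖ ≤ ρ / 2 := by
    intro t ht s hs z hz
    have := h1 (s, z) ⟨hs, hz⟩ t (hδε ht) (by
      rw [Real.dist_eq, sub_zero, abs_lt]
      have : δ ≤ δ₁ := (min_le_right _ _).trans (min_le_left _ _)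
      exact ⟨by linarith [ht.1], by linarith [ht.2]⟩)
    simpa [dist_eq_norm, hu0 s hs z (hcb hz)] using this.le
  have hu'b : ∀ t ∈ Ioo (-δ) δ, ∀ s ∈ Icc (0 : ℝ) 1, ∀ z ∈ closedBall x₀ (2 * ρ),
      ‖u' ((t, s), z)‖ ≤ 1 / 2 := by
    intro t ht s hs z hz
    have := h2 (s, z) ⟨hs, hz⟩ t (hδε ht) (by
      rw [Real.dist_eq, sub_zero, abs_lt]
      have : δ ≤ δ₂ := (min_le_right _ _).trans (min_le_right _ _)
      exact ⟨by linarith [ht.1], by linarith [ht.2]⟩)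
    simpa [dist_eq_norm, hu'0 s hs z (hcb hz)] using this.le
  have hLip : ∀ t ∈ Ioo (-δ) δ, ∀ s ∈ Icc (0 : ℝ) 1,
      LipschitzOnWith (1 / 2 : ℝ≥0) (u (t, s)) (closedBall x₀ (2 * ρ)) := by
    intro t ht s hs
    refine (convex_closedBall _ _).lipschitzOnWith_of_nnnorm_hasFDerivWithin_le
      (f' := fun z => u' ((t, s), z))
      (fun z hz => (hu'd (t, s) ⟨hδε ht, hs⟩ z (hcb hz)).hasFDerivWithinAt) (fun z hz => ?_)
    have := hu'b t ht s hs z hz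
    rw [← NNReal.coe_le_coe]
    simpa using this
  have hex : ∀ t ∈ Ioo (-δ) δ, ∀ s₀ ∈ Icc (0 : ℝ) 1, ∀ x ∈ ball x₀ ρ, ∃ α : ℝ → E, α s₀ = x ∧
      ∀ s ∈ Icc (0 : ℝ) 1, α s ∈ closedBall x (ρ / 2) ∧
      HasDerivWithinAt α (u (t, s) (α s)) (Icc 0 1) s := by
    intro t ht s₀ hs₀ x hx
    have hsub : closedBall x (ρ / 2) ⊆ closedBall x₀ (2 * ρ) :=
      closedBall_subset_closedBall' (by have := mem_ball.1 hx; linarith)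
    refine exists_solution_mem_closedBall (f := fun s => u (t, s)) hs₀
      (a := ⟨ρ / 2, by positivity⟩)
      (fun s hs => (hLip t ht s hs).mono hsub) (fun z hz => ?_)
      (fun s hs z hz => hub t ht s hs z (hsub hz))
    exact hu.continuousOn.comp (f := fun s : ℝ => ((t, s), z)) (by fun_prop)
      (fun s hs => ⟨⟨hδε ht, hs⟩, hcb (hsub hz)⟩)
  choose! ζ hζ0 hζ using hex
  set B : Set E := ball x₀ (2 * ρ) with hB
  have hBO : B ⊆ O := ball_subset_closedBall.trans hcb
  have hζB : ∀ t ∈ Ioo (-δ) δ, ∀ s₀ ∈ Icc (0 : ℝ) 1, ∀ x ∈ ball x₀ ρ, ∀ s ∈ Icc (0 : ℝ) 1,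
      ζ t s₀ x s ∈ B := by
    intro t ht s₀ hs₀ x hx s hs
    have h3 := mem_closedBall.1 (hζ t ht s₀ hs₀ x hx s hs).1
    have h4 := mem_ball.1 hx
    refine mem_ball.2 ((dist_triangle _ x _).trans_lt ?_)
    linarith
  set Y : Set ((ℝ × ℝ × ℝ) × E) := (Ioo (-δ) δ ×ˢ Icc 0 1 ×ˢ Icc 0 1) ×ˢ ball x₀ ρ with hYdef
  have hYc : Convex ℝ Y :=
    ((convex_Ioo _ _).prod ((convex_Icc _ _).prod (convex_Icc _ _))).prod (convex_ball _ _)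
  have hYu : UniqueDiffOn ℝ Y :=
    (isOpen_Ioo.uniqueDiffOn.prod ((uniqueDiffOn_Icc one_pos).prod
      (uniqueDiffOn_Icc one_pos))).prod isOpen_ball.uniqueDiffOn
  let g : ℝ × ((ℝ × ℝ × ℝ) × E) × E → E := fun p => (p.2.1.1.2.2 - p.2.1.1.2.1) •
    u (p.2.1.1.1, p.2.1.1.2.1 + p.1 * (p.2.1.1.2.2 - p.2.1.1.2.1)) p.2.2
  have haff : ∀ r ∈ Icc (0 : ℝ) 1, ∀ a ∈ Icc (0 : ℝ) 1, ∀ b ∈ Icc (0 : ℝ) 1,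
      a + r * (b - a) ∈ Icc (0 : ℝ) 1 := by
    intro r hr a ha b hb
    have := (convex_Icc (0 : ℝ) 1) ha hb (a := 1 - r) (b := r) (by linarith [hr.2]) hr.1 (by ring)
    simp only [smul_eq_mul] at this
    convert! this using 1
    ring
  have hg : ContDiffOn ℝ ∞ g (Icc 0 1 ×ˢ Y ×ˢ B) := by
    refine ContDiffOn.smul (by fun_prop) ?_
    exact hu.comp (f := fun p : ℝ × ((ℝ × ℝ × ℝ) × E) × E =>
      ((p.2.1.1.1, p.2.1.1.2.1 + p.1 * (p.2.1.1.2.2 - p.2.1.1.2.1)), p.2.2)) (by fun_prop)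
      (fun p hp => ⟨⟨hδε hp.2.1.1.1, haff _ hp.1 _ hp.2.1.1.2.1 _ hp.2.1.1.2.2⟩, hBO hp.2.2⟩)
  obtain ⟨g', hg's, hg'⟩ := exists_partial_fderiv_snd (uniqueDiffOn_Icc (one_pos (α := ℝ)))
    (hYu.prod (isOpen_ball (x := x₀) (ε := 2 * ρ)).uniqueDiffOn) hg
  have hg'inr : ∀ r ∈ Icc (0 : ℝ) 1, ∀ y ∈ Y, ∀ z ∈ B, ∀ a, g' (r, y, z) (0, a) =
      (y.1.2.2 - y.1.2.1) • u' ((y.1.1, y.1.2.1 + r * (y.1.2.2 - y.1.2.1)), z) a := by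
    intro r hr y hy z hz a
    have e1 : HasFDerivAt (fun z => g (r, y, z))
        ((g' (r, y, z)).comp (ContinuousLinearMap.inr ℝ _ E)) z :=
      ((hg' r hr (y, z) ⟨hy, hz⟩).comp z (t := Y ×ˢ B)
        (hasFDerivAt_prodMk_right y z).hasFDerivWithinAt (s := B)
        (fun w hw => ⟨hy, hw⟩)).hasFDerivAt (isOpen_ball.mem_nhds hz)
    have e2 : HasFDerivAt (fun z => g (r, y, z)) ((y.1.2.2 - y.1.2.1) •
        u' ((y.1.1, y.1.2.1 + r * (y.1.2.2 - y.1.2.1)), z)) z :=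
      (hu'd (y.1.1, y.1.2.1 + r * (y.1.2.2 - y.1.2.1))
        ⟨hδε hy.1.1, haff r hr _ hy.1.2.1 _ hy.1.2.2⟩ z (hBO hz)).const_smul (y.1.2.2 - y.1.2.1)
    have := congrArg (fun L : E →L[ℝ] E => L a) (e1.unique e2)
    simpa using this
  have habs : ∀ y ∈ Y, |y.1.2.2 - y.1.2.1| ≤ 1 := by
    intro y hy
    have h1 := hy.1.2.1
    have h2 := hy.1.2.2
    rw [abs_le]
    exact ⟨by linarith [h1.2, h2.1], by linarith [h1.1, h2.2]⟩
  have hfam : SolutionFamily Y B g g' (fun y => y.2)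
      (fun y r => ζ y.1.1 y.1.2.1 y.2 (y.1.2.1 + r * (y.1.2.2 - y.1.2.1))) := by
    have hder : ∀ y ∈ Y, ∀ r ∈ Icc (0 : ℝ) 1, HasDerivWithinAt
        (fun r => ζ y.1.1 y.1.2.1 y.2 (y.1.2.1 + r * (y.1.2.2 - y.1.2.1)))
        (g (r, y, ζ y.1.1 y.1.2.1 y.2 (y.1.2.1 + r * (y.1.2.2 - y.1.2.1)))) (Icc 0 1) r := by
      intro y hy r hr
      have h3 : HasDerivWithinAt (fun r : ℝ => y.1.2.1 + r * (y.1.2.2 - y.1.2.1))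
          (y.1.2.2 - y.1.2.1) (Icc 0 1) r := by
        simpa using ((hasDerivAt_id r).mul_const (y.1.2.2 - y.1.2.1)).const_add y.1.2.1
          |>.hasDerivWithinAt
      have h4 := (hζ y.1.1 hy.1.1 y.1.2.1 hy.1.2.1 y.2 hy.2 _
        (haff r hr _ hy.1.2.1 _ hy.1.2.2)).2
      exact h4.scomp r h3 (fun r hr => haff r hr _ hy.1.2.1 _ hy.1.2.2)
    have hmem : ∀ y ∈ Y, ∀ r ∈ Icc (0 : ℝ) 1,
        ζ y.1.1 y.1.2.1 y.2 (y.1.2.1 + r * (y.1.2.2 - y.1.2.1)) ∈ B := fun y hy r hr =>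
      hζB _ hy.1.1 _ hy.1.2.1 _ hy.2 _ (haff r hr _ hy.1.2.1 _ hy.1.2.2)
    refine ⟨convex_ball _ _, isOpen_ball, hg, hg's, hg', contDiffOn_snd, ?_, hmem, hder, ?_, ?_⟩
    · intro y hy
      simpa using hζ0 y.1.1 hy.1.1 y.1.2.1 hy.1.2.1 y.2 hy.2
    · intro y₀ hy₀ η hη
      set γ₀ := fun r => ζ y₀.1.1 y₀.1.2.1 y₀.2 (y₀.1.2.1 + r * (y₀.1.2.2 - y₀.1.2.1)) with hγ₀
      set κ : ℝ := η / (4 * Real.exp 1) with hκ'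
      have hκ : 0 < κ := by positivity
      obtain ⟨ρ', hρ', hclose⟩ := exists_dist_lt_of_continuousOn (isCompact_Icc (a := (0 : ℝ))
        (b := 1)) hg.continuousOn (z := fun r => (y₀, γ₀ r))
        (continuousOn_const.prodMk (fun r hr => (hder y₀ hy₀ r hr).continuousWithinAt))
        (fun r hr => ⟨hy₀, hmem y₀ hy₀ r hr⟩) hκ
      filter_upwards [self_mem_nhdsWithin, mem_nhdsWithin_of_mem_nhds (ball_mem_nhds y₀ hρ'),
        mem_nhdsWithin_of_mem_nhds (ball_mem_nhds y₀ hκ)] with y hy hy1 hy2 r hr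
      have := norm_le_of_norm_deriv_le (δ := κ) (K := 1) (ε := κ)
        (fun r hr => (hder y hy r hr).sub (hder y₀ hy₀ r hr))
        (by
          have e1 := hζ0 y.1.1 hy.1.1 y.1.2.1 hy.1.2.1 y.2 hy.2
          have e2 := hζ0 y₀.1.1 hy₀.1.1 y₀.1.2.1 hy₀.1.2.1 y₀.2 hy₀.2
          simp only [Pi.sub_apply, zero_mul, add_zero, e1, e2]
          rw [← dist_eq_norm]
          exact (le_max_right _ _).trans (mem_ball.1 hy2).le) le_rfl hκ.le
        (fun s hs => by
          have h5 := (hclose s hs (y, γ₀ s) ⟨hy, hmem y₀ hy₀ s hs⟩ (by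
            rw [Prod.dist_eq]; simpa [hρ'] using hy1)).le
          rw [dist_eq_norm] at h5
          set γ₁ := ζ y.1.1 y.1.2.1 y.2 (y.1.2.1 + s * (y.1.2.2 - y.1.2.1)) with hγ₁
          have h6 : ‖g (s, y, γ₁) - g (s, y, γ₀ s)‖ ≤ ‖γ₁ - γ₀ s‖ := by
            have h7 := (hLip y.1.1 hy.1.1 _ (haff s hs _ hy.1.2.1 _ hy.1.2.2)).dist_le_mul γ₁
              (ball_subset_closedBall (hmem y hy s hs)) (γ₀ s)
              (ball_subset_closedBall (hmem y₀ hy₀ s hs))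
            rw [dist_eq_norm, dist_eq_norm] at h7
            show ‖_ • _ - _ • _‖ ≤ _
            rw [← smul_sub, norm_smul, Real.norm_eq_abs]
            have h8 := habs y hy
            have h9 : ((1 / 2 : ℝ≥0) : ℝ) = 1 / 2 := by norm_num
            rw [h9] at h7
            nlinarith [norm_nonneg (γ₁ - γ₀ s), abs_nonneg (y.1.2.2 - y.1.2.1), norm_nonneg (u (y.1.1, y.1.2.1 + s * (y.1.2.2 - y.1.2.1)) γ₁ - u (y.1.1, y.1.2.1 + s * (y.1.2.2 - y.1.2.1)) (γ₀ s))]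
          have h10 : g (s, y, γ₁) - g (s, y₀, γ₀ s) =
            (g (s, y, γ₁) - g (s, y, γ₀ s)) + (g (s, y, γ₀ s) - g (s, y₀, γ₀ s)) := by abel
          show ‖g (s, y, γ₁) - g (s, y₀, γ₀ s)‖ ≤ 1 * ‖γ₁ - γ₀ s‖ + κ
          rw [h10, one_mul]
          exact (norm_add_le _ _).trans (add_le_add h6 h5)) r hr
      refine this.trans_lt ?_
      have : (κ + κ) * Real.exp 1 = η / 2 := by rw [hκ']; field_simp; norm_num
      rw [this]
      linarith
    · intro y hy N hN a
      have hzc : ContinuousOn (fun r => ζ y.1.1 y.1.2.1 y.2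
          (y.1.2.1 + r * (y.1.2.2 - y.1.2.1))) (Icc 0 1) :=
        fun r hr => (hder y hy r hr).continuousWithinAt
      have hM : ContinuousOn (fun r => (g' (r, y, ζ y.1.1 y.1.2.1 y.2
          (y.1.2.1 + r * (y.1.2.2 - y.1.2.1)))).comp (ContinuousLinearMap.inr ℝ _ E)) (Icc 0 1) :=
        (hg's.continuousOn.comp (continuousOn_id.prodMk (continuousOn_const.prodMk hzc))
          (fun r hr => ⟨hr, hy, hmem y hy r hr⟩)).clm_comp continuousOn_const
      refine exists_linear_solution hM hN (fun r hr => ?_) a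
      refine ContinuousLinearMap.opNorm_le_bound _ (by norm_num) fun b => ?_
      rw [ContinuousLinearMap.comp_apply, ContinuousLinearMap.inr_apply,
        hg'inr r hr y hy _ (hmem y hy r hr), norm_smul, Real.norm_eq_abs]
      have h3 := (u' ((y.1.1, y.1.2.1 + r * (y.1.2.2 - y.1.2.1)),
        ζ y.1.1 y.1.2.1 y.2 (y.1.2.1 + r * (y.1.2.2 - y.1.2.1)))).le_opNorm b
      have h4 := hu'b y.1.1 hy.1.1 _ (haff r hr _ hy.1.2.1 _ hy.1.2.2) _
        (ball_subset_closedBall (hmem y hy r hr))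
      have h5 := mul_le_mul_of_nonneg_right h4 (norm_nonneg b)
      exact (mul_le_mul (habs y hy) (h3.trans h5) (norm_nonneg _) zero_le_one).trans (by linarith)
  refine ⟨δ, hδ, min_le_left _ _, ρ, hρ, (ball_subset_ball (by linarith)).trans hBO, ζ,
    fun t ht s₀ hs₀ x hx => ⟨hζ0 t ht s₀ hs₀ x hx, fun s hs =>
      ⟨hBO (hζB t ht s₀ hs₀ x hx s hs), (hζ t ht s₀ hs₀ x hx s hs).2⟩⟩, ?_, ?_⟩
  · rw [contDiffOn_infty]
    intro k
    have := SolutionFamily.contDiffOn_nat hYc hYu k hfam 1 (by simp)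
    simpa only [one_mul, add_sub_cancel] using this
  · intro t ht x hx
    set y₀ : (ℝ × ℝ × ℝ) × E := ((t, 0, 1), x) with hy₀def
    have hy₀ : y₀ ∈ Y := ⟨⟨ht, by simp [hy₀def], by simp [hy₀def]⟩, hx⟩
    let J : E →L[ℝ] (ℝ × ℝ × ℝ) × E := ContinuousLinearMap.inr ℝ (ℝ × ℝ × ℝ) E
    obtain ⟨A, hA0, hA, C, hC, hAC⟩ := hfam.exists_derivative hy₀ (ContinuousLinearMap.snd ℝ _ E)
    have hd := hfam.hasFDerivWithinAt hYc hy₀ (by rw [hA0]; exact hasFDerivWithinAt_snd) hA hC hAC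
    refine ⟨fun s => (A s).comp J, ?_, fun s hs => ?_, fun s hs v => ?_⟩
    · show (A 0).comp J = _
      rw [hA0]; ext v; simp [J]
    · have h1 := (hd s hs).comp x (s := ball x₀ ρ)
        (hasFDerivAt_prodMk_right (t, (0 : ℝ), (1 : ℝ)) x).hasFDerivWithinAt
        (fun w hw => ⟨hy₀.1, hw⟩)
      have h2 := h1.hasFDerivAt (isOpen_ball.mem_nhds hx)
      convert! h2 using 2
      simp
    · have hz : ζ t 0 x s ∈ B := hζB t ht 0 (by simp) x hx s hs
      have h1 := hA (J v) s hs
      have h2 : fderiv ℝ (u (t, s)) (ζ t 0 x s) = u' ((t, s), ζ t 0 x s) :=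
        (hu'd (t, s) ⟨hδε ht, hs⟩ _ (hBO hz)).fderiv
      rw [h2]
      convert! h1 using 1
      have h3 : HasFDerivAt (fun p : E × E => g (s, ((t, 0, 1), p.1), p.2))
          ((g' (s, ((t, 0, 1), x), ζ t 0 x s)).comp
            ((J.comp (ContinuousLinearMap.fst ℝ E E)).prod (ContinuousLinearMap.snd ℝ E E)))
          (x, ζ t 0 x s) := by
        have h4 : HasFDerivWithinAt
            (fun p : E × E => ((((t, 0, 1) : ℝ × ℝ × ℝ), p.1), p.2))
            ((J.comp (ContinuousLinearMap.fst ℝ E E)).prod (ContinuousLinearMap.snd ℝ E E))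
            (ball x₀ ρ ×ˢ B) (x, ζ t 0 x s) := by
          refine HasFDerivAt.hasFDerivWithinAt ?_
          have h5 := ((hasFDerivAt_const ((t, 0, 1) : ℝ × ℝ × ℝ) (x, ζ t 0 x s)).prodMk
            (hasFDerivAt_fst (𝕜 := ℝ) (p := (x, ζ t 0 x s)))).prodMk
            (hasFDerivAt_snd (𝕜 := ℝ) (p := (x, ζ t 0 x s)))
          convert! h5 using 1
        exact ((hg' s hs (((t, 0, 1), x), ζ t 0 x s) ⟨hy₀, hz⟩).comp (x, ζ t 0 x s) h4
          (t := Y ×ˢ B) (fun w hw => ⟨⟨hy₀.1, hw.1⟩, hw.2⟩)).hasFDerivAt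
          ((isOpen_ball.prod isOpen_ball).mem_nhds ⟨hx, hz⟩)
      have h6 : HasFDerivAt (fun p : E × E => g (s, ((t, 0, 1), p.1), p.2))
          ((u' ((t, s), ζ t 0 x s)).comp (ContinuousLinearMap.snd ℝ E E)) (x, ζ t 0 x s) := by
        have h7 := (hu'd (t, s) ⟨hδε ht, hs⟩ _ (hBO hz)).comp (x, ζ t 0 x s)
          (hasFDerivAt_snd (𝕜 := ℝ) (E := E))
        convert! h7 using 1
        funext p
        simp [g]
      have h8 := congrArg (fun L : E × E →L[ℝ] E => L (v, A s (J v))) (h3.unique h6)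
      simpa [hy₀def] using h8.symm

end LocalFlow
end Engel

namespace Engel

section Inverse

open Set Filter

theorem contDiffOn_of_rightInvOn {E F : Type*} [NormedAddCommGroup E] [NormedSpace ℝ E]
    [CompleteSpace E] [NormedAddCommGroup F] [NormedSpace ℝ F] {S : Set E} {T : Set F} {f : E → F}
    {g : F → E} (hS : UniqueDiffOn ℝ S) (hT : UniqueDiffOn ℝ T) (hf : ContDiffOn ℝ ∞ f S)
    (hg : ContinuousOn g T) (hgS : MapsTo g T S) (hfg : ∀ y ∈ T, f (g y) = y)
    (he : ∀ x ∈ S, ∃ e : E ≃L[ℝ] F, HasFDerivWithinAt f (e : E →L[ℝ] F) S x) :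
    ContDiffOn ℝ ∞ g T := by
  have hd : ∀ y ∈ T, HasFDerivWithinAt g (fderivWithin ℝ f S (g y)).inverse T y := by
    intro y hy
    obtain ⟨e, he⟩ := he (g y) (hgS hy)
    rw [he.fderivWithin (hS _ (hgS hy)), ContinuousLinearMap.inverse_equiv]
    refine HasFDerivWithinAt.of_local_left_inverse (f := f) (t := S) ?_ he hy ?_
    · exact tendsto_nhdsWithin_iff.2 ⟨hg y hy, by
        filter_upwards [self_mem_nhdsWithin] with z hz using hgS hz⟩
    · filter_upwards [self_mem_nhdsWithin] with z hz using hfg z hz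
  rw [contDiffOn_infty]
  intro k
  induction k with
  | zero => simpa using hg
  | succ k ih =>
    push_cast
    rw [contDiffOn_succ_iff_fderivWithin hT]
    refine ⟨fun y hy => (hd y hy).differentiableWithinAt, by simp, ?_⟩
    refine ContDiffOn.congr (f := fun y => (fderivWithin ℝ f S (g y)).inverse) ?_
      (fun y hy => (hd y hy).fderivWithin (hT y hy))
    intro y hy
    obtain ⟨e, he⟩ := he (g y) (hgS hy)
    have h1 : ContDiffWithinAt ℝ k (fun y => fderivWithin ℝ f S (g y)) T y :=
      (((hf.fderivWithin hS (m := ∞) le_rfl).of_le (by exact_mod_cast le_top)).comp ih hgS) y hy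
    refine ContDiffAt.comp_contDiffWithinAt (g := ContinuousLinearMap.inverse) y ?_ h1
    rw [he.fderivWithin (hS _ (hgS hy))]
    exact contDiffAt_map_inverse e

theorem continuousOn_of_strictMonoOn {X : Type*} [TopologicalSpace X] {k κ : X → ℝ → ℝ}
    (hk : ContinuousOn (fun p : X × ℝ => k p.1 p.2) (univ ×ˢ Icc 0 1))
    (hmono : ∀ x, StrictMonoOn (k x) (Icc 0 1))
    (hκ : ∀ x, ∀ y ∈ Icc (0 : ℝ) 1, κ x y ∈ Icc (0 : ℝ) 1 ∧ k x (κ x y) = y) :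
    ContinuousOn (fun p : X × ℝ => κ p.1 p.2) (univ ×ˢ Icc 0 1) := by
  have hkc : ∀ s ∈ Icc (0 : ℝ) 1, Continuous (fun x => k x s) := fun s hs =>
    continuousOn_univ.1 (hk.comp (f := fun x : X => (x, s)) (by fun_prop) (fun x _ => ⟨trivial, hs⟩))
  rintro ⟨x₀, y₀⟩ ⟨-, hy₀⟩
  obtain ⟨hs₀, hks₀⟩ := hκ x₀ y₀ hy₀
  refine tendsto_order.2 ⟨fun a ha => ?_, fun a ha => ?_⟩
  · rcases lt_or_ge a 0 with h | h
    · filter_upwards [self_mem_nhdsWithin] with p hp using h.trans_le (hκ p.1 p.2 hp.2).1.1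
    · have ha1 : a ∈ Icc (0 : ℝ) 1 := ⟨h, ha.le.trans hs₀.2⟩
      have h1 : k x₀ a < y₀ := hks₀ ▸ hmono x₀ ha1 hs₀ ha
      have h2 : ∀ᶠ p : X × ℝ in 𝓝 (x₀, y₀), k p.1 a < p.2 :=
        (((hkc a ha1).comp continuous_fst).tendsto (x₀, y₀)).eventually_lt
          (continuous_snd.tendsto (x₀, y₀)) h1
      filter_upwards [self_mem_nhdsWithin, mem_nhdsWithin_of_mem_nhds h2] with p hp hp2
      obtain ⟨h3, h4⟩ := hκ p.1 p.2 hp.2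
      by_contra hcon
      exact absurd ((hmono p.1).monotoneOn h3 ha1 (not_lt.1 hcon)) (by rw [h4]; exact not_le.2 hp2)
  · rcases lt_or_ge 1 a with h | h
    · filter_upwards [self_mem_nhdsWithin] with p hp using (hκ p.1 p.2 hp.2).1.2.trans_lt h
    · have ha1 : a ∈ Icc (0 : ℝ) 1 := ⟨hs₀.1.trans ha.le, h⟩
      have h1 : y₀ < k x₀ a := hks₀ ▸ hmono x₀ hs₀ ha1 ha
      have h2 : ∀ᶠ p : X × ℝ in 𝓝 (x₀, y₀), p.2 < k p.1 a :=
        (continuous_snd.tendsto (x₀, y₀)).eventually_lt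
          (((hkc a ha1).comp continuous_fst).tendsto (x₀, y₀)) h1
      filter_upwards [self_mem_nhdsWithin, mem_nhdsWithin_of_mem_nhds h2] with p hp hp2
      obtain ⟨h3, h4⟩ := hκ p.1 p.2 hp.2
      by_contra hcon
      exact absurd ((hmono p.1).monotoneOn ha1 h3 (not_lt.1 hcon)) (by rw [h4]; exact not_le.2 hp2)

end Inverse

/-- The model space of a three-manifold. -/
abbrev E3 : Type := EuclideanSpace ℝ (Fin 3)

section Charts

open Set Filter

variable {M : Type*} [TopologicalSpace M] [ChartedSpace E3 M] [IsManifold (𝓡 3) ∞ M]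
  {T : Type*} [NormedAddCommGroup T] [NormedSpace ℝ T] {S : Set T}
  {E' : Type*} [NormedAddCommGroup E'] [NormedSpace ℝ E'] {H' : Type*} [TopologicalSpace H']
  {J : ModelWithCorners ℝ E' H'} {N : Type*} [TopologicalSpace N] [ChartedSpace H' N]

theorem ContMDiffOn.comp_extChartAt_symm {f : T × M → N} {V : Set M}
    (hf : ContMDiffOn (𝓘(ℝ, T).prod (𝓡 3)) J ∞ f (S ×ˢ V)) (m₀ : M)
    (hV : (extChartAt (𝓡 3) m₀).source ⊆ V) :
    ContMDiffOn 𝓘(ℝ, T × E3) J ∞ (fun p => f (p.1, (extChartAt (𝓡 3) m₀).symm p.2))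
      (S ×ˢ (extChartAt (𝓡 3) m₀).target) := by
  refine hf.comp (t := S ×ˢ V) (f := fun p : T × E3 => (p.1, (extChartAt (𝓡 3) m₀).symm p.2)) ?_
    (fun p hp => ⟨hp.1, hV ((extChartAt (𝓡 3) m₀).map_target hp.2)⟩)
  exact contDiff_fst.contMDiff.contMDiffOn.prodMk
    ((contMDiffOn_extChartAt_symm m₀).comp (contDiff_snd.contMDiff.contMDiffOn) (fun p hp => hp.2))

theorem ContMDiffOn.comp_extChartAt {f : T × E3 → N} {m₀ : M}
    (hf : ContMDiffOn 𝓘(ℝ, T × E3) J ∞ f (S ×ˢ (extChartAt (𝓡 3) m₀).target)) :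
    ContMDiffOn (𝓘(ℝ, T).prod (𝓡 3)) J ∞ (fun p : T × M => f (p.1, extChartAt (𝓡 3) m₀ p.2))
      (S ×ˢ (extChartAt (𝓡 3) m₀).source) := by
  refine hf.comp (f := fun p : T × M => (p.1, extChartAt (𝓡 3) m₀ p.2)) ?_
    (fun p hp => ⟨hp.1, (extChartAt (𝓡 3) m₀).map_source hp.2⟩)
  refine contMDiff_fst.contMDiffOn.prodMk_space ?_
  refine (contMDiffOn_extChartAt (x := m₀)).comp contMDiff_snd.contMDiffOn (fun p hp => ?_)
  simpa using hp.2

theorem contMDiffOn_of_extChartAt {f : T × M → N}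
    (hf : ∀ m₀ : M, ContMDiffOn 𝓘(ℝ, T × E3) J ∞
      (fun p => f (p.1, (extChartAt (𝓡 3) m₀).symm p.2)) (S ×ˢ (extChartAt (𝓡 3) m₀).target)) :
    ContMDiffOn (𝓘(ℝ, T).prod (𝓡 3)) J ∞ f (S ×ˢ univ) := by
  rintro ⟨τ, m⟩ ⟨hτ, -⟩
  have h1 := (ContMDiffOn.comp_extChartAt (hf m)).congr (f₁ := f) (fun p hp => by
    simp only
    rw [(extChartAt (𝓡 3) m).left_inv hp.2])
  refine (h1 (τ, m) ⟨hτ, mem_extChartAt_source m⟩).mono_of_mem_nhdsWithin ?_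
  rw [mem_nhdsWithin]
  exact ⟨univ ×ˢ (extChartAt (𝓡 3) m).source, isOpen_univ.prod (isOpen_extChartAt_source m),
    ⟨trivial, mem_extChartAt_source m⟩, fun p hp => ⟨hp.2.1, hp.1.2⟩⟩

/-- The inverse functions of a family of strictly increasing smooth functions on `[0, 1]`. -/
theorem contMDiffOn_inverse_Icc {k κ : M → ℝ → ℝ}
    (hk : ContMDiffOn (𝓘(ℝ, ℝ).prod (𝓡 3)) 𝓘(ℝ, ℝ) ∞ (fun p : ℝ × M => k p.2 p.1)
      (Icc 0 1 ×ˢ univ))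
    (hκ : ∀ m, ∀ y ∈ Icc (0 : ℝ) 1, κ m y ∈ Icc (0 : ℝ) 1 ∧ k m (κ m y) = y)
    (hpos : ∀ m, ∀ s ∈ Icc (0 : ℝ) 1, 0 < derivWithin (k m) (Icc 0 1) s) :
    ContMDiffOn (𝓘(ℝ, ℝ).prod (𝓡 3)) 𝓘(ℝ, ℝ) ∞ (fun p : ℝ × M => κ p.2 p.1)
      (Icc 0 1 ×ˢ univ) := by
  have hkc : ContinuousOn (fun p : M × ℝ => k p.1 p.2) (univ ×ˢ Icc 0 1) :=
    hk.continuousOn.comp (f := fun p : M × ℝ => (p.2, p.1)) (by fun_prop) (fun p hp => ⟨hp.2, hp.1⟩)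
  have hmono : ∀ m, StrictMonoOn (k m) (Icc 0 1) := by
    intro m
    refine strictMonoOn_of_deriv_pos (convex_Icc 0 1)
      (hkc.comp (f := fun s : ℝ => (m, s)) (by fun_prop) (fun s hs => ⟨trivial, hs⟩)) ?_
    intro s hs
    rw [interior_Icc] at hs
    have := hpos m s ⟨hs.1.le, hs.2.le⟩
    rwa [derivWithin_of_mem_nhds (Icc_mem_nhds hs.1 hs.2)] at this
  have hκc := continuousOn_of_strictMonoOn hkc hmono hκ
  refine contMDiffOn_of_extChartAt fun m₀ => ?_
  set φ := extChartAt (𝓡 3) m₀ with hφ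
  have hk' := contMDiffOn_iff_contDiffOn.1 (ContMDiffOn.comp_extChartAt_symm hk m₀ (subset_univ _))
  rw [← hφ] at hk'
  rw [contMDiffOn_iff_contDiffOn]
  have hφt : IsOpen φ.target := isOpen_extChartAt_target m₀
  have hu : UniqueDiffOn ℝ (Icc (0 : ℝ) 1 ×ˢ φ.target) :=
    (uniqueDiffOn_Icc one_pos).prod hφt.uniqueDiffOn
  have hF := contDiffOn_of_rightInvOn (S := Icc (0 : ℝ) 1 ×ˢ φ.target)
    (T := Icc (0 : ℝ) 1 ×ˢ φ.target) (f := fun p : ℝ × E3 => (k (φ.symm p.2) p.1, p.2))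
    (g := fun p : ℝ × E3 => (κ (φ.symm p.2) p.1, p.2)) hu hu (hk'.prodMk contDiffOn_snd) ?_
    (fun p hp => ⟨(hκ _ _ hp.1).1, hp.2⟩)
    (fun p hp => Prod.ext (hκ _ _ hp.1).2 rfl) ?_
  · exact contDiff_fst.comp_contDiffOn hF
  · refine ContinuousOn.prodMk ?_ continuousOn_snd
    refine hκc.comp (f := fun p : ℝ × E3 => (φ.symm p.2, p.1)) ?_ (fun p hp => ⟨trivial, hp.1⟩)
    exact ((continuousOn_extChartAt_symm m₀).comp continuousOn_snd (fun p hp => hp.2)).prodMk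
      continuousOn_fst
  · rintro ⟨s, x⟩ ⟨hs, hx⟩
    have h1 : HasFDerivWithinAt (fun p : ℝ × E3 => k (φ.symm p.2) p.1)
        (fderivWithin ℝ (fun p : ℝ × E3 => k (φ.symm p.2) p.1) (Icc 0 1 ×ˢ φ.target) (s, x))
        (Icc 0 1 ×ˢ φ.target) (s, x) :=
      (hk'.differentiableOn (by simp) (s, x) ⟨hs, hx⟩).hasFDerivWithinAt
    set L := fderivWithin ℝ (fun p : ℝ × E3 => k (φ.symm p.2) p.1) (Icc 0 1 ×ˢ φ.target) (s, x)
    have h2 : HasDerivWithinAt (k (φ.symm x)) (L (1, 0)) (Icc 0 1) s := by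
      have := h1.comp s (f := fun r : ℝ => (r, x)) (s := Icc 0 1) (t := Icc 0 1 ×ˢ φ.target)
        (hasFDerivAt_prodMk_left (𝕜 := ℝ) s x).hasFDerivWithinAt (fun r hr => ⟨hr, hx⟩)
      exact this.hasDerivWithinAt.congr_deriv (by simp)
    have h3 : 0 < L (1, 0) := by
      have := hpos (φ.symm x) s hs
      rwa [h2.derivWithin (uniqueDiffOn_Icc one_pos s hs)] at this
    set c := L (1, 0)
    have hL : ∀ a v, L (a, v) = a * c + L (0, v) := by
      intro a v
      have : ((a, v) : ℝ × E3) = a • (1, 0) + (0, v) := by simp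
      rw [this, map_add, map_smul]
      rfl
    let P : (ℝ × E3) →L[ℝ] ℝ × E3 := L.prod (ContinuousLinearMap.snd ℝ ℝ E3)
    let Q : (ℝ × E3) →L[ℝ] ℝ × E3 := (c⁻¹ • (ContinuousLinearMap.fst ℝ ℝ E3 -
      (L.comp (ContinuousLinearMap.inr ℝ ℝ E3)).comp (ContinuousLinearMap.snd ℝ ℝ E3))).prod
      (ContinuousLinearMap.snd ℝ ℝ E3)
    refine ⟨ContinuousLinearEquiv.equivOfInverse P Q ?_ ?_, ?_⟩
    · rintro ⟨a, v⟩
      refine Prod.ext ?_ rfl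
      simp only [P, Q, ContinuousLinearMap.prod_apply]
      show c⁻¹ * (L (a, v) - L (0, v)) = a
      rw [hL a v]
      field_simp
      ring
    · rintro ⟨a, v⟩
      refine Prod.ext ?_ rfl
      show L (c⁻¹ * (a - L (0, v)), v) = a
      rw [hL]
      field_simp
      ring
    · exact h1.prodMk hasFDerivWithinAt_snd

end Charts
end Engel

namespace Engel

open Set Filter

section ChartDeriv

variable {E : Type*} [NormedAddCommGroup E] [NormedSpace ℝ E] {H : Type*} [TopologicalSpace H]
  (I : ModelWithCorners ℝ E H) {M : Type*} [TopologicalSpace M] [ChartedSpace H M]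

/-- The differential of the chart at `m₀`. -/
def dchart (m₀ m : M) : TangentSpace I m →L[ℝ] E :=
  mfderiv I 𝓘(ℝ, E) (extChartAt I m₀) m

variable {I} [I.Boundaryless] [IsManifold I ∞ M]

theorem hasMFDerivAt_chart {m₀ m : M} (hm : m ∈ (extChartAt I m₀).source) :
    HasMFDerivAt I 𝓘(ℝ, E) (extChartAt I m₀) m (dchart I m₀ m) :=
  (mdifferentiableAt_extChartAt (by simpa using hm)).hasMFDerivAt

/-- The differential of the inverse of the chart at `m₀`. -/
def dchartSymm (I : ModelWithCorners ℝ E H) (m₀ : M) (x : E) : E →L[ℝ] TangentSpace I ((extChartAt I m₀).symm x) :=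
  mfderiv 𝓘(ℝ, E) I (extChartAt I m₀).symm x

theorem hasMFDerivAt_chartSymm {m₀ : M} {x : E} (hx : x ∈ (extChartAt I m₀).target) :
    HasMFDerivAt 𝓘(ℝ, E) I (extChartAt I m₀).symm x (dchartSymm I m₀ x) := by
  have := mdifferentiableWithinAt_extChartAt_symm hx
  rw [ModelWithCorners.range_eq_univ, mdifferentiableWithinAt_univ] at this
  exact this.hasMFDerivAt

theorem dchart_dchartSymm {m₀ : M} {x : E} (hx : x ∈ (extChartAt I m₀).target) (v : E) :
    dchart I m₀ ((extChartAt I m₀).symm x) (dchartSymm I m₀ x v) = v := by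
  have := mfderiv_extChartAt_comp_mfderivWithin_extChartAt_symm hx
  rw [ModelWithCorners.range_eq_univ, mfderivWithin_univ] at this
  exact DFunLike.congr_fun this v

theorem dchartSymm_dchart {m₀ : M} {x : E} (hx : x ∈ (extChartAt I m₀).target)
    (v : TangentSpace I ((extChartAt I m₀).symm x)) :
    dchartSymm I m₀ x (dchart I m₀ _ v) = v := by
  have := mfderivWithin_extChartAt_symm_comp_mfderiv_extChartAt hx
  rw [ModelWithCorners.range_eq_univ, mfderivWithin_univ] at this
  exact DFunLike.congr_fun this v

theorem dchart_bijective {m₀ m : M} (hm : m ∈ (extChartAt I m₀).source) :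
    Function.Bijective (dchart I m₀ m) :=
  (isInvertible_mfderiv_extChartAt hm).bijective

theorem dchart_injective {m₀ m : M} (hm : m ∈ (extChartAt I m₀).source) :
    Function.Injective (dchart I m₀ m) := (dchart_bijective hm).1

variable {E' : Type*} [NormedAddCommGroup E'] [NormedSpace ℝ E'] {H' : Type*} [TopologicalSpace H']
  {J : ModelWithCorners ℝ E' H'} {N : Type*} [TopologicalSpace N] [ChartedSpace H' N]

/-- Smoothness of vector fields along a map with values in the domain of a chart. -/
theorem contMDiffWithinAt_tangent_iff {m₀ : M} {g : N → M} {v : ∀ p, TangentSpace I (g p)}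
    {s : Set N} {p : N} (hp : p ∈ s) (hg : MapsTo g s (extChartAt I m₀).source) :
    ContMDiffWithinAt J I.tangent ∞ (fun p => (⟨g p, v p⟩ : TangentBundle I M)) s p ↔
      ContMDiffWithinAt J I ∞ g s p ∧
        ContMDiffWithinAt J 𝓘(ℝ, E) ∞ (fun p => dchart I m₀ (g p) (v p)) s p := by
  have hg' : ∀ q ∈ s, g q ∈ (trivializationAt E (TangentSpace I) m₀).baseSet := by
    intro q hq
    have := hg hq
    simpa using this
  refine (Bundle.Trivialization.contMDiffWithinAt_iff
    (e := trivializationAt E (TangentSpace I) m₀)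
    (by rw [Bundle.Trivialization.mem_source]; exact hg' p hp)).trans (and_congr Iff.rfl ?_)
  have key : ∀ q ∈ s, (trivializationAt E (TangentSpace I) m₀ ⟨g q, v q⟩).2 =
      dchart I m₀ (g q) (v q) := by
    intro q hq
    rw [dchart, ← TangentBundle.continuousLinearMapAt_trivializationAt (by simpa using hg hq)]
    rw [Bundle.Trivialization.continuousLinearMapAt_apply, Bundle.Trivialization.linearMapAt_apply,
      if_pos (hg' q hq)]
  exact ⟨fun h => h.congr (fun q hq => (key q hq).symm) (key p hp).symm,
    fun h => h.congr key (key p hp)⟩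

theorem contMDiffOn_tangent_iff {m₀ : M} {g : N → M} {v : ∀ p, TangentSpace I (g p)}
    {s : Set N} (hg : MapsTo g s (extChartAt I m₀).source) :
    ContMDiffOn J I.tangent ∞ (fun p => (⟨g p, v p⟩ : TangentBundle I M)) s ↔
      ContMDiffOn J I ∞ g s ∧
        ContMDiffOn J 𝓘(ℝ, E) ∞ (fun p => dchart I m₀ (g p) (v p)) s :=
  ⟨fun h => ⟨fun p hp => ((contMDiffWithinAt_tangent_iff hp hg).1 (h p hp)).1,
    fun p hp => ((contMDiffWithinAt_tangent_iff hp hg).1 (h p hp)).2⟩,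
    fun h p hp => (contMDiffWithinAt_tangent_iff hp hg).2 ⟨h.1 p hp, h.2 p hp⟩⟩

/-- The representation of a vector field in the chart at `m₀`. -/
def chartVec (I : ModelWithCorners ℝ E H) (m₀ : M) (V : ∀ m : M, TangentSpace I m) (x : E) : E :=
  dchart I m₀ ((extChartAt I m₀).symm x) (V ((extChartAt I m₀).symm x))

end ChartDeriv

section ChartVec

variable {M : Type*} [TopologicalSpace M] [ChartedSpace E3 M] [IsManifold (𝓡 3) ∞ M]

theorem contDiffOn_chartVec {T : Type*} [NormedAddCommGroup T] [NormedSpace ℝ T] {S : Set T}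
    {w : T → ∀ m : M, TangentSpace (𝓡 3) m}
    (hw : ContMDiffOn (𝓘(ℝ, T).prod (𝓡 3)) (𝓡 3).tangent ∞
      (fun p : T × M => (⟨p.2, w p.1 p.2⟩ : TangentBundle (𝓡 3) M)) (S ×ˢ univ)) (m₀ : M) :
    ContDiffOn ℝ ∞ (fun p : T × E3 => chartVec (𝓡 3) m₀ (w p.1) p.2)
      (S ×ˢ (extChartAt (𝓡 3) m₀).target) := by
  have h1 := ContMDiffOn.comp_extChartAt_symm hw m₀ (subset_univ _)
  rw [contMDiffOn_tangent_iff (m₀ := m₀)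
    (fun p hp => (extChartAt (𝓡 3) m₀).map_target hp.2)] at h1
  exact contMDiffOn_iff_contDiffOn.1 h1.2

end ChartVec

section Flow

variable {M : Type*} [TopologicalSpace M] [T2Space M] [ChartedSpace E3 M] [IsManifold (𝓡 3) ∞ M]

/-- `γ : [0, 1] → M` is an integral curve of the time-dependent vector field `w`. -/
def IsSol (w : ℝ → ∀ m : M, TangentSpace (𝓡 3) m) (γ : ℝ → M) : Prop :=
  ∀ s ∈ Icc (0 : ℝ) 1, HasMFDerivWithinAt 𝓘(ℝ, ℝ) (𝓡 3) γ (Icc 0 1) s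
    ((1 : ℝ →L[ℝ] ℝ).smulRight (w s (γ s)))

theorem IsSol.chart {w : ℝ → ∀ m : M, TangentSpace (𝓡 3) m} {γ : ℝ → M} (h : IsSol w γ) {m₀ : M}
    {s : ℝ} (hs : s ∈ Icc (0 : ℝ) 1) (hm : γ s ∈ (extChartAt (𝓡 3) m₀).source) :
    HasDerivWithinAt (fun s => extChartAt (𝓡 3) m₀ (γ s))
      (chartVec (𝓡 3) m₀ (w s) (extChartAt (𝓡 3) m₀ (γ s))) (Icc 0 1) s := by
  have h1 := ((hasMFDerivAt_chart hm).comp_hasMFDerivWithinAt s (h s hs))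
  have h2 : HasFDerivWithinAt (fun s => extChartAt (𝓡 3) m₀ (γ s))
      (ContinuousLinearMap.toSpanSingleton ℝ
        (chartVec (𝓡 3) m₀ (w s) (extChartAt (𝓡 3) m₀ (γ s)))) (Icc 0 1) s := by
    refine (hasMFDerivWithinAt_iff_hasFDerivWithinAt.1 h1).congr_fderiv ?_
    ext1
    change dchart (𝓡 3) m₀ (γ s) ((1 : ℝ) • w s (γ s)) = (1 : ℝ) • chartVec (𝓡 3) m₀ (w s) _
    rw [one_smul, one_smul, chartVec, (extChartAt (𝓡 3) m₀).left_inv hm]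
  simpa using h2.hasDerivWithinAt

theorem isSol_of_chart {w : ℝ → ∀ m : M, TangentSpace (𝓡 3) m} {m₀ : M} {ζ : ℝ → E3}
    (h : ∀ s ∈ Icc (0 : ℝ) 1, ζ s ∈ (extChartAt (𝓡 3) m₀).target ∧
      HasDerivWithinAt ζ (chartVec (𝓡 3) m₀ (w s) (ζ s)) (Icc 0 1) s) :
    IsSol w (fun s => (extChartAt (𝓡 3) m₀).symm (ζ s)) := by
  intro s hs
  obtain ⟨h1, h2⟩ := h s hs
  have h3 := (hasMFDerivAt_chartSymm h1).comp_hasMFDerivWithinAt s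
    (hasMFDerivWithinAt_iff_hasFDerivWithinAt.2 h2.hasFDerivWithinAt)
  refine h3.congr_mfderiv (ContinuousLinearMap.ext_ring ?_) |>.congr_mfderiv rfl
  symm
  change (1 : ℝ) • w s _ = dchartSymm (𝓡 3) m₀ (ζ s) ((1 : ℝ) • chartVec (𝓡 3) m₀ (w s) (ζ s))
  rw [one_smul, one_smul, chartVec, dchartSymm_dchart h1]

theorem IsSol.continuousOn {w : ℝ → ∀ m : M, TangentSpace (𝓡 3) m} {γ : ℝ → M}
    (h : IsSol w γ) : ContinuousOn γ (Icc 0 1) := fun s hs => (h s hs).continuousWithinAt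

/-- Two integral curves that meet agree. -/
theorem IsSol.eqOn {w : ℝ → ∀ m : M, TangentSpace (𝓡 3) m}
    (hw : ContMDiffOn (𝓘(ℝ, ℝ).prod (𝓡 3)) (𝓡 3).tangent ∞
      (fun p : ℝ × M => (⟨p.2, w p.1 p.2⟩ : TangentBundle (𝓡 3) M)) (Icc 0 1 ×ˢ univ))
    {γ₁ γ₂ : ℝ → M} (h₁ : IsSol w γ₁) (h₂ : IsSol w γ₂) {s₀ : ℝ} (hs₀ : s₀ ∈ Icc (0 : ℝ) 1)
    (he : γ₁ s₀ = γ₂ s₀) : EqOn γ₁ γ₂ (Icc 0 1) := by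
  intro s hs
  suffices hP : (γ₁ s₀ = γ₂ s₀ ↔ γ₁ s = γ₂ s) from hP.1 he
  refine isPreconnected_Icc.induction₂' (fun x y => (γ₁ x = γ₂ x ↔ γ₁ y = γ₂ y)) ?_
    (fun _ _ _ _ _ _ h h' => h.trans h') hs₀ hs
  intro x hx
  suffices h : ∀ᶠ y in 𝓝[Icc 0 1] x, (γ₁ x = γ₂ x ↔ γ₁ y = γ₂ y) by
    filter_upwards [h] with y hy using ⟨hy, hy.symm⟩
  have c1 := h₁.continuousOn x hx
  have c2 := h₂.continuousOn x hx
  by_cases hxe : γ₁ x = γ₂ x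
  swap
  · have : ∀ᶠ y in 𝓝[Icc 0 1] x, (γ₁ y, γ₂ y) ∈ (diagonal M)ᶜ :=
      (c1.prodMk c2).eventually (isClosed_diagonal.isOpen_compl.mem_nhds hxe)
    filter_upwards [this] with y hy
    exact iff_of_false hxe hy
  set m₀ := γ₁ x with hm₀
  set φ := extChartAt (𝓡 3) m₀ with hφ
  have hms : m₀ ∈ φ.source := mem_extChartAt_source m₀
  obtain ⟨R, hR, hRt⟩ := Metric.isOpen_iff.1 (isOpen_extChartAt_target (I := 𝓡 3) m₀) (φ m₀)
    (φ.map_source hms)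
  have hc : ContDiffOn ℝ ∞ (fun p : ℝ × E3 => chartVec (𝓡 3) m₀ (w p.1) p.2)
      (Icc 0 1 ×ˢ Metric.ball (φ m₀) R) :=
    (contDiffOn_chartVec hw m₀).mono (prod_mono_right hRt)
  obtain ⟨k, T, hT, hL⟩ := ((hc (x, φ m₀) ⟨hx, Metric.mem_ball_self hR⟩).of_le
    (by exact_mod_cast le_top)).exists_lipschitzOnWith
    ((convex_Icc (0 : ℝ) 1).prod (convex_ball (φ m₀) R))
  rw [nhdsWithin_prod_eq, Metric.isOpen_ball.nhdsWithin_eq (Metric.mem_ball_self hR)] at hT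
  obtain ⟨T₁, hT₁, T₂, hT₂, hTT⟩ := mem_prod_iff.1 hT
  have d1 : ContinuousWithinAt (fun s => φ (γ₁ s)) (Icc 0 1) x :=
    (continuousAt_extChartAt (I := 𝓡 3) m₀).comp_continuousWithinAt c1
  have d2 : ContinuousWithinAt (fun s => φ (γ₂ s)) (Icc 0 1) x :=
    (continuousAt_extChartAt (I := 𝓡 3) m₀).comp_continuousWithinAt_of_eq c2 hxe.symm
  have hgood : ∀ᶠ y in 𝓝[Icc 0 1] x, y ∈ T₁ ∧ (γ₁ y ∈ φ.source ∧ γ₂ y ∈ φ.source) ∧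
      φ (γ₁ y) ∈ T₂ ∧ φ (γ₂ y) ∈ T₂ := by
    have hsrc : φ.source ∈ 𝓝 m₀ := extChartAt_source_mem_nhds (I := 𝓡 3) m₀
    exact (eventually_mem_set.2 hT₁).and (((c1.eventually hsrc).and
      (c2.eventually (by rw [← hxe]; exact hsrc))).and
      ((d1.eventually hT₂).and (d2.eventually (by simp only [← hxe]; exact hT₂))))
  obtain ⟨η, hη, hηg⟩ := Metric.mem_nhdsWithin_iff.1 hgood
  have hgood : ∀ y ∈ Metric.ball x η ∩ Icc 0 1, y ∈ T₁ ∧ (γ₁ y ∈ φ.source ∧ γ₂ y ∈ φ.source) ∧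
      φ (γ₁ y) ∈ T₂ ∧ φ (γ₂ y) ∈ T₂ := fun y hy => hηg hy
  have hLip : ∀ y ∈ T₁, LipschitzOnWith k (chartVec (𝓡 3) m₀ (w y)) T₂ := by
    intro y hy a ha b hb
    have := hL (hTT (mk_mem_prod hy ha)) (hTT (mk_mem_prod hy hb))
    simpa [Prod.edist_eq] using this
  filter_upwards [inter_mem_nhdsWithin (Icc (0 : ℝ) 1) (Metric.ball_mem_nhds x hη)] with y hy
  refine iff_of_true hxe ?_
  suffices h : φ (γ₁ y) = φ (γ₂ y) by
    obtain ⟨-, ⟨ha, hb⟩, -⟩ := hgood y ⟨hy.2, hy.1⟩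
    exact φ.injOn ha hb h
  rcases le_total x y with hxy | hxy
  · have hsub : ∀ z ∈ Icc x y, z ∈ Metric.ball x η ∩ Icc 0 1 := fun z hz => by
      refine ⟨?_, hx.1.trans hz.1, hz.2.trans hy.1.2⟩
      have := hy.2
      rw [Metric.mem_ball, Real.dist_eq, abs_lt] at this ⊢
      constructor <;> linarith [hz.1, hz.2]
    have hder : ∀ γ : ℝ → M, IsSol w γ → (∀ z ∈ Icc x y, γ z ∈ φ.source) →
        ContinuousOn (fun s => φ (γ s)) (Icc x y) ∧ ∀ z ∈ Ico x y,
        HasDerivWithinAt (fun s => φ (γ s)) (chartVec (𝓡 3) m₀ (w z) (φ (γ z))) (Ici z) z := by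
      intro γ hγ hγs
      refine ⟨fun z hz => ((hγ.chart (hsub z hz).2 (hγs z hz)).continuousWithinAt).mono
        (fun r hr => (hsub r hr).2), fun z hz => ?_⟩
      have hz' : z ∈ Icc x y := ⟨hz.1, hz.2.le⟩
      refine (hγ.chart (hsub z hz').2 (hγs z hz')).mono_of_mem_nhdsWithin ?_
      refine mem_of_superset (Icc_mem_nhdsGE hz.2) (fun r hr => (hsub r ⟨hz.1.trans hr.1, hr.2⟩).2)
    obtain ⟨e1, e2⟩ := hder γ₁ h₁ (fun z hz => (hgood z (hsub z hz)).2.1.1)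
    obtain ⟨f1, f2⟩ := hder γ₂ h₂ (fun z hz => (hgood z (hsub z hz)).2.1.2)
    exact ODE_solution_unique_of_mem_Icc_right (K := k) (v := fun z => chartVec (𝓡 3) m₀ (w z))
      (s := fun _ => T₂) (fun z hz => hLip z (hgood z (hsub z ⟨hz.1, hz.2.le⟩)).1) e1 e2
      (fun z hz => (hgood z (hsub z ⟨hz.1, hz.2.le⟩)).2.2.1) f1 f2
      (fun z hz => (hgood z (hsub z ⟨hz.1, hz.2.le⟩)).2.2.2)
      (congrArg φ hxe) ⟨hxy, le_rfl⟩
  · have hsub : ∀ z ∈ Icc y x, z ∈ Metric.ball x η ∩ Icc 0 1 := fun z hz => by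
      refine ⟨?_, hy.1.1.trans hz.1, hz.2.trans hx.2⟩
      have := hy.2
      rw [Metric.mem_ball, Real.dist_eq, abs_lt] at this ⊢
      constructor <;> linarith [hz.1, hz.2]
    have hder : ∀ γ : ℝ → M, IsSol w γ → (∀ z ∈ Icc y x, γ z ∈ φ.source) →
        ContinuousOn (fun s => φ (γ s)) (Icc y x) ∧ ∀ z ∈ Ioc y x,
        HasDerivWithinAt (fun s => φ (γ s)) (chartVec (𝓡 3) m₀ (w z) (φ (γ z))) (Iic z) z := by
      intro γ hγ hγs
      refine ⟨fun z hz => ((hγ.chart (hsub z hz).2 (hγs z hz)).continuousWithinAt).mono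
        (fun r hr => (hsub r hr).2), fun z hz => ?_⟩
      have hz' : z ∈ Icc y x := ⟨hz.1.le, hz.2⟩
      refine (hγ.chart (hsub z hz').2 (hγs z hz')).mono_of_mem_nhdsWithin ?_
      refine mem_of_superset (Icc_mem_nhdsLE hz.1) (fun r hr => (hsub r ⟨hr.1, hr.2.trans hz.2⟩).2)
    obtain ⟨e1, e2⟩ := hder γ₁ h₁ (fun z hz => (hgood z (hsub z hz)).2.1.1)
    obtain ⟨f1, f2⟩ := hder γ₂ h₂ (fun z hz => (hgood z (hsub z hz)).2.1.2)
    exact ODE_solution_unique_of_mem_Icc_left (K := k) (v := fun z => chartVec (𝓡 3) m₀ (w z))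
      (s := fun _ => T₂) (fun z hz => hLip z (hgood z (hsub z ⟨hz.1.le, hz.2⟩)).1) e1 e2
      (fun z hz => (hgood z (hsub z ⟨hz.1.le, hz.2⟩)).2.2.1) f1 f2
      (fun z hz => (hgood z (hsub z ⟨hz.1.le, hz.2⟩)).2.2.2)
      (congrArg φ hxe) ⟨le_rfl, hxy⟩

end Flow
end Engel

namespace Engel

open Set Filter

section GlobalFlow

variable {M : Type*} [TopologicalSpace M] [T2Space M] [ChartedSpace E3 M] [IsManifold (𝓡 3) ∞ M]

/-- `Φ t s₀ s m`, for `m ∈ B`, is the value at time `s` of the integral curve of `w (t, ·)` that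
starts from `m` at time `s₀`. -/
structure IsFlowOn (w : ℝ × ℝ → ∀ m : M, TangentSpace (𝓡 3) m) (δ : ℝ) (B : Set M)
    (Φ : ℝ → ℝ → ℝ → M → M) : Prop where
  smooth : ContMDiffOn (𝓘(ℝ, ℝ × ℝ × ℝ).prod (𝓡 3)) (𝓡 3) ∞
    (fun p : (ℝ × ℝ × ℝ) × M => Φ p.1.1 p.1.2.1 p.1.2.2 p.2)
    ((Ioo (-δ) δ ×ˢ Icc 0 1 ×ˢ Icc 0 1) ×ˢ B)
  initial : ∀ t ∈ Ioo (-δ) δ, ∀ s₀ ∈ Icc (0 : ℝ) 1, ∀ m ∈ B, Φ t s₀ s₀ m = m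
  isSol : ∀ t ∈ Ioo (-δ) δ, ∀ s₀ ∈ Icc (0 : ℝ) 1, ∀ m ∈ B,
    IsSol (fun s => w (t, s)) (fun s => Φ t s₀ s m)
  variational : ∀ t ∈ Ioo (-δ) δ, ∀ m ∈ B, ∃ m₀ : M,
    ∀ s ∈ Icc (0 : ℝ) 1, Φ t 0 s m ∈ (extChartAt (𝓡 3) m₀).source ∧
      ∀ v : TangentSpace (𝓡 3) m,
        HasDerivWithinAt (fun s => dchart (𝓡 3) m₀ (Φ t 0 s m) (mfderiv (𝓡 3) (𝓡 3) (Φ t 0 s) m v))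
          (fderiv ℝ (chartVec (𝓡 3) m₀ (w (t, s))) (extChartAt (𝓡 3) m₀ (Φ t 0 s m))
            (dchart (𝓡 3) m₀ (Φ t 0 s m) (mfderiv (𝓡 3) (𝓡 3) (Φ t 0 s) m v))) (Icc 0 1) s

/-- A smooth time-dependent vector field that depends on a parameter `t`, and vanishes for `t = 0`
and outside of `K`. -/
structure IsSmallField (ε : ℝ) (K : Set M) (w : ℝ × ℝ → ∀ m : M, TangentSpace (𝓡 3) m) :
    Prop where
  smooth : ContMDiffOn (𝓘(ℝ, ℝ × ℝ).prod (𝓡 3)) (𝓡 3).tangent ∞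
    (fun p : (ℝ × ℝ) × M => (⟨p.2, w p.1 p.2⟩ : TangentBundle (𝓡 3) M))
    ((Ioo (-ε) ε ×ˢ Icc 0 1) ×ˢ univ)
  zero : ∀ s ∈ Icc (0 : ℝ) 1, ∀ m, w (0, s) m = 0
  support : ∀ τ ∈ Ioo (-ε) ε ×ˢ Icc (0 : ℝ) 1, ∀ m ∉ K, w τ m = 0

variable {ε : ℝ} {K : Set M} {w : ℝ × ℝ → ∀ m : M, TangentSpace (𝓡 3) m}

theorem IsFlowOn.mono {δ δ' : ℝ} {B B' : Set M} {Φ : ℝ → ℝ → ℝ → M → M} (h : IsFlowOn w δ B Φ)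
    (hδ : δ' ≤ δ) (hB : B' ⊆ B) : IsFlowOn w δ' B' Φ := by
  have hI : Ioo (-δ') δ' ⊆ Ioo (-δ) δ := Ioo_subset_Ioo (by linarith) hδ
  exact ⟨h.smooth.mono (prod_mono (prod_mono_left hI) hB),
    fun t ht s₀ hs₀ m hm => h.initial t (hI ht) s₀ hs₀ m (hB hm),
    fun t ht s₀ hs₀ m hm => h.isSol t (hI ht) s₀ hs₀ m (hB hm),
    fun t ht m hm => h.variational t (hI ht) m (hB hm)⟩

theorem IsSmallField.smooth_section (hw : IsSmallField ε K w) {t : ℝ} (ht : t ∈ Ioo (-ε) ε) :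
    ContMDiffOn (𝓘(ℝ, ℝ).prod (𝓡 3)) (𝓡 3).tangent ∞
      (fun p : ℝ × M => (⟨p.2, w (t, p.1) p.2⟩ : TangentBundle (𝓡 3) M)) (Icc 0 1 ×ˢ univ) := by
  refine hw.smooth.comp (f := fun p : ℝ × M => ((t, p.1), p.2)) ?_
    (fun p hp => ⟨⟨ht, hp.1⟩, trivial⟩)
  exact (((contDiff_prodMk_right t).contMDiff.comp contMDiff_fst).prodMk
    contMDiff_snd).contMDiffOn

theorem isFlowOn_compl (hK : IsClosed K) (hw : IsSmallField ε K w) :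
    IsFlowOn w ε Kᶜ (fun _ _ _ m => m) where
  smooth := contMDiff_snd.contMDiffOn
  initial _ _ _ _ _ _ := rfl
  isSol t ht s₀ _ m hm s hs := by
    have := hw.support (t, s) ⟨ht, hs⟩ m hm
    simp only [this]
    refine (hasMFDerivWithinAt_const m (Icc (0 : ℝ) 1) s).congr_mfderiv ?_
    ext
    simp
    rfl
  variational t ht m hm := by
    refine ⟨m, fun s hs => ⟨mem_extChartAt_source m, fun v => ?_⟩⟩
    have hz : fderiv ℝ (chartVec (𝓡 3) m (w (t, s))) (extChartAt (𝓡 3) m m) = 0 := by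
      have : chartVec (𝓡 3) m (w (t, s)) =ᶠ[𝓝 (extChartAt (𝓡 3) m m)] fun _ => (0 : E3) := by
        have h1 : ∀ᶠ x in 𝓝 (extChartAt (𝓡 3) m m), (extChartAt (𝓡 3) m).symm x ∈ Kᶜ := by
          refine (continuousAt_extChartAt_symm (I := 𝓡 3) m).eventually ?_
          rw [(extChartAt (𝓡 3) m).left_inv (mem_extChartAt_source m)]
          exact hK.isOpen_compl.mem_nhds hm
        filter_upwards [h1] with x hx
        rw [chartVec, hw.support (t, s) ⟨ht, hs⟩ _ hx, map_zero]
      rw [this.fderiv_eq]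
      simp
    rw [hz]
    exact hasDerivWithinAt_const _ _ _

theorem exists_isFlowOn_nhds (hε : 0 < ε) (hw : IsSmallField ε K w) (m₀ : M) :
    ∃ δ > 0, δ ≤ ε ∧ ∃ B, IsOpen B ∧ m₀ ∈ B ∧ ∃ Φ, IsFlowOn w δ B Φ := by
  set φ := extChartAt (𝓡 3) m₀ with hφ
  have hu := contDiffOn_chartVec hw.smooth m₀
  obtain ⟨δ, hδ, hδε, ρ, hρ, hρt, ζ, hζ, hζs, hζA⟩ := exists_local_flow hε
    (isOpen_extChartAt_target (I := 𝓡 3) m₀) (u := fun τ => chartVec (𝓡 3) m₀ (w τ)) hu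
    (fun s hs x _ => by rw [chartVec, hw.zero s hs, map_zero])
    (φ.map_source (mem_extChartAt_source (I := 𝓡 3) m₀))
  set B : Set M := φ.source ∩ φ ⁻¹' Metric.ball (φ m₀) ρ with hB
  have hBo : IsOpen B := isOpen_extChartAt_preimage' (I := 𝓡 3) m₀ Metric.isOpen_ball
  have hBs : ∀ m ∈ B, m ∈ φ.source := fun m hm => hm.1
  refine ⟨δ, hδ, hδε, B, hBo, ⟨mem_extChartAt_source m₀, Metric.mem_ball_self hρ⟩,
    fun t s₀ s m => φ.symm (ζ t s₀ (φ m) s), ?_, ?_, ?_, ?_⟩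
  · have h1 : ContMDiffOn (𝓘(ℝ, ℝ × ℝ × ℝ).prod (𝓡 3)) 𝓘(ℝ, E3) ∞
        (fun p : (ℝ × ℝ × ℝ) × M => ζ p.1.1 p.1.2.1 (φ p.2) p.1.2.2)
        ((Ioo (-δ) δ ×ˢ Icc 0 1 ×ˢ Icc 0 1) ×ˢ B) := by
      refine (contMDiffOn_iff_contDiffOn.2 hζs).comp
        (f := fun p : (ℝ × ℝ × ℝ) × M => (p.1, φ p.2)) ?_ (fun p hp => ⟨hp.1, hp.2.2⟩)
      refine contMDiff_fst.contMDiffOn.prodMk_space ?_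
      refine (contMDiffOn_extChartAt (I := 𝓡 3) (x := m₀)).comp contMDiff_snd.contMDiffOn
        (fun p hp => ?_)
      simpa [hφ] using hp.2.1
    exact (contMDiffOn_extChartAt_symm m₀).comp h1
      (fun p hp => ((hζ p.1.1 hp.1.1 p.1.2.1 hp.1.2.1 _ hp.2.2).2 _ hp.1.2.2).1)
  · intro t ht s₀ hs₀ m hm
    rw [(hζ t ht s₀ hs₀ _ hm.2).1, φ.left_inv hm.1]
  · intro t ht s₀ hs₀ m hm
    exact isSol_of_chart (fun s hs => (hζ t ht s₀ hs₀ _ hm.2).2 s hs)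
  · intro t ht m hm
    obtain ⟨A, -, hA, hA'⟩ := hζA t ht (φ m) hm.2
    have h0 : (0 : ℝ) ∈ Icc (0 : ℝ) 1 := ⟨le_rfl, zero_le_one⟩
    refine ⟨m₀, fun s hs => ⟨φ.map_target ((hζ t ht 0 h0 _ hm.2).2 s hs).1, fun v => ?_⟩⟩
    have key : ∀ r ∈ Icc (0 : ℝ) 1, dchart (𝓡 3) m₀ (φ.symm (ζ t 0 (φ m) r))
        (mfderiv (𝓡 3) (𝓡 3) (fun m => φ.symm (ζ t 0 (φ m) r)) m v) = A r (dchart (𝓡 3) m₀ m v) := by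
      intro r hr
      have hx := ((hζ t ht 0 h0 _ hm.2).2 r hr).1
      have h1 := (hasMFDerivAt_chartSymm hx).comp m
        ((hA r hr).hasMFDerivAt.comp m (hasMFDerivAt_chart (hBs m hm)))
      have h2 := DFunLike.congr_fun h1.mfderiv v
      refine (congrArg (dchart (𝓡 3) m₀ (φ.symm (ζ t 0 (φ m) r))) h2).trans ?_
      exact dchart_dchartSymm hx _
    have h3 := hA' s hs (dchart (𝓡 3) m₀ m v)
    rw [key s hs, φ.right_inv ((hζ t ht 0 h0 _ hm.2).2 s hs).1]
    exact h3.congr (fun r hr => key r hr) (key s hs)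

theorem exists_isFlowOn_local (hε : 0 < ε) (hK : IsCompact K) (hw : IsSmallField ε K w) :
    ∃ δ > 0, δ ≤ ε ∧ ∀ m, ∃ B, IsOpen B ∧ m ∈ B ∧ ∃ Φ, IsFlowOn w δ B Φ := by
  have : ∃ δ > 0, δ ≤ ε ∧ ∀ m ∈ K, ∃ B, IsOpen B ∧ m ∈ B ∧ ∃ Φ, IsFlowOn w δ B Φ := by
    refine hK.induction_on (p := fun A => ∃ δ > 0, δ ≤ ε ∧ ∀ m ∈ A, ∃ B, IsOpen B ∧ m ∈ B ∧
      ∃ Φ, IsFlowOn w δ B Φ) ⟨ε, hε, le_rfl, fun m hm => hm.elim⟩ ?_ ?_ ?_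
    · rintro A A' hA ⟨δ, h1, h2, h3⟩
      exact ⟨δ, h1, h2, fun m hm => h3 m (hA hm)⟩
    · rintro A A' ⟨δ, h1, h2, h3⟩ ⟨δ', h1', h2', h3'⟩
      refine ⟨min δ δ', lt_min h1 h1', (min_le_left _ _).trans h2, ?_⟩
      rintro m (hm | hm)
      · obtain ⟨B, hB, hmB, Φ, hΦ⟩ := h3 m hm
        exact ⟨B, hB, hmB, Φ, hΦ.mono (min_le_left _ _) le_rfl⟩
      · obtain ⟨B, hB, hmB, Φ, hΦ⟩ := h3' m hm
        exact ⟨B, hB, hmB, Φ, hΦ.mono (min_le_right _ _) le_rfl⟩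
    · intro m _
      obtain ⟨δ, h1, h2, B, hB, hmB, Φ, hΦ⟩ := exists_isFlowOn_nhds hε hw m
      exact ⟨B, mem_nhdsWithin_of_mem_nhds (hB.mem_nhds hmB), δ, h1, h2,
        fun m' hm' => ⟨B, hB, hm', Φ, hΦ⟩⟩
  obtain ⟨δ, h1, h2, h3⟩ := this
  refine ⟨δ, h1, h2, fun m => ?_⟩
  by_cases hm : m ∈ K
  · exact h3 m hm
  · exact ⟨Kᶜ, hK.isClosed.isOpen_compl, hm, _,
      (isFlowOn_compl hK.isClosed hw).mono h2 le_rfl⟩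

/-- The flow of a small time-dependent vector field. -/
theorem exists_flow (hε : 0 < ε) (hK : IsCompact K) (hw : IsSmallField ε K w) :
    ∃ δ > 0, δ ≤ ε ∧ ∃ Φ, IsFlowOn w δ univ Φ ∧
      (∀ t ∈ Ioo (-δ) δ, ∀ s₀ ∈ Icc (0 : ℝ) 1, ∀ s₁ ∈ Icc (0 : ℝ) 1, ∀ s ∈ Icc (0 : ℝ) 1, ∀ m,
        Φ t s₁ s (Φ t s₀ s₁ m) = Φ t s₀ s m) ∧
      (∀ s₀ ∈ Icc (0 : ℝ) 1, ∀ s ∈ Icc (0 : ℝ) 1, ∀ m, Φ 0 s₀ s m = m) ∧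
      ∀ t ∈ Ioo (-δ) δ, ∀ s₀ ∈ Icc (0 : ℝ) 1, ∀ s ∈ Icc (0 : ℝ) 1, ∀ m ∉ K, Φ t s₀ s m = m := by
  obtain ⟨δ, hδ, hδε, h⟩ := exists_isFlowOn_local hε hK hw
  choose B hBo hB F hF using h
  have hI : Ioo (-δ) δ ⊆ Ioo (-ε) ε := Ioo_subset_Ioo (by linarith) hδε
  have hagree : ∀ m, ∀ m' ∈ B m, ∀ t ∈ Ioo (-δ) δ, ∀ s₀ ∈ Icc (0 : ℝ) 1, ∀ s ∈ Icc (0 : ℝ) 1,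
      F m' t s₀ s m' = F m t s₀ s m' := by
    intro m m' hm' t ht s₀ hs₀ s hs
    refine IsSol.eqOn (hw.smooth_section (hI ht)) ((hF m').isSol t ht s₀ hs₀ m' (hB m'))
      ((hF m).isSol t ht s₀ hs₀ m' hm') hs₀ ?_ hs
    rw [(hF m').initial t ht s₀ hs₀ m' (hB m'), (hF m).initial t ht s₀ hs₀ m' hm']
  have hflow : IsFlowOn w δ univ (fun t s₀ s m => F m t s₀ s m) := by
    refine ⟨?_, fun t ht s₀ hs₀ m _ => (hF m).initial t ht s₀ hs₀ m (hB m),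
      fun t ht s₀ hs₀ m _ => (hF m).isSol t ht s₀ hs₀ m (hB m), ?_⟩
    · rintro ⟨r, m⟩ ⟨hr, -⟩
      have h1 := (hF m).smooth.congr (f₁ := fun p => F p.2 p.1.1 p.1.2.1 p.1.2.2 p.2)
        (fun p hp => hagree m p.2 hp.2 _ hp.1.1 _ hp.1.2.1 _ hp.1.2.2)
      refine (h1 (r, m) ⟨hr, hB m⟩).mono_of_mem_nhdsWithin (mem_nhdsWithin.2
        ⟨univ ×ˢ B m, isOpen_univ.prod (hBo m), ⟨trivial, hB m⟩, fun p hp => ⟨hp.2.1, hp.1.2⟩⟩)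
    · intro t ht m _
      obtain ⟨m₀, hm₀⟩ := (hF m).variational t ht m (hB m)
      refine ⟨m₀, fun s hs => ⟨(hm₀ s hs).1, fun v => ?_⟩⟩
      have h0 : (0 : ℝ) ∈ Icc (0 : ℝ) 1 := ⟨le_rfl, zero_le_one⟩
      have hd : ∀ r ∈ Icc (0 : ℝ) 1, mfderiv (𝓡 3) (𝓡 3) (fun m => F m t 0 r m) m =
          mfderiv (𝓡 3) (𝓡 3) (F m t 0 r) m := fun r hr => by
        refine Filter.EventuallyEq.mfderiv_eq ?_
        filter_upwards [(hBo m).mem_nhds (hB m)] with m' hm'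
        exact hagree m m' hm' t ht 0 h0 r hr
      have h1 := (hm₀ s hs).2 v
      rw [hd s hs]
      exact h1.congr (fun r hr => by rw [hd r hr]) (by rw [hd s hs])
  have huniq : ∀ t ∈ Ioo (-δ) δ, ∀ s₀ ∈ Icc (0 : ℝ) 1, ∀ s ∈ Icc (0 : ℝ) 1, ∀ m, ∀ γ : ℝ → M,
      IsSol (fun s => w (t, s)) γ → γ s₀ = m → F m t s₀ s m = γ s := by
    intro t ht s₀ hs₀ s hs m γ hγ hm
    refine (hflow.isSol t ht s₀ hs₀ m trivial).eqOn (hw.smooth_section (hI ht)) hγ hs₀ ?_ hs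
    exact (hflow.initial t ht s₀ hs₀ m trivial).trans hm.symm
  have hconst : ∀ t, ∀ m, (∀ s ∈ Icc (0 : ℝ) 1, w (t, s) m = 0) →
      IsSol (fun s => w (t, s)) (fun _ => m) := by
    intro t m hm s hs
    simp only [hm s hs]
    refine (hasMFDerivWithinAt_const m (Icc (0 : ℝ) 1) s).congr_mfderiv ?_
    ext
    simp
    rfl
  refine ⟨δ, hδ, hδε, _, hflow, ?_, ?_, ?_⟩
  · intro t ht s₀ hs₀ s₁ hs₁ s hs m
    exact huniq t ht s₁ hs₁ s hs _ (fun s => F m t s₀ s m) (hflow.isSol t ht s₀ hs₀ m trivial) rfl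
  · intro s₀ hs₀ s hs m
    exact huniq 0 ⟨by linarith, hδ⟩ s₀ hs₀ s hs m _ (hconst 0 m (fun s hs => hw.zero s hs m)) rfl
  · intro t ht s₀ hs₀ s hs m hm
    exact huniq t ht s₀ hs₀ s hs m _
      (hconst t m (fun s hs => hw.support (t, s) ⟨hI ht, hs⟩ m hm)) rfl

end GlobalFlow
end Engel

namespace Engel

open Set Filter

section Frames

variable {M : Type*} [TopologicalSpace M] [ChartedSpace E3 M] [IsManifold (𝓡 3) ∞ M]

instance : IsManifold (𝓡 3) (minSmoothness ℝ 3) M := by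
  rw [minSmoothness_of_isRCLikeNormedField]
  infer_instance

/-- `V` is a smooth vector field. -/
def IsSmoothField (V : ∀ m : M, TangentSpace (𝓡 3) m) : Prop :=
  ContMDiff (𝓡 3) (𝓡 3).tangent ∞ (fun m => (⟨m, V m⟩ : TangentBundle (𝓡 3) M))

theorem IsSmoothField.contDiffOn {V : ∀ m : M, TangentSpace (𝓡 3) m} (hV : IsSmoothField V)
    (m₀ : M) : ContDiffOn ℝ ∞ (chartVec (𝓡 3) m₀ V) (extChartAt (𝓡 3) m₀).target := by
  have h1 : ContMDiffOn 𝓘(ℝ, E3) (𝓡 3).tangent ∞ (fun x => (⟨(extChartAt (𝓡 3) m₀).symm x,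
      V ((extChartAt (𝓡 3) m₀).symm x)⟩ : TangentBundle (𝓡 3) M)) (extChartAt (𝓡 3) m₀).target :=
    hV.comp_contMDiffOn (contMDiffOn_extChartAt_symm m₀)
  rw [contMDiffOn_tangent_iff (m₀ := m₀) (fun p hp => (extChartAt (𝓡 3) m₀).map_target hp)] at h1
  exact contMDiffOn_iff_contDiffOn.1 h1.2

theorem mpullback_chartSymm {m₀ : M} (V : ∀ m : M, TangentSpace (𝓡 3) m) {x : E3}
    (hx : x ∈ (extChartAt (𝓡 3) m₀).target) :
    VectorField.mpullback 𝓘(ℝ, E3) (𝓡 3) (extChartAt (𝓡 3) m₀).symm V x = chartVec (𝓡 3) m₀ V x := by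
  rw [VectorField.mpullback_apply, chartVec]
  have : (mfderiv 𝓘(ℝ, E3) (𝓡 3) (extChartAt (𝓡 3) m₀).symm x).inverse =
      dchart (𝓡 3) m₀ ((extChartAt (𝓡 3) m₀).symm x) := by
    refine ContinuousLinearMap.inverse_eq ?_ ?_
    · ext v
      exact dchartSymm_dchart hx v
    · ext1 v
      exact dchart_dchartSymm hx v
  exact DFunLike.congr_fun this _

theorem mlieBracket_eq_lieBracket {E : Type*} [NormedAddCommGroup E] [NormedSpace ℝ E]
    (A B : E → E) (x : E) :
    VectorField.mlieBracket 𝓘(ℝ, E) A B x = VectorField.lieBracket ℝ A B x := by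
  have h := VectorField.mlieBracketWithin_eq_lieBracketWithin (𝕜 := ℝ) (V := A) (W := B)
    (s := univ)
  exact (congrFun h x).trans (congrFun (VectorField.lieBracketWithin_univ (V := A) (W := B)) x)

theorem chartVec_mlieBracket {V W : ∀ m : M, TangentSpace (𝓡 3) m} (hV : IsSmoothField V)
    (hW : IsSmoothField W) {m₀ : M} {x : E3} (hx : x ∈ (extChartAt (𝓡 3) m₀).target) :
    chartVec (𝓡 3) m₀ (VectorField.mlieBracket (𝓡 3) V W) x =
      VectorField.lieBracket ℝ (chartVec (𝓡 3) m₀ V) (chartVec (𝓡 3) m₀ W) x := by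
  rw [← mpullback_chartSymm _ hx, VectorField.mpullback_mlieBracket (n := ∞)
    (hV.mdifferentiable (by simp) _) (hW.mdifferentiable (by simp) _)
    ((contMDiffOn_extChartAt_symm m₀).contMDiffAt (extChartAt_target_mem_nhds' hx))
    (by rw [minSmoothness_of_isRCLikeNormedField]
        exact WithTop.coe_le_coe.2 (le_top : (2 : ℕ∞) ≤ ⊤))]
  refine (mlieBracket_eq_lieBracket (E := E3) _ _ x).trans ?_
  refine Filter.EventuallyEq.lieBracket_vectorField_eq (𝕜 := ℝ) (E := E3) ?_ ?_ <;>
  · filter_upwards [extChartAt_target_mem_nhds' (I := 𝓡 3) hx] with y hy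
    exact mpullback_chartSymm _ hy

theorem IsSmoothField.mlieBracket {V W : ∀ m : M, TangentSpace (𝓡 3) m} (hV : IsSmoothField V)
    (hW : IsSmoothField W) : IsSmoothField (VectorField.mlieBracket (𝓡 3) V W) := by
  intro m₀
  have hm := extChartAt_source_mem_nhds (I := 𝓡 3) m₀
  refine ContMDiffOn.contMDiffAt (s := (extChartAt (𝓡 3) m₀).source) ?_ hm
  refine (contMDiffOn_tangent_iff (m₀ := m₀) (g := fun m => m) (mapsTo_id _)).2
    ⟨contMDiffOn_id, ?_⟩
  have h1 : ContDiffOn ℝ ∞ (VectorField.lieBracket ℝ (chartVec (𝓡 3) m₀ V) (chartVec (𝓡 3) m₀ W))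
      (extChartAt (𝓡 3) m₀).target := by
    intro x hx
    refine ContDiffAt.contDiffWithinAt ?_
    have hx' := extChartAt_target_mem_nhds' (I := 𝓡 3) hx
    have hv := (hV.contDiffOn m₀).contDiffAt hx'
    have hw := (hW.contDiffOn m₀).contDiffAt hx'
    exact ((hw.fderiv_right (m := ∞) le_rfl).clm_apply hv).sub
      ((hv.fderiv_right (m := ∞) le_rfl).clm_apply hw)
  have h2 := (contMDiffOn_iff_contDiffOn.2 h1).comp (contMDiffOn_extChartAt (I := 𝓡 3) (x := m₀))
    (fun m hm => (extChartAt (𝓡 3) m₀).map_source (by simpa using hm))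
  refine ContMDiffOn.congr (h2.mono (by simp)) ?_
  intro m hm
  simp only [Function.comp]
  rw [← chartVec_mlieBracket hV hW ((extChartAt (𝓡 3) m₀).map_source hm), chartVec,
    (extChartAt (𝓡 3) m₀).left_inv hm]

/-- A global frame of a three-manifold. -/
structure IsGlobalFrame (e : Fin 3 → ∀ m : M, TangentSpace (𝓡 3) m) : Prop where
  smooth : ∀ i, IsSmoothField (e i)
  linearIndependent : ∀ m, LinearIndependent ℝ (fun i => e i m)

variable {e : Fin 3 → ∀ m : M, TangentSpace (𝓡 3) m}

/-- The basis of a tangent space given by a frame. -/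
def IsGlobalFrame.basis (he : IsGlobalFrame e) (m : M) :
    Module.Basis (Fin 3) ℝ (TangentSpace (𝓡 3) m) :=
  basisOfLinearIndependentOfCardEqFinrank (he.linearIndependent m) (by
    rw [show Module.finrank ℝ (TangentSpace (𝓡 3) m) = Module.finrank ℝ E3 from rfl]
    simp)

@[simp] theorem IsGlobalFrame.basis_apply (he : IsGlobalFrame e) (m : M) (i : Fin 3) :
    he.basis m i = e i m := by
  simp [IsGlobalFrame.basis]

/-- The dual frame. -/
def IsGlobalFrame.coframe (he : IsGlobalFrame e) (k : Fin 3) (m : M) :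
    TangentSpace (𝓡 3) m →ₗ[ℝ] ℝ := (he.basis m).coord k

theorem IsGlobalFrame.sum_coframe (he : IsGlobalFrame e) {m : M} (v : TangentSpace (𝓡 3) m) :
    ∑ k, he.coframe k m v • e k m = v := by
  conv_rhs => rw [← (he.basis m).sum_repr v]
  simp [IsGlobalFrame.coframe]

theorem IsGlobalFrame.coframe_sum (he : IsGlobalFrame e) {m : M} (c : Fin 3 → ℝ) (k : Fin 3) :
    he.coframe k m (∑ j, c j • e j m) = c k := by
  have := (he.basis m).repr_sum_self c
  simp only [IsGlobalFrame.basis_apply] at this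
  exact congrFun this k

theorem IsGlobalFrame.coframe_frame (he : IsGlobalFrame e) {m : M} (k j : Fin 3) :
    he.coframe k m (e j m) = if j = k then 1 else 0 := by
  rw [IsGlobalFrame.coframe, ← he.basis_apply, Module.Basis.coord_apply, Module.Basis.repr_self,
    Finsupp.single_apply]

theorem IsGlobalFrame.ext_coframe (he : IsGlobalFrame e) {m : M} {v w : TangentSpace (𝓡 3) m}
    (h : ∀ k, he.coframe k m v = he.coframe k m w) : v = w := by
  rw [← he.sum_coframe v, ← he.sum_coframe w]
  simp [h]

/-- Linear combinations of the frame vectors in the chart at `m₀`. -/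
def frameMap (e : Fin 3 → ∀ m : M, TangentSpace (𝓡 3) m) (m₀ : M) (x : E3) :
    (Fin 3 → ℝ) →L[ℝ] E3 :=
  ∑ k, (ContinuousLinearMap.proj (R := ℝ) (φ := fun _ : Fin 3 => ℝ) k).smulRight
    (chartVec (𝓡 3) m₀ (e k) x)

theorem frameMap_apply (m₀ : M) (x : E3) (c : Fin 3 → ℝ) :
    frameMap e m₀ x c = ∑ k, c k • chartVec (𝓡 3) m₀ (e k) x := by
  simp [frameMap]

theorem frameMap_eq_dchart (m₀ : M) (x : E3) (c : Fin 3 → ℝ) :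
    frameMap e m₀ x c = dchart (𝓡 3) m₀ ((extChartAt (𝓡 3) m₀).symm x)
      (∑ k, c k • e k ((extChartAt (𝓡 3) m₀).symm x)) := by
  rw [frameMap_apply, map_sum]
  simp only [map_smul]
  rfl

theorem IsGlobalFrame.contDiffOn_frameMap (he : IsGlobalFrame e) (m₀ : M) :
    ContDiffOn ℝ ∞ (frameMap e m₀) (extChartAt (𝓡 3) m₀).target := by
  refine ContDiffOn.sum (fun k _ => ?_)
  exact contDiffOn_const.smulRight ((he.smooth k).contDiffOn m₀)

theorem IsGlobalFrame.exists_equiv (he : IsGlobalFrame e) {m₀ : M} {x : E3}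
    (hx : x ∈ (extChartAt (𝓡 3) m₀).target) :
    ∃ L : (Fin 3 → ℝ) ≃L[ℝ] E3, (L : (Fin 3 → ℝ) →L[ℝ] E3) = frameMap e m₀ x := by
  have hx' := (extChartAt (𝓡 3) m₀).map_target hx
  have hinj : Function.Injective (frameMap e m₀ x) := by
    intro c c' hc
    rw [frameMap_eq_dchart, frameMap_eq_dchart] at hc
    have := dchart_injective hx' hc
    ext k
    rw [← he.coframe_sum c k, this, he.coframe_sum]
  refine ⟨(LinearEquiv.ofInjectiveOfFinrankEq (frameMap e m₀ x : (Fin 3 → ℝ) →ₗ[ℝ] E3) hinj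
    (by simp)).toContinuousLinearEquiv, ?_⟩
  ext c
  rfl

theorem IsGlobalFrame.frameMap_inverse (he : IsGlobalFrame e) {m₀ : M} {x : E3}
    (hx : x ∈ (extChartAt (𝓡 3) m₀).target)
    (v : TangentSpace (𝓡 3) ((extChartAt (𝓡 3) m₀).symm x)) (k : Fin 3) :
    (frameMap e m₀ x).inverse (dchart (𝓡 3) m₀ _ v) k = he.coframe k _ v := by
  obtain ⟨L, hL⟩ := he.exists_equiv hx
  have h1 : frameMap e m₀ x (fun k => he.coframe k _ v) = dchart (𝓡 3) m₀ _ v := by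
    rw [frameMap_eq_dchart, he.sum_coframe]
  rw [← h1, ← hL, ContinuousLinearMap.inverse_equiv]
  simp

theorem IsGlobalFrame.contDiffOn_frameMap_inverse (he : IsGlobalFrame e) (m₀ : M) :
    ContDiffOn ℝ ∞ (fun x => (frameMap e m₀ x).inverse) (extChartAt (𝓡 3) m₀).target := by
  intro x hx
  obtain ⟨L, hL⟩ := he.exists_equiv hx
  refine ContDiffAt.comp_contDiffWithinAt (g := ContinuousLinearMap.inverse) x ?_
    (he.contDiffOn_frameMap m₀ x hx)
  rw [← hL]
  exact contDiffAt_map_inverse L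

variable {E' : Type*} [NormedAddCommGroup E'] [NormedSpace ℝ E'] {H' : Type*} [TopologicalSpace H']
  {J : ModelWithCorners ℝ E' H'} {N : Type*} [TopologicalSpace N] [ChartedSpace H' N]

/-- The components in a frame of a smooth vector field along a map. -/
theorem IsGlobalFrame.contMDiffWithinAt_coframe (he : IsGlobalFrame e) {g : N → M}
    {v : ∀ p, TangentSpace (𝓡 3) (g p)} {s : Set N} {p : N} (hp : p ∈ s)
    (h : ContMDiffWithinAt J (𝓡 3).tangent ∞ (fun p => (⟨g p, v p⟩ : TangentBundle (𝓡 3) M)) s p)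
    (k : Fin 3) : ContMDiffWithinAt J 𝓘(ℝ, ℝ) ∞ (fun p => he.coframe k (g p) (v p)) s p := by
  set m₀ := g p with hm₀
  set φ := extChartAt (𝓡 3) m₀ with hφ
  have hgc : ContinuousWithinAt g s p :=
    (FiberBundle.continuous_proj E3 (TangentSpace (𝓡 3) (M := M))).continuousAt.comp_continuousWithinAt
      h.continuousWithinAt
  have hs' : s ∩ g ⁻¹' φ.source ∈ 𝓝[s] p :=
    inter_mem self_mem_nhdsWithin (hgc (extChartAt_source_mem_nhds (I := 𝓡 3) m₀))
  have hp' : p ∈ s ∩ g ⁻¹' φ.source := ⟨hp, mem_extChartAt_source (I := 𝓡 3) m₀⟩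
  obtain ⟨h1, h2⟩ := (contMDiffWithinAt_tangent_iff (m₀ := m₀) hp' (fun q hq => hq.2)).1
    (h.mono inter_subset_left)
  have h3 : ContMDiffWithinAt J 𝓘(ℝ, E3) ∞ (fun q => φ (g q)) (s ∩ g ⁻¹' φ.source) p :=
    (contMDiffAt_extChartAt (I := 𝓡 3) (x := m₀)).comp_contMDiffWithinAt p h1
  have h4 : ContMDiffWithinAt J 𝓘(ℝ, E3 →L[ℝ] (Fin 3 → ℝ)) ∞
      (fun q => (frameMap e m₀ (φ (g q))).inverse) (s ∩ g ⁻¹' φ.source) p := by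
    have h5 := (he.contDiffOn_frameMap_inverse m₀).contDiffAt
      (extChartAt_target_mem_nhds' (I := 𝓡 3) (φ.map_source (mem_extChartAt_source (I := 𝓡 3) m₀)))
    exact ContMDiffAt.comp_contMDiffWithinAt
      (g := fun x => (frameMap e m₀ x).inverse) p h5.contMDiffAt h3
  have h6 := h4.clm_apply h2
  have h7 : ContMDiffWithinAt J 𝓘(ℝ, ℝ) ∞
      (fun q => (frameMap e m₀ (φ (g q))).inverse (dchart (𝓡 3) m₀ (g q) (v q)) k)
      (s ∩ g ⁻¹' φ.source) p := by
    exact (ContinuousLinearMap.contMDiff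
      (ContinuousLinearMap.proj (R := ℝ) (φ := fun _ : Fin 3 => ℝ) k)).contMDiffAt.comp_contMDiffWithinAt
      p h6
  have key : ∀ q ∈ s ∩ g ⁻¹' φ.source, he.coframe k (g q) (v q) =
      (frameMap e m₀ (φ (g q))).inverse (dchart (𝓡 3) m₀ (g q) (v q)) k := by
    intro q hq
    have := he.frameMap_inverse (φ.map_source hq.2) (m₀ := m₀) (k := k)
    rw [φ.left_inv hq.2] at this
    exact (this (v q)).symm
  exact (h7.congr key (key p hp')).mono_of_mem_nhdsWithin hs'

/-- Linear combinations of frame vectors along a smooth map. -/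
theorem IsGlobalFrame.contMDiffWithinAt_sum (he : IsGlobalFrame e) {g : N → M}
    {c : Fin 3 → N → ℝ} {s : Set N} {p : N} (hp : p ∈ s) (hg : ContMDiffWithinAt J (𝓡 3) ∞ g s p)
    (hc : ∀ k, ContMDiffWithinAt J 𝓘(ℝ, ℝ) ∞ (c k) s p) :
    ContMDiffWithinAt J (𝓡 3).tangent ∞
      (fun p => (⟨g p, ∑ k, c k p • e k (g p)⟩ : TangentBundle (𝓡 3) M)) s p := by
  set m₀ := g p with hm₀
  set φ := extChartAt (𝓡 3) m₀ with hφ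
  have hs' : s ∩ g ⁻¹' φ.source ∈ 𝓝[s] p :=
    inter_mem self_mem_nhdsWithin
      (hg.continuousWithinAt (extChartAt_source_mem_nhds (I := 𝓡 3) m₀))
  have hp' : p ∈ s ∩ g ⁻¹' φ.source := ⟨hp, mem_extChartAt_source (I := 𝓡 3) m₀⟩
  refine ContMDiffWithinAt.mono_of_mem_nhdsWithin ?_ hs'
  rw [contMDiffWithinAt_tangent_iff (m₀ := m₀) hp' (fun q hq => hq.2)]
  have hg' := hg.mono (inter_subset_left (t := g ⁻¹' φ.source))
  refine ⟨hg', ?_⟩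
  have h1 : ∀ k, ContMDiffWithinAt J 𝓘(ℝ, E3) ∞ (fun q => dchart (𝓡 3) m₀ (g q) (e k (g q)))
      (s ∩ g ⁻¹' φ.source) p := fun k =>
    ((contMDiffWithinAt_tangent_iff (m₀ := m₀) hp' (fun q hq => hq.2)).1
      ((he.smooth k).contMDiffAt.comp_contMDiffWithinAt p hg')).2
  have h2 : ContMDiffWithinAt J 𝓘(ℝ, E3) ∞
      (fun q => ∑ k, c k q • dchart (𝓡 3) m₀ (g q) (e k (g q))) (s ∩ g ⁻¹' φ.source) p := by
    have : ∀ k ∈ Finset.univ, ContMDiffWithinAt J 𝓘(ℝ, E3) ∞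
        (fun q => c k q • dchart (𝓡 3) m₀ (g q) (e k (g q))) (s ∩ g ⁻¹' φ.source) p :=
      fun k _ => ((hc k).mono inter_subset_left).smul (h1 k)
    simpa using contMDiffWithinAt_finsetSum this
  refine h2.congr (fun q hq => ?_) ?_ <;> simp

end Frames
end Engel

namespace Engel

open Set Filter

section Scalars

variable {M : Type*} [TopologicalSpace M] [ChartedSpace E3 M] [IsManifold (𝓡 3) ∞ M]

/-- A function of `t`, `s` and `m` that is smooth for `|t| < δ` and `0 ≤ s ≤ 1`. -/
def SmoothFamily (δ : ℝ) (g : ℝ × ℝ → M → ℝ) : Prop :=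
  ContMDiffOn (𝓘(ℝ, ℝ × ℝ).prod (𝓡 3)) 𝓘(ℝ, ℝ) ∞ (fun p : (ℝ × ℝ) × M => g p.1 p.2)
    ((Ioo (-δ) δ ×ˢ Icc 0 1) ×ˢ univ)

/-- The derivative of a family of functions along a vector field. -/
def dX (V : ∀ m : M, TangentSpace (𝓡 3) m) (g : ℝ × ℝ → M → ℝ) (τ : ℝ × ℝ) (m : M) : ℝ :=
  (mfderiv (𝓡 3) 𝓘(ℝ, ℝ) (g τ) m : TangentSpace (𝓡 3) m →L[ℝ] ℝ) (V m)

/-- The derivative of a family of functions with respect to the second parameter. -/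
def dS (g : ℝ × ℝ → M → ℝ) (τ : ℝ × ℝ) (m : M) : ℝ :=
  derivWithin (fun s => g (τ.1, s) m) (Icc 0 1) τ.2

namespace SmoothFamily

variable {δ : ℝ} {g h : ℝ × ℝ → M → ℝ} {V : ∀ m : M, TangentSpace (𝓡 3) m}

theorem mono {δ' : ℝ} (hg : SmoothFamily δ g) (hδ : δ' ≤ δ) : SmoothFamily δ' g :=
  ContMDiffOn.mono hg
    (prod_mono_left (prod_mono_left (Ioo_subset_Ioo (by linarith) hδ)))

theorem congr (hg : SmoothFamily δ g)
    (H : ∀ τ ∈ Ioo (-δ) δ ×ˢ Icc (0 : ℝ) 1, ∀ m, h τ m = g τ m) : SmoothFamily δ h :=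
  ContMDiffOn.congr hg (fun p hp => H p.1 hp.1 p.2)

theorem add (hg : SmoothFamily δ g) (hh : SmoothFamily δ h) :
    SmoothFamily δ (fun τ m => g τ m + h τ m) := ContMDiffOn.add hg hh

theorem mul (hg : SmoothFamily δ g) (hh : SmoothFamily δ h) :
    SmoothFamily δ (fun τ m => g τ m * h τ m) := ContMDiffOn.mul hg hh

theorem neg (hg : SmoothFamily δ g) : SmoothFamily δ (fun τ m => -g τ m) :=
  (contDiff_neg.contMDiff (n := ∞)).comp_contMDiffOn (I' := 𝓘(ℝ, ℝ)) hg

theorem sub (hg : SmoothFamily δ g) (hh : SmoothFamily δ h) :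
    SmoothFamily δ (fun τ m => g τ m - h τ m) := by
  simpa only [sub_eq_add_neg] using hg.add hh.neg

theorem of_contMDiff {c : M → ℝ} (hc : ContMDiff (𝓡 3) 𝓘(ℝ, ℝ) ∞ c) :
    SmoothFamily δ (fun _ m => c m) := (hc.comp contMDiff_snd).contMDiffOn

theorem const (c : ℝ) : SmoothFamily (M := M) δ (fun _ _ => c) := contMDiffOn_const

theorem inv (hg : SmoothFamily δ g) (h0 : ∀ τ ∈ Ioo (-δ) δ ×ˢ Icc (0 : ℝ) 1, ∀ m, g τ m ≠ 0) :
    SmoothFamily δ (fun τ m => (g τ m)⁻¹) := fun p hp =>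
  ContMDiffAt.comp_contMDiffWithinAt (I' := 𝓘(ℝ, ℝ)) (g := fun x : ℝ => x⁻¹) p
    (contDiffAt_inv ℝ (h0 p.1 hp.1 p.2)).contMDiffAt (hg p hp)

theorem sum {ι : Type*} {s : Finset ι} {g : ι → ℝ × ℝ → M → ℝ} (hg : ∀ i, SmoothFamily δ (g i)) :
    SmoothFamily δ (fun τ m => ∑ i ∈ s, g i τ m) := by
  classical
  induction s using Finset.induction_on with
  | empty => simpa using const (M := M) (δ := δ) 0
  | insert i s hi ih => simpa [Finset.sum_insert hi] using (hg i).add ih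

theorem contDiffOn_chart (hg : SmoothFamily δ g) (m₀ : M) :
    ContDiffOn ℝ ∞ (fun p : (ℝ × ℝ) × E3 => g p.1 ((extChartAt (𝓡 3) m₀).symm p.2))
      ((Ioo (-δ) δ ×ˢ Icc 0 1) ×ˢ (extChartAt (𝓡 3) m₀).target) :=
  contMDiffOn_iff_contDiffOn.1 (ContMDiffOn.comp_extChartAt_symm hg m₀ (subset_univ _))

theorem contMDiff_slice (hg : SmoothFamily δ g) {τ : ℝ × ℝ}
    (hτ : τ ∈ Ioo (-δ) δ ×ˢ Icc (0 : ℝ) 1) : ContMDiff (𝓡 3) 𝓘(ℝ, ℝ) ∞ (g τ) := by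
  have h1 : ContMDiffOn (𝓡 3) (𝓘(ℝ, ℝ × ℝ).prod (𝓡 3)) ∞ (fun m : M => (τ, m)) univ :=
    (contMDiff_const.prodMk contMDiff_id).contMDiffOn
  exact contMDiffOn_univ.1 (ContMDiffOn.comp (g := fun p : (ℝ × ℝ) × M => g p.1 p.2) hg h1
    (fun m _ => ⟨hτ, trivial⟩))

theorem mdifferentiableAt (hg : SmoothFamily δ g) {τ : ℝ × ℝ}
    (hτ : τ ∈ Ioo (-δ) δ ×ˢ Icc (0 : ℝ) 1) (m : M) :
    MDifferentiableAt (𝓡 3) 𝓘(ℝ, ℝ) (g τ) m :=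
  (hg.contMDiff_slice hτ).mdifferentiable (by simp) m

theorem hasFDerivAt_chart (hg : SmoothFamily δ g) {τ : ℝ × ℝ}
    (hτ : τ ∈ Ioo (-δ) δ ×ˢ Icc (0 : ℝ) 1) {m₀ : M} {x : E3}
    (hx : x ∈ (extChartAt (𝓡 3) m₀).target) :
    ∃ L : E3 →L[ℝ] ℝ, HasFDerivAt (fun x => g τ ((extChartAt (𝓡 3) m₀).symm x)) L x ∧
      ∀ V, L (chartVec (𝓡 3) m₀ V x) = dX V g τ ((extChartAt (𝓡 3) m₀).symm x) := by
  have h1 := (hg.mdifferentiableAt hτ _).hasMFDerivAt.comp x (hasMFDerivAt_chartSymm hx)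
  refine ⟨_, hasMFDerivAt_iff_hasFDerivAt.1 h1, fun V => ?_⟩
  change mfderiv (𝓡 3) 𝓘(ℝ, ℝ) (g τ) _ (dchartSymm (𝓡 3) m₀ x (chartVec (𝓡 3) m₀ V x)) = _
  rw [chartVec, dchartSymm_dchart hx]
  rfl

theorem uniqueDiffOn : UniqueDiffOn ℝ (Ioo (-δ) δ ×ˢ Icc (0 : ℝ) 1) :=
  isOpen_Ioo.uniqueDiffOn.prod (uniqueDiffOn_Icc one_pos)

theorem dX (hg : SmoothFamily δ g) (hV : IsSmoothField V) : SmoothFamily δ (dX V g) := by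
  refine contMDiffOn_of_extChartAt fun m₀ => contMDiffOn_iff_contDiffOn.2 ?_
  have hto := isOpen_extChartAt_target (I := 𝓡 3) m₀
  obtain ⟨f', h1, h2⟩ := exists_partial_fderiv_snd uniqueDiffOn hto.uniqueDiffOn
    (hg.contDiffOn_chart m₀)
  have h3 : ContDiffOn ℝ ∞ (fun p : (ℝ × ℝ) × E3 => chartVec (𝓡 3) m₀ V p.2)
      ((Ioo (-δ) δ ×ˢ Icc 0 1) ×ˢ (extChartAt (𝓡 3) m₀).target) :=
    (hV.contDiffOn m₀).comp contDiffOn_snd (fun p hp => hp.2)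
  refine (h1.clm_apply h3).congr ?_
  rintro ⟨τ, x⟩ ⟨hτ, hx⟩
  obtain ⟨L, hL, hLV⟩ := hg.hasFDerivAt_chart hτ hx
  simp only
  rw [← hLV V, hL.unique ((h2 τ hτ x hx).hasFDerivAt (hto.mem_nhds hx))]

theorem contDiffOn_slice (hg : SmoothFamily δ g) {t : ℝ} (ht : t ∈ Ioo (-δ) δ) (m₀ : M) :
    ContDiffOn ℝ ∞ (fun p : ℝ × E3 => g (t, p.1) ((extChartAt (𝓡 3) m₀).symm p.2))
      (Icc 0 1 ×ˢ (extChartAt (𝓡 3) m₀).target) :=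
  (hg.contDiffOn_chart m₀).comp (f := fun p : ℝ × E3 => ((t, p.1), p.2)) (by fun_prop)
    (fun p hp => ⟨⟨ht, hp.1⟩, hp.2⟩)

theorem hasDerivWithinAt (hg : SmoothFamily δ g) {t s : ℝ} (ht : t ∈ Ioo (-δ) δ)
    (hs : s ∈ Icc (0 : ℝ) 1) (m : M) :
    HasDerivWithinAt (fun s => g (t, s) m) (dS g (t, s) m) (Icc 0 1) s := by
  have hx := (extChartAt (𝓡 3) m).map_source (mem_extChartAt_source m)
  have h1 := (hg.contDiffOn_slice ht m).comp (s := Icc (0 : ℝ) 1)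
    (f := fun s : ℝ => (s, extChartAt (𝓡 3) m m)) (by fun_prop) (fun s hs => ⟨hs, hx⟩)
  have h2 := (h1.differentiableOn (by simp)) s hs
  simp only [Function.comp_def, (extChartAt (𝓡 3) m).left_inv (mem_extChartAt_source m)] at h2
  exact h2.hasDerivWithinAt

theorem hasFDerivWithinAt_slice (hg : SmoothFamily δ g) {t s : ℝ} (ht : t ∈ Ioo (-δ) δ)
    (hs : s ∈ Icc (0 : ℝ) 1) {m₀ : M} {x : E3} (hx : x ∈ (extChartAt (𝓡 3) m₀).target) :
    ∃ G : ℝ × E3 →L[ℝ] ℝ, HasFDerivWithinAt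
      (fun p : ℝ × E3 => g (t, p.1) ((extChartAt (𝓡 3) m₀).symm p.2)) G
      (Icc 0 1 ×ˢ (extChartAt (𝓡 3) m₀).target) (s, x) ∧
      G (1, 0) = dS g (t, s) ((extChartAt (𝓡 3) m₀).symm x) ∧
      ∀ V, G (0, chartVec (𝓡 3) m₀ V x) = Engel.dX V g (t, s) ((extChartAt (𝓡 3) m₀).symm x) := by
  have hto := isOpen_extChartAt_target (I := 𝓡 3) m₀
  have h1 := ((hg.contDiffOn_slice ht m₀).differentiableOn (by simp) (s, x)
    ⟨hs, hx⟩).hasFDerivWithinAt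
  set G := fderivWithin ℝ (fun p : ℝ × E3 => g (t, p.1) ((extChartAt (𝓡 3) m₀).symm p.2))
    (Icc 0 1 ×ˢ (extChartAt (𝓡 3) m₀).target) (s, x) with hG
  refine ⟨G, h1, ?_, fun V => ?_⟩
  · have h2 : HasDerivWithinAt (fun r => g (t, r) ((extChartAt (𝓡 3) m₀).symm x)) (G (1, 0))
        (Icc 0 1) s :=
      HasFDerivWithinAt.comp_hasDerivWithinAt (f := fun r : ℝ => (r, x)) s h1
        ((hasDerivWithinAt_id _ _).prodMk (hasDerivWithinAt_const _ _ _)) (fun r hr => ⟨hr, hx⟩)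
    exact (h2.derivWithin (uniqueDiffOn_Icc one_pos s hs)).symm
  · have h2 : HasFDerivAt (fun y => g (t, s) ((extChartAt (𝓡 3) m₀).symm y))
        (G.comp (ContinuousLinearMap.inr ℝ ℝ E3)) x :=
      (HasFDerivWithinAt.comp (f := fun y : E3 => (s, y)) x h1
        (hasFDerivAt_prodMk_right (𝕜 := ℝ) s x).hasFDerivWithinAt
        (fun r hr => ⟨hs, hr⟩)).hasFDerivAt (hto.mem_nhds hx)
    obtain ⟨L, hL, hLV⟩ := hg.hasFDerivAt_chart (τ := (t, s)) ⟨ht, hs⟩ hx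
    rw [← hLV V, hL.unique h2]
    rfl

theorem dS (hg : SmoothFamily δ g) : SmoothFamily δ (dS g) := by
  refine contMDiffOn_of_extChartAt fun m₀ => contMDiffOn_iff_contDiffOn.2 ?_
  have hto := isOpen_extChartAt_target (I := 𝓡 3) m₀
  have hc := hg.contDiffOn_chart m₀
  have h1 := hc.fderivWithin (m := ∞) (uniqueDiffOn.prod hto.uniqueDiffOn) le_rfl
  refine (h1.clm_apply (contDiffOn_const (c := (((0 : ℝ), (1 : ℝ)), (0 : E3))))).congr ?_
  rintro ⟨⟨t, s⟩, x⟩ ⟨⟨ht, hs⟩, hx⟩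
  have h2 := (hc.differentiableOn (by simp) ((t, s), x) ⟨⟨ht, hs⟩, hx⟩).hasFDerivWithinAt
  have h3 : HasDerivWithinAt (fun r => g (t, r) ((extChartAt (𝓡 3) m₀).symm x)) _ (Icc 0 1) s :=
    HasFDerivWithinAt.comp_hasDerivWithinAt (f := fun r : ℝ => ((t, r), x))
    (f' := (((0 : ℝ), (1 : ℝ)), (0 : E3))) s h2
    (((hasDerivWithinAt_const _ _ _).prodMk (hasDerivWithinAt_id _ _)).prodMk
      (hasDerivWithinAt_const _ _ _)) (fun r hr => ⟨⟨ht, hr⟩, hx⟩)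
  exact h3.derivWithin (uniqueDiffOn_Icc one_pos s hs)

end SmoothFamily

variable {δ : ℝ}

theorem dX_mul {g h : ℝ × ℝ → M → ℝ} {V : ∀ m : M, TangentSpace (𝓡 3) m}
    (hg : SmoothFamily δ g) (hh : SmoothFamily δ h) {τ : ℝ × ℝ}
    (hτ : τ ∈ Ioo (-δ) δ ×ˢ Icc (0 : ℝ) 1) (m : M) :
    dX V (fun τ m => g τ m * h τ m) τ m = dX V g τ m * h τ m + g τ m * dX V h τ m := by
  have := ((hg.mdifferentiableAt hτ m).hasMFDerivAt.mul (hh.mdifferentiableAt hτ m).hasMFDerivAt)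
  rw [dX]
  refine (DFunLike.congr_fun this.mfderiv (V m)).trans ?_
  change g τ m * dX V h τ m + h τ m * dX V g τ m = _
  ring

theorem dX_add {g h : ℝ × ℝ → M → ℝ} {V : ∀ m : M, TangentSpace (𝓡 3) m}
    (hg : SmoothFamily δ g) (hh : SmoothFamily δ h) {τ : ℝ × ℝ}
    (hτ : τ ∈ Ioo (-δ) δ ×ˢ Icc (0 : ℝ) 1) (m : M) :
    dX V (fun τ m => g τ m + h τ m) τ m = dX V g τ m + dX V h τ m := by
  have := ((hg.mdifferentiableAt hτ m).hasMFDerivAt.add (hh.mdifferentiableAt hτ m).hasMFDerivAt)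
  rw [dX]
  exact DFunLike.congr_fun this.mfderiv (V m)

theorem dX_sum_mul {g h : Fin 3 → ℝ × ℝ → M → ℝ} {V : ∀ m : M, TangentSpace (𝓡 3) m}
    (hg : ∀ k, SmoothFamily δ (g k)) (hh : ∀ k, SmoothFamily δ (h k)) {τ : ℝ × ℝ}
    (hτ : τ ∈ Ioo (-δ) δ ×ˢ Icc (0 : ℝ) 1) (m : M) :
    dX V (fun τ m => ∑ k, g k τ m * h k τ m) τ m =
      ∑ k, (dX V (g k) τ m * h k τ m + g k τ m * dX V (h k) τ m) := by
  simp only [Fin.sum_univ_three]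
  rw [dX_add (((hg 0).mul (hh 0)).add ((hg 1).mul (hh 1))) ((hg 2).mul (hh 2)) hτ,
    dX_add ((hg 0).mul (hh 0)) ((hg 1).mul (hh 1)) hτ,
    dX_mul (hg 0) (hh 0) hτ, dX_mul (hg 1) (hh 1) hτ, dX_mul (hg 2) (hh 2) hτ]

theorem dS_sum_mul {g h : Fin 3 → ℝ × ℝ → M → ℝ}
    (hg : ∀ k, SmoothFamily δ (g k)) (hh : ∀ k, SmoothFamily δ (h k)) {τ : ℝ × ℝ}
    (hτ : τ ∈ Ioo (-δ) δ ×ˢ Icc (0 : ℝ) 1) (m : M) :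
    dS (fun τ m => ∑ k, g k τ m * h k τ m) τ m =
      ∑ k, (dS (g k) τ m * h k τ m + g k τ m * dS (h k) τ m) :=
  (HasDerivWithinAt.fun_sum (fun k _ => ((hg k).hasDerivWithinAt hτ.1 hτ.2 m).mul
    ((hh k).hasDerivWithinAt hτ.1 hτ.2 m))).derivWithin (uniqueDiffOn_Icc one_pos _ hτ.2)

theorem dX_congr {g h : ℝ × ℝ → M → ℝ} {V : ∀ m : M, TangentSpace (𝓡 3) m} {τ : ℝ × ℝ}
    (H : ∀ m, g τ m = h τ m) (m : M) : dX V g τ m = dX V h τ m := by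
  rw [dX, dX, show g τ = h τ from funext H]

theorem dS_congr {g h : ℝ × ℝ → M → ℝ} {τ : ℝ × ℝ} {m : M} (hτ : τ.2 ∈ Icc (0 : ℝ) 1)
    (H : ∀ s ∈ Icc (0 : ℝ) 1, g (τ.1, s) m = h (τ.1, s) m) : dS g τ m = dS h τ m :=
  derivWithin_congr H (H _ hτ)

theorem dX_const {V : ∀ m : M, TangentSpace (𝓡 3) m} {g : ℝ × ℝ → M → ℝ} {τ : ℝ × ℝ} {c : ℝ}
    (H : ∀ m, g τ m = c) (m : M) : dX V g τ m = 0 := by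
  rw [dX, show g τ = fun _ => c from funext H, mfderiv_const]
  rfl

theorem dS_const {g : ℝ × ℝ → M → ℝ} {τ : ℝ × ℝ} {m : M} {c : ℝ} (hτ : τ.2 ∈ Icc (0 : ℝ) 1)
    (H : ∀ s ∈ Icc (0 : ℝ) 1, g (τ.1, s) m = c) : dS g τ m = 0 := by
  rw [dS_congr (h := fun _ _ => c) hτ H, dS]
  simp

/-- A smooth family of functions that vanishes for `t = 0` and outside of `K`. -/
structure SmallFamily (δ : ℝ) (K : Set M) (g : ℝ × ℝ → M → ℝ) : Prop where
  smooth : SmoothFamily δ g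
  zero : ∀ s ∈ Icc (0 : ℝ) 1, ∀ m, g (0, s) m = 0
  support : ∀ τ ∈ Ioo (-δ) δ ×ˢ Icc (0 : ℝ) 1, ∀ m ∉ K, g τ m = 0

namespace SmallFamily

variable {K : Set M} {g h : ℝ × ℝ → M → ℝ} {V : ∀ m : M, TangentSpace (𝓡 3) m}

theorem mono {δ' : ℝ} (hg : SmallFamily δ K g) (hδ : δ' ≤ δ) : SmallFamily δ' K g :=
  ⟨hg.smooth.mono hδ, hg.zero, fun τ hτ => hg.support τ
    (prod_mono_left (Ioo_subset_Ioo (by linarith) hδ) hτ)⟩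

theorem add (hg : SmallFamily δ K g) (hh : SmallFamily δ K h) :
    SmallFamily δ K (fun τ m => g τ m + h τ m) :=
  ⟨hg.smooth.add hh.smooth, fun s hs m => by simp [hg.zero s hs, hh.zero s hs],
    fun τ hτ m hm => by simp [hg.support τ hτ m hm, hh.support τ hτ m hm]⟩

theorem mul_left (hg : SmoothFamily δ g) (hh : SmallFamily δ K h) :
    SmallFamily δ K (fun τ m => g τ m * h τ m) :=
  ⟨hg.mul hh.smooth, fun s hs m => by simp [hh.zero s hs],
    fun τ hτ m hm => by simp [hh.support τ hτ m hm]⟩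

theorem neg (hg : SmallFamily δ K g) : SmallFamily δ K (fun τ m => -g τ m) :=
  ⟨hg.smooth.neg, fun s hs m => by simp [hg.zero s hs],
    fun τ hτ m hm => by simp [hg.support τ hτ m hm]⟩

theorem dX (hK : IsClosed K) (hg : SmallFamily δ K g) (hV : IsSmoothField V) :
    SmallFamily δ K (dX V g) :=
  ⟨hg.smooth.dX hV, fun s hs m => dX_const (hg.zero s hs) m, fun τ hτ m hm => by
    have h1 : g τ =ᶠ[𝓝 m] fun _ => (0 : ℝ) := by
      filter_upwards [hK.isOpen_compl.mem_nhds hm] with m' hm' using hg.support τ hτ m' hm'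
    rw [Engel.dX, h1.mfderiv_eq, mfderiv_const]
    rfl⟩

theorem dS (hg : SmallFamily δ K g) : SmallFamily δ K (dS g) :=
  ⟨hg.smooth.dS, fun _ hs m => dS_const hs (fun r hr => hg.zero r hr m), fun τ hτ m hm =>
    dS_const hτ.2 (fun r hr => hg.support (τ.1, r) ⟨hτ.1, hr⟩ m hm)⟩

end SmallFamily

theorem exists_forall_pos {ε : ℝ} (hε : 0 < ε) {K : Set M} (hK : IsCompact K) {g : ℝ × ℝ → M → ℝ}
    (hg : SmoothFamily ε g) (h0 : ∀ s ∈ Icc (0 : ℝ) 1, ∀ m, 0 < g (0, s) m)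
    (hs : ∀ τ ∈ Ioo (-ε) ε ×ˢ Icc (0 : ℝ) 1, ∀ m ∉ K, 0 < g τ m) :
    ∃ δ > 0, δ ≤ ε ∧ ∀ τ ∈ Ioo (-δ) δ ×ˢ Icc (0 : ℝ) 1, ∀ m, 0 < g τ m := by
  have key : ∀ᶠ t in 𝓝 (0 : ℝ), ∀ q ∈ Icc (0 : ℝ) 1 ×ˢ K,
      (t ∈ Ioo (-ε) ε → q.1 ∈ Icc (0 : ℝ) 1 → 0 < g (t, q.1) q.2) := by
    refine (isCompact_Icc.prod hK).eventually_forall_of_forall_eventually ?_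
    rintro ⟨s, m⟩ ⟨hs, -⟩
    have h1 := (hg.continuousOn ((0, s), m) ⟨⟨⟨by linarith, hε⟩, hs⟩, trivial⟩).eventually
      (lt_mem_nhds (h0 s hs m))
    rw [eventually_nhdsWithin_iff] at h1
    have h2 : Continuous (fun z : ℝ × ℝ × M => ((z.1, z.2.1), z.2.2)) := by fun_prop
    filter_upwards [h2.continuousAt.eventually h1] with z hz ht hs
    exact hz ⟨⟨ht, hs⟩, trivial⟩
  obtain ⟨δ, hδ, hball⟩ := Metric.eventually_nhds_iff.1 key
  refine ⟨min δ ε, lt_min hδ hε, min_le_right _ _, ?_⟩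
  rintro ⟨t, s⟩ ⟨ht, hs'⟩ m
  simp only at ht hs'
  have htε : t ∈ Ioo (-ε) ε := Ioo_subset_Ioo (by linarith [min_le_right δ ε]) (min_le_right _ _) ht
  by_cases hm : m ∈ K
  · refine hball (y := t) ?_ (s, m) ⟨hs', hm⟩ htε hs'
    rw [Real.dist_eq, sub_zero, abs_lt]
    exact ⟨by linarith [ht.1, min_le_left δ ε], ht.2.trans_le (min_le_left _ _)⟩
  · exact hs (t, s) ⟨htε, hs'⟩ m hm

end Scalars
end Engel

namespace Engel

open Set Filter

section Invariance

variable {M : Type*} [TopologicalSpace M] [ChartedSpace E3 M] [IsManifold (𝓡 3) ∞ M]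
  {e : Fin 3 → ∀ m : M, TangentSpace (𝓡 3) m}

/-- The structure functions of a frame. -/
def IsGlobalFrame.structFun (he : IsGlobalFrame e) (i j k : Fin 3) (m : M) : ℝ :=
  he.coframe k m (VectorField.mlieBracket (𝓡 3) (e i) (e j) m)

theorem IsGlobalFrame.smooth_structFun (he : IsGlobalFrame e) (δ : ℝ) (i j k : Fin 3) :
    SmoothFamily δ (fun _ => he.structFun i j k) := by
  refine SmoothFamily.of_contMDiff (contMDiffOn_univ.1 fun m _ => ?_)
  exact he.contMDiffWithinAt_coframe (g := fun m => m) (mem_univ m)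
    (((he.smooth i).mlieBracket (he.smooth j)).contMDiffAt.contMDiffWithinAt) k

theorem IsGlobalFrame.structFun_swap (he : IsGlobalFrame e) (i j k : Fin 3) (m : M) :
    he.structFun i j k m = -he.structFun j i k m := by
  rw [structFun, structFun, VectorField.mlieBracket_swap, Pi.neg_apply, map_neg]

/-- The values `dα (e i, e j)` for the family of 1-forms `α` with components `α k`. -/
def IsGlobalFrame.extDeriv (he : IsGlobalFrame e) (α : Fin 3 → ℝ × ℝ → M → ℝ) (i j : Fin 3)
    (τ : ℝ × ℝ) (m : M) : ℝ :=
  dX (e i) (α j) τ m - dX (e j) (α i) τ m - ∑ k, he.structFun i j k m * α k τ m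

theorem IsGlobalFrame.extDeriv_swap (he : IsGlobalFrame e) (α : Fin 3 → ℝ × ℝ → M → ℝ)
    (i j : Fin 3) (τ : ℝ × ℝ) (m : M) :
    he.extDeriv α i j τ m = -he.extDeriv α j i τ m := by
  simp only [extDeriv, he.structFun_swap i j, neg_mul, Finset.sum_neg_distrib]
  ring

theorem IsGlobalFrame.extDeriv_self (he : IsGlobalFrame e) (α : Fin 3 → ℝ × ℝ → M → ℝ)
    (i : Fin 3) (τ : ℝ × ℝ) (m : M) : he.extDeriv α i i τ m = 0 := by
  linarith [he.extDeriv_swap α i i τ m]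

theorem IsGlobalFrame.smooth_extDeriv (he : IsGlobalFrame e) {δ : ℝ}
    {α : Fin 3 → ℝ × ℝ → M → ℝ} (hα : ∀ k, SmoothFamily δ (α k)) (i j : Fin 3) :
    SmoothFamily δ (he.extDeriv α i j) :=
  (((hα j).dX (he.smooth i)).sub ((hα i).dX (he.smooth j))).sub
    (SmoothFamily.sum fun k => (he.smooth_structFun δ i j k).mul (hα k))

theorem eq_zero_of_deriv_eq_mul {Q f : ℝ → ℝ} (hQ : ContinuousOn Q (Icc 0 1))
    (hf : ∀ s ∈ Icc (0 : ℝ) 1, HasDerivWithinAt f (Q s * f s) (Icc 0 1) s) {s₀ : ℝ}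
    (hs₀ : s₀ ∈ Icc (0 : ℝ) 1) (h0 : f s₀ = 0) : ∀ s ∈ Icc (0 : ℝ) 1, f s = 0 := by
  obtain ⟨B, hB⟩ := isCompact_Icc.exists_bound_of_continuousOn hQ
  have hB0 : 0 ≤ B := (norm_nonneg _).trans (hB s₀ hs₀)
  have hlip : ∀ s ∈ Icc (0 : ℝ) 1, LipschitzOnWith B.toNNReal (fun y => Q s * y) univ := by
    intro s hs
    refine LipschitzOnWith.of_dist_le_mul fun x _ y _ => ?_
    rw [Real.dist_eq, Real.dist_eq, ← mul_sub, abs_mul, Real.coe_toNNReal _ hB0]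
    exact mul_le_mul_of_nonneg_right (hB s hs) (abs_nonneg _)
  intro s hs
  have hfc : ContinuousOn f (Icc 0 1) := fun r hr => (hf r hr).continuousWithinAt
  rcases le_total s₀ s with h | h
  · have hsub : Icc s₀ s ⊆ Icc 0 1 := Icc_subset_Icc hs₀.1 hs.2
    refine ODE_solution_unique_of_mem_Icc_right (v := fun s y => Q s * y) (s := fun _ => univ)
      (g := fun _ => 0) (fun r hr => hlip r (hsub ⟨hr.1, hr.2.le⟩)) (hfc.mono hsub) ?_
      (fun _ _ => trivial) continuousOn_const ?_ (fun _ _ => trivial) h0 ⟨h, le_rfl⟩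
    · intro r hr
      refine (hf r (hsub ⟨hr.1, hr.2.le⟩)).mono_of_mem_nhdsWithin ?_
      exact mem_of_superset (Icc_mem_nhdsGE hr.2) (fun x hx => hsub ⟨hr.1.trans hx.1, hx.2⟩)
    · intro r _
      simpa using hasDerivWithinAt_const r (Ici r) (0 : ℝ)
  · have hsub : Icc s s₀ ⊆ Icc 0 1 := Icc_subset_Icc hs.1 hs₀.2
    refine ODE_solution_unique_of_mem_Icc_left (v := fun s y => Q s * y) (s := fun _ => univ)
      (g := fun _ => 0) (fun r hr => hlip r (hsub ⟨hr.1.le, hr.2⟩)) (hfc.mono hsub) ?_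
      (fun _ _ => trivial) continuousOn_const ?_ (fun _ _ => trivial) h0 ⟨le_rfl, h⟩
    · intro r hr
      refine (hf r (hsub ⟨hr.1.le, hr.2⟩)).mono_of_mem_nhdsWithin ?_
      exact mem_of_superset (Icc_mem_nhdsLE hr.1) (fun x hx => hsub ⟨hx.1, hx.2.trans hr.2⟩)
    · intro r _
      simpa using hasDerivWithinAt_const r (Iic r) (0 : ℝ)

variable [T2Space M]

/-- If `∂ₛα + L_w α` is a multiple of `α`, then the flow of `w` preserves the kernel of `α`. -/
theorem IsFlowOn.coframe_eq_zero_iff (he : IsGlobalFrame e) {δ : ℝ}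
    {α w : Fin 3 → ℝ × ℝ → M → ℝ} {f Q : ℝ × ℝ → M → ℝ} {Φ : ℝ → ℝ → ℝ → M → M}
    (hα : ∀ k, SmoothFamily δ (α k)) (hw : ∀ k, SmoothFamily δ (w k)) (hQs : SmoothFamily δ Q)
    (hΦ : IsFlowOn (fun τ m => ∑ k, w k τ m • e k m) δ univ Φ)
    (hf : ∀ τ ∈ Ioo (-δ) δ ×ˢ Icc (0 : ℝ) 1, ∀ m, f τ m = ∑ k, α k τ m * w k τ m)
    (hQ : ∀ τ ∈ Ioo (-δ) δ ×ˢ Icc (0 : ℝ) 1, ∀ m i,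
      dS (α i) τ m + dX (e i) f τ m + ∑ j, w j τ m * he.extDeriv α j i τ m = Q τ m * α i τ m)
    {t s : ℝ} (ht : t ∈ Ioo (-δ) δ) (hs : s ∈ Icc (0 : ℝ) 1) (m : M)
    (v : TangentSpace (𝓡 3) m) :
    ∑ k, α k (t, s) (Φ t 0 s m) * he.coframe k (Φ t 0 s m) (mfderiv (𝓡 3) (𝓡 3) (Φ t 0 s) m v) = 0
      ↔ ∑ k, α k (t, 0) (Φ t 0 0 m) *
        he.coframe k (Φ t 0 0 m) (mfderiv (𝓡 3) (𝓡 3) (Φ t 0 0) m v) = 0 := by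
  set F : ℝ → ℝ := fun s => ∑ k, α k (t, s) (Φ t 0 s m) *
    he.coframe k (Φ t 0 s m) (mfderiv (𝓡 3) (𝓡 3) (Φ t 0 s) m v) with hF
  have h0 : (0 : ℝ) ∈ Icc (0 : ℝ) 1 := ⟨le_rfl, zero_le_one⟩
  suffices h : ∀ s ∈ Icc (0 : ℝ) 1, HasDerivWithinAt F (Q (t, s) (Φ t 0 s m) * F s) (Icc 0 1) s by
    have hQc : ContinuousOn (fun s => Q (t, s) (Φ t 0 s m)) (Icc 0 1) := by
      refine ContinuousOn.comp (f := fun s => ((t, s), Φ t 0 s m)) hQs.continuousOn ?_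
        (fun s hs => ⟨⟨ht, hs⟩, trivial⟩)
      exact ContinuousOn.prodMk (by fun_prop) (hΦ.isSol t ht 0 h0 m trivial).continuousOn
    exact ⟨fun h1 => eq_zero_of_deriv_eq_mul hQc h hs h1 0 h0,
      fun h1 => eq_zero_of_deriv_eq_mul hQc h h0 h1 s hs⟩
  obtain ⟨m₀, hm₀⟩ := hΦ.variational t ht m trivial
  set φ := extChartAt (𝓡 3) m₀ with hφ
  have hto : IsOpen φ.target := isOpen_extChartAt_target (I := 𝓡 3) m₀
  set A : ℝ × E3 → E3 →L[ℝ] ℝ := fun p =>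
    (∑ k, α k (t, p.1) (φ.symm p.2) •
      ContinuousLinearMap.proj (R := ℝ) (φ := fun _ : Fin 3 => ℝ) k).comp
      (frameMap e m₀ p.2).inverse with hA
  have hAs : ContDiffOn ℝ ∞ A (Icc 0 1 ×ˢ φ.target) := by
    refine ContDiffOn.clm_comp (ContDiffOn.sum fun k _ =>
      ((hα k).contDiffOn_slice ht m₀).smul contDiffOn_const) ?_
    exact (he.contDiffOn_frameMap_inverse m₀).comp contDiffOn_snd (fun p hp => hp.2)
  have hAd : ∀ s, ∀ x ∈ φ.target, ∀ u : TangentSpace (𝓡 3) (φ.symm x),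
      A (s, x) (dchart (𝓡 3) m₀ (φ.symm x) u) = ∑ k, α k (t, s) (φ.symm x) * he.coframe k _ u := by
    intro s x hx u
    have := he.frameMap_inverse hx u
    simp only [hA, ContinuousLinearMap.comp_apply, sum_apply,
      smul_apply, ContinuousLinearMap.proj_apply, smul_eq_mul] at this ⊢
    exact Finset.sum_congr rfl fun k _ => by rw [this k]
  have hAe : ∀ s, ∀ x ∈ φ.target, ∀ i, A (s, x) (chartVec (𝓡 3) m₀ (e i) x) =
      α i (t, s) (φ.symm x) := by
    intro s x hx i
    refine (hAd s x hx (e i (φ.symm x))).trans ?_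
    simp only [he.coframe_frame]
    simp
  intro s hs
  obtain ⟨hPs, hV⟩ := hm₀ s hs
  set x : ℝ → E3 := fun s => φ (Φ t 0 s m) with hx
  have hxt : ∀ s ∈ Icc (0 : ℝ) 1, x s ∈ φ.target := fun s hs => φ.map_source (hm₀ s hs).1
  have hFA : ∀ s ∈ Icc (0 : ℝ) 1, F s = A (s, x s)
      (dchart (𝓡 3) m₀ (Φ t 0 s m) (mfderiv (𝓡 3) (𝓡 3) (Φ t 0 s) m v)) := by
    intro s hs
    have h1 := hAd s (x s) (hxt s hs)
    rw [show φ.symm (x s) = Φ t 0 s m from φ.left_inv (hm₀ s hs).1] at h1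
    exact (h1 (mfderiv (𝓡 3) (𝓡 3) (Φ t 0 s) m v)).symm
  set W : ∀ m : M, TangentSpace (𝓡 3) m := fun m => ∑ k, w k (t, s) m • e k m with hW
  set u : E3 := chartVec (𝓡 3) m₀ W (x s) with hu
  have hxd : HasDerivWithinAt x u (Icc 0 1) s := (hΦ.isSol t ht 0 h0 m trivial).chart hs hPs
  set A' := fderivWithin ℝ A (Icc 0 1 ×ˢ φ.target) (s, x s)
  have hA' : HasFDerivWithinAt A A' (Icc 0 1 ×ˢ φ.target) (s, x s) :=
    (hAs.differentiableOn (by simp) (s, x s) ⟨hs, hxt s hs⟩).hasFDerivWithinAt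
  have hc : HasDerivWithinAt (fun s => A (s, x s)) (A' (1, u)) (Icc 0 1) s :=
    HasFDerivWithinAt.comp_hasDerivWithinAt (l := A) (f := fun s => (s, x s)) s hA'
      ((hasDerivWithinAt_id _ _).prodMk hxd) (fun r hr => ⟨hr, hxt r hr⟩)
  have hF' := (hc.clm_apply (hV v)).congr (f₁ := F) hFA (hFA s hs)
  refine hF'.congr_deriv ?_
  rw [hFA s hs]
  set D := fderiv ℝ (chartVec (𝓡 3) m₀ W) (x s) with hD
  suffices key : ∀ V : E3, A' (1, u) V + A (s, x s) (D V) =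
      Q (t, s) (Φ t 0 s m) * A (s, x s) V from key _
  have hx' : x s ∈ φ.target := hxt s hs
  have hxP : φ.symm (x s) = Φ t 0 s m := φ.left_inv (hm₀ s hs).1
  have hτ : (t, s) ∈ Ioo (-δ) δ ×ˢ Icc (0 : ℝ) 1 := ⟨ht, hs⟩
  suffices key : ∀ i, A' (1, u) (chartVec (𝓡 3) m₀ (e i) (x s)) + A (s, x s) (D (chartVec (𝓡 3) m₀ (e i) (x s)))
      = Q (t, s) (Φ t 0 s m) * A (s, x s) (chartVec (𝓡 3) m₀ (e i) (x s)) by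
    intro V
    obtain ⟨L, hL⟩ := he.exists_equiv hx'
    have hV : V = ∑ k, (L.symm V) k • chartVec (𝓡 3) m₀ (e k) (x s) := by
      rw [← frameMap_apply, ← hL]
      simp
    rw [hV]
    simp only [map_sum, map_smul, smul_eq_mul, Finset.mul_sum, ← Finset.sum_add_distrib]
    refine Finset.sum_congr rfl fun i _ => ?_
    linear_combination (L.symm V) i * key i
  have hde : ∀ i, HasFDerivAt (chartVec (𝓡 3) m₀ (e i)) (fderiv ℝ (chartVec (𝓡 3) m₀ (e i)) (x s)) (x s) :=
    fun i => (((he.smooth i).contDiffOn m₀).differentiableOn (by simp) (x s) hx').differentiableAt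
      (hto.mem_nhds hx') |>.hasFDerivAt
  have huw : u = ∑ j, w j (t, s) (Φ t 0 s m) • chartVec (𝓡 3) m₀ (e j) (x s) := by
    rw [hu, chartVec, hW, map_sum]
    simp only [map_smul, ← hφ, hxP]
    refine Finset.sum_congr rfl fun j _ => ?_
    rw [chartVec, ← hφ, hxP]
  intro i
  have e1 : A' (1, u) (chartVec (𝓡 3) m₀ (e i) (x s)) +
      A (s, x s) (fderiv ℝ (chartVec (𝓡 3) m₀ (e i)) (x s) u) =
      dS (α i) (t, s) (Φ t 0 s m) +
        ∑ j, w j (t, s) (Φ t 0 s m) * dX (e j) (α i) (t, s) (Φ t 0 s m) := by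
    obtain ⟨G, hG, hG1, hG2⟩ := (hα i).hasFDerivWithinAt_slice ht hs hx'
    have h1 : HasFDerivWithinAt (fun p : ℝ × E3 => chartVec (𝓡 3) m₀ (e i) p.2)
        ((fderiv ℝ (chartVec (𝓡 3) m₀ (e i)) (x s)).comp (ContinuousLinearMap.snd ℝ ℝ E3))
        (Icc 0 1 ×ˢ φ.target) (s, x s) :=
      (HasFDerivAt.comp (g := chartVec (𝓡 3) m₀ (e i)) (f := Prod.snd) (s, x s) (hde i)
        hasFDerivAt_snd).hasFDerivWithinAt
    have h2 := (hA'.clm_apply h1).congr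
      (f₁ := fun p : ℝ × E3 => α i (t, p.1) (φ.symm p.2))
      (fun p hp => (hAe p.1 p.2 hp.2 i).symm) (hAe s (x s) hx' i).symm
    have h3 := ((uniqueDiffOn_Icc one_pos).prod hto.uniqueDiffOn (s, x s) ⟨hs, hx'⟩).eq h2 hG
    have h4 := DFunLike.congr_fun h3 (1, u)
    simp only [add_apply, ContinuousLinearMap.comp_apply,
      ContinuousLinearMap.flip_apply, ContinuousLinearMap.coe_snd'] at h4
    have h5 : G (1, u) = dS (α i) (t, s) (Φ t 0 s m) +
        ∑ j, w j (t, s) (Φ t 0 s m) * dX (e j) (α i) (t, s) (Φ t 0 s m) := by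
      have : ((1, u) : ℝ × E3) = (1, 0) + ∑ j, w j (t, s) (Φ t 0 s m) •
          ((0 : ℝ), chartVec (𝓡 3) m₀ (e j) (x s)) := by
        refine Prod.ext ?_ ?_
        · simp [Prod.fst_sum]
        · simp [Prod.snd_sum, huw]
      rw [this, map_add, map_sum, hG1, ← hφ, hxP]
      refine congrArg _ (Finset.sum_congr rfl fun j _ => ?_)
      rw [map_smul, hG2, ← hφ, hxP, smul_eq_mul]
    rw [← h5, ← h4]
    ring
  have e2 : A (s, x s) (D (chartVec (𝓡 3) m₀ (e i) (x s))) =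
      ∑ j, (w j (t, s) (Φ t 0 s m) * A (s, x s) (fderiv ℝ (chartVec (𝓡 3) m₀ (e j)) (x s)
        (chartVec (𝓡 3) m₀ (e i) (x s))) + dX (e i) (w j) (t, s) (Φ t 0 s m) *
          α j (t, s) (Φ t 0 s m)) := by
    choose L hL hLV using fun j => (hw j).hasFDerivAt_chart hτ hx'
    have h1 : HasFDerivAt (fun y => ∑ j, w j (t, s) (φ.symm y) • chartVec (𝓡 3) m₀ (e j) y) _ (x s) :=
      HasFDerivAt.fun_sum (fun j _ => (hL j).smul (hde j))
    have h2 : chartVec (𝓡 3) m₀ W = fun y => ∑ j, w j (t, s) (φ.symm y) • chartVec (𝓡 3) m₀ (e j) y := by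
      funext y
      rw [chartVec, hW, map_sum]
      simp only [map_smul]
      rfl
    rw [hD, h2, h1.fderiv, sum_apply, map_sum]
    refine Finset.sum_congr rfl fun j _ => ?_
    simp only [add_apply, smul_apply,
      ContinuousLinearMap.smulRight_apply, map_add, map_smul, smul_eq_mul]
    rw [hAe s (x s) hx' j, hLV, ← hφ, hxP]
  have e3 : ∀ j, A (s, x s) (fderiv ℝ (chartVec (𝓡 3) m₀ (e j)) (x s) (chartVec (𝓡 3) m₀ (e i) (x s))) -
      A (s, x s) (fderiv ℝ (chartVec (𝓡 3) m₀ (e i)) (x s) (chartVec (𝓡 3) m₀ (e j) (x s))) =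
      ∑ k, he.structFun i j k (Φ t 0 s m) * α k (t, s) (Φ t 0 s m) := by
    intro j
    have h1 := chartVec_mlieBracket (he.smooth i) (he.smooth j) hx'
    have h2 := hAd s (x s) hx' (VectorField.mlieBracket (𝓡 3) (e i) (e j) (φ.symm (x s)))
    rw [chartVec, ← hφ] at h1
    rw [h1, VectorField.lieBracket, map_sub, hxP] at h2
    rw [h2]
    exact Finset.sum_congr rfl fun k _ => by rw [IsGlobalFrame.structFun, mul_comm]
  have e4 : A (s, x s) (fderiv ℝ (chartVec (𝓡 3) m₀ (e i)) (x s) u) = ∑ j, w j (t, s) (Φ t 0 s m) *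
      A (s, x s) (fderiv ℝ (chartVec (𝓡 3) m₀ (e i)) (x s) (chartVec (𝓡 3) m₀ (e j) (x s))) := by
    rw [huw]
    simp only [map_sum, map_smul, smul_eq_mul]
  have e5 : dX (e i) f (t, s) (Φ t 0 s m) = ∑ k, (dX (e i) (α k) (t, s) (Φ t 0 s m) *
      w k (t, s) (Φ t 0 s m) + α k (t, s) (Φ t 0 s m) * dX (e i) (w k) (t, s) (Φ t 0 s m)) := by
    rw [dX_congr (h := fun τ m => ∑ k, α k τ m * w k τ m) (hf (t, s) hτ), dX_sum_mul hα hw hτ]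
  have e6 := hQ (t, s) hτ (Φ t 0 s m) i
  rw [hAe s (x s) hx' i, hxP, ← e6, e5]
  have e7 : ∀ j, he.extDeriv α j i (t, s) (Φ t 0 s m) = dX (e j) (α i) (t, s) (Φ t 0 s m) -
      dX (e i) (α j) (t, s) (Φ t 0 s m) +
      (A (s, x s) (fderiv ℝ (chartVec (𝓡 3) m₀ (e j)) (x s) (chartVec (𝓡 3) m₀ (e i) (x s))) -
      A (s, x s) (fderiv ℝ (chartVec (𝓡 3) m₀ (e i)) (x s) (chartVec (𝓡 3) m₀ (e j) (x s)))) := by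
    intro j
    rw [e3, IsGlobalFrame.extDeriv]
    simp only [he.structFun_swap j i, neg_mul, Finset.sum_neg_distrib]
    ring
  rw [e2]
  simp only [e7]
  rw [e4] at e1
  simp only [Fin.sum_univ_three] at e1 ⊢
  linear_combination e1

end Invariance
end Engel

namespace Engel

open Set Filter

section ContactField

variable {M : Type*} [TopologicalSpace M] [ChartedSpace E3 M] [IsManifold (𝓡 3) ∞ M] [T2Space M]
  {e : Fin 3 → ∀ m : M, TangentSpace (𝓡 3) m}

/-- The value of `dα` on the vectors `e 0 - α 0 • e 2` and `e 1 - α 1 • e 2`, which span the kernel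
of `α` if `α 2 = 1`. -/
def IsGlobalFrame.contactDet (he : IsGlobalFrame e) (α : Fin 3 → ℝ × ℝ → M → ℝ) (τ : ℝ × ℝ)
    (m : M) : ℝ :=
  he.extDeriv α 0 1 τ m - α 1 τ m * he.extDeriv α 0 2 τ m + α 0 τ m * he.extDeriv α 1 2 τ m

/-- The components of the commutator of `∂ₛ + a` and `b`. -/
def IsGlobalFrame.commutator (he : IsGlobalFrame e) (a b : Fin 3 → ℝ × ℝ → M → ℝ) (k : Fin 3)
    (τ : ℝ × ℝ) (m : M) : ℝ :=
  dS (b k) τ m + ∑ i, (a i τ m * dX (e i) (b k) τ m - b i τ m * dX (e i) (a k) τ m) +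
    ∑ i, ∑ j, a i τ m * b j τ m * he.structFun i j k m

theorem IsGlobalFrame.smooth_commutator (he : IsGlobalFrame e) {δ : ℝ}
    {a b : Fin 3 → ℝ × ℝ → M → ℝ} (ha : ∀ k, SmoothFamily δ (a k))
    (hb : ∀ k, SmoothFamily δ (b k)) (k : Fin 3) : SmoothFamily δ (he.commutator a b k) :=
  ((hb k).dS.add (SmoothFamily.sum fun i => ((ha i).mul ((hb k).dX (he.smooth i))).sub
    ((hb i).mul ((ha k).dX (he.smooth i))))).add
    (SmoothFamily.sum fun i => SmoothFamily.sum fun j =>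
      ((ha i).mul (hb j)).mul (he.smooth_structFun δ i j k))

theorem exists_contact_field (he : IsGlobalFrame e)
    (hc : ∀ m, he.structFun 0 1 2 m = 1) {ε : ℝ} (hε : 0 < ε) {K : Set M} (hK : IsCompact K)
    {α : Fin 3 → ℝ × ℝ → M → ℝ} {f : ℝ × ℝ → M → ℝ} (h0 : SmallFamily ε K (α 0))
    (h1 : SmallFamily ε K (α 1)) (h2 : ∀ τ m, α 2 τ m = 1) (hf : SmallFamily ε K f) :
    ∃ δ > 0, δ ≤ ε ∧ (∀ τ ∈ Ioo (-δ) δ ×ˢ Icc (0 : ℝ) 1, ∀ m, he.contactDet α τ m ≠ 0) ∧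
      ∃ w : Fin 3 → ℝ × ℝ → M → ℝ, (∀ k, SmallFamily δ K (w k)) ∧
      (∀ τ ∈ Ioo (-δ) δ ×ˢ Icc (0 : ℝ) 1, ∀ m, f τ m = ∑ k, α k τ m * w k τ m) ∧
      ∃ Q, SmoothFamily δ Q ∧ ∀ τ ∈ Ioo (-δ) δ ×ˢ Icc (0 : ℝ) 1, ∀ m i,
        dS (α i) τ m + dX (e i) f τ m + ∑ j, w j τ m * he.extDeriv α j i τ m =
          Q τ m * α i τ m := by
  have h2s : SmoothFamily ε (α 2) := (SmoothFamily.const 1).congr fun τ _ m => h2 τ m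
  have hα : ∀ k, SmoothFamily ε (α k) := by
    intro k
    fin_cases k
    exacts [h0.smooth, h1.smooth, h2s]
  have hdetval : ∀ τ m, α 0 τ m = 0 → α 1 τ m = 0 → dX (e 0) (α 1) τ m = 0 →
      dX (e 1) (α 0) τ m = 0 → he.contactDet α τ m = -1 := by
    intro τ m ha hb hc' hd
    simp [IsGlobalFrame.contactDet, IsGlobalFrame.extDeriv, Fin.sum_univ_three, ha, hb, hc', hd,
      h2, hc]
  have hdets : SmoothFamily ε (he.contactDet α) :=
    ((he.smooth_extDeriv hα 0 1).sub ((hα 1).mul (he.smooth_extDeriv hα 0 2))).add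
      ((hα 0).mul (he.smooth_extDeriv hα 1 2))
  have d1 := h1.dX hK.isClosed (he.smooth 0)
  have d0 := h0.dX hK.isClosed (he.smooth 1)
  obtain ⟨δ, hδ, hδε, hpos⟩ := exists_forall_pos hε hK hdets.neg
    (fun s hs m => by
      rw [hdetval _ m (h0.zero s hs m) (h1.zero s hs m) (d1.zero s hs m) (d0.zero s hs m)]
      norm_num)
    (fun τ hτ m hm => by
      rw [hdetval _ m (h0.support τ hτ m hm) (h1.support τ hτ m hm) (d1.support τ hτ m hm)
        (d0.support τ hτ m hm)]
      norm_num)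
  have hne : ∀ τ ∈ Ioo (-δ) δ ×ˢ Icc (0 : ℝ) 1, ∀ m, he.contactDet α τ m ≠ 0 := by
    intro τ hτ m h
    have := hpos τ hτ m
    rw [h] at this
    norm_num at this
  replace hdets := (hdets.mono hδε).inv hne
  replace hα := fun k => (hα k).mono hδε
  replace h0 := h0.mono hδε
  replace h1 := h1.mono hδε
  replace hf := hf.mono hδε
  have hρ : ∀ i, SmallFamily δ K (α i) → SmallFamily δ K (fun τ m =>
      dS (α i) τ m + he.extDeriv α 2 i τ m * f τ m + dX (e i) f τ m +
        -(α i τ m * dX (e 2) f τ m)) := fun i hi =>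
    ((hi.dS.add (SmallFamily.mul_left (he.smooth_extDeriv hα 2 i) hf)).add
      (hf.dX hK.isClosed (he.smooth i))).add
      (SmallFamily.mul_left (hα i) (hf.dX hK.isClosed (he.smooth 2))).neg
  set w₀ : ℝ × ℝ → M → ℝ := fun τ m => -((he.contactDet α τ m)⁻¹ *
    (dS (α 1) τ m + he.extDeriv α 2 1 τ m * f τ m + dX (e 1) f τ m +
        -(α 1 τ m * dX (e 2) f τ m))) with hw₀
  set w₁ : ℝ × ℝ → M → ℝ := fun τ m => (he.contactDet α τ m)⁻¹ *
    (dS (α 0) τ m + he.extDeriv α 2 0 τ m * f τ m + dX (e 0) f τ m +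
        -(α 0 τ m * dX (e 2) f τ m)) with hw₁
  have s₀ : SmallFamily δ K w₀ := (SmallFamily.mul_left hdets (hρ 1 h1)).neg
  have s₁ : SmallFamily δ K w₁ := SmallFamily.mul_left hdets (hρ 0 h0)
  set w₂ : ℝ × ℝ → M → ℝ := fun τ m => f τ m + -(α 0 τ m * w₀ τ m) + -(α 1 τ m * w₁ τ m) with hw₂
  have s₂ : SmallFamily δ K w₂ :=
    (hf.add (SmallFamily.mul_left (hα 0) s₀).neg).add (SmallFamily.mul_left (hα 1) s₁).neg
  have hw : ∀ k, SmallFamily δ K ((![w₀, w₁, w₂] : Fin 3 → ℝ × ℝ → M → ℝ) k) := by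
    intro k
    fin_cases k
    exacts [s₀, s₁, s₂]
  refine ⟨δ, hδ, hδε, hne, ![w₀, w₁, w₂], hw, ?_, fun τ m => dX (e 2) f τ m +
    ∑ j, (![w₀, w₁, w₂] : Fin 3 → ℝ × ℝ → M → ℝ) j τ m * he.extDeriv α j 2 τ m,
    (hf.smooth.dX (he.smooth 2)).add
      (SmoothFamily.sum fun j => (hw j).smooth.mul (he.smooth_extDeriv hα j 2)), ?_⟩
  · intro τ _ m
    simp [Fin.sum_univ_three, hw₂, h2]
    ring
  · intro τ hτ m i
    have hD := hne τ hτ m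
    have e0 : w₀ τ m * he.contactDet α τ m = -(dS (α 1) τ m + he.extDeriv α 2 1 τ m * f τ m +
        dX (e 1) f τ m + -(α 1 τ m * dX (e 2) f τ m)) := by
      rw [hw₀]
      field_simp
    have e1 : w₁ τ m * he.contactDet α τ m = dS (α 0) τ m + he.extDeriv α 2 0 τ m * f τ m +
        dX (e 0) f τ m + -(α 0 τ m * dX (e 2) f τ m) := by
      rw [hw₁]
      field_simp
    have e2 : w₂ τ m = f τ m + -(α 0 τ m * w₀ τ m) + -(α 1 τ m * w₁ τ m) := rfl
    have a10 := he.extDeriv_swap α 1 0 τ m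
    have a20 := he.extDeriv_swap α 2 0 τ m
    have a21 := he.extDeriv_swap α 2 1 τ m
    have a00 := he.extDeriv_self α 0 τ m
    have a11 := he.extDeriv_self α 1 τ m
    have a22 := he.extDeriv_self α 2 τ m
    rw [a20] at e1
    rw [a21] at e0
    have hS2 : dS (α 2) τ m = 0 := dS_const hτ.2 (fun r _ => h2 (τ.1, r) m)
    rw [IsGlobalFrame.contactDet] at e0 e1
    fin_cases i
    · simp only [Fin.sum_univ_three, Fin.zero_eta, Matrix.cons_val_zero, Matrix.cons_val_one,
        Matrix.cons_val, a10, a20, a00, a22]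
      rw [e2]
      linear_combination -e1
    · simp only [Fin.sum_univ_three, Fin.mk_one, Matrix.cons_val_zero, Matrix.cons_val_one,
        Matrix.cons_val, a21, a11, a22]
      rw [e2]
      linear_combination e0
    · simp only [Fin.sum_univ_three, Fin.reduceFinMk, Matrix.cons_val_zero, Matrix.cons_val_one,
        Matrix.cons_val, a22, hS2, h2]
      ring

/-- A vector field `w` with `α w = α a` that preserves the planes `ker α` differs from `a` by a
multiple of `b`, if `b` and the commutator of `∂ₛ + a` and `b` lie in these planes. -/
theorem exists_smul_eq_sub (he : IsGlobalFrame e) {δ : ℝ} {α a b w : Fin 3 → ℝ × ℝ → M → ℝ}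
    {f Q : ℝ × ℝ → M → ℝ} (hα : ∀ k, SmoothFamily δ (α k)) (h2 : ∀ τ m, α 2 τ m = 1)
    (ha : ∀ k, SmoothFamily δ (a k)) (hb : ∀ k, SmoothFamily δ (b k))
    (hαb : ∀ τ ∈ Ioo (-δ) δ ×ˢ Icc (0 : ℝ) 1, ∀ m, ∑ k, α k τ m * b k τ m = 0)
    (hαC : ∀ τ ∈ Ioo (-δ) δ ×ˢ Icc (0 : ℝ) 1, ∀ m, ∑ k, α k τ m * he.commutator a b k τ m = 0)
    (hfa : ∀ τ ∈ Ioo (-δ) δ ×ˢ Icc (0 : ℝ) 1, ∀ m, f τ m = ∑ k, α k τ m * a k τ m)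
    (hfw : ∀ τ ∈ Ioo (-δ) δ ×ˢ Icc (0 : ℝ) 1, ∀ m, f τ m = ∑ k, α k τ m * w k τ m)
    (hQ : ∀ τ ∈ Ioo (-δ) δ ×ˢ Icc (0 : ℝ) 1, ∀ m i,
      dS (α i) τ m + dX (e i) f τ m + ∑ j, w j τ m * he.extDeriv α j i τ m = Q τ m * α i τ m)
    {τ : ℝ × ℝ} (hτ : τ ∈ Ioo (-δ) δ ×ˢ Icc (0 : ℝ) 1) (m : M) (hdet : he.contactDet α τ m ≠ 0)
    (hb0 : b 0 τ m ^ 2 + b 1 τ m ^ 2 ≠ 0) :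
    ∃ c : ℝ, ∀ k, w k τ m - a k τ m = c * b k τ m := by
  have eX : ∀ i, ∑ k, (dX (e i) (α k) τ m * b k τ m + α k τ m * dX (e i) (b k) τ m) = 0 :=
    fun i => by
      rw [← dX_sum_mul hα hb hτ]
      exact dX_const (c := 0) (hαb τ hτ) m
  have eS : ∑ k, (dS (α k) τ m * b k τ m + α k τ m * dS (b k) τ m) = 0 := by
    rw [← dS_sum_mul hα hb hτ]
    exact dS_const (c := 0) hτ.2 (fun r hr => hαb (τ.1, r) ⟨hτ.1, hr⟩ m)
  have ef : ∀ i, dX (e i) f τ m =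
      ∑ k, (dX (e i) (α k) τ m * a k τ m + α k τ m * dX (e i) (a k) τ m) := fun i => by
    rw [← dX_sum_mul hα ha hτ]
    exact dX_congr (hfa τ hτ) m
  have eC := hαC τ hτ m
  have eb := hαb τ hτ m
  have eaw : ∑ k, α k τ m * (w k τ m - a k τ m) = 0 := by
    simp only [mul_sub, Finset.sum_sub_distrib]
    rw [← hfa τ hτ m, ← hfw τ hτ m, sub_self]
  have hw : ∑ i, b i τ m * ∑ j, w j τ m * he.extDeriv α j i τ m =
      -∑ i, b i τ m * (dS (α i) τ m + dX (e i) f τ m) := by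
    have : ∑ i, b i τ m * (dS (α i) τ m + dX (e i) f τ m +
        ∑ j, w j τ m * he.extDeriv α j i τ m) = Q τ m * ∑ i, α i τ m * b i τ m := by
      rw [Finset.mul_sum]
      refine Finset.sum_congr rfl fun i _ => ?_
      rw [hQ τ hτ m i]
      ring
    rw [eb, mul_zero] at this
    simp only [mul_add, Finset.sum_add_distrib] at this ⊢
    linarith
  have hA : ∑ i, b i τ m * ∑ j, a j τ m * he.extDeriv α j i τ m =
      -∑ i, b i τ m * (dS (α i) τ m + dX (e i) f τ m) := by
    simp only [IsGlobalFrame.extDeriv, IsGlobalFrame.commutator, ef] at eC ⊢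
    simp only [Fin.sum_univ_three] at eX eS eC ⊢
    have x0 := eX 0
    have x1 := eX 1
    have x2 := eX 2
    linear_combination a 0 τ m * x0 + a 1 τ m * x1 + a 2 τ m * x2 + eS - eC
  have hd : ∑ i, b i τ m * ∑ j, (w j τ m - a j τ m) * he.extDeriv α j i τ m = 0 := by
    simp only [sub_mul, Finset.sum_sub_distrib, mul_sub]
    rw [hw, hA, sub_self]
  have a10 := he.extDeriv_swap α 1 0 τ m
  have a20 := he.extDeriv_swap α 2 0 τ m
  have a21 := he.extDeriv_swap α 2 1 τ m
  have a00 := he.extDeriv_self α 0 τ m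
  have a11 := he.extDeriv_self α 1 τ m
  have a22 := he.extDeriv_self α 2 τ m
  simp only [Fin.sum_univ_three, h2, one_mul] at eb eaw
  set u := fun k => w k τ m - a k τ m with hu
  have hu2 : w 2 τ m - a 2 τ m = -(α 0 τ m * u 0) - α 1 τ m * u 1 := by
    simp only [hu]
    linarith
  have hb2 : b 2 τ m = -(α 0 τ m * b 0 τ m) - α 1 τ m * b 1 τ m := by linarith
  have hcross : u 0 * b 1 τ m - u 1 * b 0 τ m = 0 := by
    have : (u 0 * b 1 τ m - u 1 * b 0 τ m) * he.contactDet α τ m = 0 := by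
      rw [← hd, IsGlobalFrame.contactDet]
      simp only [Fin.sum_univ_three, a10, a20, a21, a00, a11, a22]
      rw [hu2, hb2]
      simp only [hu]
      ring
    exact (mul_eq_zero.1 this).resolve_right hdet
  have key0 : u 0 = (u 0 * b 0 τ m + u 1 * b 1 τ m) / (b 0 τ m ^ 2 + b 1 τ m ^ 2) * b 0 τ m := by
    field_simp
    linear_combination b 1 τ m * hcross
  have key1 : u 1 = (u 0 * b 0 τ m + u 1 * b 1 τ m) / (b 0 τ m ^ 2 + b 1 τ m ^ 2) * b 1 τ m := by
    field_simp
    linear_combination -b 0 τ m * hcross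
  refine ⟨(u 0 * b 0 τ m + u 1 * b 1 τ m) / (b 0 τ m ^ 2 + b 1 τ m ^ 2), fun k => ?_⟩
  fin_cases k
  · exact key0
  · exact key1
  · change w 2 τ m - a 2 τ m = _ * b 2 τ m
    rw [hu2, hb2]
    linear_combination -α 0 τ m * key0 - α 1 τ m * key1

end ContactField
end Engel

namespace Engel

open Set Filter

section Straightening

variable {M : Type*} [TopologicalSpace M] [ChartedSpace E3 M] [IsManifold (𝓡 3) ∞ M] [T2Space M]
  {e : Fin 3 → ∀ m : M, TangentSpace (𝓡 3) m}

/-- A family of maps of `M` that is smooth for `|t| < δ` and `0 ≤ s ≤ 1`. -/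
def SmoothMapFamily (δ : ℝ) (F : ℝ × ℝ → M → M) : Prop :=
  ContMDiffOn (𝓘(ℝ, ℝ × ℝ).prod (𝓡 3)) (𝓡 3) ∞ (fun p : (ℝ × ℝ) × M => F p.1 p.2)
    ((Ioo (-δ) δ ×ˢ Icc 0 1) ×ˢ univ)

theorem SmoothMapFamily.mono {δ δ' : ℝ} {F : ℝ × ℝ → M → M} (hF : SmoothMapFamily δ F)
    (hδ : δ' ≤ δ) : SmoothMapFamily δ' F :=
  ContMDiffOn.mono hF (prod_mono_left (prod_mono_left (Ioo_subset_Ioo (by linarith) hδ)))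

theorem SmoothMapFamily.mdifferentiableAt {δ : ℝ} {F : ℝ × ℝ → M → M} (hF : SmoothMapFamily δ F)
    {τ : ℝ × ℝ} (hτ : τ ∈ Ioo (-δ) δ ×ˢ Icc (0 : ℝ) 1) (m : M) :
    MDifferentiableAt (𝓡 3) (𝓡 3) (F τ) m := by
  have h1 : ContMDiffOn (𝓡 3) (𝓘(ℝ, ℝ × ℝ).prod (𝓡 3)) ∞ (fun m : M => (τ, m)) univ :=
    (contMDiff_const.prodMk contMDiff_id).contMDiffOn
  have h2 := contMDiffOn_univ.1 (ContMDiffOn.comp (g := fun p : (ℝ × ℝ) × M => F p.1 p.2) hF h1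
    (fun m _ => ⟨hτ, trivial⟩))
  exact h2.mdifferentiable (by simp) m

theorem SmoothMapFamily.comp {δ : ℝ} {F G : ℝ × ℝ → M → M} (hF : SmoothMapFamily δ F)
    (hG : SmoothMapFamily δ G) : SmoothMapFamily δ (fun τ m => F τ (G τ m)) :=
  ContMDiffOn.comp (g := fun p : (ℝ × ℝ) × M => F p.1 p.2)
    (f := fun p : (ℝ × ℝ) × M => (p.1, G p.1 p.2)) hF
    (contMDiff_fst.contMDiffOn.prodMk hG) (fun _ hp => ⟨hp.1, trivial⟩)

theorem SmoothMapFamily.reparam {δ : ℝ} {F : ℝ × ℝ → M → M} (hF : SmoothMapFamily δ F)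
    {r : ℝ × ℝ → ℝ × ℝ} (hr : ContDiff ℝ ∞ r)
    (hrm : MapsTo r (Ioo (-δ) δ ×ˢ Icc (0 : ℝ) 1) (Ioo (-δ) δ ×ˢ Icc (0 : ℝ) 1)) :
    SmoothMapFamily δ (fun τ m => F (r τ) m) :=
  ContMDiffOn.comp (g := fun p : (ℝ × ℝ) × M => F p.1 p.2)
    (f := fun p : (ℝ × ℝ) × M => (r p.1, p.2)) hF
    ((hr.contMDiff.comp contMDiff_fst).prodMk contMDiff_snd).contMDiffOn
    (fun _ hp => ⟨hrm hp.1, trivial⟩)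

theorem SmoothFamily.reparam {δ : ℝ} {g : ℝ × ℝ → M → ℝ} (hg : SmoothFamily δ g)
    {r : ℝ × ℝ → ℝ × ℝ} (hr : ContDiff ℝ ∞ r)
    (hrm : MapsTo r (Ioo (-δ) δ ×ˢ Icc (0 : ℝ) 1) (Ioo (-δ) δ ×ˢ Icc (0 : ℝ) 1)) :
    SmoothFamily δ (fun τ m => g (r τ) m) :=
  ContMDiffOn.comp (g := fun p : (ℝ × ℝ) × M => g p.1 p.2)
    (f := fun p : (ℝ × ℝ) × M => (r p.1, p.2)) hg
    ((hr.contMDiff.comp contMDiff_fst).prodMk contMDiff_snd).contMDiffOn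
    (fun _ hp => ⟨hrm hp.1, trivial⟩)

theorem isSmallField_sum (he : IsGlobalFrame e) {δ : ℝ} {K : Set M} {w : Fin 3 → ℝ × ℝ → M → ℝ}
    (hw : ∀ k, SmallFamily δ K (w k)) :
    IsSmallField δ K (fun τ m => ∑ k, w k τ m • e k m) where
  smooth p hp := he.contMDiffWithinAt_sum (g := fun p : (ℝ × ℝ) × M => p.2)
    (c := fun k p => w k p.1 p.2) hp contMDiffWithinAt_snd (fun k => (hw k).smooth p hp)
  zero s hs m := by simp [(hw _).zero s hs m]
  support τ hτ m hm := by simp [(hw _).support τ hτ m hm]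

/-- A pair of families of maps that are inverse to each other, and the identity for `t = 0` and
outside of `K`. -/
structure IsIsotopy (δ : ℝ) (K : Set M) (F G : ℝ × ℝ → M → M) : Prop where
  smooth_left : SmoothMapFamily δ F
  smooth_right : SmoothMapFamily δ G
  left_inv : ∀ τ ∈ Ioo (-δ) δ ×ˢ Icc (0 : ℝ) 1, ∀ m, G τ (F τ m) = m
  right_inv : ∀ τ ∈ Ioo (-δ) δ ×ˢ Icc (0 : ℝ) 1, ∀ m, F τ (G τ m) = m
  zero_left : ∀ s ∈ Icc (0 : ℝ) 1, ∀ m, F (0, s) m = m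
  zero_right : ∀ s ∈ Icc (0 : ℝ) 1, ∀ m, G (0, s) m = m
  support_left : ∀ τ ∈ Ioo (-δ) δ ×ˢ Icc (0 : ℝ) 1, ∀ m ∉ K, F τ m = m
  support_right : ∀ τ ∈ Ioo (-δ) δ ×ˢ Icc (0 : ℝ) 1, ∀ m ∉ K, G τ m = m

namespace IsIsotopy

variable {δ : ℝ} {K : Set M} {F G F' G' : ℝ × ℝ → M → M}

theorem mono {δ' : ℝ} (h : IsIsotopy δ K F G) (hδ : δ' ≤ δ) : IsIsotopy δ' K F G := by
  have hs : Ioo (-δ') δ' ×ˢ Icc (0 : ℝ) 1 ⊆ Ioo (-δ) δ ×ˢ Icc (0 : ℝ) 1 :=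
    prod_mono_left (Ioo_subset_Ioo (by linarith) hδ)
  exact ⟨h.smooth_left.mono hδ, h.smooth_right.mono hδ, fun τ hτ => h.left_inv τ (hs hτ),
    fun τ hτ => h.right_inv τ (hs hτ), h.zero_left, h.zero_right,
    fun τ hτ => h.support_left τ (hs hτ), fun τ hτ => h.support_right τ (hs hτ)⟩

theorem comp (h : IsIsotopy δ K F G) (h' : IsIsotopy δ K F' G') :
    IsIsotopy δ K (fun τ m => F τ (F' τ m)) (fun τ m => G' τ (G τ m)) where
  smooth_left := h.smooth_left.comp h'.smooth_left
  smooth_right := h'.smooth_right.comp h.smooth_right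
  left_inv τ hτ m := by rw [h.left_inv τ hτ, h'.left_inv τ hτ]
  right_inv τ hτ m := by rw [h'.right_inv τ hτ, h.right_inv τ hτ]
  zero_left s hs m := by rw [h'.zero_left s hs, h.zero_left s hs]
  zero_right s hs m := by rw [h.zero_right s hs, h'.zero_right s hs]
  support_left τ hτ m hm := by rw [h'.support_left τ hτ m hm, h.support_left τ hτ m hm]
  support_right τ hτ m hm := by rw [h.support_right τ hτ m hm, h'.support_right τ hτ m hm]

theorem reparam (h : IsIsotopy δ K F G) {r : ℝ × ℝ → ℝ × ℝ} (hr : ContDiff ℝ ∞ r)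
    (hrm : MapsTo r (Ioo (-δ) δ ×ˢ Icc (0 : ℝ) 1) (Ioo (-δ) δ ×ˢ Icc (0 : ℝ) 1))
    (hr0 : ∀ s, (r (0, s)).1 = 0) (hr1 : ∀ s ∈ Icc (0 : ℝ) 1, (r (0, s)).2 ∈ Icc (0 : ℝ) 1) :
    IsIsotopy δ K (fun τ m => F (r τ) m) (fun τ m => G (r τ) m) where
  smooth_left := h.smooth_left.reparam hr hrm
  smooth_right := h.smooth_right.reparam hr hrm
  left_inv τ hτ := h.left_inv _ (hrm hτ)
  right_inv τ hτ := h.right_inv _ (hrm hτ)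
  zero_left s hs m := by
    rw [show r (0, s) = (0, (r (0, s)).2) from Prod.ext (hr0 s) rfl]
    exact h.zero_left _ (hr1 s hs) m
  zero_right s hs m := by
    rw [show r (0, s) = (0, (r (0, s)).2) from Prod.ext (hr0 s) rfl]
    exact h.zero_right _ (hr1 s hs) m
  support_left τ hτ := h.support_left _ (hrm hτ)
  support_right τ hτ := h.support_right _ (hrm hτ)

theorem mfderiv_right_inv (h : IsIsotopy δ K F G) {τ : ℝ × ℝ}
    (hτ : τ ∈ Ioo (-δ) δ ×ˢ Icc (0 : ℝ) 1) (m : M) (v : TangentSpace (𝓡 3) (F τ m)) :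
    mfderiv (𝓡 3) (𝓡 3) (F τ) m ((mfderiv (𝓡 3) (𝓡 3) (G τ) (F τ m) v : E3)) = v := by
  have h1 := (h.smooth_right.mdifferentiableAt hτ (F τ m)).hasMFDerivAt
  have h2 := (h.smooth_left.mdifferentiableAt hτ (G τ (F τ m))).hasMFDerivAt
  have h3 := (h2.comp (F τ m) h1).congr_of_eventuallyEq (f₁ := id)
    (Eventually.of_forall fun m => (h.right_inv τ hτ m).symm)
  have h4 := DFunLike.congr_fun ((hasMFDerivAt_id (F τ m)).mfderiv.symm.trans h3.mfderiv) v
  have h5 : mfderiv (𝓡 3) (𝓡 3) (F τ) (G τ (F τ m)) ((mfderiv (𝓡 3) (𝓡 3) (G τ) (F τ m) v : E3))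
      = v := h4.symm
  rwa [h.left_inv τ hτ] at h5

end IsIsotopy

/-- The flow of a contact vector field, as an isotopy. -/
theorem exists_contact_isotopy (he : IsGlobalFrame e)
    (hc : ∀ m, he.structFun 0 1 2 m = 1) {ε : ℝ} (hε : 0 < ε) {K : Set M} (hK : IsCompact K)
    {α : Fin 3 → ℝ × ℝ → M → ℝ} {f : ℝ × ℝ → M → ℝ} (h0 : SmallFamily ε K (α 0))
    (h1 : SmallFamily ε K (α 1)) (h2 : ∀ τ m, α 2 τ m = 1) (hf : SmallFamily ε K f) :
    ∃ δ > 0, δ ≤ ε ∧ (∀ τ ∈ Ioo (-δ) δ ×ˢ Icc (0 : ℝ) 1, ∀ m, he.contactDet α τ m ≠ 0) ∧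
      ∃ w : Fin 3 → ℝ × ℝ → M → ℝ, (∀ k, SmallFamily δ K (w k)) ∧
      (∀ τ ∈ Ioo (-δ) δ ×ˢ Icc (0 : ℝ) 1, ∀ m, f τ m = ∑ k, α k τ m * w k τ m) ∧
      (∃ Q : ℝ × ℝ → M → ℝ, ∀ τ ∈ Ioo (-δ) δ ×ˢ Icc (0 : ℝ) 1, ∀ m i,
        dS (α i) τ m + dX (e i) f τ m + ∑ j, w j τ m * he.extDeriv α j i τ m =
          Q τ m * α i τ m) ∧
      ∃ F G, IsIsotopy δ K F G ∧ (∀ t ∈ Ioo (-δ) δ, ∀ m, F (t, 0) m = m) ∧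
        (∀ t ∈ Ioo (-δ) δ, ∀ m, IsSol (fun s m => ∑ k, w k (t, s) m • e k m)
          (fun s => F (t, s) m)) ∧
        ∀ τ ∈ Ioo (-δ) δ ×ˢ Icc (0 : ℝ) 1, ∀ m (v : TangentSpace (𝓡 3) m),
          ∑ k, α k τ (F τ m) * he.coframe k (F τ m) (mfderiv (𝓡 3) (𝓡 3) (F τ) m v) = 0 ↔
          ∑ k, α k (τ.1, 0) m * he.coframe k m v = 0 := by
  obtain ⟨δ₁, hδ₁, hδ₁ε, hdet, w, hw, hfw, Q, hQs, hQ⟩ := exists_contact_field he hc hε hK h0 h1 h2 hf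
  obtain ⟨δ, hδ, hδδ, Φ, hΦ, hcoc, hΦ0, hΦK⟩ := exists_flow hδ₁ hK (isSmallField_sum he hw)
  have hs : Ioo (-δ) δ ×ˢ Icc (0 : ℝ) 1 ⊆ Ioo (-δ₁) δ₁ ×ˢ Icc (0 : ℝ) 1 :=
    prod_mono_left (Ioo_subset_Ioo (by linarith) hδδ)
  have z0 : (0 : ℝ) ∈ Icc (0 : ℝ) 1 := ⟨le_rfl, zero_le_one⟩
  have hα : ∀ k, SmoothFamily ε (α k) := by
    intro k
    fin_cases k
    exacts [h0.smooth, h1.smooth, (SmoothFamily.const 1).congr fun τ _ m => h2 τ m]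
  refine ⟨δ, hδ, hδδ.trans hδ₁ε, fun τ hτ => hdet τ (hs hτ), w, fun k => (hw k).mono hδδ,
    fun τ hτ => hfw τ (hs hτ), ⟨Q, fun τ hτ => hQ τ (hs hτ)⟩,
    fun τ m => Φ τ.1 0 τ.2 m, fun τ m => Φ τ.1 τ.2 0 m, ?_, ?_, ?_, ?_⟩
  · refine ⟨?_, ?_, ?_, ?_, ?_, ?_, ?_, ?_⟩
    · refine hΦ.smooth.comp (f := fun p : (ℝ × ℝ) × M => ((p.1.1, (0 : ℝ), p.1.2), p.2)) ?_
        (fun p hp => ⟨⟨hp.1.1, z0, hp.1.2⟩, trivial⟩)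
      have : ContDiff ℝ ∞ (fun τ : ℝ × ℝ => (τ.1, (0 : ℝ), τ.2)) := by fun_prop
      exact ((this.contMDiff.comp contMDiff_fst).prodMk contMDiff_snd).contMDiffOn
    · refine hΦ.smooth.comp (f := fun p : (ℝ × ℝ) × M => ((p.1.1, p.1.2, (0 : ℝ)), p.2)) ?_
        (fun p hp => ⟨⟨hp.1.1, hp.1.2, z0⟩, trivial⟩)
      have : ContDiff ℝ ∞ (fun τ : ℝ × ℝ => (τ.1, τ.2, (0 : ℝ))) := by fun_prop
      exact ((this.contMDiff.comp contMDiff_fst).prodMk contMDiff_snd).contMDiffOn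
    · intro τ hτ m
      rw [hcoc _ hτ.1 _ z0 _ hτ.2 _ z0, hΦ.initial _ hτ.1 _ z0 _ trivial]
    · intro τ hτ m
      rw [hcoc _ hτ.1 _ hτ.2 _ z0 _ hτ.2, hΦ.initial _ hτ.1 _ hτ.2 _ trivial]
    · exact fun s hs m => hΦ0 0 z0 s hs m
    · exact fun s hs m => hΦ0 s hs 0 z0 m
    · exact fun τ hτ m hm => hΦK _ hτ.1 _ z0 _ hτ.2 m hm
    · exact fun τ hτ m hm => hΦK _ hτ.1 _ hτ.2 _ z0 m hm
  · exact fun t ht m => hΦ.initial t ht 0 z0 m trivial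
  · exact fun t ht m => hΦ.isSol t ht 0 z0 m trivial
  · intro τ hτ m v
    have h3 := hΦ.coframe_eq_zero_iff he (α := α) (w := w) (f := f) (Q := Q)
      (fun k => (hα k).mono (hδδ.trans hδ₁ε)) (fun k => ((hw k).mono hδδ).smooth) (hQs.mono hδδ)
      (fun τ hτ => hfw τ (hs hτ)) (fun τ hτ => hQ τ (hs hτ)) hτ.1 hτ.2 m v
    have h4 : Φ τ.1 0 0 = id := funext fun m => hΦ.initial _ hτ.1 0 z0 m trivial
    rw [h4] at h3
    simpa using h3

/-- Gray stability: an isotopy that maps the kernel of the third coframe form to the kernel of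
`α (t, 0)`. -/
theorem exists_gray_isotopy (he : IsGlobalFrame e)
    (hc : ∀ m, he.structFun 0 1 2 m = 1) {ε : ℝ} (hε : 0 < ε) {K : Set M} (hK : IsCompact K)
    {α : Fin 3 → ℝ × ℝ → M → ℝ} (h0 : SmallFamily ε K (α 0))
    (h1 : SmallFamily ε K (α 1)) (h2 : ∀ τ m, α 2 τ m = 1) :
    ∃ δ > 0, δ ≤ ε ∧ ∃ F G, IsIsotopy δ K F G ∧ (∀ t s s' m, F (t, s) m = F (t, s') m) ∧
      ∀ τ ∈ Ioo (-δ) δ ×ˢ Icc (0 : ℝ) 1, ∀ m (v : TangentSpace (𝓡 3) m),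
        ∑ k, α k (τ.1, 0) (F τ m) * he.coframe k (F τ m) (mfderiv (𝓡 3) (𝓡 3) (F τ) m v) = 0 ↔
        he.coframe 2 m v = 0 := by
  have z0 : (0 : ℝ) ∈ Icc (0 : ℝ) 1 := ⟨le_rfl, zero_le_one⟩
  have z1 : (1 : ℝ) ∈ Icc (0 : ℝ) 1 := ⟨zero_le_one, le_rfl⟩
  have hr : ContDiff ℝ ∞ (fun τ : ℝ × ℝ => (τ.1 * τ.2, (0 : ℝ))) := by fun_prop
  have hrm : MapsTo (fun τ : ℝ × ℝ => (τ.1 * τ.2, (0 : ℝ))) (Ioo (-ε) ε ×ˢ Icc (0 : ℝ) 1)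
      (Ioo (-ε) ε ×ˢ Icc (0 : ℝ) 1) := by
    rintro ⟨t, s⟩ ⟨ht, hs⟩
    refine ⟨?_, z0⟩
    rw [mem_Ioo, ← abs_lt] at ht ⊢
    simp only [abs_mul, abs_of_nonneg hs.1] at ht ⊢
    exact (mul_le_of_le_one_right (abs_nonneg t) hs.2).trans_lt ht
  have hsm : ∀ {g}, SmallFamily ε K g →
      SmallFamily ε K (fun (τ : ℝ × ℝ) (m : M) => g (τ.1 * τ.2, 0) m) := fun hg =>
    ⟨hg.smooth.reparam hr hrm, fun s hs m => by simpa using hg.zero 0 z0 m,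
      fun τ hτ m hm => hg.support _ (hrm hτ) m hm⟩
  obtain ⟨δ, hδ, hδε, -, w, -, -, -, F, G, hFG, -, -, hk⟩ := exists_contact_isotopy he hc hε hK
    (α := fun k τ m => α k (τ.1 * τ.2, 0) m) (f := fun _ _ => 0) (hsm h0) (hsm h1)
    (fun τ m => h2 _ m) ⟨SmoothFamily.const 0, fun _ _ _ => rfl, fun _ _ _ _ => rfl⟩
  refine ⟨δ, hδ, hδε, fun τ m => F (τ.1, 1) m, fun τ m => G (τ.1, 1) m,
    hFG.reparam (r := fun τ => (τ.1, 1)) (by fun_prop) (fun τ hτ => ⟨hτ.1, z1⟩) (fun _ => rfl)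
      (fun _ _ => z1), fun _ _ _ _ => rfl, ?_⟩
  intro τ hτ m v
  have := hk (τ.1, 1) ⟨hτ.1, z1⟩ m v
  simp only [mul_one, mul_zero] at this
  rw [this]
  simp [Fin.sum_univ_three, h2, h0.zero 0 z0, h1.zero 0 z0]

/-- Isotopies `F`, `G = F⁻¹` of `M` that straighten the plane field on `M × [0, 1]` spanned by
`b` and `∂ₛ + a`: modulo `b` the velocity `w` of `F` is `a`, and the projections of `b` by `G` lie
in the kernel of the third coframe form. -/
structure IsStraightening (he : IsGlobalFrame e) (δ : ℝ) (K : Set M)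
    (a b : Fin 3 → ℝ × ℝ → M → ℝ) (F G : ℝ × ℝ → M → M) : Prop extends IsIsotopy δ K F G where
  exists_velocity : ∃ w : Fin 3 → ℝ × ℝ → M → ℝ, (∀ k, SmoothFamily δ (w k)) ∧
    (∀ t ∈ Ioo (-δ) δ, ∀ m, IsSol (fun s m => ∑ k, w k (t, s) m • e k m) (fun s => F (t, s) m)) ∧
    ∀ τ ∈ Ioo (-δ) δ ×ˢ Icc (0 : ℝ) 1, ∀ m, ∃ c : ℝ, ∀ k, w k τ m - a k τ m = c * b k τ m
  coframe_mfderiv : ∀ τ ∈ Ioo (-δ) δ ×ˢ Icc (0 : ℝ) 1, ∀ m,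
    he.coframe 2 (G τ m) (mfderiv (𝓡 3) (𝓡 3) (G τ) m (∑ k, b k τ m • e k m)) = 0

theorem exists_isStraightening_of_isotopy (he : IsGlobalFrame e)
    (hc : ∀ m, he.structFun 0 1 2 m = 1) {ε : ℝ} (hε : 0 < ε) {K : Set M} (hK : IsCompact K)
    {α a b : Fin 3 → ℝ × ℝ → M → ℝ} (h0 : SmallFamily ε K (α 0))
    (h1 : SmallFamily ε K (α 1)) (h2 : ∀ τ m, α 2 τ m = 1) (ha : ∀ k, SmallFamily ε K (a k))
    (hb : ∀ k, SmoothFamily ε (b k))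
    (hb0 : ∀ τ ∈ Ioo (-ε) ε ×ˢ Icc (0 : ℝ) 1, ∀ m, b 0 τ m ^ 2 + b 1 τ m ^ 2 ≠ 0)
    (hαb : ∀ τ ∈ Ioo (-ε) ε ×ˢ Icc (0 : ℝ) 1, ∀ m, ∑ k, α k τ m * b k τ m = 0)
    (hαC : ∀ τ ∈ Ioo (-ε) ε ×ˢ Icc (0 : ℝ) 1, ∀ m, ∑ k, α k τ m * he.commutator a b k τ m = 0)
    {h g : ℝ × ℝ → M → M} (hh : IsIsotopy ε K h g) (hhs : ∀ t s s' m, h (t, s) m = h (t, s') m)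
    (hhα : ∀ τ ∈ Ioo (-ε) ε ×ˢ Icc (0 : ℝ) 1, ∀ m (v : TangentSpace (𝓡 3) m),
        ∑ k, α k (τ.1, 0) (h τ m) * he.coframe k (h τ m) (mfderiv (𝓡 3) (𝓡 3) (h τ) m v) = 0 ↔
        he.coframe 2 m v = 0) :
    ∃ δ > 0, δ ≤ ε ∧ ∃ F G, IsStraightening he δ K a b F G ∧
      (∀ t ∈ Ioo (-δ) δ, ∀ m, F (t, 0) m = h (t, 0) m) ∧
      ∀ τ ∈ Ioo (-δ) δ ×ˢ Icc (0 : ℝ) 1, ∀ m (v : TangentSpace (𝓡 3) m),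
        ∑ k, α k τ (F τ m) * he.coframe k (F τ m) (mfderiv (𝓡 3) (𝓡 3) (F τ) m v) = 0 ↔
        he.coframe 2 m v = 0 := by
  have hα : ∀ k, SmoothFamily ε (α k) := by
    intro k
    fin_cases k
    exacts [h0.smooth, h1.smooth, (SmoothFamily.const 1).congr fun τ _ m => h2 τ m]
  have hf : SmallFamily ε K (fun τ m => ∑ k, α k τ m * a k τ m) := by
    simp only [Fin.sum_univ_three]
    exact ((SmallFamily.mul_left (hα 0) (ha 0)).add (SmallFamily.mul_left (hα 1) (ha 1))).add
      (SmallFamily.mul_left (hα 2) (ha 2))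
  obtain ⟨δ, hδ, hδε, hdet, w, hw, hfw, ⟨Q, hQ⟩, F, G, hFG, hF0, hFs, hk⟩ :=
    exists_contact_isotopy he hc hε hK h0 h1 h2 hf
  have hs : Ioo (-δ) δ ×ˢ Icc (0 : ℝ) 1 ⊆ Ioo (-ε) ε ×ˢ Icc (0 : ℝ) 1 :=
    prod_mono_left (Ioo_subset_Ioo (by linarith) hδε)
  have hI := hFG.comp (hh.mono hδε)
  have hker : ∀ τ ∈ Ioo (-δ) δ ×ˢ Icc (0 : ℝ) 1, ∀ m (v : TangentSpace (𝓡 3) m),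
        ∑ k, α k τ (F τ (h τ m)) * he.coframe k (F τ (h τ m))
          (mfderiv (𝓡 3) (𝓡 3) (fun m => F τ (h τ m)) m v) = 0 ↔ he.coframe 2 m v = 0 := by
    intro τ hτ m v
    rw [← hhα τ (hs hτ) m v, ← hk τ hτ (h τ m)]
    have h3 := ((hFG.smooth_left.mdifferentiableAt hτ (h τ m)).hasMFDerivAt.comp m
      (hh.smooth_left.mdifferentiableAt (hs hτ) m).hasMFDerivAt)
    rw [show mfderiv (𝓡 3) (𝓡 3) (fun m => F τ (h τ m)) m = _ from h3.mfderiv]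
    rfl
  refine ⟨δ, hδ, hδε, _, _, ⟨hI, ⟨w, fun k => (hw k).smooth, ?_, ?_⟩, ?_⟩, ?_, hker⟩
  · intro t ht m
    have h3 := hFs t ht (h (t, 0) m)
    convert h3 using 3 with s
    exact hhs t s 0 m
  · exact fun τ hτ m => exists_smul_eq_sub he (fun k => (hα k).mono hδε) h2
      (fun k => (ha k).smooth.mono hδε) (fun k => (hb k).mono hδε) (fun τ hτ => hαb τ (hs hτ))
      (fun τ hτ => hαC τ (hs hτ)) (fun _ _ _ => rfl) hfw hQ hτ m (hdet τ hτ m) (hb0 τ (hs hτ) m)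
  · intro τ hτ m
    obtain ⟨m, rfl⟩ : ∃ m', F τ (h τ m') = m := ⟨_, hI.right_inv τ hτ m⟩
    have h3 := hI.mfderiv_right_inv hτ m (∑ k, b k τ (F τ (h τ m)) • e k (F τ (h τ m)))
    have h4 := (hker τ hτ m (mfderiv (𝓡 3) (𝓡 3) (fun m => g τ (G τ m)) (F τ (h τ m))
      (∑ k, b k τ (F τ (h τ m)) • e k (F τ (h τ m))) : E3)).1 (by
        rw [h3]
        simp only [he.coframe_sum]
        exact hαb τ (hs hτ) _)
    have h5 := hI.left_inv τ hτ m
    convert h4 using 2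
    rw [h5]
  · intro t ht m
    exact hF0 t ht _

end Straightening
end Engel

namespace Engel

open Set Filter VectorField

section LocalBrackets

/-- The Lie bracket of two vector fields in the kernel of a 1-form `η` is determined, modulo the
kernel, by `dη`. -/
theorem apply_lieBracketWithin_of_ker {E : Type*} [NormedAddCommGroup E] [NormedSpace ℝ E]
    {G : Type*} [NormedAddCommGroup G] [NormedSpace ℝ G]
    {S : Set E} {x : E} {A B : E → E} {η : E → E →L[ℝ] G} {η' : E →L[ℝ] E →L[ℝ] G}
    (hS : UniqueDiffWithinAt ℝ S x) (hx : x ∈ S) (hη : HasFDerivWithinAt η η' S x)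
    (hA : DifferentiableWithinAt ℝ A S x) (hB : DifferentiableWithinAt ℝ B S x)
    (hηA : ∀ᶠ y in 𝓝[S] x, η y (A y) = 0) (hηB : ∀ᶠ y in 𝓝[S] x, η y (B y) = 0) :
    η x (lieBracketWithin ℝ A B S x) = η' (B x) (A x) - η' (A x) (B x) := by
  have key : ∀ C : E → E, DifferentiableWithinAt ℝ C S x → (∀ᶠ y in 𝓝[S] x, η y (C y) = 0) →
      ∀ v, η x (fderivWithin ℝ C S x v) = -η' v (C x) := by
    intro C hC hηC v
    have h1 := hη.clm_apply hC.hasFDerivWithinAt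
    have h2 : HasFDerivWithinAt (fun y => η y (C y)) (0 : E →L[ℝ] G) S x :=
      (hasFDerivWithinAt_const (0 : G) x S).congr_of_eventuallyEq hηC
        (hηC.self_of_nhdsWithin hx)
    have h3 := DFunLike.congr_fun (hS.eq h1 h2) v
    simp only [add_apply, ContinuousLinearMap.comp_apply,
      ContinuousLinearMap.flip_apply, zero_apply] at h3
    exact eq_neg_of_add_eq_zero_left h3
  rw [lieBracketWithin, map_sub, key B hB hηB, key A hA hηA]
  abel

variable {E : Type*} [NormedAddCommGroup E] [NormedSpace ℝ E] {H : Type*} [TopologicalSpace H]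
  {I : ModelWithCorners ℝ E H} [I.Boundaryless] {N : Type*} [TopologicalSpace N] [ChartedSpace H N]
  [IsManifold I ∞ N]

theorem dchart_self (q : N) : dchart I q q = ContinuousLinearMap.id ℝ E := mfderiv_extChartAt_self

theorem chartVec_self (q : N) (V : ∀ p : N, TangentSpace I p) :
    chartVec I q V (extChartAt I q q) = V q := by
  rw [chartVec, (extChartAt I q).left_inv (mem_extChartAt_source q), dchart_self]
  rfl

theorem mpullbackWithin_chartSymm {q : N} (V : ∀ p : N, TangentSpace I p) {x : E}
    (hx : x ∈ (extChartAt I q).target) :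
    mpullbackWithin 𝓘(ℝ, E) I (extChartAt I q).symm V (range I) x = chartVec I q V x := by
  rw [mpullbackWithin_apply, chartVec, ModelWithCorners.range_eq_univ, mfderivWithin_univ]
  have : (mfderiv 𝓘(ℝ, E) I (extChartAt I q).symm x).inverse =
      dchart I q ((extChartAt I q).symm x) := by
    refine ContinuousLinearMap.inverse_eq ?_ ?_
    · ext v
      exact dchartSymm_dchart hx v
    · ext1 v
      exact dchart_dchartSymm hx v
  exact DFunLike.congr_fun this _

theorem mlieBracketWithin_eq_chart {S : Set N} {q : N} {A B : ∀ p : N, TangentSpace I p} :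
    mlieBracketWithin I A B S q = lieBracketWithin ℝ (chartVec I q A) (chartVec I q B)
      ((extChartAt I q).symm ⁻¹' S) (extChartAt I q q) := by
  refine mlieBracketWithin_apply.trans ?_
  rw [mfderiv_extChartAt_self]
  refine (DFunLike.congr_fun ContinuousLinearMap.inverse_id _).trans ?_
  rw [ModelWithCorners.range_eq_univ, inter_univ]
  have ht : ∀ V : ∀ p : N, TangentSpace I p,
      (mpullbackWithin 𝓘(ℝ, E) I (extChartAt I q).symm V (range I) : E → E) =ᶠ[𝓝 (extChartAt I q q)]
      chartVec I q V := by
    intro V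
    filter_upwards [extChartAt_target_mem_nhds (I := I) q] with y hy
    exact mpullbackWithin_chartSymm V hy
  have h1 := ht A
  have h2 := ht B
  rw [ModelWithCorners.range_eq_univ] at h1 h2
  exact Filter.EventuallyEq.lieBracketWithin_vectorField_eq_nhds (𝕜 := ℝ) (E := E) h1 h2

theorem ContMDiffWithinAt.chartVec {S : Set N} {q : N} {A : ∀ p : N, TangentSpace I p} (hq : q ∈ S)
    (hA : ContMDiffWithinAt I I.tangent ∞ (fun p => (⟨p, A p⟩ : TangentBundle I N)) S q) :
    ContDiffWithinAt ℝ ∞ (chartVec I q A) ((extChartAt I q).symm ⁻¹' S) (extChartAt I q q) := by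
  have h1 := (contMDiffWithinAt_tangent_iff (m₀ := q) (g := fun p => p)
    (s := S ∩ (extChartAt I q).source) ⟨hq, mem_extChartAt_source q⟩ (fun p hp => hp.2)).1
    (hA.mono inter_subset_left)
  have h2 := ContMDiffWithinAt.comp_of_eq (f := (extChartAt I q).symm)
    (s := (extChartAt I q).symm ⁻¹' S ∩ (extChartAt I q).target) (x := extChartAt I q q) h1.2
    (((contMDiffOn_extChartAt_symm (I := I) (n := ∞) q) _
      ((extChartAt I q).map_source (mem_extChartAt_source q))).mono inter_subset_right)
    (fun y hy => ⟨hy.1, (extChartAt I q).map_target hy.2⟩)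
    ((extChartAt I q).left_inv (mem_extChartAt_source q))
  exact (contMDiffWithinAt_iff_contDiffWithinAt.1 h2).mono_of_mem_nhdsWithin
    (inter_mem_nhdsWithin _ (extChartAt_target_mem_nhds (I := I) q))

end LocalBrackets

section ContactFrame

variable {M : Type*} [TopologicalSpace M] [ChartedSpace E3 M] [IsManifold (𝓡 3) ∞ M]
  {ξ : ∀ m : M, Submodule ℝ (TangentSpace (𝓡 3) m)} {X Y : ∀ m : M, TangentSpace (𝓡 3) m}

/-- A plane field spanned by two vector fields is, near a point, the kernel of a 1-form. -/
theorem exists_local_form {A B : E3 → E3} {x : E3} (hA : ContDiffAt ℝ ∞ A x)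
    (hB : ContDiffAt ℝ ∞ B x) (hli : LinearIndependent ℝ ![A x, B x]) :
    ∃ η : E3 → E3 →L[ℝ] ℝ, ContDiffAt ℝ ∞ η x ∧
      ∀ᶠ y in 𝓝 x, ∀ v, η y v = 0 ↔ v ∈ Submodule.span ℝ {A y, B y} := by
  obtain ⟨C, hC⟩ : ∃ C : E3, C ∉ Submodule.span ℝ (range ![A x, B x]) := by
    by_contra! h
    have h1 := finrank_span_eq_card hli
    rw [Submodule.eq_top_iff'.2 h, finrank_top] at h1
    simp at h1
  have hli3 : LinearIndependent ℝ ![C, A x, B x] := linearIndependent_finCons.2 ⟨hli, hC⟩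
  let P := fun k => ContinuousLinearMap.proj (R := ℝ) (φ := fun _ : Fin 3 => ℝ) k
  set L : E3 → (Fin 3 → ℝ) →L[ℝ] E3 := fun y =>
    (P 0).smulRight C + (P 1).smulRight (A y) + (P 2).smulRight (B y) with hL
  have hLs : ContDiffAt ℝ ∞ L x :=
    (contDiffAt_const.add (contDiffAt_const.smulRight hA)).add (contDiffAt_const.smulRight hB)
  have hLa : ∀ y c, L y c = c 0 • C + c 1 • A y + c 2 • B y := fun y c => by simp [hL, P]
  have hinj : Function.Injective (L x) := by
    rw [injective_iff_map_eq_zero]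
    intro c hc
    rw [hLa] at hc
    have := Fintype.linearIndependent_iff.1 hli3 c (by simpa [Fin.sum_univ_three] using hc)
    exact funext this
  let e : (Fin 3 → ℝ) ≃L[ℝ] E3 := (LinearEquiv.ofInjectiveOfFinrankEq
    (L x : (Fin 3 → ℝ) →ₗ[ℝ] E3) hinj (by simp)).toContinuousLinearEquiv
  have he : (e : (Fin 3 → ℝ) →L[ℝ] E3) = L x := by ext1; rfl
  have hinv : ∀ᶠ y in 𝓝 x, ∃ e' : (Fin 3 → ℝ) ≃L[ℝ] E3, (e' : (Fin 3 → ℝ) →L[ℝ] E3) = L y := by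
    have h1 : ∀ᶠ l in 𝓝 (L x), l ∈ range ((↑) : ((Fin 3 → ℝ) ≃L[ℝ] E3) → (Fin 3 → ℝ) →L[ℝ] E3) := by
      rw [← he]
      exact ContinuousLinearEquiv.nhds e
    exact hLs.continuousAt.eventually h1
  refine ⟨fun y => (P 0).comp (L y).inverse, ?_, ?_⟩
  · refine contDiffAt_const.clm_comp ?_
    refine ContDiffAt.comp (g := ContinuousLinearMap.inverse) x ?_ hLs
    rw [← he]
    exact contDiffAt_map_inverse e
  · filter_upwards [hinv] with y ⟨e', he'⟩ v
    obtain ⟨c, rfl⟩ := e'.surjective v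
    have h1 : (L y).inverse (e' c) = c := by
      rw [← he', ContinuousLinearMap.inverse_equiv]
      simp
    have h2 : e' c = L y c := by rw [← he']; rfl
    rw [ContinuousLinearMap.comp_apply, h1, h2, hLa]
    simp only [P, ContinuousLinearMap.proj_apply]
    constructor
    · intro h0
      rw [h0, zero_smul, zero_add]
      exact Submodule.mem_span_pair.2 ⟨_, _, rfl⟩
    · intro hmem
      obtain ⟨a, b, hab⟩ := Submodule.mem_span_pair.1 hmem
      have h3 : L y ![0, a, b] = L y c := by rw [hLa, hLa, ← hab]; simp
      rw [← he'] at h3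
      have := e'.injective h3
      rw [← this]
      rfl

/-- The frame of a contact manifold given by two vector fields and their Lie bracket. -/
def contactFrame (X Y : ∀ m : M, TangentSpace (𝓡 3) m) :
    Fin 3 → ∀ m : M, TangentSpace (𝓡 3) m :=
  ![X, Y, mlieBracket (𝓡 3) X Y]

theorem IsFrame.isGlobalFrame (hξ : IsContact (𝓡 3) ξ) (h : IsFrame ξ X Y) :
    IsGlobalFrame (contactFrame X Y) := by
  have hX : IsSmoothField X := h.smooth_left
  have hY : IsSmoothField Y := h.smooth_right
  refine ⟨fun i => ?_, fun m => ?_⟩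
  · fin_cases i
    exacts [hX, hY, hX.mlieBracket hY]
  have hr : range ![X m, Y m] = {X m, Y m} := by
    ext v
    simp [or_comm]
  suffices hZ : mlieBracket (𝓡 3) X Y m ∉ ξ m by
    have h1 : LinearIndependent ℝ (Fin.snoc ![X m, Y m] (mlieBracket (𝓡 3) X Y m) :
        Fin 3 → TangentSpace (𝓡 3) m) := by
      refine linearIndependent_finSnoc.2 ⟨h.linearIndependent m, ?_⟩
      rwa [h.span_eq, ← hr] at hZ
    convert h1 using 1
    ext1 i
    fin_cases i <;> rfl
  intro hZ
  set x := extChartAt (𝓡 3) m m with hx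
  have hxt : x ∈ (extChartAt (𝓡 3) m).target :=
    (extChartAt (𝓡 3) m).map_source (mem_extChartAt_source m)
  have ht := extChartAt_target_mem_nhds (I := 𝓡 3) m
  have sX := (hX.contDiffOn m).contDiffAt ht
  have sY := (hY.contDiffOn m).contDiffAt ht
  have vX : chartVec (𝓡 3) m X x = X m := chartVec_self m X
  have vY : chartVec (𝓡 3) m Y x = Y m := chartVec_self m Y
  have hli := h.linearIndependent m
  rw [← vX, ← vY] at hli
  obtain ⟨η, hηs, hη⟩ := exists_local_form sX sY hli
  have hηd : HasFDerivWithinAt η (fderiv ℝ η x) univ x :=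
    (hηs.differentiableAt (by simp)).hasFDerivAt.hasFDerivWithinAt
  have hspan : ∀ y ∈ (extChartAt (𝓡 3) m).target, ∀ v ∈ ξ ((extChartAt (𝓡 3) m).symm y),
      dchart (𝓡 3) m _ v ∈
        Submodule.span ℝ {chartVec (𝓡 3) m X y, chartVec (𝓡 3) m Y y} := by
    intro y _ v hv
    rw [h.span_eq, Submodule.mem_span_pair] at hv
    obtain ⟨a, b, rfl⟩ := hv
    rw [map_add, map_smul, map_smul]
    exact Submodule.mem_span_pair.2 ⟨a, b, rfl⟩
  have hηx : ∀ v : E3, η x v = 0 ↔ v ∈ ξ m := by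
    intro v
    rw [hη.self_of_nhds, h.span_eq, vX, vY]
    rfl
  have hbr : ∀ A B : ∀ m : M, TangentSpace (𝓡 3) m, IsLocalSection (𝓡 3) univ ξ m A →
      IsLocalSection (𝓡 3) univ ξ m B → A m ∈ ξ m ∧ B m ∈ ξ m ∧
      η x (mlieBracketWithin (𝓡 3) A B univ m) =
        fderiv ℝ η x (B m) (A m) - fderiv ℝ η x (A m) (B m) := by
    have hs : ∀ A : ∀ m : M, TangentSpace (𝓡 3) m, IsLocalSection (𝓡 3) univ ξ m A →
        A m ∈ ξ m ∧ DifferentiableWithinAt ℝ (chartVec (𝓡 3) m A) univ x ∧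
        ∀ᶠ y in 𝓝[univ] x, η y (chartVec (𝓡 3) m A y) = 0 := by
      rintro A ⟨U, hU, hA, hAξ⟩
      rw [inter_univ] at hA hAξ
      refine ⟨hAξ m (mem_of_mem_nhds hU), ?_, ?_⟩
      · have h1 : ContMDiffWithinAt (𝓡 3) (𝓡 3).tangent ∞
            (fun p => (⟨p, A p⟩ : TangentBundle (𝓡 3) M)) univ m :=
          (hA.contMDiffAt hU).contMDiffWithinAt
        exact (ContMDiffWithinAt.chartVec (mem_univ m) h1).differentiableWithinAt (by simp)
      · rw [nhdsWithin_univ]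
        have h2 : ∀ᶠ y in 𝓝 x, (extChartAt (𝓡 3) m).symm y ∈ U :=
          (continuousAt_extChartAt_symm (I := 𝓡 3) m).eventually (by
            rw [(extChartAt (𝓡 3) m).left_inv (mem_extChartAt_source m)]
            exact hU)
        filter_upwards [hη, ht, h2] with y hy hyt hyU
        exact (hy _).2 (hspan y hyt _ (hAξ _ hyU))
    intro A B hA hB
    obtain ⟨h1, h2, h3⟩ := hs A hA
    obtain ⟨h1', h2', h3'⟩ := hs B hB
    refine ⟨h1, h1', ?_⟩
    rw [mlieBracketWithin_eq_chart, preimage_univ,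
      apply_lieBracketWithin_of_ker uniqueDiffWithinAt_univ (mem_univ _) hηd h2 h2' h3 h3',
      chartVec_self, chartVec_self]
  have sec : ∀ A : ∀ m : M, TangentSpace (𝓡 3) m, IsSmoothField A → (∀ m, A m ∈ ξ m) →
      IsLocalSection (𝓡 3) univ ξ m A := fun A hA hAξ =>
    ⟨univ, univ_mem, hA.contMDiffOn, fun p _ => hAξ p⟩
  have hXY := (hbr X Y (sec X hX fun m => by
      rw [h.span_eq]; exact Submodule.subset_span (by simp))
    (sec Y hY fun m => by rw [h.span_eq]; exact Submodule.subset_span (by simp))).2.2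
  rw [mlieBracketWithin_univ, (hηx _).2 hZ] at hXY
  have alg : ∀ (D : E3 →L[ℝ] E3 →L[ℝ] ℝ) (u v : E3), 0 = D v u - D u v → ∀ a b c d : ℝ,
      D (c • u + d • v) (a • u + b • v) - D (a • u + b • v) (c • u + d • v) = 0 := by
    intro D u v h0 a b c d
    simp only [map_add, map_smul, add_apply, smul_apply, smul_eq_mul]
    linear_combination (b * c - a * d) * h0
  have hanti : ∀ v ∈ ξ m, ∀ w ∈ ξ m, fderiv ℝ η x (w : E3) (v : E3) -
      fderiv ℝ η x (v : E3) (w : E3) = 0 := by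
    intro v hv w hw
    rw [h.span_eq, Submodule.mem_span_pair] at hv hw
    obtain ⟨a, b, rfl⟩ := hv
    obtain ⟨c, d, rfl⟩ := hw
    exact alg _ _ _ hXY a b c d
  have htop := hξ.sq_eq_top m
  have hle : sq (𝓡 3) univ ξ m ≤ ξ m := by
    rw [sq, bracketSum]
    refine sup_le (sup_le le_rfl le_rfl) (Submodule.span_le.2 ?_)
    rintro v ⟨A, B, hA, hB, rfl⟩
    obtain ⟨h1, h2, h3⟩ := hbr A B hA hB
    refine (hηx _).1 ?_
    rw [h3]
    exact hanti _ h1 _ h2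
  have h3 : Module.finrank ℝ (ξ m) ≤ 2 := by
    rw [h.span_eq, ← hr]
    exact (finrank_range_le_card (R := ℝ) ![X m, Y m]).trans (by simp)
  rw [htop, top_le_iff] at hle
  rw [hle, finrank_top, show Module.finrank ℝ (TangentSpace (𝓡 3) m) = Module.finrank ℝ E3 from rfl]
    at h3
  simp at h3

theorem IsFrame.structFun_eq_one (hξ : IsContact (𝓡 3) ξ) (h : IsFrame ξ X Y) (m : M) :
    (h.isGlobalFrame hξ).structFun 0 1 2 m = 1 := by
  have := (h.isGlobalFrame hξ).coframe_frame (m := m) 2 2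
  exact this.trans (if_pos rfl)

end ContactFrame
end Engel

namespace Engel

open Set Filter

section Angle

theorem contDiffAt_arg {z : ℂ} (hz : z ∈ Complex.slitPlane) : ContDiffAt ℝ ∞ Complex.arg z := by
  have h := (Complex.contDiffAt_log (n := ∞) hz).restrict_scalars ℝ
  have h2 : Complex.arg = fun w => Complex.imCLM (Complex.log w) := by
    ext w; simp [Complex.log_im]
  rw [h2]
  exact Complex.imCLM.contDiff.contDiffAt.comp z h

theorem circle_mem_slitPlane {z : Circle} (hz : z ≠ -1) : (z : ℂ) ∈ Complex.slitPlane := by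
  rw [Complex.mem_slitPlane_iff]
  by_contra! h
  refine hz (Circle.ext ?_)
  have h2 : (z : ℂ).re ^ 2 + (z : ℂ).im ^ 2 = 1 := by
    have := Circle.normSq_coe z
    rw [Complex.normSq_apply] at this
    linarith
  rw [h.2] at h2
  have h3 : (z : ℂ).re = -1 := by nlinarith [h.1]
  apply Complex.ext <;> simp [h.2, h3]

theorem circle_one_add_re_pos_iff {z : Circle} : 0 < 1 + (z : ℂ).re ↔ z ≠ -1 := by
  have h2 : (z : ℂ).re ^ 2 + (z : ℂ).im ^ 2 = 1 := by
    have := Circle.normSq_coe z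
    rw [Complex.normSq_apply] at this
    linarith
  constructor
  · rintro h rfl
    simp at h
  · intro h
    rcases Complex.mem_slitPlane_iff.1 (circle_mem_slitPlane h) with h1 | h1
    · linarith
    · nlinarith [sq_pos_of_ne_zero h1]

theorem contMDiffAt_circleArg {z : Circle} (hz : z ≠ -1) :
    ContMDiffAt (𝓡 1) 𝓘(ℝ, ℝ) ∞ (fun z : Circle => Complex.arg z) z :=
  haveI := finrank_real_complex_fact'
  ((contDiffAt_arg (circle_mem_slitPlane hz)).contMDiffAt).comp (I' := 𝓘(ℝ, ℂ)) z
    ((contMDiff_coe_sphere (E := ℂ) (n := 1) (m := ∞)).contMDiffAt)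

theorem circleExp_ne_neg_one {x : ℝ} (hx : |x| < Real.pi) : Circle.exp x ≠ -1 := by
  intro h
  have h1 := Circle.arg_exp (by linarith [neg_abs_le x]) (le_trans (le_abs_self x) hx.le)
  rw [h] at h1
  simp at h1
  rw [← h1, abs_of_pos Real.pi_pos] at hx
  exact lt_irrefl _ hx

/-- The normalization of a nonzero complex number. -/
def toCircle (u : ℂ) : Circle := Circle.exp u.arg

theorem coe_toCircle {u : ℂ} : (‖u‖ : ℂ) * (toCircle u : ℂ) = u := by
  rw [toCircle, Circle.coe_exp, Complex.norm_mul_exp_arg_mul_I]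

theorem toCircle_coe (z : Circle) : toCircle (z : ℂ) = z := Circle.exp_arg z

theorem toCircle_mul (z : Circle) {u : ℂ} (hu : u ≠ 0) : toCircle (z * u) = z * toCircle u := by
  apply Circle.ext
  have h1 := coe_toCircle (u := z * u)
  rw [norm_mul, Circle.norm_coe, one_mul] at h1
  have h2 : (‖u‖ : ℂ) ≠ 0 := by exact_mod_cast (norm_pos_iff.2 hu).ne'
  refine mul_left_cancel₀ h2 (h1.trans ?_)
  rw [Circle.coe_mul, mul_left_comm, coe_toCircle]

theorem contMDiffAt_toCircle {u : ℂ} (hu : u ≠ 0) :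
    ContMDiffAt 𝓘(ℝ, ℂ) (𝓡 1) ∞ toCircle u := by
  set z := toCircle u with hz
  have h0 : (z⁻¹ : Circle) * u = (‖u‖ : ℂ) := by
    conv_lhs => rw [← coe_toCircle (u := u), ← hz]
    rw [mul_left_comm, ← Circle.coe_mul]
    simp
  have h1 : toCircle =ᶠ[𝓝 u] fun v => z * Circle.exp (Complex.arg ((z⁻¹ : Circle) * v)) := by
    filter_upwards [isOpen_ne.mem_nhds hu] with v hv
    have : Circle.exp (Complex.arg ((z⁻¹ : Circle) * v)) = toCircle ((z⁻¹ : Circle) * v) := rfl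
    rw [this, toCircle_mul _ hv, mul_inv_cancel_left]
  refine ContMDiffAt.congr_of_eventuallyEq ?_ h1
  have h2 : ContDiffAt ℝ ∞ (fun v : ℂ => Complex.arg ((z⁻¹ : Circle) * v)) u := by
    refine ContDiffAt.comp u (contDiffAt_arg ?_) (by fun_prop)
    rw [h0]
    exact Complex.ofReal_mem_slitPlane.2 (norm_pos_iff.2 hu)
  have h3 := (contMDiff_circleExp (m := ∞)).contMDiffAt.comp u h2.contMDiffAt
  exact (contMDiffAt_const (c := z)).mul h3

theorem sin_nonneg_and_iff {x θ : ℝ} (hθ : |θ| < Real.pi) (h0 : θ ≠ 0) (hx : -Real.pi < x)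
    (hx' : x ≤ Real.pi) {a b : ℝ} (ha : 0 ≤ a) (hb : 0 ≤ b) (h1 : Real.sin x = b * Real.sin θ)
    (h2 : Real.sin (θ - x) = a * Real.sin θ) : x / θ ∈ Icc (0 : ℝ) 1 := by
  have hθ1 := abs_lt.1 hθ
  rcases lt_or_gt_of_ne h0 with hn | hp
  · have hs := Real.sin_neg_of_neg_of_neg_pi_lt hn hθ1.1
    have hx0 : x ≤ 0 := by
      by_contra! h
      rcases hx'.eq_or_lt with rfl | hlt
      · rw [Real.sin_sub_pi] at h2
        nlinarith
      · have := Real.sin_pos_of_pos_of_lt_pi h hlt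
        nlinarith [mul_nonneg hb (neg_nonneg.2 hs.le)]
    have hx1 : θ ≤ x := by
      by_contra! h
      have := Real.sin_pos_of_pos_of_lt_pi (x := θ - x) (by linarith) (by linarith)
      nlinarith [mul_nonneg ha (neg_nonneg.2 hs.le)]
    exact ⟨div_nonneg_of_nonpos hx0 hn.le, (div_le_one_of_neg hn).2 hx1⟩
  · have hs := Real.sin_pos_of_pos_of_lt_pi hp hθ1.2
    have hx0 : 0 ≤ x := by
      by_contra! h
      have := Real.sin_neg_of_neg_of_neg_pi_lt h hx
      nlinarith [mul_nonneg hb hs.le]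
    have hx1 : x ≤ θ := by
      by_contra! h
      have := Real.sin_neg_of_neg_of_neg_pi_lt (x := θ - x) (by linarith) (by linarith)
      nlinarith [mul_nonneg ha hs.le]
    exact ⟨div_nonneg hx0 hp.le, (div_le_one hp).2 hx1⟩

theorem circle_mem_cone_iff {w : Circle} {θ : ℝ} (hθ : |θ| < Real.pi) (h0 : θ ≠ 0) :
    (∃ a b : ℝ, 0 ≤ a ∧ 0 ≤ b ∧ (w : ℂ) = a + b * (Circle.exp θ : ℂ)) ↔
      Complex.arg w / θ ∈ Icc (0 : ℝ) 1 := by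
  have hexp : ∀ x : ℝ, (Circle.exp x : ℂ) = ⟨Real.cos x, Real.sin x⟩ := by
    intro x
    rw [Circle.coe_exp]
    apply Complex.ext
    · rw [Complex.exp_ofReal_mul_I_re]
    · rw [Complex.exp_ofReal_mul_I_im]
  have hs0 : Real.sin θ ≠ 0 := by
    intro h
    rw [Real.sin_eq_zero_iff_of_lt_of_lt (abs_lt.1 hθ).1 (abs_lt.1 hθ).2] at h
    exact h0 h
  have hw : w = Circle.exp (Complex.arg w) := (Circle.exp_arg w).symm
  set x := Complex.arg w with hxdef
  rw [hw, hexp, hexp]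
  constructor
  · rintro ⟨a, b, ha, hb, h⟩
    have hre := congrArg Complex.re h
    have him := congrArg Complex.im h
    simp at hre him
    refine sin_nonneg_and_iff hθ h0 (Complex.neg_pi_lt_arg _) (Complex.arg_le_pi _) ha hb him ?_
    rw [Real.sin_sub, hre, him]
    ring
  · intro hx
    refine ⟨Real.sin (θ - x) / Real.sin θ, Real.sin x / Real.sin θ, ?_, ?_, ?_⟩
    · set s := x / θ with hs
      have hx2 : x = s * θ := by rw [hs]; field_simp
      rcases lt_or_gt_of_ne h0 with hn | hp
      · refine div_nonneg_of_nonpos (Real.sin_nonpos_of_nonpos_of_neg_pi_le ?_ ?_)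
          (Real.sin_nonpos_of_nonpos_of_neg_pi_le hn.le (abs_lt.1 hθ).1.le)
        · rw [hx2]; nlinarith [hx.2]
        · rw [hx2]; nlinarith [hx.1, (abs_lt.1 hθ).1]
      · refine div_nonneg (Real.sin_nonneg_of_nonneg_of_le_pi ?_ ?_)
          (Real.sin_nonneg_of_nonneg_of_le_pi hp.le (abs_lt.1 hθ).2.le)
        · rw [hx2]; nlinarith [hx.2]
        · rw [hx2]; nlinarith [hx.1, (abs_lt.1 hθ).2]
    · set s := x / θ with hs
      have hx2 : x = s * θ := by rw [hs]; field_simp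
      rcases lt_or_gt_of_ne h0 with hn | hp
      · refine div_nonneg_of_nonpos (Real.sin_nonpos_of_nonpos_of_neg_pi_le ?_ ?_)
          (Real.sin_nonpos_of_nonpos_of_neg_pi_le hn.le (abs_lt.1 hθ).1.le)
        · rw [hx2]; nlinarith [hx.1]
        · rw [hx2]; nlinarith [hx.2, (abs_lt.1 hθ).1]
      · refine div_nonneg (Real.sin_nonneg_of_nonneg_of_le_pi ?_ ?_)
          (Real.sin_nonneg_of_nonneg_of_le_pi hp.le (abs_lt.1 hθ).2.le)
        · rw [hx2]; nlinarith [hx.1]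
        · rw [hx2]; nlinarith [hx.2, (abs_lt.1 hθ).2]
    · apply Complex.ext
      · rw [Complex.add_re, Complex.re_ofReal_mul, Complex.ofReal_re, Real.sin_sub]
        field_simp
        ring
      · rw [Complex.add_im, Complex.im_ofReal_mul, Complex.ofReal_im]
        field_simp
        ring

end Angle

section Wedge

variable {M : Type*}

/-- The oriented angle from `V₀` to `V₁`. -/
def angle (V₀ V₁ : M → Circle) (m : M) : ℝ := Complex.arg ((V₁ m / V₀ m : Circle) : ℂ)

/-- The parametrization of the domain `Ω(V₀, V₁)` by `M × [0, 1]`. -/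
def wedge (V₀ V₁ : M → Circle) (p : M × ℝ) : M × Circle :=
  (p.1, V₀ p.1 * Circle.exp (p.2 * angle V₀ V₁ p.1))

/-- The height of a ray between `V₀` and `V₁`. -/
def height (V₀ V₁ : M → Circle) (q : M × Circle) : ℝ :=
  Complex.arg ((q.2 / V₀ q.1 : Circle) : ℂ) / angle V₀ V₁ q.1

variable {V₀ V₁ : M → Circle}

theorem linearIndependent_circle_iff {z w : Circle} :
    LinearIndependent ℝ ![(z : ℂ), (w : ℂ)] ↔ ((w / z : Circle) : ℂ).im ≠ 0 := by
  have hz : (z : ℂ) ≠ 0 := Circle.coe_ne_zero z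
  have hw : (w : ℂ) = ((w / z : Circle) : ℂ) * z := by rw [← Circle.coe_mul, div_mul_cancel]
  set u := ((w / z : Circle) : ℂ)
  rw [LinearIndependent.pair_iff, hw]
  constructor
  · intro h h0
    have := (h u.re (-1) ?_).2
    · norm_num at this
    · have : u = (u.re : ℂ) := by apply Complex.ext <;> simp [h0]
      rw [neg_one_smul, Complex.real_smul, ← this]
      ring
  · intro h a b hab
    rw [Complex.real_smul, Complex.real_smul] at hab
    have h1 : (a + b * u : ℂ) = 0 := by
      refine (mul_eq_zero.1 ?_).resolve_right hz
      linear_combination hab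
    have h2 := congrArg Complex.im h1
    have h3 := congrArg Complex.re h1
    simp at h2 h3
    have hb : b = 0 := h2.resolve_right h
    exact ⟨by rw [hb] at h3; simpa using h3, hb⟩

theorem arg_pos_iff {w : Circle} :
    (w : ℂ).im ≠ 0 ↔ |Complex.arg w| < Real.pi ∧ Complex.arg w ≠ 0 := by
  have h0 : |Complex.arg w| < Real.pi ↔ Complex.arg (w : ℂ) ≠ Real.pi := by
    rw [abs_lt]
    exact ⟨fun h => h.2.ne, fun h => ⟨Complex.neg_pi_lt_arg _, (Complex.arg_le_pi _).lt_of_ne h⟩⟩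
  rw [h0, ne_eq, ne_eq, ne_eq, Complex.arg_eq_zero_iff, Complex.arg_eq_pi_iff]
  have h2 : (w : ℂ).re ^ 2 + (w : ℂ).im ^ 2 = 1 := by
    have := Circle.normSq_coe w
    rw [Complex.normSq_apply] at this
    linarith
  constructor
  · intro h
    exact ⟨fun h' => h h'.2, fun h' => h h'.2⟩
  · rintro ⟨h1, h3⟩ h0
    rcases lt_or_ge (w : ℂ).re 0 with h4 | h4
    · exact h1 ⟨h4, h0⟩
    · exact h3 ⟨h4, h0⟩

theorem neverCollinear_iff : NeverCollinear V₀ V₁ ↔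
    ∀ m, |angle V₀ V₁ m| < Real.pi ∧ angle V₀ V₁ m ≠ 0 :=
  forall_congr' fun _ => linearIndependent_circle_iff.trans arg_pos_iff

theorem exp_angle (m : M) : V₀ m * Circle.exp (angle V₀ V₁ m) = V₁ m := by
  rw [angle, Circle.exp_arg, mul_div_cancel]

theorem abs_angle_lt (hV : NeverCollinear V₀ V₁) (m : M) : |angle V₀ V₁ m| < Real.pi := (neverCollinear_iff.1 hV m).1

theorem angle_ne_zero (hV : NeverCollinear V₀ V₁) (m : M) : angle V₀ V₁ m ≠ 0 := (neverCollinear_iff.1 hV m).2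

theorem wedge_height (hV : NeverCollinear V₀ V₁) (q : M × Circle) : wedge V₀ V₁ (q.1, height V₀ V₁ q) = q := by
  refine Prod.ext rfl ?_
  change V₀ q.1 * Circle.exp (height V₀ V₁ q * angle V₀ V₁ q.1) = q.2
  rw [height, div_mul_cancel₀ _ (angle_ne_zero hV q.1), Circle.exp_arg, mul_div_cancel]

theorem height_wedge (hV : NeverCollinear V₀ V₁) {p : M × ℝ} (hp : |p.2 * angle V₀ V₁ p.1| < Real.pi) :
    height V₀ V₁ (wedge V₀ V₁ p) = p.2 := by
  rw [height, wedge]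
  dsimp only
  rw [mul_div_cancel_left, Circle.arg_exp (abs_lt.1 hp).1 (abs_lt.1 hp).2.le,
    mul_div_cancel_right₀ _ (angle_ne_zero hV p.1)]

theorem abs_mul_angle_lt (hV : NeverCollinear V₀ V₁) {s : ℝ} (hs : s ∈ Icc (0 : ℝ) 1) (m : M) :
    |s * angle V₀ V₁ m| < Real.pi := by
  rw [abs_mul, abs_of_nonneg hs.1]
  nlinarith [abs_angle_lt hV m, abs_nonneg (angle V₀ V₁ m), hs.2]

theorem mem_domain_iff (hV : NeverCollinear V₀ V₁) (q : M × Circle) :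
    q ∈ domain V₀ V₁ ↔ height V₀ V₁ q ∈ Icc (0 : ℝ) 1 := by
  rw [height, ← circle_mem_cone_iff (abs_angle_lt hV q.1) (angle_ne_zero hV q.1)]
  have h0 : (V₀ q.1 : ℂ) ≠ 0 := Circle.coe_ne_zero _
  refine exists_congr fun a => exists_congr fun b => and_congr_right fun _ => and_congr_right fun _ => ?_
  rw [angle, Circle.exp_arg, Circle.coe_div, Circle.coe_div, div_eq_iff h0]
  constructor
  · intro h; rw [h]; field_simp
  · intro h; rw [h]; field_simp

theorem wedge_mem_domain (hV : NeverCollinear V₀ V₁) {m : M} {s : ℝ} (hs : s ∈ Icc (0 : ℝ) 1) :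
    wedge V₀ V₁ (m, s) ∈ domain V₀ V₁ := by
  rw [mem_domain_iff hV, height_wedge hV (abs_mul_angle_lt hV hs m)]
  exact hs

end Wedge
end Engel

namespace Engel

open Set Filter

section CircleMaps

variable {E' : Type*} [NormedAddCommGroup E'] [NormedSpace ℝ E'] {H' : Type*} [TopologicalSpace H']
  {J : ModelWithCorners ℝ E' H'} {P : Type*} [TopologicalSpace P] [ChartedSpace H' P]

theorem contMDiffWithinAt_arg_div {z w : P → Circle} {s : Set P} {p : P}
    (hz : ContMDiffWithinAt J (𝓡 1) ∞ z s p) (hw : ContMDiffWithinAt J (𝓡 1) ∞ w s p)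
    (h : w p / z p ≠ -1) :
    ContMDiffWithinAt J 𝓘(ℝ, ℝ) ∞ (fun p => Complex.arg ((w p / z p : Circle) : ℂ)) s p :=
  (contMDiffAt_circleArg h).comp_contMDiffWithinAt p (hw.div hz)

theorem contMDiffWithinAt_mul_exp {z : P → Circle} {r : P → ℝ} {s : Set P} {p : P}
    (hz : ContMDiffWithinAt J (𝓡 1) ∞ z s p) (hr : ContMDiffWithinAt J 𝓘(ℝ, ℝ) ∞ r s p) :
    ContMDiffWithinAt J (𝓡 1) ∞ (fun p => z p * Circle.exp (r p)) s p :=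
  hz.mul ((contMDiff_circleExp (m := ∞)).contMDiffAt.comp_contMDiffWithinAt p hr)

end CircleMaps

theorem angle_div_ne_neg_one {M : Type*} {V₀ V₁ : M → Circle} (hV : NeverCollinear V₀ V₁) (m : M) :
    V₁ m / V₀ m ≠ -1 := by
  have h := circleExp_ne_neg_one (abs_angle_lt hV m)
  rwa [angle, Circle.exp_arg] at h

theorem div_ne_neg_one_of_mem_domain {M : Type*} {V₀ V₁ : M → Circle} (hV : NeverCollinear V₀ V₁)
    {q : M × Circle} (hq : q ∈ domain V₀ V₁) : q.2 / V₀ q.1 ≠ -1 := by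
  have h := (mem_domain_iff hV q).1 hq
  have h2 := circleExp_ne_neg_one (abs_mul_angle_lt hV h q.1)
  rwa [height, div_mul_cancel₀ _ (angle_ne_zero hV q.1), Circle.exp_arg] at h2

section Domain

variable {M : Type*} [TopologicalSpace M] [ChartedSpace E3 M] [IsManifold (𝓡 3) ∞ M]
  {V₀ V₁ : M → Circle}

theorem contMDiff_angle (hV₀ : ContMDiff (𝓡 3) (𝓡 1) ∞ V₀) (hV₁ : ContMDiff (𝓡 3) (𝓡 1) ∞ V₁)
    (hV : NeverCollinear V₀ V₁) : ContMDiff (𝓡 3) 𝓘(ℝ, ℝ) ∞ (angle V₀ V₁) := fun m =>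
  contMDiffWithinAt_arg_div (hV₀ m) (hV₁ m) (angle_div_ne_neg_one hV m)

theorem contMDiff_wedge (hV₀ : ContMDiff (𝓡 3) (𝓡 1) ∞ V₀) (hV₁ : ContMDiff (𝓡 3) (𝓡 1) ∞ V₁)
    (hV : NeverCollinear V₀ V₁) : ContMDiff ((𝓡 3).prod 𝓘(ℝ, ℝ)) SI ∞ (wedge V₀ V₁) := by
  refine contMDiff_fst.prodMk fun p => contMDiffWithinAt_mul_exp ?_ ?_
  · exact (hV₀.comp contMDiff_fst) p
  · exact (contMDiff_snd.mul ((contMDiff_angle hV₀ hV₁ hV).comp contMDiff_fst)) p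

theorem contMDiffAt_height (hV₀ : ContMDiff (𝓡 3) (𝓡 1) ∞ V₀) (hV₁ : ContMDiff (𝓡 3) (𝓡 1) ∞ V₁)
    (hV : NeverCollinear V₀ V₁) {q : M × Circle} (hq : q.2 / V₀ q.1 ≠ -1) :
    ContMDiffAt SI 𝓘(ℝ, ℝ) ∞ (height V₀ V₁) q := by
  refine ContMDiffAt.div₀ (contMDiffWithinAt_arg_div ?_ ?_ hq) ?_ (angle_ne_zero hV q.1)
  · exact (hV₀.comp contMDiff_fst) q
  · exact contMDiff_snd q
  · exact ((contMDiff_angle hV₀ hV₁ hV).comp contMDiff_fst) q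

variable (hV₀ : ContMDiff (𝓡 3) (𝓡 1) ∞ V₀) (hV₁ : ContMDiff (𝓡 3) (𝓡 1) ∞ V₁)
  (hV : NeverCollinear V₀ V₁)

theorem isOpen_height_domain (hV₀ : ContMDiff (𝓡 3) (𝓡 1) ∞ V₀) :
    IsOpen {q : M × Circle | q.2 / V₀ q.1 ≠ -1} :=
  isOpen_ne_fun (continuous_snd.div' (hV₀.continuous.comp continuous_fst)) continuous_const

theorem wedge_div_ne_neg_one (hV : NeverCollinear V₀ V₁) {m : M} {s : ℝ} (hs : s ∈ Icc (0 : ℝ) 1) :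
    (wedge V₀ V₁ (m, s)).2 / V₀ (wedge V₀ V₁ (m, s)).1 ≠ -1 :=
  div_ne_neg_one_of_mem_domain hV (wedge_mem_domain hV hs)

/-- The differential of the parametrization of the domain. -/
def dwedge (V₀ V₁ : M → Circle) (m : M) (s : ℝ) (u : TangentSpace (𝓡 3) m) (c : ℝ) :
    TangentSpace SI (wedge V₀ V₁ (m, s)) :=
  mfderiv ((𝓡 3).prod 𝓘(ℝ, ℝ)) SI (wedge V₀ V₁) (m, s) ((u, c) : E3 × ℝ)

/-- The horizontal component of a tangent vector. -/
def dbase (q : M × Circle) (F : TangentSpace SI q) : TangentSpace (𝓡 3) q.1 :=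
  mfderiv SI (𝓡 3) (Prod.fst : M × Circle → M) q F

/-- The derivative of the height. -/
def dheight (V₀ V₁ : M → Circle) (q : M × Circle) (F : TangentSpace SI q) : ℝ :=
  mfderiv SI 𝓘(ℝ, ℝ) (height V₀ V₁) q F

theorem dbase_dwedge (hV₀ : ContMDiff (𝓡 3) (𝓡 1) ∞ V₀) (hV₁ : ContMDiff (𝓡 3) (𝓡 1) ∞ V₁)
    (hV : NeverCollinear V₀ V₁) (m : M) (s : ℝ) (u : TangentSpace (𝓡 3) m) (c : ℝ) :
    dbase (wedge V₀ V₁ (m, s)) (dwedge V₀ V₁ m s u c) = u := by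
  have h1 := (((contMDiff_wedge hV₀ hV₁ hV).mdifferentiable (by simp)) (m, s)).hasMFDerivAt
  have h2 := (hasMFDerivAt_fst (I := 𝓡 3) (I' := 𝓡 1) (wedge V₀ V₁ (m, s)))
  have h3 := h2.comp (m, s) h1
  have h4 := hasMFDerivAt_fst (I := 𝓡 3) (I' := 𝓘(ℝ, ℝ)) ((m, s) : M × ℝ)
  have h5 := hasMFDerivAt_unique h3 h4
  have h6 := DFunLike.congr_fun h5 ((u, c) : E3 × ℝ)
  rw [dbase, h2.mfderiv]
  exact h6

theorem dheight_dwedge (hV₀ : ContMDiff (𝓡 3) (𝓡 1) ∞ V₀) (hV₁ : ContMDiff (𝓡 3) (𝓡 1) ∞ V₁)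
    (hV : NeverCollinear V₀ V₁) {m : M} {s : ℝ} (hs : s ∈ Icc (0 : ℝ) 1)
    (u : TangentSpace (𝓡 3) m) (c : ℝ) :
    dheight V₀ V₁ (wedge V₀ V₁ (m, s)) (dwedge V₀ V₁ m s u c) = c := by
  have h1 := (((contMDiff_wedge hV₀ hV₁ hV).mdifferentiable (by simp)) (m, s)).hasMFDerivAt
  have h2 := ((contMDiffAt_height hV₀ hV₁ hV (wedge_div_ne_neg_one hV (m := m) hs)).mdifferentiableAt
    (by simp)).hasMFDerivAt
  have h3 := h2.comp (m, s) h1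
  have h4 := hasMFDerivAt_snd (I := 𝓡 3) (I' := 𝓘(ℝ, ℝ)) ((m, s) : M × ℝ)
  have hc : Continuous fun p : M × ℝ => |p.2 * angle V₀ V₁ p.1| :=
    (continuous_snd.mul ((contMDiff_angle hV₀ hV₁ hV).continuous.comp continuous_fst)).abs
  have h5 := hasMFDerivAt_unique h3 (h4.congr_of_eventuallyEq (by
    filter_upwards [(isOpen_lt hc continuous_const).mem_nhds (abs_mul_angle_lt hV hs m)] with p hp
    exact height_wedge hV hp))
  exact DFunLike.congr_fun h5 ((u, c) : E3 × ℝ)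

theorem dwedge_dbase (hV₀ : ContMDiff (𝓡 3) (𝓡 1) ∞ V₀) (hV₁ : ContMDiff (𝓡 3) (𝓡 1) ∞ V₁)
    (hV : NeverCollinear V₀ V₁) {m : M} {s : ℝ} (hs : s ∈ Icc (0 : ℝ) 1)
    (F : TangentSpace SI (wedge V₀ V₁ (m, s))) :
    dwedge V₀ V₁ m s (dbase _ F) (dheight V₀ V₁ _ F) = F := by
  have h1 := (((contMDiff_wedge hV₀ hV₁ hV).mdifferentiable (by simp)) (m, s)).hasMFDerivAt
  have h2 := ((contMDiffAt_height hV₀ hV₁ hV (wedge_div_ne_neg_one hV (m := m) hs)).mdifferentiableAt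
    (by simp)).hasMFDerivAt
  have h0 := (hasMFDerivAt_fst (I := 𝓡 3) (I' := 𝓡 1) (wedge V₀ V₁ (m, s)))
  have h3 := h0.prodMk h2
  have h4 : ((wedge V₀ V₁ (m, s)).1, height V₀ V₁ (wedge V₀ V₁ (m, s))) = (m, s) :=
    Prod.ext rfl (height_wedge hV (abs_mul_angle_lt hV hs m))
  rw [← h4] at h1
  have h5 := h1.comp (wedge V₀ V₁ (m, s)) h3
  have h6 := hasMFDerivAt_unique h5 ((hasMFDerivAt_id (wedge V₀ V₁ (m, s))).congr_of_eventuallyEq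
    (Eventually.of_forall fun q' => wedge_height hV q'))
  rw [h4] at h6
  have h7 := DFunLike.congr_fun h6 F
  rw [dbase, h0.mfderiv]
  exact h7

theorem uniqueMDiffOn_domain (hV₀ : ContMDiff (𝓡 3) (𝓡 1) ∞ V₀) (hV₁ : ContMDiff (𝓡 3) (𝓡 1) ∞ V₁)
    (hV : NeverCollinear V₀ V₁) : UniqueMDiffOn SI (domain V₀ V₁) := by
  intro q hq
  have himg : domain V₀ V₁ = wedge V₀ V₁ '' (univ ×ˢ Icc (0 : ℝ) 1) := by
    ext q'
    constructor
    · intro h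
      exact ⟨(q'.1, height V₀ V₁ q'), ⟨mem_univ _, (mem_domain_iff hV q').1 h⟩, wedge_height hV q'⟩
    · rintro ⟨⟨m, s⟩, ⟨-, h⟩, rfl⟩
      exact wedge_mem_domain hV h
  obtain ⟨⟨m, s⟩, ⟨-, hs⟩, rfl⟩ := himg ▸ hq
  rw [himg]
  have hu : UniqueMDiffWithinAt ((𝓡 3).prod 𝓘(ℝ, ℝ)) ((univ : Set M) ×ˢ Icc (0 : ℝ) 1) (m, s) :=
    (uniqueMDiffWithinAt_univ (𝓡 3)).prod
      (uniqueMDiffWithinAt_iff_uniqueDiffWithinAt.2 (uniqueDiffOn_Icc zero_lt_one s hs))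
  have h1 := (((contMDiff_wedge hV₀ hV₁ hV).mdifferentiable (by simp)) (m, s)).hasMFDerivAt
  refine hu.image_denseRange h1.hasMFDerivWithinAt (Function.Surjective.denseRange fun F => ?_)
  exact ⟨((dbase _ F : E3), (dheight V₀ V₁ _ F : ℝ)), dwedge_dbase hV₀ hV₁ hV hs F⟩

theorem mem_closure_interior_domain (hV₀ : ContMDiff (𝓡 3) (𝓡 1) ∞ V₀)
    (hV₁ : ContMDiff (𝓡 3) (𝓡 1) ∞ V₁) (hV : NeverCollinear V₀ V₁) {q : M × Circle}
    (hq : q ∈ domain V₀ V₁) : q ∈ closure (interior (domain V₀ V₁)) := by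
  have hs := (mem_domain_iff hV q).1 hq
  have hc : Continuous fun r : ℝ => wedge V₀ V₁ (q.1, r) :=
    (contMDiff_wedge hV₀ hV₁ hV).continuous.comp (by fun_prop)
  have h1 : height V₀ V₁ q ∈ closure (Ioo (0 : ℝ) 1) := by
    rwa [closure_Ioo zero_ne_one]
  have h2 := map_mem_closure hc h1 (t := interior (domain V₀ V₁)) (fun r hr => by
    rw [mem_interior_iff_mem_nhds]
    have hr' : r ∈ Icc (0 : ℝ) 1 := Ioo_subset_Icc_self hr
    have h3 := (contMDiffAt_height hV₀ hV₁ hV (wedge_div_ne_neg_one hV (m := q.1) hr')).continuousAt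
    have h4 : height V₀ V₁ (wedge V₀ V₁ (q.1, r)) ∈ Ioo (0 : ℝ) 1 := by
      rwa [height_wedge hV (abs_mul_angle_lt hV hr' q.1)]
    filter_upwards [h3.preimage_mem_nhds (isOpen_Ioo.mem_nhds h4)] with q' hq'
    exact (mem_domain_iff hV q').2 (Ioo_subset_Icc_self hq'))
  rwa [wedge_height hV] at h2

end Domain

section Apply

variable {E : Type*} [NormedAddCommGroup E] [NormedSpace ℝ E] {H : Type*} [TopologicalSpace H]
  {I : ModelWithCorners ℝ E H} {N : Type*} [TopologicalSpace N] [ChartedSpace H N]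
  [IsManifold I ∞ N]
  {E₁ : Type*} [NormedAddCommGroup E₁] [NormedSpace ℝ E₁] {H₁ : Type*} [TopologicalSpace H₁]
  {I₁ : ModelWithCorners ℝ E₁ H₁} {N₁ : Type*} [TopologicalSpace N₁] [ChartedSpace H₁ N₁]
  [IsManifold I₁ ∞ N₁]
  {E' : Type*} [NormedAddCommGroup E'] [NormedSpace ℝ E'] {H' : Type*} [TopologicalSpace H']
  {J : ModelWithCorners ℝ E' H'} {P : Type*} [TopologicalSpace P] [ChartedSpace H' P]

/-- The differential of a smooth map takes smooth sections to smooth sections. -/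
theorem contMDiffWithinAt_mfderiv_apply {f : N → N₁} {U : Set N} (hU : IsOpen U)
    (hf : ContMDiffOn I I₁ ∞ f U) {g : P → N} {v : ∀ p, TangentSpace I (g p)} {s : Set P} {p : P}
    (hp : p ∈ s) (hg : MapsTo g s U)
    (hv : ContMDiffWithinAt J I.tangent ∞ (fun p => (⟨g p, v p⟩ : TangentBundle I N)) s p) :
    ContMDiffWithinAt J I₁.tangent ∞
      (fun p => (⟨f (g p), mfderiv I I₁ f (g p) (v p)⟩ : TangentBundle I₁ N₁)) s p := by
  have h1 := hf.contMDiffOn_tangentMapWithin (m := ∞) (by simp) hU.uniqueMDiffOn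
  have h2 := (h1 ⟨g p, v p⟩ (hg hp)).comp p hv (fun p' hp' => hg hp')
  refine h2.congr (fun p' hp' => ?_) ?_
  · simp only [Function.comp, tangentMapWithin]
    rw [mfderivWithin_of_isOpen hU (hg hp')]
  · simp only [Function.comp, tangentMapWithin]
    rw [mfderivWithin_of_isOpen hU (hg hp)]

end Apply

section ApplyScalar

variable {E : Type*} [NormedAddCommGroup E] [NormedSpace ℝ E] {H : Type*} [TopologicalSpace H]
  {I : ModelWithCorners ℝ E H} {N : Type*} [TopologicalSpace N] [ChartedSpace H N]
  [IsManifold I ∞ N]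
  {E' : Type*} [NormedAddCommGroup E'] [NormedSpace ℝ E'] {H' : Type*} [TopologicalSpace H']
  {J : ModelWithCorners ℝ E' H'} {P : Type*} [TopologicalSpace P] [ChartedSpace H' P]
  {E₁ : Type*} [NormedAddCommGroup E₁] [NormedSpace ℝ E₁]

theorem contMDiffWithinAt_mfderiv_apply_vector {f : N → E₁} {U : Set N} (hU : IsOpen U)
    (hf : ContMDiffOn I 𝓘(ℝ, E₁) ∞ f U) {g : P → N} {v : ∀ p, TangentSpace I (g p)} {s : Set P}
    {p : P} (hp : p ∈ s) (hg : MapsTo g s U)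
    (hv : ContMDiffWithinAt J I.tangent ∞ (fun p => (⟨g p, v p⟩ : TangentBundle I N)) s p) :
    ContMDiffWithinAt J 𝓘(ℝ, E₁) ∞
      (fun p => (mfderiv I 𝓘(ℝ, E₁) f (g p) (v p) : E₁)) s p := by
  have h := contMDiffWithinAt_mfderiv_apply hU hf hp hg hv
  have h2 := ((contMDiffWithinAt_tangent_iff (I := 𝓘(ℝ, E₁)) (m₀ := f (g p)) (s := s) hp
    (fun p' _ => by rw [extChartAt_model_space_eq_id]; trivial)).1 h).2
  refine h2.congr (fun p' hp' => ?_) ?_ <;>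
  · rw [dchart, extChartAt_model_space_eq_id]
    simp
    rfl

end ApplyScalar

end Engel

namespace Engel

open Set Filter

section GraphAlgebra

variable {V : Type*} [AddCommGroup V] [Module ℝ V] {R P Q H : V →ₗ[ℝ] ℝ}

/-- The plane `D` is the graph, with the coefficients `c`, of a linear map from the first and fourth
coordinate to the second and third. -/
def IsGraph (R P Q H : V →ₗ[ℝ] ℝ) (D : Submodule ℝ V) (c : Fin 4 → ℝ) : Prop :=
  ∀ F, F ∈ D ↔ P F = c 0 * R F + c 1 * H F ∧ Q F = c 2 * R F + c 3 * H F

/-- The coefficients of the plane spanned by a pair of vectors with the coordinates `r`, `p`, `q`,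
`h`, by Cramer's rule. -/
def graphCoeff (r p q h : Fin 2 → ℝ) : Fin 4 → ℝ :=
  ![(p 0 * h 1 - p 1 * h 0) / (r 0 * h 1 - r 1 * h 0),
    (r 0 * p 1 - r 1 * p 0) / (r 0 * h 1 - r 1 * h 0),
    (q 0 * h 1 - q 1 * h 0) / (r 0 * h 1 - r 1 * h 0),
    (r 0 * q 1 - r 1 * q 0) / (r 0 * h 1 - r 1 * h 0)]

theorem isGraph_span (hinj : ∀ F, R F = 0 → P F = 0 → Q F = 0 → H F = 0 → F = 0) {F : Fin 2 → V}
    (hμ : R (F 0) * H (F 1) - R (F 1) * H (F 0) ≠ 0) :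
    IsGraph R P Q H (Submodule.span ℝ (Set.range F))
      (graphCoeff (fun i => R (F i)) (fun i => P (F i)) (fun i => Q (F i)) (fun i => H (F i))) := by
  have hrange : Set.range F = {F 0, F 1} := by
    ext v; simp [Fin.exists_fin_two, eq_comm]
  intro v
  rw [hrange, Submodule.mem_span_pair]
  simp only [graphCoeff, Matrix.cons_val]
  set μ := R (F 0) * H (F 1) - R (F 1) * H (F 0) with hμdef
  constructor
  · rintro ⟨x, y, rfl⟩
    simp only [map_add, map_smul, smul_eq_mul]
    constructor <;> field_simp <;> rw [hμdef] <;> ring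
  · rintro ⟨h1, h2⟩
    refine ⟨(R v * H (F 1) - R (F 1) * H v) / μ, (R (F 0) * H v - R v * H (F 0)) / μ, ?_⟩
    rw [← sub_eq_zero]
    apply hinj <;> simp only [map_add, map_sub, map_smul, smul_eq_mul]
    · field_simp; rw [hμdef]; ring
    · rw [h1]; field_simp; ring
    · rw [h2]; field_simp; ring
    · field_simp; rw [hμdef]; ring

theorem IsGraph.minor_ne_zero (hinj : ∀ F, R F = 0 → P F = 0 → Q F = 0 → H F = 0 → F = 0)
    {F : Fin 2 → V} (hF : LinearIndependent ℝ F) {c : Fin 4 → ℝ}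
    (h : IsGraph R P Q H (Submodule.span ℝ (Set.range F)) c) :
    R (F 0) * H (F 1) - R (F 1) * H (F 0) ≠ 0 := by
  intro h0
  have hF' := LinearIndependent.pair_iff.1 (show LinearIndependent ℝ ![F 0, F 1] by
    convert hF using 1; ext i; fin_cases i <;> rfl)
  have hmem : ∀ i, F i ∈ Submodule.span ℝ (Set.range F) := fun i =>
    Submodule.subset_span ⟨i, rfl⟩
  have key : ∀ x y : ℝ, x * R (F 0) + y * R (F 1) = 0 → x * H (F 0) + y * H (F 1) = 0 →
      x = 0 ∧ y = 0 := by
    intro x y h1 h2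
    have h3 : x • F 0 + y • F 1 ∈ Submodule.span ℝ (Set.range F) :=
      Submodule.add_mem _ (Submodule.smul_mem _ _ (hmem 0)) (Submodule.smul_mem _ _ (hmem 1))
    have h4 := (h _).1 h3
    have hR : R (x • F 0 + y • F 1) = 0 := by simpa using h1
    have hH : H (x • F 0 + y • F 1) = 0 := by simpa using h2
    rw [hR, hH] at h4
    exact hF' x y (hinj _ hR (by simpa using h4.1) (by simpa using h4.2) hH)
  have h1 := key (R (F 1)) (-R (F 0)) (by ring) (by linarith)
  have h2 := key (H (F 1)) (-H (F 0)) (by linarith) (by ring)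
  have h3 := key 1 0 (by linarith [h1.2]) (by linarith [h2.2])
  exact one_ne_zero h3.1

theorem IsGraph.eq_graphCoeff {F : Fin 2 → V} {c : Fin 4 → ℝ}
    (h : IsGraph R P Q H (Submodule.span ℝ (Set.range F)) c)
    (hμ : R (F 0) * H (F 1) - R (F 1) * H (F 0) ≠ 0) :
    c = graphCoeff (fun i => R (F i)) (fun i => P (F i)) (fun i => Q (F i)) (fun i => H (F i)) := by
  have hmem : ∀ i, F i ∈ Submodule.span ℝ (Set.range F) := fun i =>
    Submodule.subset_span ⟨i, rfl⟩
  have h0 := (h _).1 (hmem 0)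
  have h1 := (h _).1 (hmem 1)
  have e0 : c 0 = (P (F 0) * H (F 1) - P (F 1) * H (F 0)) /
      (R (F 0) * H (F 1) - R (F 1) * H (F 0)) := by
    rw [eq_div_iff hμ, h0.1, h1.1]; ring
  have e1 : c 1 = (R (F 0) * P (F 1) - R (F 1) * P (F 0)) /
      (R (F 0) * H (F 1) - R (F 1) * H (F 0)) := by
    rw [eq_div_iff hμ, h0.1, h1.1]; ring
  have e2 : c 2 = (Q (F 0) * H (F 1) - Q (F 1) * H (F 0)) /
      (R (F 0) * H (F 1) - R (F 1) * H (F 0)) := by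
    rw [eq_div_iff hμ, h0.2, h1.2]; ring
  have e3 : c 3 = (R (F 0) * Q (F 1) - R (F 1) * Q (F 0)) /
      (R (F 0) * H (F 1) - R (F 1) * H (F 0)) := by
    rw [eq_div_iff hμ, h0.2, h1.2]; ring
  funext j
  fin_cases j
  exacts [e0, e1, e2, e3]

end GraphAlgebra

section Graph

variable {M : Type*} [TopologicalSpace M] [ChartedSpace E3 M] [IsManifold (𝓡 3) ∞ M]
  {V₀ V₁ : M → Circle} {e : Fin 3 → ∀ m : M, TangentSpace (𝓡 3) m}

/-- The components of the projection of a tangent vector to `M`. -/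
def IsGlobalFrame.base (he : IsGlobalFrame e) (k : Fin 3) (q : M × Circle) :
    TangentSpace SI q →ₗ[ℝ] ℝ :=
  (he.coframe k q.1).comp
    (mfderiv SI (𝓡 3) (Prod.fst : M × Circle → M) q : TangentSpace SI q →ₗ[ℝ] TangentSpace (𝓡 3) q.1)

theorem IsGlobalFrame.base_apply (he : IsGlobalFrame e) (k : Fin 3) (q : M × Circle)
    (F : TangentSpace SI q) : he.base k q F = he.coframe k q.1 (dbase q F) := rfl

/-- The component of a tangent vector along the ray. -/
def IsGlobalFrame.along (he : IsGlobalFrame e) (q : M × Circle) : TangentSpace SI q →ₗ[ℝ] ℝ :=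
  (q.2 : ℂ).re • he.base 0 q + (q.2 : ℂ).im • he.base 1 q

/-- The component of a tangent vector in the contact plane perpendicular to the ray. -/
def IsGlobalFrame.across (he : IsGlobalFrame e) (q : M × Circle) : TangentSpace SI q →ₗ[ℝ] ℝ :=
  (-(q.2 : ℂ).im) • he.base 0 q + (q.2 : ℂ).re • he.base 1 q

/-- The derivative of the height as a linear map. -/
def heightForm (V₀ V₁ : M → Circle) (q : M × Circle) : TangentSpace SI q →ₗ[ℝ] ℝ :=
  (mfderiv SI 𝓘(ℝ, ℝ) (height V₀ V₁) q).toLinearMap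

theorem heightForm_apply (q : M × Circle) (F : TangentSpace SI q) :
    heightForm V₀ V₁ q F = dheight V₀ V₁ q F := rfl

theorem circle_re_sq_add (z : Circle) : (z : ℂ).re ^ 2 + (z : ℂ).im ^ 2 = 1 := by
  have := Circle.normSq_coe z
  rw [Complex.normSq_apply] at this
  linarith

theorem IsGlobalFrame.eq_zero_of_components (he : IsGlobalFrame e)
    (hV₀ : ContMDiff (𝓡 3) (𝓡 1) ∞ V₀) (hV₁ : ContMDiff (𝓡 3) (𝓡 1) ∞ V₁)
    (hV : NeverCollinear V₀ V₁) {m : M} {s : ℝ} (hs : s ∈ Icc (0 : ℝ) 1)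
    (F : TangentSpace SI (wedge V₀ V₁ (m, s))) (hR : he.along _ F = 0) (hP : he.across _ F = 0)
    (hQ : he.base 2 _ F = 0) (hH : heightForm V₀ V₁ _ F = 0) : F = 0 := by
  rw [IsGlobalFrame.along, LinearMap.add_apply, LinearMap.smul_apply, LinearMap.smul_apply,
    smul_eq_mul, smul_eq_mul] at hR
  rw [IsGlobalFrame.across, LinearMap.add_apply, LinearMap.smul_apply, LinearMap.smul_apply,
    smul_eq_mul, smul_eq_mul] at hP
  have hz := circle_re_sq_add (wedge V₀ V₁ (m, s)).2
  set x := ((wedge V₀ V₁ (m, s)).2 : ℂ).re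
  set y := ((wedge V₀ V₁ (m, s)).2 : ℂ).im
  have h0 : he.base 0 _ F = 0 := by linear_combination x * hR - y * hP - he.base 0 _ F * hz
  have h1 : he.base 1 _ F = 0 := by linear_combination y * hR + x * hP - he.base 1 _ F * hz
  have hb : dbase _ F = 0 := by
    refine he.ext_coframe fun k => ?_
    rw [map_zero]
    fin_cases k
    exacts [h0, h1, hQ]
  rw [heightForm_apply] at hH
  rw [← dwedge_dbase hV₀ hV₁ hV hs F, hb, hH]
  exact map_zero (mfderiv ((𝓡 3).prod 𝓘(ℝ, ℝ)) SI (wedge V₀ V₁) (m, s))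

theorem IsGlobalFrame.mem_canonical_iff (he : IsGlobalFrame e) {q : M × Circle}
    (F : TangentSpace SI q) : F ∈ canonical (e 0) (e 1) q ↔ he.across q F = 0 ∧ he.base 2 q F = 0 := by
  have hz := circle_re_sq_add q.2
  have h1 : F ∈ canonical (e 0) (e 1) q ↔ ∃ r : ℝ, r • rayVec (e 0) (e 1) q = dbase q F := by
    rw [canonical, Submodule.mem_comap, Submodule.mem_span_singleton]
    rfl
  have hray : ∀ k, he.coframe k q.1 (rayVec (e 0) (e 1) q) =
      ![(q.2 : ℂ).re, (q.2 : ℂ).im, 0] k := by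
    intro k
    rw [rayVec, map_add, map_smul, map_smul, he.coframe_frame, he.coframe_frame]
    fin_cases k <;> simp
  rw [h1, IsGlobalFrame.across, LinearMap.add_apply, LinearMap.smul_apply, LinearMap.smul_apply,
    smul_eq_mul, smul_eq_mul, he.base_apply, he.base_apply, he.base_apply]
  constructor
  · rintro ⟨r, hr⟩
    rw [← hr]
    simp only [map_smul, hray, smul_eq_mul, Matrix.cons_val]
    constructor <;> ring
  · rintro ⟨hP, hQ⟩
    set x := (q.2 : ℂ).re
    set y := (q.2 : ℂ).im
    refine ⟨x * he.coframe 0 q.1 (dbase q F) + y * he.coframe 1 q.1 (dbase q F), ?_⟩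
    refine he.ext_coframe fun k => ?_
    rw [map_smul, hray, smul_eq_mul]
    fin_cases k
    · simp
      linear_combination y * hP + he.coframe 0 q.1 (dbase q F) * hz
    · simp
      linear_combination -x * hP + he.coframe 1 q.1 (dbase q F) * hz
    · simpa using hQ.symm

theorem IsGlobalFrame.isGraph_canonical (he : IsGlobalFrame e) (q : M × Circle) :
    IsGraph (he.along q) (he.across q) (he.base 2 q) (heightForm V₀ V₁ q)
      (canonical (e 0) (e 1) q) (fun _ => 0) := by
  intro F
  rw [he.mem_canonical_iff]
  simp

theorem exists_local_components (he : IsGlobalFrame e)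
    (hV₀ : ContMDiff (𝓡 3) (𝓡 1) ∞ V₀) (hV₁ : ContMDiff (𝓡 3) (𝓡 1) ∞ V₁)
    (hV : NeverCollinear V₀ V₁) {ε : ℝ} {D : ℝ → ∀ q : M × Circle, Submodule ℝ (TangentSpace SI q)}
    (hD : IsSmoothFamily SI (Ioo (-ε) ε) (domain V₀ V₁) 2 D) {p₀ : (ℝ × ℝ) × M}
    (hp₀ : p₀ ∈ (Ioo (-ε) ε ×ˢ Icc (0 : ℝ) 1) ×ˢ (univ : Set M)) :
    ∃ U ∈ 𝓝 p₀, ∃ F : Fin 2 → ∀ p : (ℝ × ℝ) × M, TangentSpace SI (wedge V₀ V₁ (p.2, p.1.2)),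
      (∀ p ∈ (Ioo (-ε) ε ×ˢ Icc (0 : ℝ) 1) ×ˢ (univ : Set M) ∩ U,
        LinearIndependent ℝ (fun i => F i p) ∧
        D p.1.1 (wedge V₀ V₁ (p.2, p.1.2)) = Submodule.span ℝ (range fun i => F i p)) ∧
      ∀ i, ContMDiffWithinAt (𝓘(ℝ, ℝ × ℝ).prod (𝓡 3)) 𝓘(ℝ, ℝ) ∞
          (fun p => he.along _ (F i p)) ((Ioo (-ε) ε ×ˢ Icc (0 : ℝ) 1) ×ˢ (univ : Set M)) p₀ ∧
        ContMDiffWithinAt (𝓘(ℝ, ℝ × ℝ).prod (𝓡 3)) 𝓘(ℝ, ℝ) ∞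
          (fun p => he.across _ (F i p)) ((Ioo (-ε) ε ×ˢ Icc (0 : ℝ) 1) ×ˢ (univ : Set M)) p₀ ∧
        ContMDiffWithinAt (𝓘(ℝ, ℝ × ℝ).prod (𝓡 3)) 𝓘(ℝ, ℝ) ∞
          (fun p => he.base 2 _ (F i p)) ((Ioo (-ε) ε ×ˢ Icc (0 : ℝ) 1) ×ˢ (univ : Set M)) p₀ ∧
        ContMDiffWithinAt (𝓘(ℝ, ℝ × ℝ).prod (𝓡 3)) 𝓘(ℝ, ℝ) ∞
          (fun p => heightForm V₀ V₁ _ (F i p))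
          ((Ioo (-ε) ε ×ˢ Icc (0 : ℝ) 1) ×ˢ (univ : Set M)) p₀ := by
  set T := (Ioo (-ε) ε ×ˢ Icc (0 : ℝ) 1) ×ˢ (univ : Set M) with hT
  set g : (ℝ × ℝ) × M → M × Circle := fun p => wedge V₀ V₁ (p.2, p.1.2) with hg
  have hgs : ContMDiff (𝓘(ℝ, ℝ × ℝ).prod (𝓡 3)) SI ∞ g := by
    refine (contMDiff_wedge hV₀ hV₁ hV).comp (contMDiff_snd.prodMk ?_)
    exact (contDiff_snd.contMDiff (n := ∞)).comp contMDiff_fst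
  have hΓs : ContMDiff (𝓘(ℝ, ℝ × ℝ).prod (𝓡 3)) (𝓘(ℝ, ℝ).prod SI) ∞
      (fun p : (ℝ × ℝ) × M => (p.1.1, g p)) :=
    ((contDiff_fst.contMDiff (n := ∞)).comp contMDiff_fst).prodMk hgs
  have hgT : ∀ p ∈ T, g p ∈ domain V₀ V₁ := fun p hp => wedge_mem_domain hV hp.1.2
  obtain ⟨U, hU, F, hFs, hF⟩ := hD p₀.1.1 hp₀.1.1 (g p₀) (hgT p₀ hp₀)
  have hU' : (fun p : (ℝ × ℝ) × M => (p.1.1, g p)) ⁻¹' U ∈ 𝓝 p₀ :=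
    hΓs.continuous.continuousAt.preimage_mem_nhds hU
  refine ⟨_, hU', fun i p => F i p.1.1 (g p), fun p hp => hF (p.1.1, g p)
    ⟨hp.2, hp.1.1.1, hgT p hp.1⟩, fun i => ?_⟩
  set T' := T ∩ (fun p : (ℝ × ℝ) × M => (p.1.1, g p)) ⁻¹' U with hT'
  have hpT' : p₀ ∈ T' := ⟨hp₀, mem_of_mem_nhds hU'⟩
  have hTT : T' ∈ 𝓝[T] p₀ := inter_mem self_mem_nhdsWithin (mem_nhdsWithin_of_mem_nhds hU')
  have hsec : ContMDiffWithinAt (𝓘(ℝ, ℝ × ℝ).prod (𝓡 3)) SI.tangent ∞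
      (fun p => (⟨g p, F i p.1.1 (g p)⟩ : TangentBundle SI (M × Circle))) T' p₀ :=
    ContMDiffWithinAt.comp (t := U ∩ Ioo (-ε) ε ×ˢ domain V₀ V₁) (g := fun x : ℝ × (M × Circle) =>
      (⟨x.2, F i x.1 x.2⟩ : TangentBundle SI (M × Circle))) p₀
      (hFs i (p₀.1.1, g p₀) (show (p₀.1.1, g p₀) ∈ U ∩ Ioo (-ε) ε ×ˢ domain V₀ V₁ from
        ⟨hpT'.2, hp₀.1.1, hgT p₀ hp₀⟩)) hΓs.contMDiffAt.contMDiffWithinAt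
      (fun p hp => ⟨hp.2, hp.1.1.1, hgT p hp.1⟩)
  have hbase : ∀ k, ContMDiffWithinAt (𝓘(ℝ, ℝ × ℝ).prod (𝓡 3)) 𝓘(ℝ, ℝ) ∞
      (fun p => he.base k _ (F i p.1.1 (g p))) T' p₀ := fun k =>
    he.contMDiffWithinAt_coframe hpT' (contMDiffWithinAt_mfderiv_apply isOpen_univ
      contMDiff_fst.contMDiffOn hpT' (fun _ _ => trivial) hsec) k
  have hheight : ContMDiffWithinAt (𝓘(ℝ, ℝ × ℝ).prod (𝓡 3)) 𝓘(ℝ, ℝ) ∞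
      (fun p => heightForm V₀ V₁ _ (F i p.1.1 (g p))) T' p₀ :=
    contMDiffWithinAt_mfderiv_apply_vector (isOpen_height_domain hV₀)
      (fun q hq => (contMDiffAt_height hV₀ hV₁ hV hq).contMDiffWithinAt) hpT'
      (fun p hp => div_ne_neg_one_of_mem_domain hV (hgT p hp.1)) hsec
  have hz : ContMDiffWithinAt (𝓘(ℝ, ℝ × ℝ).prod (𝓡 3)) 𝓘(ℝ, ℂ) ∞
      (fun p => ((g p).2 : ℂ)) T' p₀ := by
    have := finrank_real_complex_fact'
    exact ((contMDiff_coe_sphere (E := ℂ) (n := 1) (m := ∞)).comp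
      (contMDiff_snd.comp hgs)).contMDiffAt.contMDiffWithinAt
  have hre : ContMDiffWithinAt (𝓘(ℝ, ℝ × ℝ).prod (𝓡 3)) 𝓘(ℝ, ℝ) ∞
      (fun p => ((g p).2 : ℂ).re) T' p₀ :=
    Complex.reCLM.contDiff.contMDiff.contMDiffAt.comp_contMDiffWithinAt p₀ hz
  have him : ContMDiffWithinAt (𝓘(ℝ, ℝ × ℝ).prod (𝓡 3)) 𝓘(ℝ, ℝ) ∞
      (fun p => ((g p).2 : ℂ).im) T' p₀ :=
    Complex.imCLM.contDiff.contMDiff.contMDiffAt.comp_contMDiffWithinAt p₀ hz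
  exact ⟨((hre.mul (hbase 0)).add (him.mul (hbase 1))).mono_of_mem_nhdsWithin hTT,
    ((him.neg.mul (hbase 0)).add (hre.mul (hbase 1))).mono_of_mem_nhdsWithin hTT,
    (hbase 2).mono_of_mem_nhdsWithin hTT, hheight.mono_of_mem_nhdsWithin hTT⟩

theorem exists_graph (he : IsGlobalFrame e)
    (hV₀ : ContMDiff (𝓡 3) (𝓡 1) ∞ V₀) (hV₁ : ContMDiff (𝓡 3) (𝓡 1) ∞ V₁)
    (hV : NeverCollinear V₀ V₁) {ε : ℝ} (hε : 0 < ε)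
    {D : ℝ → ∀ q : M × Circle, Submodule ℝ (TangentSpace SI q)}
    (hD : IsSmoothFamily SI (Ioo (-ε) ε) (domain V₀ V₁) 2 D)
    (hD0 : ∀ q ∈ domain V₀ V₁, D 0 q = canonical (e 0) (e 1) q) {K : Set M} (hK : IsCompact K)
    (hDK : ∀ t ∈ Ioo (-ε) ε, ∀ q ∈ domain V₀ V₁, q.1 ∉ K → D t q = canonical (e 0) (e 1) q) :
    ∃ δ > 0, δ ≤ ε ∧ ∃ c : Fin 4 → ℝ × ℝ → M → ℝ, (∀ j, SmallFamily δ K (c j)) ∧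
      ∀ τ ∈ Ioo (-δ) δ ×ˢ Icc (0 : ℝ) 1, ∀ m,
        IsGraph (he.along _) (he.across _) (he.base 2 _) (heightForm V₀ V₁ _)
          (D τ.1 (wedge V₀ V₁ (m, τ.2))) (fun j => c j τ m) ∧
        (D τ.1 (wedge V₀ V₁ (m, τ.2)) = canonical (e 0) (e 1) _ → ∀ j, c j τ m = 0) := by
  set G : ℝ × ℝ → M → (Fin 4 → ℝ) → Prop := fun τ m c =>
    IsGraph (he.along _) (he.across _) (he.base 2 _) (heightForm V₀ V₁ _)
          (D τ.1 (wedge V₀ V₁ (m, τ.2))) c with hG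
  set T := (Ioo (-ε) ε ×ˢ Icc (0 : ℝ) 1) ×ˢ (univ : Set M) with hT
  have hinj := fun (p : (ℝ × ℝ) × M) (hp : p ∈ T) =>
    he.eq_zero_of_components hV₀ hV₁ hV (m := p.2) hp.1.2
  have huniq : ∀ p ∈ T, ∀ c c', G p.1 p.2 c → G p.1 p.2 c' → c = c' := by
    intro p hp c c' hc hc'
    obtain ⟨U, hU, F, hF, -⟩ := exists_local_components he hV₀ hV₁ hV hD hp
    obtain ⟨hli, hsp⟩ := hF p ⟨hp, mem_of_mem_nhds hU⟩
    rw [hG] at hc hc'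
    simp only [hsp] at hc hc'
    have hμ := hc.minor_ne_zero (hinj p hp) hli
    rw [hc.eq_graphCoeff hμ, hc'.eq_graphCoeff hμ]
  have hloc : ∀ p₀ ∈ T, (∃ c, G p₀.1 p₀.2 c) → ∃ c : Fin 4 → (ℝ × ℝ) × M → ℝ,
      (∀ j, ContMDiffWithinAt (𝓘(ℝ, ℝ × ℝ).prod (𝓡 3)) 𝓘(ℝ, ℝ) ∞ (c j) T p₀) ∧
      ∀ᶠ p in 𝓝[T] p₀, G p.1 p.2 (fun j => c j p) := by
    rintro p₀ hp₀ ⟨c₀, hc₀⟩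
    obtain ⟨U, hU, F, hF, hFs⟩ := exists_local_components he hV₀ hV₁ hV hD hp₀
    obtain ⟨hli, hsp⟩ := hF p₀ ⟨hp₀, mem_of_mem_nhds hU⟩
    rw [hG] at hc₀
    simp only [hsp] at hc₀
    have hμ := hc₀.minor_ne_zero (hinj p₀ hp₀) hli
    have hμs := ((hFs 0).1.mul (hFs 1).2.2.2).sub ((hFs 1).1.mul (hFs 0).2.2.2)
    refine ⟨fun j p => graphCoeff (fun i => he.along _ (F i p)) (fun i => he.across _ (F i p))
      (fun i => he.base 2 _ (F i p)) (fun i => heightForm V₀ V₁ _ (F i p)) j, fun j => ?_, ?_⟩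
    · fin_cases j
      · exact (((hFs 0).2.1.mul (hFs 1).2.2.2).sub ((hFs 1).2.1.mul (hFs 0).2.2.2)).div₀ hμs hμ
      · exact (((hFs 0).1.mul (hFs 1).2.1).sub ((hFs 1).1.mul (hFs 0).2.1)).div₀ hμs hμ
      · exact (((hFs 0).2.2.1.mul (hFs 1).2.2.2).sub
          ((hFs 1).2.2.1.mul (hFs 0).2.2.2)).div₀ hμs hμ
      · exact (((hFs 0).1.mul (hFs 1).2.2.1).sub ((hFs 1).1.mul (hFs 0).2.2.1)).div₀ hμs hμ
    · filter_upwards [hμs.continuousWithinAt.eventually_ne hμ, self_mem_nhdsWithin,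
        mem_nhdsWithin_of_mem_nhds hU] with p hp1 hp2 hp3
      rw [hG]
      simp only [(hF p ⟨hp2, hp3⟩).2]
      exact isGraph_span (hinj p hp2) hp1
  have hzero : ∀ p ∈ T, D p.1.1 (wedge V₀ V₁ (p.2, p.1.2)) = canonical (e 0) (e 1) _ →
      G p.1 p.2 (fun _ => 0) := by
    intro p hp h
    rw [hG]
    simp only [h]
    exact he.isGraph_canonical _
  have key : ∀ᶠ t in 𝓝 (0 : ℝ), ∀ q ∈ Icc (0 : ℝ) 1 ×ˢ K,
      (t ∈ Ioo (-ε) ε → q.1 ∈ Icc (0 : ℝ) 1 → ∃ c, G (t, q.1) q.2 c) := by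
    refine (isCompact_Icc.prod hK).eventually_forall_of_forall_eventually ?_
    rintro ⟨s, m⟩ ⟨hs, -⟩
    have hp : ((0, s), m) ∈ T := ⟨⟨⟨by linarith, hε⟩, hs⟩, trivial⟩
    obtain ⟨c, -, hc⟩ := hloc _ hp ⟨_, hzero _ hp (hD0 _ (wedge_mem_domain hV hs))⟩
    rw [eventually_nhdsWithin_iff] at hc
    have h2 : Continuous (fun z : ℝ × ℝ × M => ((z.1, z.2.1), z.2.2)) := by fun_prop
    filter_upwards [h2.continuousAt.eventually hc] with z hz ht hs
    exact ⟨_, hz ⟨⟨ht, hs⟩, trivial⟩⟩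
  obtain ⟨δ, hδ, hball⟩ := Metric.eventually_nhds_iff.1 key
  have hex : ∀ τ ∈ Ioo (-min δ ε) (min δ ε) ×ˢ Icc (0 : ℝ) 1, ∀ m, ∃ c, G τ m c := by
    rintro ⟨t, s⟩ ⟨ht, hs'⟩ m
    simp only at ht hs'
    have htε : t ∈ Ioo (-ε) ε :=
      Ioo_subset_Ioo (by linarith [min_le_right δ ε]) (min_le_right _ _) ht
    by_cases hm : m ∈ K
    · refine hball (y := t) ?_ (s, m) ⟨hs', hm⟩ htε hs'
      rw [Real.dist_eq, sub_zero, abs_lt]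
      exact ⟨by linarith [ht.1, min_le_left δ ε], ht.2.trans_le (min_le_left _ _)⟩
    · exact ⟨_, hzero ((t, s), m) ⟨⟨htε, hs'⟩, trivial⟩
        (hDK t htε _ (wedge_mem_domain hV hs') hm)⟩
  have hsub : Ioo (-min δ ε) (min δ ε) ×ˢ Icc (0 : ℝ) 1 ⊆ Ioo (-ε) ε ×ˢ Icc (0 : ℝ) 1 :=
    prod_mono_left (Ioo_subset_Ioo (by linarith [min_le_right δ ε]) (min_le_right _ _))
  classical
  set c : ℝ × ℝ → M → Fin 4 → ℝ := fun τ m => if h : ∃ c, G τ m c then h.choose else 0 with hc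
  have hcG : ∀ τ m, (∃ c, G τ m c) → G τ m (c τ m) := by
    intro τ m h
    rw [hc]
    simp only [dif_pos h]
    exact h.choose_spec
  have hc0 : ∀ p ∈ T, D p.1.1 (wedge V₀ V₁ (p.2, p.1.2)) = canonical (e 0) (e 1) _ →
      ∀ j, c p.1 p.2 j = 0 := fun p hp h j =>
    congrFun (huniq p hp _ _ (hcG _ _ ⟨_, hzero p hp h⟩) (hzero p hp h)) j
  refine ⟨min δ ε, lt_min hδ hε, min_le_right _ _, fun j τ m => c τ m j, fun j => ⟨?_, ?_, ?_⟩,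
    fun τ hτ m => ⟨hcG τ m (hex τ hτ m), hc0 (τ, m) ⟨hsub hτ, trivial⟩⟩⟩
  · intro p hp
    have hpT : p ∈ T := ⟨hsub hp.1, trivial⟩
    obtain ⟨c', hc's, hc'⟩ := hloc p hpT (hex p.1 hp.1 p.2)
    have hst : (Ioo (-min δ ε) (min δ ε) ×ˢ Icc (0 : ℝ) 1) ×ˢ (univ : Set M) ⊆ T :=
      prod_mono_left hsub
    have hev : ∀ᶠ p' in 𝓝[(Ioo (-min δ ε) (min δ ε) ×ˢ Icc (0 : ℝ) 1) ×ˢ (univ : Set M)] p,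
        c p'.1 p'.2 j = c' j p' := by
      filter_upwards [nhdsWithin_mono p hst hc', self_mem_nhdsWithin] with p' h1 h2
      exact congrFun (huniq p' (hst h2) _ _ (hcG _ _ ⟨_, h1⟩) h1) j
    exact ((hc's j).mono hst).congr_of_eventuallyEq hev (hev.self_of_nhdsWithin hp)
  · intro s hs m
    exact hc0 ((0, s), m) ⟨⟨⟨by linarith, hε⟩, hs⟩, trivial⟩ (hD0 _ (wedge_mem_domain hV hs)) j
  · intro τ hτ m hm
    exact hc0 (τ, m) ⟨hsub hτ, trivial⟩
      (hDK τ.1 (hsub hτ).1 _ (wedge_mem_domain hV hτ.2) hm) j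

end Graph
end Engel

namespace Engel

open Set Filter

section Fields

variable {M : Type*} [TopologicalSpace M] [ChartedSpace E3 M] [IsManifold (𝓡 3) ∞ M]
  {V₀ V₁ : M → Circle} {e : Fin 3 → ∀ m : M, TangentSpace (𝓡 3) m}

/-- The components of the ray at height `τ.2` over `m`. -/
def rayComp (V₀ V₁ : M → Circle) (k : Fin 3) (τ : ℝ × ℝ) (m : M) : ℝ :=
  ![((wedge V₀ V₁ (m, τ.2)).2 : ℂ).re, ((wedge V₀ V₁ (m, τ.2)).2 : ℂ).im, 0] k

theorem smoothFamily_rayComp (hV₀ : ContMDiff (𝓡 3) (𝓡 1) ∞ V₀) (hV₁ : ContMDiff (𝓡 3) (𝓡 1) ∞ V₁)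
    (hV : NeverCollinear V₀ V₁) (δ : ℝ) (k : Fin 3) : SmoothFamily δ (rayComp V₀ V₁ k) := by
  have hz : ContMDiff (𝓘(ℝ, ℝ × ℝ).prod (𝓡 3)) 𝓘(ℝ, ℂ) ∞
      (fun p : (ℝ × ℝ) × M => ((wedge V₀ V₁ (p.2, p.1.2)).2 : ℂ)) := by
    have := finrank_real_complex_fact'
    refine (contMDiff_coe_sphere (E := ℂ) (n := 1) (m := ∞)).comp
      (contMDiff_snd.comp ((contMDiff_wedge hV₀ hV₁ hV).comp (contMDiff_snd.prodMk ?_)))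
    exact (contDiff_snd.contMDiff (n := ∞)).comp contMDiff_fst
  fin_cases k
  · exact (Complex.reCLM.contDiff.contMDiff.comp hz).contMDiffOn
  · exact (Complex.imCLM.contDiff.contMDiff.comp hz).contMDiffOn
  · exact SmoothFamily.const 0

theorem rayComp_sq_add (τ : ℝ × ℝ) (m : M) :
    rayComp V₀ V₁ 0 τ m ^ 2 + rayComp V₀ V₁ 1 τ m ^ 2 = 1 := circle_re_sq_add _

theorem hasDerivAt_rayComp (k : Fin 3) (t s : ℝ) (m : M) :
    HasDerivAt (fun s => rayComp V₀ V₁ k (t, s) m)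
      (![-(angle V₀ V₁ m * rayComp V₀ V₁ 1 (t, s) m), angle V₀ V₁ m * rayComp V₀ V₁ 0 (t, s) m, 0] k)
      s := by
  have h1 : ∀ s : ℝ, ((wedge V₀ V₁ (m, s)).2 : ℂ) =
      V₀ m * Complex.exp ((s : ℂ) * ((angle V₀ V₁ m : ℂ) * Complex.I)) := by
    intro s
    rw [wedge, Circle.coe_mul, Circle.coe_exp]
    push_cast
    rw [mul_assoc (s : ℂ)]
  have h2 : HasDerivAt (fun s : ℝ => ((wedge V₀ V₁ (m, s)).2 : ℂ))
      (((wedge V₀ V₁ (m, s)).2 : ℂ) * ((angle V₀ V₁ m : ℂ) * Complex.I)) s := by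
    simp only [h1]
    have h3 : HasDerivAt (fun s : ℝ => (s : ℂ) * ((angle V₀ V₁ m : ℂ) * Complex.I))
        ((angle V₀ V₁ m : ℂ) * Complex.I) s := by
      simpa using (Complex.ofRealCLM.hasDerivAt (x := s)).mul_const
        ((angle V₀ V₁ m : ℂ) * Complex.I)
    simpa [mul_assoc] using h3.cexp.const_mul (V₀ m : ℂ)
  fin_cases k
  · refine (Complex.reCLM.hasFDerivAt.comp_hasDerivAt s h2).congr_deriv ?_
    change (((wedge V₀ V₁ (m, s)).2 : ℂ) * ((angle V₀ V₁ m : ℂ) * Complex.I)).re =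
      -(angle V₀ V₁ m * ((wedge V₀ V₁ (m, s)).2 : ℂ).im)
    simp
    ring
  · refine (Complex.imCLM.hasFDerivAt.comp_hasDerivAt s h2).congr_deriv ?_
    change (((wedge V₀ V₁ (m, s)).2 : ℂ) * ((angle V₀ V₁ m : ℂ) * Complex.I)).im =
      angle V₀ V₁ m * ((wedge V₀ V₁ (m, s)).2 : ℂ).re
    simp
    ring
  · exact hasDerivAt_const s (0 : ℝ)

theorem dS_rayComp (k : Fin 3) {τ : ℝ × ℝ} (hτ : τ.2 ∈ Icc (0 : ℝ) 1) (m : M) :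
    dS (rayComp V₀ V₁ k) τ m =
      ![-(angle V₀ V₁ m * rayComp V₀ V₁ 1 τ m), angle V₀ V₁ m * rayComp V₀ V₁ 0 τ m, 0] k :=
  (hasDerivAt_rayComp k τ.1 τ.2 m).hasDerivWithinAt.derivWithin
    (uniqueDiffOn_Icc zero_lt_one τ.2 hτ)

/-- Fields `a` and `b` such that the planes `D` are spanned by `b` and `∂ₛ + a`. -/
structure IsPlaneData (he : IsGlobalFrame e) (V₀ V₁ : M → Circle)
    (D : ℝ → ∀ q : M × Circle, Submodule ℝ (TangentSpace SI q)) (δ : ℝ) (K : Set M)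
    (a b : Fin 3 → ℝ × ℝ → M → ℝ) : Prop where
  small_left : ∀ k, SmallFamily δ K (a k)
  small_right : ∀ k, SmallFamily δ K (fun τ m => b k τ m - rayComp V₀ V₁ k τ m)
  ne_zero : ∀ τ ∈ Ioo (-δ) δ ×ˢ Icc (0 : ℝ) 1, ∀ m, b 0 τ m ^ 2 + b 1 τ m ^ 2 ≠ 0
  mem_iff : ∀ τ ∈ Ioo (-δ) δ ×ˢ Icc (0 : ℝ) 1, ∀ m, ∀ F,
    F ∈ D τ.1 (wedge V₀ V₁ (m, τ.2)) ↔ ∃ r : ℝ, ∀ k, he.base k _ F =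
      r * b k τ m + heightForm V₀ V₁ _ F * a k τ m
  eq_of_canonical : ∀ τ ∈ Ioo (-δ) δ ×ˢ Icc (0 : ℝ) 1, ∀ m,
    D τ.1 (wedge V₀ V₁ (m, τ.2)) = canonical (e 0) (e 1) _ →
      ∀ k, a k τ m = 0 ∧ b k τ m = rayComp V₀ V₁ k τ m

theorem IsPlaneData.mono {he : IsGlobalFrame e}
    {D : ℝ → ∀ q : M × Circle, Submodule ℝ (TangentSpace SI q)} {δ δ' : ℝ} {K : Set M}
    {a b : Fin 3 → ℝ × ℝ → M → ℝ} (h : IsPlaneData he V₀ V₁ D δ K a b) (hδ : δ' ≤ δ) :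
    IsPlaneData he V₀ V₁ D δ' K a b := by
  have hs : Ioo (-δ') δ' ×ˢ Icc (0 : ℝ) 1 ⊆ Ioo (-δ) δ ×ˢ Icc (0 : ℝ) 1 :=
    prod_mono_left (Ioo_subset_Ioo (by linarith) hδ)
  exact ⟨fun k => (h.small_left k).mono hδ, fun k => (h.small_right k).mono hδ,
    fun τ hτ => h.ne_zero τ (hs hτ), fun τ hτ => h.mem_iff τ (hs hτ),
    fun τ hτ => h.eq_of_canonical τ (hs hτ)⟩

theorem exists_isPlaneData (he : IsGlobalFrame e)
    (hV₀ : ContMDiff (𝓡 3) (𝓡 1) ∞ V₀) (hV₁ : ContMDiff (𝓡 3) (𝓡 1) ∞ V₁)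
    (hV : NeverCollinear V₀ V₁) {ε : ℝ} (hε : 0 < ε)
    {D : ℝ → ∀ q : M × Circle, Submodule ℝ (TangentSpace SI q)}
    (hD : IsSmoothFamily SI (Ioo (-ε) ε) (domain V₀ V₁) 2 D)
    (hD0 : ∀ q ∈ domain V₀ V₁, D 0 q = canonical (e 0) (e 1) q) {K : Set M} (hK : IsCompact K)
    (hDK : ∀ t ∈ Ioo (-ε) ε, ∀ q ∈ domain V₀ V₁, q.1 ∉ K → D t q = canonical (e 0) (e 1) q) :
    ∃ δ > 0, δ ≤ ε ∧ ∃ a b, IsPlaneData he V₀ V₁ D δ K a b := by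
  obtain ⟨δ, hδ, hδε, c, hc, hg⟩ := exists_graph he hV₀ hV₁ hV hε hD hD0 hK hDK
  have hr := smoothFamily_rayComp hV₀ hV₁ hV δ
  set x := rayComp V₀ V₁ 0 with hx
  set y := rayComp V₀ V₁ 1 with hy
  refine ⟨δ, hδ, hδε, ![fun τ m => -(y τ m * c 1 τ m), fun τ m => x τ m * c 1 τ m, c 3],
    ![fun τ m => x τ m + -(y τ m * c 0 τ m), fun τ m => y τ m + x τ m * c 0 τ m, c 2],
    fun k => ?_, fun k => ?_, fun τ hτ m => ?_, fun τ hτ m F => ?_, fun τ hτ m hcan k => ?_⟩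
  · fin_cases k
    exacts [(SmallFamily.mul_left (hr 1) (hc 1)).neg, SmallFamily.mul_left (hr 0) (hc 1), hc 3]
  · fin_cases k
    · simpa [← hx] using (SmallFamily.mul_left (hr 1) (hc 0)).neg
    · simpa [← hy] using SmallFamily.mul_left (hr 0) (hc 0)
    · simpa [rayComp] using hc 2
  · have h1 := rayComp_sq_add (V₀ := V₀) (V₁ := V₁) τ m
    simp only [Matrix.cons_val]
    have : (x τ m + -(y τ m * c 0 τ m)) ^ 2 + (y τ m + x τ m * c 0 τ m) ^ 2 = 1 + c 0 τ m ^ 2 := by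
      rw [← hx, ← hy] at h1
      linear_combination (1 + c 0 τ m ^ 2) * h1
    rw [this]
    positivity
  · rw [(hg τ hτ m).1 F]
    have h1 := rayComp_sq_add (V₀ := V₀) (V₁ := V₁) τ m
    rw [← hx, ← hy] at h1
    have hR : he.along _ F = x τ m * he.base 0 _ F + y τ m * he.base 1 _ F := rfl
    have hP : he.across _ F = -y τ m * he.base 0 _ F + x τ m * he.base 1 _ F := rfl
    simp only [hR, hP, Fin.forall_fin_succ, Fin.succ_zero_eq_one, Fin.succ_one_eq_two, Matrix.cons_val]
    set h := heightForm V₀ V₁ _ F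
    set b0 := he.base 0 _ F
    set b1 := he.base 1 _ F
    constructor
    · rintro ⟨h2, h3⟩
      refine ⟨x τ m * b0 + y τ m * b1, ?_, ?_, ?_, fun i => i.elim0⟩
      · linear_combination -(y τ m) * h2 - b0 * h1
      · linear_combination (x τ m) * h2 - b1 * h1
      · linear_combination h3
    · rintro ⟨r, h2, h3, h4, -⟩
      rw [h4]
      constructor
      · rw [h2, h3]
        linear_combination h * c 1 τ m * h1
      · rw [h2, h3]
        linear_combination -(c 2 τ m) * r * h1
  · have h0 := (hg τ hτ m).2 hcan
    fin_cases k
    · simp [h0, hx]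
    · simp [h0, hy]
    · simp [h0, rayComp]

end Fields

section Rotation

variable {M : Type*} [TopologicalSpace M] [ChartedSpace E3 M] [IsManifold (𝓡 3) ∞ M] [T2Space M]
  {V₀ V₁ : M → Circle} {e : Fin 3 → ∀ m : M, TangentSpace (𝓡 3) m}

theorem IsPlaneData.smooth_right {he : IsGlobalFrame e}
    {D : ℝ → ∀ q : M × Circle, Submodule ℝ (TangentSpace SI q)} {δ : ℝ} {K : Set M}
    {a b : Fin 3 → ℝ × ℝ → M → ℝ} (h : IsPlaneData he V₀ V₁ D δ K a b)
    (hV₀ : ContMDiff (𝓡 3) (𝓡 1) ∞ V₀) (hV₁ : ContMDiff (𝓡 3) (𝓡 1) ∞ V₁)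
    (hV : NeverCollinear V₀ V₁) (k : Fin 3) : SmoothFamily δ (b k) :=
  ((h.small_right k).smooth.add (smoothFamily_rayComp hV₀ hV₁ hV δ k)).congr
    fun τ _ m => by simp

theorem dS_eq_of_sub_eq_zero {g h : ℝ × ℝ → M → ℝ} {τ : ℝ × ℝ} {m : M} (hτ : τ.2 ∈ Icc (0 : ℝ) 1)
    (hgh : ∀ s ∈ Icc (0 : ℝ) 1, g (τ.1, s) m - h (τ.1, s) m = 0) : dS g τ m = dS h τ m :=
  dS_congr hτ fun s hs => sub_eq_zero.1 (hgh s hs)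

/-- The one-form that vanishes on `b` and on the commutator of `∂ₛ + a` and `b`. -/
theorem exists_form (he : IsGlobalFrame e)
    (hV₀ : ContMDiff (𝓡 3) (𝓡 1) ∞ V₀) (hV₁ : ContMDiff (𝓡 3) (𝓡 1) ∞ V₁)
    (hV : NeverCollinear V₀ V₁) {ε : ℝ} (hε : 0 < ε) {K : Set M} (hK : IsCompact K)
    {D : ℝ → ∀ q : M × Circle, Submodule ℝ (TangentSpace SI q)}
    {a b : Fin 3 → ℝ × ℝ → M → ℝ} (hab : IsPlaneData he V₀ V₁ D ε K a b) :
    ∃ δ > 0, δ ≤ ε ∧ ∃ α : Fin 3 → ℝ × ℝ → M → ℝ, SmallFamily δ K (α 0) ∧ SmallFamily δ K (α 1) ∧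
      (∀ τ m, α 2 τ m = 1) ∧
      (∀ τ ∈ Ioo (-δ) δ ×ˢ Icc (0 : ℝ) 1, ∀ m, ∑ k, α k τ m * b k τ m = 0) ∧
      (∀ τ ∈ Ioo (-δ) δ ×ˢ Icc (0 : ℝ) 1, ∀ m, ∑ k, α k τ m * he.commutator a b k τ m = 0) ∧
      (∀ τ ∈ Ioo (-δ) δ ×ˢ Icc (0 : ℝ) 1, ∀ m, b 2 τ m = 0 → he.commutator a b 2 τ m = 0 →
        α 0 τ m = 0 ∧ α 1 τ m = 0) := by
  have ha := hab.small_left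
  have hb := hab.smooth_right hV₀ hV₁ hV
  set C := he.commutator a b with hC
  have hCs : ∀ k, SmoothFamily ε (C k) := he.smooth_commutator (fun k => (ha k).smooth) hb
  set β := angle V₀ V₁ with hβ
  have hβs : SmoothFamily ε (fun _ => β) := SmoothFamily.of_contMDiff (contMDiff_angle hV₀ hV₁ hV)
  set cr : ℝ × ℝ → M → ℝ := fun τ m => b 0 τ m * C 1 τ m - b 1 τ m * C 0 τ m with hcr
  have hcrs : SmoothFamily ε cr := ((hb 0).mul (hCs 1)).sub ((hb 1).mul (hCs 0))
  have hdec : ∀ k, SmallFamily ε K (fun τ m => C k τ m - dS (b k) τ m) := by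
    intro k
    have h1 : ∀ i, SmallFamily ε K
        (fun τ m => a i τ m * dX (e i) (b k) τ m - b i τ m * dX (e i) (a k) τ m) := fun i => by
      have h2 := SmallFamily.mul_left ((hb k).dX (he.smooth i)) (ha i)
      have h3 := (SmallFamily.mul_left (hb i) ((ha k).dX hK.isClosed (he.smooth i))).neg
      simpa [sub_eq_add_neg, mul_comm] using h2.add h3
    have h2 : ∀ i j, SmallFamily ε K
        (fun τ m => a i τ m * b j τ m * he.structFun i j k m) := fun i j => by
      have := SmallFamily.mul_left ((hb j).mul (he.smooth_structFun ε i j k)) (ha i)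
      convert this using 3
      ring
    have h3 : ∀ g : Fin 3 → ℝ × ℝ → M → ℝ, (∀ i, SmallFamily ε K (g i)) →
        SmallFamily ε K (fun τ m => ∑ i, g i τ m) := fun g hg => by
      simp only [Fin.sum_univ_three]
      exact ((hg 0).add (hg 1)).add (hg 2)
    have h4 := (h3 _ h1).add (h3 _ fun i => h3 _ (h2 i))
    convert h4 using 3 with τ m
    rw [hC, IsGlobalFrame.commutator]
    ring
  have hpos : ∀ τ m, τ.2 ∈ Icc (0 : ℝ) 1 → (∀ k, C k τ m - dS (b k) τ m = 0) →
      (∀ k, ∀ s ∈ Icc (0 : ℝ) 1, b k (τ.1, s) m - rayComp V₀ V₁ k (τ.1, s) m = 0) →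
      0 < cr τ m * β m := by
    intro τ m hs h1 h2
    have h3 : ∀ k, C k τ m = _ := fun k =>
      ((sub_eq_zero.1 (h1 k)).trans (dS_eq_of_sub_eq_zero hs (h2 k))).trans (dS_rayComp k hs m)
    have h4 : ∀ k, b k τ m = rayComp V₀ V₁ k τ m := fun k => sub_eq_zero.1 (h2 k τ.2 hs)
    rw [hcr]
    simp only [h3, h4, Matrix.cons_val]
    have h5 := rayComp_sq_add (V₀ := V₀) (V₁ := V₁) τ m
    have h6 : 0 < angle V₀ V₁ m ^ 2 := sq_pos_of_ne_zero (angle_ne_zero hV m)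
    rw [hβ]
    nlinarith
  obtain ⟨δ, hδ, hδε, hcrpos⟩ := exists_forall_pos hε hK (hcrs.mul hβs)
    (fun s hs m => hpos (0, s) m hs (fun k => (hdec k).zero s hs m)
      fun k r hr => (hab.small_right k).zero r hr m)
    (fun τ hτ m hm => hpos τ m hτ.2 (fun k => (hdec k).support τ hτ m hm)
      fun k r hr => (hab.small_right k).support (τ.1, r) ⟨hτ.1, hr⟩ m hm)
  have hcr0 : ∀ τ ∈ Ioo (-δ) δ ×ˢ Icc (0 : ℝ) 1, ∀ m, cr τ m ≠ 0 := fun τ hτ m h0 => by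
    have := hcrpos τ hτ m
    simp [h0] at this
  have hb2 : SmallFamily ε K (b 2) := by
    simpa [rayComp] using hab.small_right 2
  have hC2 : SmallFamily ε K (C 2) := by
    have := (hdec 2).add hb2.dS
    simpa using this
  have hinv := (hcrs.mono hδε).inv hcr0
  have hsm : ∀ i, SmallFamily δ K
      (fun τ m => (cr τ m)⁻¹ * (b i τ m * C 2 τ m + -(C i τ m * b 2 τ m))) := fun i =>
    SmallFamily.mul_left hinv (((SmallFamily.mul_left (hb i) hC2).add
      (SmallFamily.mul_left (hCs i) hb2).neg).mono hδε)
  refine ⟨δ, hδ, hδε, ![fun τ m => (cr τ m)⁻¹ * (b 1 τ m * C 2 τ m + -(C 1 τ m * b 2 τ m)),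
    fun τ m => -((cr τ m)⁻¹ * (b 0 τ m * C 2 τ m + -(C 0 τ m * b 2 τ m))), fun _ _ => 1],
    hsm 1, (hsm 0).neg, fun _ _ => rfl, fun τ hτ m => ?_, fun τ hτ m => ?_, fun τ hτ m h1 h2 => ?_⟩
  · have h0 := hcr0 τ hτ m
    simp only [Fin.sum_univ_three, Matrix.cons_val]
    field_simp
    rw [hcr]
    ring
  · have h0 := hcr0 τ hτ m
    simp only [Fin.sum_univ_three, Matrix.cons_val]
    field_simp
    rw [hcr]
    ring
  · simp [h1, h2]

end Rotation
end Engel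

namespace Engel

open Set Filter

section Sections

variable {E : Type*} [NormedAddCommGroup E] [NormedSpace ℝ E] {H : Type*} [TopologicalSpace H]
  {I : ModelWithCorners ℝ E H} {N : Type*} [TopologicalSpace N] [ChartedSpace H N]
  [IsManifold I ∞ N]
  {E₁ : Type*} [NormedAddCommGroup E₁] [NormedSpace ℝ E₁] {H₁ : Type*} [TopologicalSpace H₁]
  {I₁ : ModelWithCorners ℝ E₁ H₁} {N₁ : Type*} [TopologicalSpace N₁] [ChartedSpace H₁ N₁]
  [IsManifold I₁ ∞ N₁]
  {E' : Type*} [NormedAddCommGroup E'] [NormedSpace ℝ E'] {H' : Type*} [TopologicalSpace H']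
  {J : ModelWithCorners ℝ E' H'} {P : Type*} [TopologicalSpace P] [ChartedSpace H' P]

theorem contMDiffWithinAt_section_prod {g : P → N} {v : ∀ p, TangentSpace I (g p)} {g₁ : P → N₁}
    {v₁ : ∀ p, TangentSpace I₁ (g₁ p)} {s : Set P} {p : P}
    (h : ContMDiffWithinAt J I.tangent ∞ (fun p => (⟨g p, v p⟩ : TangentBundle I N)) s p)
    (h₁ : ContMDiffWithinAt J I₁.tangent ∞ (fun p => (⟨g₁ p, v₁ p⟩ : TangentBundle I₁ N₁)) s p) :
    ContMDiffWithinAt J (I.prod I₁).tangent ∞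
      (fun p => (⟨(g p, g₁ p), (v p, v₁ p)⟩ : TangentBundle (I.prod I₁) (N × N₁))) s p :=
  (contMDiff_equivTangentBundleProd_symm (I := I) (M := N) (I' := I₁) (M' := N₁)
    (n := ∞)).contMDiffAt.comp_contMDiffWithinAt p (h.prodMk h₁)

theorem contMDiffWithinAt_section_const {g : P → N} {s : Set P} {p : P}
    (h : ContMDiffWithinAt J I ∞ g s p) :
    ContMDiffWithinAt J I.tangent ∞ (fun p => (⟨g p, 0⟩ : TangentBundle I N)) s p :=
  (Bundle.contMDiff_zeroSection ℝ (TangentSpace I : N → Type _)).contMDiffAt.comp_contMDiffWithinAt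
    p h

theorem contMDiffWithinAt_section_vector {g : P → E₁} {v : P → E₁} {s : Set P} {p : P}
    (h : ContMDiffWithinAt J 𝓘(ℝ, E₁) ∞ g s p) (hv : ContMDiffWithinAt J 𝓘(ℝ, E₁) ∞ v s p)
    (hp : p ∈ s) :
    ContMDiffWithinAt J 𝓘(ℝ, E₁).tangent ∞ (fun p => (⟨g p, v p⟩ : TangentBundle 𝓘(ℝ, E₁) E₁)) s p := by
  refine (contMDiffWithinAt_tangent_iff (I := 𝓘(ℝ, E₁)) (m₀ := g p) (s := s) hp
    (fun p' _ => by rw [extChartAt_model_space_eq_id]; trivial)).2 ⟨h, ?_⟩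
  refine hv.congr (fun p' hp' => ?_) ?_ <;>
  · rw [dchart, extChartAt_model_space_eq_id]
    simp
    rfl

/-- The differential of a smooth map takes smooth sections to smooth sections. -/
theorem contMDiffWithinAt_mfderivWithin_apply {f : N → N₁} {U : Set N} (hU : UniqueMDiffOn I U)
    (hf : ContMDiffOn I I₁ ∞ f U) {g : P → N} {v : ∀ p, TangentSpace I (g p)} {s : Set P} {p : P}
    (hp : p ∈ s) (hg : MapsTo g s U)
    (hv : ContMDiffWithinAt J I.tangent ∞ (fun p => (⟨g p, v p⟩ : TangentBundle I N)) s p) :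
    ContMDiffWithinAt J I₁.tangent ∞
      (fun p => (⟨f (g p), mfderivWithin I I₁ f U (g p) (v p)⟩ : TangentBundle I₁ N₁)) s p := by
  have h1 := hf.contMDiffOn_tangentMapWithin (m := ∞) (by simp) hU
  exact (h1 ⟨g p, v p⟩ (hg hp)).comp p hv (fun p' hp' => hg hp')

end Sections

section Maps

variable {M : Type*} [TopologicalSpace M] [ChartedSpace E3 M] [IsManifold (𝓡 3) ∞ M]
  {e : Fin 3 → ∀ m : M, TangentSpace (𝓡 3) m} {δ : ℝ}

theorem uniqueMDiffOn_family : UniqueMDiffOn (𝓘(ℝ, ℝ × ℝ).prod (𝓡 3))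
    ((Ioo (-δ) δ ×ˢ Icc (0 : ℝ) 1) ×ˢ (univ : Set M)) :=
  (SmoothFamily.uniqueDiffOn (δ := δ)).uniqueMDiffOn.prod uniqueMDiffOn_univ

theorem SmoothMapFamily.contMDiffOn_mfderiv {G : ℝ × ℝ → M → M} (hG : SmoothMapFamily δ G)
    (he : IsGlobalFrame e) {b : Fin 3 → ℝ × ℝ → M → ℝ} (hb : ∀ k, SmoothFamily δ (b k)) :
    ContMDiffOn (𝓘(ℝ, ℝ × ℝ).prod (𝓡 3)) (𝓡 3).tangent ∞
      (fun p : (ℝ × ℝ) × M => (⟨G p.1 p.2, mfderiv (𝓡 3) (𝓡 3) (G p.1) p.2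
        (∑ k, b k p.1 p.2 • e k p.2)⟩ : TangentBundle (𝓡 3) M))
      ((Ioo (-δ) δ ×ˢ Icc 0 1) ×ˢ univ) := by
  set T := (Ioo (-δ) δ ×ˢ Icc (0 : ℝ) 1) ×ˢ (univ : Set M) with hT
  intro p hp
  have h1 : ContMDiffWithinAt (𝓘(ℝ, ℝ × ℝ).prod (𝓡 3)) (𝓡 3).tangent ∞
      (fun p : (ℝ × ℝ) × M => (⟨p.2, ∑ k, b k p.1 p.2 • e k p.2⟩ : TangentBundle (𝓡 3) M)) T p :=
    he.contMDiffWithinAt_sum (g := fun p : (ℝ × ℝ) × M => p.2)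
      (c := fun k p => b k p.1 p.2) hp contMDiffWithinAt_snd (fun k => hb k p hp)
  have h2 := contMDiffWithinAt_section_prod (contMDiffWithinAt_section_const
    (contMDiffWithinAt_fst (I := 𝓘(ℝ, ℝ × ℝ)) (J := 𝓡 3) (n := ∞) (s := T) (p := p))) h1
  have h3 := contMDiffWithinAt_mfderivWithin_apply uniqueMDiffOn_family hG hp (fun p hp => hp) h2
  have key : ∀ p ∈ T, ∀ v : TangentSpace (𝓡 3) p.2,
      mfderivWithin (𝓘(ℝ, ℝ × ℝ).prod (𝓡 3)) (𝓡 3) (fun p : (ℝ × ℝ) × M => G p.1 p.2) T p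
        ((0, v) : (ℝ × ℝ) × E3) = mfderiv (𝓡 3) (𝓡 3) (G p.1) p.2 v := by
    intro p hp v
    have h4 := ((hG p hp).mdifferentiableWithinAt (by simp)).hasMFDerivWithinAt
    have h5 : HasMFDerivAt (𝓡 3) (𝓘(ℝ, ℝ × ℝ).prod (𝓡 3)) (fun m : M => (p.1, m)) p.2 _ :=
      (hasMFDerivAt_const p.1 p.2).prodMk (hasMFDerivAt_id p.2)
    have h6 := h4.comp p.2 h5.hasMFDerivWithinAt (s := univ)
      (show univ ⊆ (fun m : M => (p.1, m)) ⁻¹' T from fun m _ => ⟨hp.1, trivial⟩)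
    rw [hasMFDerivWithinAt_univ] at h6
    have h7 := h6.mfderiv
    exact (DFunLike.congr_fun h7 v).symm
  refine h3.congr (fun p' hp' => ?_) ?_
  · exact congrArg (fun v => (⟨G p'.1 p'.2, v⟩ : TangentBundle (𝓡 3) M)) (key p' hp' _).symm
  · exact congrArg (fun v => (⟨G p.1 p.2, v⟩ : TangentBundle (𝓡 3) M)) (key p hp _).symm

theorem SmoothMapFamily.contMDiffOn_slice {G : ℝ × ℝ → M → M} (hG : SmoothMapFamily δ G) {t : ℝ}
    (ht : t ∈ Ioo (-δ) δ) : ContMDiffOn (𝓘(ℝ, ℝ).prod (𝓡 3)) (𝓡 3) ∞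
      (fun x : ℝ × M => G (t, x.1) x.2) (Icc 0 1 ×ˢ univ) := by
  have h1 : ContMDiff (𝓘(ℝ, ℝ).prod (𝓡 3)) (𝓘(ℝ, ℝ × ℝ).prod (𝓡 3)) ∞
      (fun x : ℝ × M => ((t, x.1), x.2)) := by
    refine ContMDiff.prodMk ?_ contMDiff_snd
    exact (contDiff_const.prodMk contDiff_id).contMDiff.comp contMDiff_fst
  exact ContMDiffOn.comp (g := fun p : (ℝ × ℝ) × M => G p.1 p.2) hG h1.contMDiffOn
    (fun x hx => ⟨⟨ht, hx.1⟩, trivial⟩)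

theorem SmoothFamily.contMDiffOn_slice_prod {g : ℝ × ℝ → M → ℝ} (hg : SmoothFamily δ g) {t : ℝ}
    (ht : t ∈ Ioo (-δ) δ) : ContMDiffOn (𝓘(ℝ, ℝ).prod (𝓡 3)) 𝓘(ℝ, ℝ) ∞
      (fun x : ℝ × M => g (t, x.1) x.2) (Icc 0 1 ×ˢ univ) := by
  have h1 : ContMDiff (𝓘(ℝ, ℝ).prod (𝓡 3)) (𝓘(ℝ, ℝ × ℝ).prod (𝓡 3)) ∞
      (fun x : ℝ × M => ((t, x.1), x.2)) := by
    refine ContMDiff.prodMk ?_ contMDiff_snd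
    exact (contDiff_const.prodMk contDiff_id).contMDiff.comp contMDiff_fst
  exact ContMDiffOn.comp (g := fun p : (ℝ × ℝ) × M => g p.1 p.2) hg h1.contMDiffOn
    (fun x hx => ⟨⟨ht, hx.1⟩, trivial⟩)

/-- The differential of the inverse of a flow. -/
theorem hasMFDerivWithinAt_right {K : Set M} {F G : ℝ × ℝ → M → M} (h : IsIsotopy δ K F G)
    {w : ℝ → ∀ m : M, TangentSpace (𝓡 3) m} {t : ℝ} (ht : t ∈ Ioo (-δ) δ)
    (hw : ∀ m, IsSol w (fun s => F (t, s) m)) {s : ℝ} (hs : s ∈ Icc (0 : ℝ) 1) (m : M) :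
    ∃ g' : E3 × ℝ →L[ℝ] E3, HasMFDerivWithinAt ((𝓡 3).prod 𝓘(ℝ, ℝ)) (𝓡 3)
      (fun x : M × ℝ => G (t, x.2) x.1) (univ ×ˢ Icc 0 1) (m, s) g' ∧
      ∀ (v : TangentSpace (𝓡 3) m) (c : ℝ),
        g' ((v, c) : E3 × ℝ) = mfderiv (𝓡 3) (𝓡 3) (G (t, s)) m (v - c • w s m) := by
  have h0 : ContMDiffOn ((𝓡 3).prod 𝓘(ℝ, ℝ)) (𝓡 3) ∞ (fun x : M × ℝ => G (t, x.2) x.1)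
      (univ ×ˢ Icc 0 1) :=
    ContMDiffOn.comp (g := fun x : ℝ × M => G (t, x.1) x.2) (h.smooth_right.contMDiffOn_slice ht)
      (contMDiff_snd.prodMk contMDiff_fst).contMDiffOn (fun x hx => ⟨hx.2, trivial⟩)
  obtain ⟨g', h1⟩ : ∃ g' : E3 × ℝ →L[ℝ] E3, HasMFDerivWithinAt ((𝓡 3).prod 𝓘(ℝ, ℝ)) (𝓡 3)
      (fun x : M × ℝ => G (t, x.2) x.1) (univ ×ˢ Icc 0 1) (m, s) g' :=
    ⟨_, ((h0 (m, s) ⟨trivial, hs⟩).mdifferentiableWithinAt (by simp)).hasMFDerivWithinAt⟩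
  have hspace : ∀ v : TangentSpace (𝓡 3) m,
      g' ((v, 0) : E3 × ℝ) = mfderiv (𝓡 3) (𝓡 3) (G (t, s)) m v := by
    intro v
    have h5 : HasMFDerivAt (𝓡 3) ((𝓡 3).prod 𝓘(ℝ, ℝ)) (fun m : M => (m, s)) m _ :=
      (hasMFDerivAt_id m).prodMk (hasMFDerivAt_const s m)
    have h6 := h1.comp m h5.hasMFDerivWithinAt (s := univ)
      (show univ ⊆ (fun m : M => (m, s)) ⁻¹' (univ ×ˢ Icc (0 : ℝ) 1) from
        fun m _ => ⟨trivial, hs⟩)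
    rw [hasMFDerivWithinAt_univ] at h6
    exact (DFunLike.congr_fun h6.mfderiv v).symm
  have htime : g' ((w s m, 1) : E3 × ℝ) = 0 := by
    obtain ⟨m', rfl⟩ : ∃ m', F (t, s) m' = m := ⟨_, h.right_inv (t, s) ⟨ht, hs⟩ m⟩
    have h5 : HasMFDerivWithinAt 𝓘(ℝ, ℝ) ((𝓡 3).prod 𝓘(ℝ, ℝ)) (fun r : ℝ => (F (t, r) m', r))
        (Icc 0 1) s _ := (hw m' s hs).prodMk
      (hasMFDerivAt_id s).hasMFDerivWithinAt
    have h6 := HasMFDerivWithinAt.comp (f := fun r : ℝ => (F (t, r) m', r)) s h1 h5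
      (fun r hr => ⟨trivial, hr⟩)
    have h7 : HasMFDerivWithinAt 𝓘(ℝ, ℝ) (𝓡 3) (fun _ : ℝ => m') (Icc 0 1) s _ :=
      h6.congr_mono (fun r hr => (h.left_inv (t, r) ⟨ht, hr⟩ m').symm)
        (h.left_inv (t, s) ⟨ht, hs⟩ m').symm subset_rfl
    have hu : UniqueMDiffWithinAt 𝓘(ℝ, ℝ) (Icc (0 : ℝ) 1) s :=
      uniqueMDiffWithinAt_iff_uniqueDiffWithinAt.2 (uniqueDiffOn_Icc zero_lt_one s hs)
    have h8 := h7.mfderivWithin hu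
    rw [mfderivWithin_const] at h8
    have h9 := DFunLike.congr_fun h8 (1 : ℝ)
    have h10 : g' (((1 : ℝ) • w s (F (t, s) m'), (1 : ℝ)) : E3 × ℝ) = 0 := h9.symm
    rwa [one_smul] at h10
  refine ⟨g', h1, fun v c => ?_⟩
  rw [← hspace]
  have h2 : ∀ v u : E3, g' (v, c) = g' (v - c • u, 0) + c • g' (u, 1) := by
    intro v u
    rw [← map_smul, ← map_add]
    simp
  exact (h2 v (w s m)).trans (by rw [htime, smul_zero, add_zero]; rfl)

end Maps
end Engel

namespace Engel

open Set Filter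

section Model

variable {M : Type*} [TopologicalSpace M] [ChartedSpace E3 M] [IsManifold (𝓡 3) ∞ M] [T2Space M]
  {V₀ V₁ : M → Circle} {e : Fin 3 → ∀ m : M, TangentSpace (𝓡 3) m}

/-- The components of the projections by `G` of the vectors `b`. -/
def IsGlobalFrame.pushComp (he : IsGlobalFrame e) (b : Fin 3 → ℝ × ℝ → M → ℝ) (G : ℝ × ℝ → M → M)
    (k : Fin 3) (τ : ℝ × ℝ) (m : M) : ℝ :=
  he.coframe k (G τ m) (mfderiv (𝓡 3) (𝓡 3) (G τ) m (∑ j, b j τ m • e j m))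

/-- The directions of the projections by `G` of the vectors `b`. -/
def IsGlobalFrame.direction (he : IsGlobalFrame e) (b : Fin 3 → ℝ × ℝ → M → ℝ)
    (G : ℝ × ℝ → M → M) (τ : ℝ × ℝ) (m : M) : Circle :=
  toCircle ⟨he.pushComp b G 0 τ m, he.pushComp b G 1 τ m⟩

/-- The map of `M × Circle` that projects along the flow and keeps track of the direction. -/
def IsGlobalFrame.develop (he : IsGlobalFrame e) (V₀ V₁ : M → Circle) (b : Fin 3 → ℝ × ℝ → M → ℝ)
    (G : ℝ × ℝ → M → M) (t : ℝ) (q : M × Circle) : M × Circle :=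
  (G (t, height V₀ V₁ q) q.1, he.direction b G (t, height V₀ V₁ q) q.1)

/-- The horizontal component of a tangent vector over `m`. -/
def dbaseAt (V₀ V₁ : M → Circle) (m : M) (s : ℝ) (v : TangentSpace SI (wedge V₀ V₁ (m, s))) :
    TangentSpace (𝓡 3) m := dbase (wedge V₀ V₁ (m, s)) v

/-- The planes `D` on the domain between `V₀` and `V₁`, together with the fields `a`, `b` that span
them and isotopies that straighten them. -/
structure IsModel (he : IsGlobalFrame e) (V₀ V₁ : M → Circle)
    (D : ℝ → ∀ q : M × Circle, Submodule ℝ (TangentSpace SI q)) (δ : ℝ) (K : Set M)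
    (a b : Fin 3 → ℝ × ℝ → M → ℝ) (F G : ℝ × ℝ → M → M) : Prop where
  smooth_bottom : ContMDiff (𝓡 3) (𝓡 1) ∞ V₀
  smooth_top : ContMDiff (𝓡 3) (𝓡 1) ∞ V₁
  never : NeverCollinear V₀ V₁
  plane : IsPlaneData he V₀ V₁ D δ K a b
  straight : IsStraightening he δ K a b F G
  isCompact : IsCompact K

namespace IsModel

variable {he : IsGlobalFrame e} {D : ℝ → ∀ q : M × Circle, Submodule ℝ (TangentSpace SI q)} {δ : ℝ}
  {K : Set M} {a b : Fin 3 → ℝ × ℝ → M → ℝ} {F G : ℝ × ℝ → M → M}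

theorem mono (h : IsModel he V₀ V₁ D δ K a b F G) {δ' : ℝ} (hδ : δ' ≤ δ) :
    IsModel he V₀ V₁ D δ' K a b F G := by
  have hs : Ioo (-δ') δ' ×ˢ Icc (0 : ℝ) 1 ⊆ Ioo (-δ) δ ×ˢ Icc (0 : ℝ) 1 :=
    prod_mono_left (Ioo_subset_Ioo (by linarith) hδ)
  refine ⟨h.1, h.2, h.3, h.4.mono hδ, ⟨h.straight.toIsIsotopy.mono hδ, ?_,
    fun τ hτ => h.straight.coframe_mfderiv τ (hs hτ)⟩, h.isCompact⟩
  obtain ⟨w, h1, h2, h3⟩ := h.straight.exists_velocity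
  exact ⟨w, fun k => (h1 k).mono hδ, fun t ht => h2 t (Ioo_subset_Ioo (by linarith) hδ ht),
    fun τ hτ => h3 τ (hs hτ)⟩

theorem smooth_b (h : IsModel he V₀ V₁ D δ K a b F G) (k : Fin 3) : SmoothFamily δ (b k) :=
  h.plane.smooth_right h.smooth_bottom h.smooth_top h.never k

theorem smooth_pushComp (h : IsModel he V₀ V₁ D δ K a b F G) (k : Fin 3) :
    SmoothFamily δ (he.pushComp b G k) := fun p hp =>
  he.contMDiffWithinAt_coframe hp (h.straight.smooth_right.contMDiffOn_mfderiv he h.smooth_b p hp) k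

theorem mfderiv_injective (h : IsModel he V₀ V₁ D δ K a b F G) {τ : ℝ × ℝ}
    (hτ : τ ∈ Ioo (-δ) δ ×ˢ Icc (0 : ℝ) 1) (m : M) {v : TangentSpace (𝓡 3) m}
    (hv : mfderiv (𝓡 3) (𝓡 3) (G τ) m v = 0) : v = 0 := by
  obtain ⟨m, rfl⟩ : ∃ m', F τ m' = m := ⟨_, h.straight.right_inv τ hτ m⟩
  rw [← h.straight.toIsIsotopy.mfderiv_right_inv hτ m v, hv]
  exact map_zero (mfderiv (𝓡 3) (𝓡 3) (F τ) m)

theorem pushComp_two (h : IsModel he V₀ V₁ D δ K a b F G) {τ : ℝ × ℝ}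
    (hτ : τ ∈ Ioo (-δ) δ ×ˢ Icc (0 : ℝ) 1) (m : M) : he.pushComp b G 2 τ m = 0 :=
  h.straight.coframe_mfderiv τ hτ m

theorem pushComp_ne_zero (h : IsModel he V₀ V₁ D δ K a b F G) {τ : ℝ × ℝ}
    (hτ : τ ∈ Ioo (-δ) δ ×ˢ Icc (0 : ℝ) 1) (m : M) :
    (⟨he.pushComp b G 0 τ m, he.pushComp b G 1 τ m⟩ : ℂ) ≠ 0 := by
  intro h0
  have h1 : he.pushComp b G 0 τ m = 0 := congrArg Complex.re h0
  have h2 : he.pushComp b G 1 τ m = 0 := congrArg Complex.im h0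
  have h3 : mfderiv (𝓡 3) (𝓡 3) (G τ) m (∑ j, b j τ m • e j m) = 0 := by
    refine he.ext_coframe fun k => ?_
    rw [map_zero]
    fin_cases k
    exacts [h1, h2, h.pushComp_two hτ m]
  have h4 := h.mfderiv_injective hτ m h3
  have h5 : ∀ k, b k τ m = 0 := fun k => by
    rw [← he.coframe_sum (m := m) (fun j => b j τ m) k, h4, map_zero]
  exact h.plane.ne_zero τ hτ m (by rw [h5, h5]; ring)

theorem mfderiv_eq_smul_rayVec (h : IsModel he V₀ V₁ D δ K a b F G) {τ : ℝ × ℝ}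
    (hτ : τ ∈ Ioo (-δ) δ ×ˢ Icc (0 : ℝ) 1) (m : M) : ∃ c : ℝ, 0 < c ∧
    mfderiv (𝓡 3) (𝓡 3) (G τ) m (∑ j, b j τ m • e j m) =
      c • rayVec (e 0) (e 1) (G τ m, he.direction b G τ m) := by
  refine ⟨‖(⟨he.pushComp b G 0 τ m, he.pushComp b G 1 τ m⟩ : ℂ)‖,
    norm_pos_iff.2 (h.pushComp_ne_zero hτ m), ?_⟩
  set u : ℂ := ⟨he.pushComp b G 0 τ m, he.pushComp b G 1 τ m⟩ with hu
  have h1 := coe_toCircle (u := u)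
  rw [← he.sum_coframe (mfderiv (𝓡 3) (𝓡 3) (G τ) m (∑ j, b j τ m • e j m)), Fin.sum_univ_three]
  change he.pushComp b G 0 τ m • e 0 _ + he.pushComp b G 1 τ m • e 1 _ +
    he.pushComp b G 2 τ m • e 2 _ = _
  rw [h.pushComp_two hτ, zero_smul, add_zero, rayVec, smul_add, smul_smul, smul_smul]
  have h2 : ‖u‖ * (toCircle u : ℂ).re = he.pushComp b G 0 τ m := by
    rw [← Complex.re_ofReal_mul, h1]
  have h3 : ‖u‖ * (toCircle u : ℂ).im = he.pushComp b G 1 τ m := by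
    rw [← Complex.im_ofReal_mul, h1]
  rw [← h2, ← h3]
  rfl

theorem contMDiffOn_direction (h : IsModel he V₀ V₁ D δ K a b F G) :
    ContMDiffOn (𝓘(ℝ, ℝ × ℝ).prod (𝓡 3)) (𝓡 1) ∞
      (fun p : (ℝ × ℝ) × M => he.direction b G p.1 p.2) ((Ioo (-δ) δ ×ˢ Icc 0 1) ×ˢ univ) := by
  intro p hp
  have h1 : ContMDiffWithinAt (𝓘(ℝ, ℝ × ℝ).prod (𝓡 3)) 𝓘(ℝ, ℂ) ∞
      (fun p : (ℝ × ℝ) × M => (⟨he.pushComp b G 0 p.1 p.2, he.pushComp b G 1 p.1 p.2⟩ : ℂ))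
      ((Ioo (-δ) δ ×ˢ Icc 0 1) ×ˢ univ) p := by
    have h2 := ((h.smooth_pushComp 0) p hp).prodMk_space ((h.smooth_pushComp 1) p hp)
    exact (Complex.equivRealProdCLM.symm.contDiff.contMDiff.contMDiffAt).comp_contMDiffWithinAt p h2
  exact (contMDiffAt_toCircle (h.pushComp_ne_zero hp.1 p.2)).comp_contMDiffWithinAt p h1

theorem pushComp_eq_rayComp (h : IsModel he V₀ V₁ D δ K a b F G) {τ : ℝ × ℝ}
    (hτ : τ ∈ Ioo (-δ) δ ×ˢ Icc (0 : ℝ) 1) {m : M} (hm : τ.1 = 0 ∨ m ∉ K) (k : Fin 3) :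
    he.pushComp b G k τ m = rayComp V₀ V₁ k τ m := by
  have h1 : G τ =ᶠ[𝓝 m] id := by
    rcases hm with h0 | hm
    · refine Eventually.of_forall fun m => ?_
      obtain ⟨t, s⟩ := τ
      obtain rfl : t = 0 := h0
      exact h.straight.zero_right s hτ.2 m
    · filter_upwards [h.isCompact.isClosed.isOpen_compl.mem_nhds hm] with m' hm'
      exact h.straight.support_right τ hτ m' hm'
  have h2 : ∀ j, b j τ m = rayComp V₀ V₁ j τ m := by
    intro j
    rw [← sub_eq_zero]
    rcases hm with h0 | hm
    · obtain ⟨t, s⟩ := τ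
      obtain rfl : t = 0 := h0
      exact (h.plane.small_right j).zero s hτ.2 m
    · exact (h.plane.small_right j).support τ hτ m hm
  have h3 : G τ m = m := h1.self_of_nhds
  rw [IsGlobalFrame.pushComp, h1.mfderiv_eq, mfderiv_id, ← h2 k]
  rw [← he.coframe_sum (m := m) (fun j => b j τ m) k]
  have h4 : ∀ (m' : M) (v : E3), m' = m → he.coframe k m' (v : TangentSpace (𝓡 3) m') =
      he.coframe k m (v : TangentSpace (𝓡 3) m) := by
    rintro m' v rfl; rfl
  exact h4 _ _ h3

theorem direction_eq (h : IsModel he V₀ V₁ D δ K a b F G) {τ : ℝ × ℝ}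
    (hτ : τ ∈ Ioo (-δ) δ ×ˢ Icc (0 : ℝ) 1) {m : M} (hm : τ.1 = 0 ∨ m ∉ K) :
    he.direction b G τ m = (wedge V₀ V₁ (m, τ.2)).2 := by
  rw [IsGlobalFrame.direction, h.pushComp_eq_rayComp hτ hm, h.pushComp_eq_rayComp hτ hm,
    ← toCircle_coe (wedge V₀ V₁ (m, τ.2)).2]
  rfl

theorem develop_wedge (h : IsModel he V₀ V₁ D δ K a b F G) (t : ℝ) {s : ℝ}
    (hs : s ∈ Icc (0 : ℝ) 1) (m : M) :
    he.develop V₀ V₁ b G t (wedge V₀ V₁ (m, s)) = (G (t, s) m, he.direction b G (t, s) m) := by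
  rw [IsGlobalFrame.develop, height_wedge h.never (abs_mul_angle_lt h.never hs m)]
  rfl

theorem contMDiffOn_develop (h : IsModel he V₀ V₁ D δ K a b F G) :
    ContMDiffOn (𝓘(ℝ, ℝ).prod SI) SI ∞
      (fun x : ℝ × (M × Circle) => he.develop V₀ V₁ b G x.1 x.2)
      (Ioo (-δ) δ ×ˢ domain V₀ V₁) := by
  have h1 : ContMDiffOn (𝓘(ℝ, ℝ).prod SI) (𝓘(ℝ, ℝ × ℝ).prod (𝓡 3)) ∞
      (fun x : ℝ × (M × Circle) => ((x.1, height V₀ V₁ x.2), x.2.1))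
      (Ioo (-δ) δ ×ˢ domain V₀ V₁) := by
    intro x hx
    have h2 := (contMDiffAt_height h.smooth_bottom h.smooth_top h.never
      (div_ne_neg_one_of_mem_domain h.never hx.2)).comp_contMDiffWithinAt x
      (contMDiffWithinAt_snd (I := 𝓘(ℝ, ℝ)) (s := Ioo (-δ) δ ×ˢ domain V₀ V₁))
    exact (contMDiffWithinAt_fst.prodMk_space h2).prodMk
      (contMDiff_fst.contMDiffAt.comp_contMDiffWithinAt x contMDiffWithinAt_snd)
  have h2 : MapsTo (fun x : ℝ × (M × Circle) => ((x.1, height V₀ V₁ x.2), x.2.1))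
      (Ioo (-δ) δ ×ˢ domain V₀ V₁) ((Ioo (-δ) δ ×ˢ Icc (0 : ℝ) 1) ×ˢ univ) := fun x hx =>
    ⟨⟨hx.1, (mem_domain_iff h.never x.2).1 hx.2⟩, trivial⟩
  have h3 := ContMDiffOn.comp (g := fun p : (ℝ × ℝ) × M => G p.1 p.2)
    h.straight.smooth_right h1 h2
  have h4 := ContMDiffOn.comp (g := fun p : (ℝ × ℝ) × M => he.direction b G p.1 p.2)
      h.contMDiffOn_direction h1 h2
  exact h3.prodMk h4

theorem contMDiffOn_develop_slice (h : IsModel he V₀ V₁ D δ K a b F G) {t : ℝ}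
    (ht : t ∈ Ioo (-δ) δ) :
    ContMDiffOn SI SI ∞ (he.develop V₀ V₁ b G t) (domain V₀ V₁) :=
  ContMDiffOn.comp (g := fun x : ℝ × (M × Circle) => he.develop V₀ V₁ b G x.1 x.2)
    h.contMDiffOn_develop (f := fun q => (t, q))
    (contMDiff_const.prodMk contMDiff_id).contMDiffOn (fun _ hq => ⟨ht, hq⟩)

/-- The differential of the projection along the flow. -/
theorem hasMFDerivWithinAt_develop_fst (h : IsModel he V₀ V₁ D δ K a b F G)
    {w : Fin 3 → ℝ × ℝ → M → ℝ} {t : ℝ} (ht : t ∈ Ioo (-δ) δ)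
    (hw : ∀ m, IsSol (fun s m => ∑ k, w k (t, s) m • e k m) (fun s => F (t, s) m)) {s : ℝ}
    (hs : s ∈ Icc (0 : ℝ) 1) (m : M) :
    ∃ p' : TangentSpace SI (wedge V₀ V₁ (m, s)) →L[ℝ] E3, HasMFDerivWithinAt SI (𝓡 3)
      (fun q => (he.develop V₀ V₁ b G t q).1) (domain V₀ V₁) (wedge V₀ V₁ (m, s)) p' ∧
      ∀ v, p' v = mfderiv (𝓡 3) (𝓡 3) (G (t, s)) m
        (dbaseAt V₀ V₁ m _ v - dheight V₀ V₁ _ v • ∑ k, w k (t, s) m • e k m) := by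
  obtain ⟨g', h1, h2⟩ := hasMFDerivWithinAt_right h.straight.toIsIsotopy ht hw hs m
  have h3 : HasMFDerivAt SI ((𝓡 3).prod 𝓘(ℝ, ℝ)) (fun q : M × Circle => (q.1, height V₀ V₁ q))
      (wedge V₀ V₁ (m, s)) _ :=
    (hasMFDerivAt_fst (I := 𝓡 3) (I' := 𝓡 1) (wedge V₀ V₁ (m, s))).prodMk
      ((contMDiffAt_height h.smooth_bottom h.smooth_top h.never
        (wedge_div_ne_neg_one h.never (m := m) hs)).mdifferentiableAt (by simp)).hasMFDerivAt
  have h4 : ((wedge V₀ V₁ (m, s)).1, height V₀ V₁ (wedge V₀ V₁ (m, s))) = (m, s) :=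
    Prod.ext rfl (height_wedge h.never (abs_mul_angle_lt h.never hs m))
  rw [← h4] at h1
  have h5 := HasMFDerivWithinAt.comp (f := fun q : M × Circle => (q.1, height V₀ V₁ q))
    (wedge V₀ V₁ (m, s)) h1 h3.hasMFDerivWithinAt
    (show domain V₀ V₁ ⊆ _ from fun q hq => ⟨trivial, (mem_domain_iff h.never q).1 hq⟩)
  refine ⟨_, h5, fun v => ?_⟩
  have h6 := h2 (dbaseAt V₀ V₁ m s v) (dheight V₀ V₁ _ v)
  rw [← h6, dbaseAt, dbase, (hasMFDerivAt_fst (I := 𝓡 3) (I' := 𝓡 1) (wedge V₀ V₁ (m, s))).mfderiv]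
  rfl

theorem mem_plane_iff (h : IsModel he V₀ V₁ D δ K a b F G)
    {w : Fin 3 → ℝ × ℝ → M → ℝ}
    (hwa : ∀ τ ∈ Ioo (-δ) δ ×ˢ Icc (0 : ℝ) 1, ∀ m, ∃ c : ℝ, ∀ k, w k τ m - a k τ m = c * b k τ m)
    {τ : ℝ × ℝ} (hτ : τ ∈ Ioo (-δ) δ ×ˢ Icc (0 : ℝ) 1) (m : M)
    (v : TangentSpace SI (wedge V₀ V₁ (m, τ.2))) :
    v ∈ D τ.1 (wedge V₀ V₁ (m, τ.2)) ↔
      ∃ r : ℝ, mfderiv (𝓡 3) (𝓡 3) (G τ) m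
        (dbaseAt V₀ V₁ m _ v - dheight V₀ V₁ _ v • ∑ k, w k τ m • e k m) =
          r • rayVec (e 0) (e 1) (G τ m, he.direction b G τ m) := by
  obtain ⟨c, hc⟩ := hwa τ hτ m
  obtain ⟨ρ, hρ, hray⟩ := h.mfderiv_eq_smul_rayVec hτ m
  have h1 : ∀ r : ℝ, (∀ k, he.base k _ v = r * b k τ m + heightForm V₀ V₁ _ v * a k τ m) ↔
      dbaseAt V₀ V₁ m _ v - dheight V₀ V₁ _ v • ∑ k, w k τ m • e k m =
        (r - dheight V₀ V₁ _ v * c) • ∑ k, b k τ m • e k m := by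
    intro r
    constructor
    · intro hr
      refine he.ext_coframe fun k => ?_
      have h2 := hr k
      rw [he.base_apply, heightForm_apply] at h2
      have h3 := he.coframe_sum (m := m) (fun j => w j τ m) k
      have h4 := he.coframe_sum (m := m) (fun j => b j τ m) k
      rw [map_sub, map_smul, map_smul]
      refine (congrArg₂ (fun x y => x - _ • y) h2 h3).trans (Eq.trans ?_
        (congrArg (fun y => _ • y) h4).symm)
      simp only [smul_eq_mul]
      linear_combination -dheight V₀ V₁ _ v * hc k
    · intro hr k
      have h2 := congrArg (he.coframe k m) hr
      have h3 := he.coframe_sum (m := m) (fun j => w j τ m) k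
      have h4 := he.coframe_sum (m := m) (fun j => b j τ m) k
      rw [map_sub, map_smul, map_smul] at h2
      rw [he.base_apply, heightForm_apply]
      have h5 : he.coframe k m (dbaseAt V₀ V₁ m _ v) - dheight V₀ V₁ _ v * w k τ m =
          (r - dheight V₀ V₁ _ v * c) * b k τ m := by
        rw [← h3, ← h4]
        exact h2
      change he.coframe k m (dbaseAt V₀ V₁ m _ v) = _
      linear_combination h5 + dheight V₀ V₁ _ v * hc k
  rw [h.plane.mem_iff τ hτ m v]
  constructor
  · rintro ⟨r, hr⟩
    refine ⟨(r - dheight V₀ V₁ _ v * c) * ρ, ?_⟩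
    rw [(h1 r).1 hr, map_smul, hray, smul_smul]
  · rintro ⟨r, hr⟩
    refine ⟨r / ρ + dheight V₀ V₁ _ v * c, (h1 _).2 ?_⟩
    rw [add_sub_cancel_right, ← sub_eq_zero]
    refine h.mfderiv_injective hτ m ?_
    rw [map_sub, hr, map_smul, hray, smul_smul, div_mul_cancel₀ _ hρ.ne', sub_self]

end IsModel

end Model
end Engel

namespace Engel

open Set Filter

section Rotation

variable {M : Type*} [TopologicalSpace M] [ChartedSpace E3 M] [IsManifold (𝓡 3) ∞ M] [T2Space M]
  {V₀ V₁ : M → Circle} {e : Fin 3 → ∀ m : M, TangentSpace (𝓡 3) m}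

/-- The direction at height `τ.2` on the leaf labelled by `m`. -/
def IsGlobalFrame.leafDirection (he : IsGlobalFrame e) (b : Fin 3 → ℝ × ℝ → M → ℝ)
    (F G : ℝ × ℝ → M → M) (τ : ℝ × ℝ) (m : M) : Circle :=
  he.direction b G τ (F τ m)

/-- The angle by which the direction on the leaf labelled by `m` has turned at height `τ.2`. -/
def IsGlobalFrame.turning (he : IsGlobalFrame e) (b : Fin 3 → ℝ × ℝ → M → ℝ)
    (F G : ℝ × ℝ → M → M) (τ : ℝ × ℝ) (m : M) : ℝ :=
  Complex.arg ((he.leafDirection b F G τ m / he.leafDirection b F G (τ.1, 0) m : Circle) : ℂ)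

/-- The directions turn monotonically along the leaves, by less than a half-turn. -/
structure IsTurning (he : IsGlobalFrame e) (V₀ V₁ : M → Circle) (δ : ℝ)
    (b : Fin 3 → ℝ × ℝ → M → ℝ) (F G : ℝ × ℝ → M → M) : Prop where
  ne_neg_one : ∀ τ ∈ Ioo (-δ) δ ×ˢ Icc (0 : ℝ) 1, ∀ m,
    he.leafDirection b F G τ m / he.leafDirection b F G (τ.1, 0) m ≠ -1
  smooth : SmoothFamily δ (he.turning b F G)
  pos : ∀ τ ∈ Ioo (-δ) δ ×ˢ Icc (0 : ℝ) 1, ∀ m,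
    0 < dS (he.turning b F G) τ m * angle V₀ V₁ m

namespace IsModel

variable {he : IsGlobalFrame e} {D : ℝ → ∀ q : M × Circle, Submodule ℝ (TangentSpace SI q)} {δ : ℝ}
  {K : Set M} {a b : Fin 3 → ℝ × ℝ → M → ℝ} {F G : ℝ × ℝ → M → M}

theorem contMDiffOn_leafDirection (h : IsModel he V₀ V₁ D δ K a b F G) :
    ContMDiffOn (𝓘(ℝ, ℝ × ℝ).prod (𝓡 3)) (𝓡 1) ∞
      (fun p : (ℝ × ℝ) × M => he.leafDirection b F G p.1 p.2)
      ((Ioo (-δ) δ ×ˢ Icc 0 1) ×ˢ univ) :=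
  ContMDiffOn.comp (g := fun p : (ℝ × ℝ) × M => he.direction b G p.1 p.2)
    (f := fun p : (ℝ × ℝ) × M => (p.1, F p.1 p.2)) h.contMDiffOn_direction
    (contMDiff_fst.contMDiffOn.prodMk h.straight.smooth_left) (fun _ hp => ⟨hp.1, trivial⟩)

theorem contMDiffOn_leafDirection_const (h : IsModel he V₀ V₁ D δ K a b F G) {s : ℝ}
    (hs : s ∈ Icc (0 : ℝ) 1) :
    ContMDiffOn (𝓘(ℝ, ℝ × ℝ).prod (𝓡 3)) (𝓡 1) ∞
      (fun p : (ℝ × ℝ) × M => he.leafDirection b F G (p.1.1, s) p.2)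
      ((Ioo (-δ) δ ×ˢ Icc 0 1) ×ˢ univ) := by
  have h1 : ContMDiff (𝓘(ℝ, ℝ × ℝ).prod (𝓡 3)) (𝓘(ℝ, ℝ × ℝ).prod (𝓡 3)) ∞
      (fun p : (ℝ × ℝ) × M => ((p.1.1, s), p.2)) := by
    refine ContMDiff.prodMk ?_ contMDiff_snd
    exact (contDiff_fst.prodMk contDiff_const).contMDiff.comp contMDiff_fst
  exact ContMDiffOn.comp (g := fun p : (ℝ × ℝ) × M => he.leafDirection b F G p.1 p.2)
    (f := fun p : (ℝ × ℝ) × M => ((p.1.1, s), p.2))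
    h.contMDiffOn_leafDirection h1.contMDiffOn (fun p hp => ⟨⟨hp.1.1, hs⟩, trivial⟩)

theorem contMDiffOn_edge (h : IsModel he V₀ V₁ D δ K a b F G) {s : ℝ}
    (hs : s ∈ Icc (0 : ℝ) 1) :
    ContMDiffOn (𝓘(ℝ, ℝ).prod (𝓡 3)) (𝓡 1) ∞
      (fun x : ℝ × M => he.leafDirection b F G (x.1, s) x.2) (Ioo (-δ) δ ×ˢ univ) := by
  have h1 : ContMDiff (𝓘(ℝ, ℝ).prod (𝓡 3)) (𝓘(ℝ, ℝ × ℝ).prod (𝓡 3)) ∞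
      (fun x : ℝ × M => ((x.1, s), x.2)) := by
    refine ContMDiff.prodMk ?_ contMDiff_snd
    exact (contDiff_id.prodMk contDiff_const).contMDiff.comp contMDiff_fst
  exact ContMDiffOn.comp (g := fun p : (ℝ × ℝ) × M => he.leafDirection b F G p.1 p.2)
    (f := fun x : ℝ × M => ((x.1, s), x.2))
    h.contMDiffOn_leafDirection h1.contMDiffOn (fun p hp => ⟨⟨hp.1, hs⟩, trivial⟩)

theorem leafDirection_eq (h : IsModel he V₀ V₁ D δ K a b F G) {τ : ℝ × ℝ}
    (hτ : τ ∈ Ioo (-δ) δ ×ˢ Icc (0 : ℝ) 1) {m : M} (hm : τ.1 = 0 ∨ m ∉ K) :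
    he.leafDirection b F G τ m = (wedge V₀ V₁ (m, τ.2)).2 := by
  have h1 : F τ m = m := by
    rcases hm with h0 | hm
    · obtain ⟨t, s⟩ := τ
      obtain rfl : t = 0 := h0
      exact h.straight.zero_left s hτ.2 m
    · exact h.straight.support_left τ hτ m hm
  rw [IsGlobalFrame.leafDirection, h1, h.direction_eq hτ hm]

theorem leafDirection_div_eq (h : IsModel he V₀ V₁ D δ K a b F G) {τ : ℝ × ℝ}
    (hτ : τ ∈ Ioo (-δ) δ ×ˢ Icc (0 : ℝ) 1) {m : M} (hm : τ.1 = 0 ∨ m ∉ K) :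
    he.leafDirection b F G τ m / he.leafDirection b F G (τ.1, 0) m =
      Circle.exp (τ.2 * angle V₀ V₁ m) := by
  rw [h.leafDirection_eq hτ hm, h.leafDirection_eq (τ := (τ.1, 0))
    ⟨hτ.1, left_mem_Icc.2 zero_le_one⟩ hm]
  simp [wedge]

theorem turning_eq (h : IsModel he V₀ V₁ D δ K a b F G) {τ : ℝ × ℝ}
    (hτ : τ ∈ Ioo (-δ) δ ×ˢ Icc (0 : ℝ) 1) {m : M} (hm : τ.1 = 0 ∨ m ∉ K) :
    he.turning b F G τ m = τ.2 * angle V₀ V₁ m := by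
  have h1 := abs_lt.1 (abs_mul_angle_lt h.never hτ.2 m)
  rw [IsGlobalFrame.turning, h.leafDirection_div_eq hτ hm, Circle.arg_exp h1.1 h1.2.le]

theorem exists_isTurning (h : IsModel he V₀ V₁ D δ K a b F G) (hδ : 0 < δ) :
    ∃ δ' > 0, δ' ≤ δ ∧ IsTurning he V₀ V₁ δ' b F G := by
  have z0 : (0 : ℝ) ∈ Icc (0 : ℝ) 1 := left_mem_Icc.2 zero_le_one
  have h00 : ∀ s ∈ Icc (0 : ℝ) 1, ((0 : ℝ), s) ∈ Ioo (-δ) δ ×ˢ Icc (0 : ℝ) 1 := fun s hs =>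
    ⟨⟨by linarith, hδ⟩, hs⟩
  have hq := h.contMDiffOn_leafDirection.div (h.contMDiffOn_leafDirection_const z0)
  have hre : SmoothFamily δ (fun τ m => 1 +
      ((he.leafDirection b F G τ m / he.leafDirection b F G (τ.1, 0) m : Circle) : ℂ).re) := by
    have := finrank_real_complex_fact'
    refine (SmoothFamily.const 1).add ?_
    exact (Complex.reCLM.contDiff.contMDiff (n := ∞)).comp_contMDiffOn
      ((contMDiff_coe_sphere (E := ℂ) (n := 1) (m := ∞)).comp_contMDiffOn hq)
  have hre0 : ∀ τ ∈ Ioo (-δ) δ ×ˢ Icc (0 : ℝ) 1, ∀ m, (τ.1 = 0 ∨ m ∉ K) → 0 < 1 +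
      ((he.leafDirection b F G τ m / he.leafDirection b F G (τ.1, 0) m : Circle) : ℂ).re := by
    intro τ hτ m hm
    rw [h.leafDirection_div_eq hτ hm, circle_one_add_re_pos_iff]
    exact circleExp_ne_neg_one (abs_mul_angle_lt h.never hτ.2 m)
  obtain ⟨δ₁, hδ₁, hδ₁δ, hpos₁⟩ := exists_forall_pos hδ h.isCompact hre
    (fun s hs m => hre0 (0, s) (h00 s hs) m (Or.inl rfl)) (fun τ hτ m hm => hre0 τ hτ m (Or.inr hm))
  have h₁ := h.mono hδ₁δ
  have hne : ∀ τ ∈ Ioo (-δ₁) δ₁ ×ˢ Icc (0 : ℝ) 1, ∀ m,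
      he.leafDirection b F G τ m / he.leafDirection b F G (τ.1, 0) m ≠ -1 := fun τ hτ m =>
    circle_one_add_re_pos_iff.1 (hpos₁ τ hτ m)
  have hsm : SmoothFamily δ₁ (he.turning b F G) := fun p hp =>
    contMDiffWithinAt_arg_div (h₁.contMDiffOn_leafDirection_const z0 p hp)
      (h₁.contMDiffOn_leafDirection p hp) (hne p.1 hp.1 p.2)
  have hang : SmoothFamily δ₁ (fun _ => angle V₀ V₁) :=
    SmoothFamily.of_contMDiff (contMDiff_angle h.smooth_bottom h.smooth_top h.never)
  have hpos0 : ∀ τ ∈ Ioo (-δ₁) δ₁ ×ˢ Icc (0 : ℝ) 1, ∀ m, (τ.1 = 0 ∨ m ∉ K) →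
      0 < dS (he.turning b F G) τ m * angle V₀ V₁ m := by
    intro τ hτ m hm
    have h2 : dS (he.turning b F G) τ m = angle V₀ V₁ m := by
      rw [dS, derivWithin_congr (f := fun s => s * angle V₀ V₁ m)
        (fun s hs => h₁.turning_eq (τ := (τ.1, s)) ⟨hτ.1, hs⟩ hm) (h₁.turning_eq hτ hm)]
      have h3 := ((hasDerivAt_id τ.2).mul_const (angle V₀ V₁ m)).hasDerivWithinAt.derivWithin
        (uniqueDiffOn_Icc zero_lt_one τ.2 hτ.2)
      simpa using h3
    rw [h2, ← pow_two]
    exact sq_pos_of_ne_zero (angle_ne_zero h.never m)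
  obtain ⟨δ₂, hδ₂, hδ₂δ, hpos₂⟩ := exists_forall_pos hδ₁ h.isCompact (hsm.dS.mul hang)
    (fun s hs m => hpos0 (0, s) ⟨⟨by linarith, hδ₁⟩, hs⟩ m (Or.inl rfl))
    (fun τ hτ m hm => hpos0 τ hτ m (Or.inr hm))
  have hs : Ioo (-δ₂) δ₂ ×ˢ Icc (0 : ℝ) 1 ⊆ Ioo (-δ₁) δ₁ ×ˢ Icc (0 : ℝ) 1 :=
    prod_mono_left (Ioo_subset_Ioo (by linarith) hδ₂δ)
  exact ⟨δ₂, hδ₂, hδ₂δ.trans hδ₁δ, fun τ hτ => hne τ (hs hτ), hsm.mono hδ₂δ, hpos₂⟩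

end IsModel

namespace IsTurning

variable {he : IsGlobalFrame e} {δ : ℝ} {b : Fin 3 → ℝ × ℝ → M → ℝ} {F G : ℝ × ℝ → M → M}

theorem turning_zero (t : ℝ) (m : M) : he.turning b F G (t, 0) m = 0 := by
  rw [IsGlobalFrame.turning, div_self', Circle.coe_one, Complex.arg_one]

theorem leafDirection_eq_mul_exp (τ : ℝ × ℝ) (m : M) : he.leafDirection b F G τ m =
    he.leafDirection b F G (τ.1, 0) m * Circle.exp (he.turning b F G τ m) := by
  rw [IsGlobalFrame.turning, Circle.exp_arg, mul_div_cancel]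

theorem hasDerivWithinAt (h : IsTurning he V₀ V₁ δ b F G) {t s : ℝ} (ht : t ∈ Ioo (-δ) δ)
    (hs : s ∈ Icc (0 : ℝ) 1) (m : M) :
    HasDerivWithinAt (fun s => he.turning b F G (t, s) m) (dS (he.turning b F G) (t, s) m)
      (Icc 0 1) s := by
  exact h.smooth.hasDerivWithinAt ht hs m

theorem strictMonoOn (h : IsTurning he V₀ V₁ δ b F G) {t : ℝ} (ht : t ∈ Ioo (-δ) δ) (m : M) :
    StrictMonoOn (fun s => he.turning b F G (t, s) m * angle V₀ V₁ m) (Icc 0 1) := by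
  have hd := fun s (hs : s ∈ Icc (0 : ℝ) 1) => (h.hasDerivWithinAt ht hs m).mul_const (angle V₀ V₁ m)
  refine strictMonoOn_of_deriv_pos (convex_Icc 0 1)
    (fun s hs => (hd s hs).continuousWithinAt) (fun s hs => ?_)
  rw [interior_Icc] at hs
  rw [((hd s (Ioo_subset_Icc_self hs)).hasDerivAt (Icc_mem_nhds hs.1 hs.2)).deriv]
  exact h.pos (t, s) ⟨ht, Ioo_subset_Icc_self hs⟩ m

theorem turning_one_mul_pos (h : IsTurning he V₀ V₁ δ b F G) {t : ℝ} (ht : t ∈ Ioo (-δ) δ) (m : M) :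
    0 < he.turning b F G (t, 1) m * angle V₀ V₁ m := by
  have := h.strictMonoOn ht m (left_mem_Icc.2 zero_le_one) (right_mem_Icc.2 zero_le_one) zero_lt_one
  simpa [turning_zero] using this

theorem turning_one_ne_zero (h : IsTurning he V₀ V₁ δ b F G) {t : ℝ} (ht : t ∈ Ioo (-δ) δ) (m : M) :
    he.turning b F G (t, 1) m ≠ 0 := fun h0 => by
  have := h.turning_one_mul_pos ht m
  simp [h0] at this

theorem neverCollinear (h : IsTurning he V₀ V₁ δ b F G) {t : ℝ} (ht : t ∈ Ioo (-δ) δ) :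
    NeverCollinear (he.leafDirection b F G (t, 0)) (he.leafDirection b F G (t, 1)) := by
  refine neverCollinear_iff.2 fun m => ⟨?_, h.turning_one_ne_zero ht m⟩
  have h1 := h.ne_neg_one (t, 1) ⟨ht, right_mem_Icc.2 zero_le_one⟩ m
  have h2 := Complex.mem_slitPlane_iff_arg.1 (circle_mem_slitPlane h1)
  rw [abs_lt]
  exact ⟨Complex.neg_pi_lt_arg _, (Complex.arg_le_pi _).lt_of_ne h2.1⟩

/-- The height in the straightened domain. -/
def _root_.Engel.IsGlobalFrame.newHeight (he : IsGlobalFrame e) (b : Fin 3 → ℝ × ℝ → M → ℝ)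
    (F G : ℝ × ℝ → M → M) (t : ℝ) (m : M) (s : ℝ) : ℝ :=
  he.turning b F G (t, s) m / he.turning b F G (t, 1) m

theorem wedge_newHeight (h : IsTurning he V₀ V₁ δ b F G) {t : ℝ} (ht : t ∈ Ioo (-δ) δ) (m : M)
    (s : ℝ) :
    wedge (he.leafDirection b F G (t, 0)) (he.leafDirection b F G (t, 1))
      (m, he.newHeight b F G t m s) = (m, he.leafDirection b F G (t, s) m) := by
  refine Prod.ext rfl ?_
  change he.leafDirection b F G (t, 0) m * Circle.exp
    (he.turning b F G (t, s) m / he.turning b F G (t, 1) m * he.turning b F G (t, 1) m) = _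
  rw [div_mul_cancel₀ _ (h.turning_one_ne_zero ht m), ← leafDirection_eq_mul_exp (t, s) m]

theorem newHeight_strictMonoOn (h : IsTurning he V₀ V₁ δ b F G) {t : ℝ} (ht : t ∈ Ioo (-δ) δ)
    (m : M) : StrictMonoOn (he.newHeight b F G t m) (Icc 0 1) := by
  intro s hs r hr hsr
  have h1 := h.strictMonoOn ht m hs hr hsr
  have h2 := h.turning_one_mul_pos ht m
  have h3 := h.turning_one_ne_zero ht m
  have h4 : angle V₀ V₁ m ≠ 0 := fun h0 => by simp [h0] at h2
  have h5 : ∀ s, he.newHeight b F G t m s = (he.turning b F G (t, s) m * angle V₀ V₁ m) /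
      (he.turning b F G (t, 1) m * angle V₀ V₁ m) := by
    intro s
    rw [mul_div_mul_right _ _ h4]
    rfl
  rw [h5, h5]
  exact div_lt_div_of_pos_right h1 h2

theorem newHeight_zero (t : ℝ) (m : M) : he.newHeight b F G t m 0 = 0 := by
  rw [IsGlobalFrame.newHeight, turning_zero, zero_div]

theorem newHeight_one (h : IsTurning he V₀ V₁ δ b F G) {t : ℝ} (ht : t ∈ Ioo (-δ) δ) (m : M) :
    he.newHeight b F G t m 1 = 1 := div_self (h.turning_one_ne_zero ht m)

theorem newHeight_mem (h : IsTurning he V₀ V₁ δ b F G) {t : ℝ} (ht : t ∈ Ioo (-δ) δ) (m : M) {s : ℝ}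
    (hs : s ∈ Icc (0 : ℝ) 1) : he.newHeight b F G t m s ∈ Icc (0 : ℝ) 1 := by
  have h1 := (h.newHeight_strictMonoOn ht m).monotoneOn
  constructor
  · rw [← newHeight_zero (he := he) (b := b) (F := F) (G := G) t m]
    exact h1 (left_mem_Icc.2 zero_le_one) hs hs.1
  · rw [← h.newHeight_one ht m]
    exact h1 hs (right_mem_Icc.2 zero_le_one) hs.2

theorem contMDiffOn_newHeight (h : IsTurning he V₀ V₁ δ b F G) {t : ℝ} (ht : t ∈ Ioo (-δ) δ) :
    ContMDiffOn (𝓘(ℝ, ℝ).prod (𝓡 3)) 𝓘(ℝ, ℝ) ∞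
      (fun p : ℝ × M => he.newHeight b F G t p.2 p.1) (Icc 0 1 ×ˢ univ) := by
  have h1 := h.smooth.contMDiffOn_slice_prod ht
  have h2 : ContMDiffOn (𝓘(ℝ, ℝ).prod (𝓡 3)) 𝓘(ℝ, ℝ) ∞
      (fun p : ℝ × M => he.turning b F G (t, 1) p.2) (Icc 0 1 ×ˢ univ) :=
    ContMDiffOn.comp (g := fun p : ℝ × M => he.turning b F G (t, p.1) p.2)
      (f := fun p : ℝ × M => ((1 : ℝ), p.2)) h1
      (contMDiff_const.prodMk contMDiff_snd).contMDiffOn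
      (fun p _ => ⟨right_mem_Icc.2 zero_le_one, trivial⟩)
  exact h1.div₀ h2 (fun p _ => h.turning_one_ne_zero ht p.2)

theorem exists_inverse (h : IsTurning he V₀ V₁ δ b F G) {t : ℝ} (ht : t ∈ Ioo (-δ) δ) :
    ∃ κ : M → ℝ → ℝ, ContMDiffOn (𝓘(ℝ, ℝ).prod (𝓡 3)) 𝓘(ℝ, ℝ) ∞
      (fun p : ℝ × M => κ p.2 p.1) (Icc 0 1 ×ˢ univ) ∧
      (∀ m, ∀ y ∈ Icc (0 : ℝ) 1, κ m y ∈ Icc (0 : ℝ) 1 ∧ he.newHeight b F G t m (κ m y) = y) ∧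
      ∀ m, ∀ s ∈ Icc (0 : ℝ) 1, κ m (he.newHeight b F G t m s) = s := by
  have hd : ∀ m, ∀ s ∈ Icc (0 : ℝ) 1, HasDerivWithinAt (he.newHeight b F G t m)
      (dS (he.turning b F G) (t, s) m / he.turning b F G (t, 1) m) (Icc 0 1) s := fun m s hs =>
    (h.hasDerivWithinAt ht hs m).div_const _
  have hex : ∀ m y, ∃ s, y ∈ Icc (0 : ℝ) 1 → s ∈ Icc (0 : ℝ) 1 ∧ he.newHeight b F G t m s = y := by
    intro m y
    by_cases hy : y ∈ Icc (0 : ℝ) 1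
    · have h1 := intermediate_value_Icc (zero_le_one (α := ℝ))
        (fun s hs => (hd m s hs).continuousWithinAt)
      rw [newHeight_zero, h.newHeight_one ht] at h1
      obtain ⟨s, hs, hsy⟩ := h1 hy
      exact ⟨s, fun _ => ⟨hs, hsy⟩⟩
    · exact ⟨0, fun h' => absurd h' hy⟩
  choose κ hκ using hex
  refine ⟨κ, contMDiffOn_inverse_Icc (h.contMDiffOn_newHeight ht) hκ (fun m s hs => ?_), hκ,
    fun m s hs => ?_⟩
  · rw [(hd m s hs).derivWithin (uniqueDiffOn_Icc zero_lt_one s hs)]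
    have h1 := h.pos (t, s) ⟨ht, hs⟩ m
    have h2 := h.turning_one_mul_pos ht m
    rcases lt_or_gt_of_ne (fun h0 => by simp [h0] at h2 : angle V₀ V₁ m ≠ 0) with h3 | h3
    · exact div_pos_of_neg_of_neg (by nlinarith) (by nlinarith)
    · exact div_pos (by nlinarith) (by nlinarith)
  · have h1 := hκ m _ (h.newHeight_mem ht m hs)
    exact (h.newHeight_strictMonoOn ht m).injOn h1.1 hs h1.2

end IsTurning

end Rotation
end Engel

namespace Engel

open Set Filter

section Iso

variable {M : Type*} [TopologicalSpace M] [ChartedSpace E3 M] [IsManifold (𝓡 3) ∞ M] [T2Space M]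
  {V₀ V₁ : M → Circle} {e : Fin 3 → ∀ m : M, TangentSpace (𝓡 3) m}

namespace IsModel

variable {he : IsGlobalFrame e} {D : ℝ → ∀ q : M × Circle, Submodule ℝ (TangentSpace SI q)} {δ : ℝ}
  {K : Set M} {a b : Fin 3 → ℝ × ℝ → M → ℝ} {F G : ℝ × ℝ → M → M}

theorem contMDiff_leafDirection (h : IsModel he V₀ V₁ D δ K a b F G) {t s : ℝ}
    (ht : t ∈ Ioo (-δ) δ) (hs : s ∈ Icc (0 : ℝ) 1) :
    ContMDiff (𝓡 3) (𝓡 1) ∞ (he.leafDirection b F G (t, s)) := by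
  rw [← contMDiffOn_univ]
  exact ContMDiffOn.comp (g := fun x : ℝ × M => he.leafDirection b F G (x.1, s) x.2)
    (f := fun m : M => (t, m)) (h.contMDiffOn_edge hs)
    (contMDiff_const.prodMk contMDiff_id).contMDiffOn (fun m _ => ⟨ht, trivial⟩)

theorem develop_leaf (h : IsModel he V₀ V₁ D δ K a b F G) (hT : IsTurning he V₀ V₁ δ b F G) {t s : ℝ}
    (ht : t ∈ Ioo (-δ) δ) (hs : s ∈ Icc (0 : ℝ) 1) (m : M) :
    he.develop V₀ V₁ b G t (wedge V₀ V₁ (F (t, s) m, s)) =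
      wedge (he.leafDirection b F G (t, 0)) (he.leafDirection b F G (t, 1))
        (m, he.newHeight b F G t m s) := by
  rw [h.develop_wedge t hs, hT.wedge_newHeight ht m s, h.straight.left_inv (t, s) ⟨ht, hs⟩]
  rfl

theorem exists_leaf (h : IsModel he V₀ V₁ D δ K a b F G) {t : ℝ}
    (ht : t ∈ Ioo (-δ) δ) {q : M × Circle} (hq : q ∈ domain V₀ V₁) :
    ∃ m, ∃ s ∈ Icc (0 : ℝ) 1, q = wedge V₀ V₁ (F (t, s) m, s) := by
  have hs := (mem_domain_iff h.never q).1 hq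
  refine ⟨G (t, height V₀ V₁ q) q.1, height V₀ V₁ q, hs, ?_⟩
  rw [h.straight.right_inv (t, height V₀ V₁ q) ⟨ht, hs⟩, wedge_height h.never]

theorem mem_iff_mfderivWithin_mem (h : IsModel he V₀ V₁ D δ K a b F G) {t : ℝ}
    (ht : t ∈ Ioo (-δ) δ) {q : M × Circle} (hq : q ∈ domain V₀ V₁) (v : TangentSpace SI q) :
    v ∈ D t q ↔ mfderivWithin SI SI (he.develop V₀ V₁ b G t) (domain V₀ V₁) q v ∈
      canonical (e 0) (e 1) (he.develop V₀ V₁ b G t q) := by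
  obtain ⟨m', s, hs, rfl⟩ : ∃ m, ∃ s ∈ Icc (0 : ℝ) 1, q = wedge V₀ V₁ (m, s) :=
    ⟨q.1, height V₀ V₁ q, (mem_domain_iff h.never q).1 hq, (wedge_height h.never q).symm⟩
  obtain ⟨w, -, hw, hwa⟩ := h.straight.exists_velocity
  refine (h.mem_plane_iff hwa (τ := (t, s)) ⟨ht, hs⟩ m' v).trans ?_
  obtain ⟨p', hp', hp⟩ := h.hasMFDerivWithinAt_develop_fst ht (hw t ht) hs m'
  have hu := uniqueMDiffOn_domain h.smooth_bottom h.smooth_top h.never _ hq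
  have h1 := ((h.contMDiffOn_develop_slice ht _ hq).mdifferentiableWithinAt
    (by simp)).hasMFDerivWithinAt
  have h2 := (hasMFDerivAt_fst (I := 𝓡 3) (I' := 𝓡 1)
    (he.develop V₀ V₁ b G t (wedge V₀ V₁ (m', s))))
  have h3 := (h2.comp_hasMFDerivWithinAt _ h1).mfderivWithin hu
  have h4 := hp'.mfderivWithin hu
  have h5 : dbase _ (mfderivWithin SI SI (he.develop V₀ V₁ b G t) (domain V₀ V₁)
      (wedge V₀ V₁ (m', s)) v) = p' v := by
    rw [dbase, h2.mfderiv]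
    exact DFunLike.congr_fun (h3.symm.trans h4) v
  rw [canonical, Submodule.mem_comap, Submodule.mem_span_singleton]
  have h6 : ∀ r : ℝ, (r • rayVec (e 0) (e 1) (he.develop V₀ V₁ b G t (wedge V₀ V₁ (m', s))) : E3) =
      r • rayVec (e 0) (e 1) (G (t, s) m', he.direction b G (t, s) m') := fun r =>
    congrArg (fun q => (r • rayVec (e 0) (e 1) q : E3)) (h.develop_wedge t hs m')
  refine exists_congr fun r => ?_
  rw [eq_comm]
  exact (congrArg₂ Eq (h6 r).symm ((hp v).symm.trans h5.symm)).to_iff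

theorem isDistIso_develop (h : IsModel he V₀ V₁ D δ K a b F G) (hT : IsTurning he V₀ V₁ δ b F G)
    {t : ℝ} (ht : t ∈ Ioo (-δ) δ) :
    IsDistIso SI (domain V₀ V₁) (D t)
      (domain (he.leafDirection b F G (t, 0)) (he.leafDirection b F G (t, 1)))
      (canonical (e 0) (e 1)) (he.develop V₀ V₁ b G t) := by
  have hW := hT.neverCollinear ht
  set W₀ := he.leafDirection b F G (t, 0) with hW₀
  set W₁ := he.leafDirection b F G (t, 1) with hW₁
  have hW₀s := h.contMDiff_leafDirection ht (left_mem_Icc.2 zero_le_one)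
  have hW₁s := h.contMDiff_leafDirection ht (right_mem_Icc.2 zero_le_one)
  rw [← hW₀] at hW₀s
  rw [← hW₁] at hW₁s
  obtain ⟨κ, hκs, hκ, hκ'⟩ := hT.exists_inverse ht
  have hmaps : MapsTo (he.develop V₀ V₁ b G t) (domain V₀ V₁) (domain W₀ W₁) := by
    intro q hq
    obtain ⟨m, s, hs, rfl⟩ := h.exists_leaf ht hq
    rw [h.develop_leaf hT ht hs]
    exact wedge_mem_domain hW (hT.newHeight_mem ht m hs)
  set χ : M × Circle → M × Circle := fun q =>
    wedge V₀ V₁ (F (t, κ q.1 (height W₀ W₁ q)) q.1, κ q.1 (height W₀ W₁ q)) with hχ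
  have hχleft : ∀ q ∈ domain V₀ V₁, χ (he.develop V₀ V₁ b G t q) = q := by
    intro q hq
    obtain ⟨m, s, hs, rfl⟩ := h.exists_leaf ht hq
    rw [h.develop_leaf hT ht hs, hχ]
    simp only
    rw [height_wedge hW (abs_mul_angle_lt hW (hT.newHeight_mem ht m hs) m)]
    simp only [wedge]
    rw [hκ' m s hs]
  have hχright : ∀ q ∈ domain W₀ W₁, he.develop V₀ V₁ b G t (χ q) = q := by
    intro q hq
    have h1 := hκ q.1 _ ((mem_domain_iff hW q).1 hq)
    rw [hχ]
    simp only
    rw [h.develop_leaf hT ht h1.1, h1.2, ← hW₀, ← hW₁, wedge_height hW]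
  have hχmaps : MapsTo χ (domain W₀ W₁) (domain V₀ V₁) := fun q hq =>
    wedge_mem_domain h.never (hκ q.1 _ ((mem_domain_iff hW q).1 hq)).1
  have hχs : ContMDiffOn SI SI ∞ χ (domain W₀ W₁) := by
    have h1 : ContMDiffOn SI 𝓘(ℝ, ℝ) ∞ (fun q : M × Circle => κ q.1 (height W₀ W₁ q))
        (domain W₀ W₁) := by
      refine ContMDiffOn.comp (g := fun p : ℝ × M => κ p.2 p.1)
        (f := fun q : M × Circle => (height W₀ W₁ q, q.1)) hκs (fun q hq => ?_)
        (fun q hq => ⟨(mem_domain_iff hW q).1 hq, trivial⟩)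
      exact (contMDiffAt_height hW₀s hW₁s hW
        (div_ne_neg_one_of_mem_domain hW hq)).contMDiffWithinAt.prodMk contMDiffWithinAt_fst
    have h2 : ContMDiffOn SI (𝓡 3) ∞
        (fun q : M × Circle => F (t, κ q.1 (height W₀ W₁ q)) q.1) (domain W₀ W₁) :=
      ContMDiffOn.comp (g := fun x : ℝ × M => F (t, x.1) x.2)
        (f := fun q : M × Circle => (κ q.1 (height W₀ W₁ q), q.1))
        (h.straight.smooth_left.contMDiffOn_slice ht) (h1.prodMk contMDiff_fst.contMDiffOn)
        (fun q hq => ⟨(hκ q.1 _ ((mem_domain_iff hW q).1 hq)).1, trivial⟩)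
    exact (contMDiff_wedge h.smooth_bottom h.smooth_top h.never).comp_contMDiffOn (h2.prodMk h1)
  refine ⟨hmaps, h.contMDiffOn_develop_slice ht, ⟨χ, hχmaps, hχs, hχleft, hχright⟩, fun q hq => ?_⟩
  have hsurj : Function.Surjective
      (mfderivWithin SI SI (he.develop V₀ V₁ b G t) (domain V₀ V₁) q) := by
    intro v
    have hq' := hmaps hq
    have h1 := ((h.contMDiffOn_develop_slice ht _ hq).mdifferentiableWithinAt
      (by simp)).hasMFDerivWithinAt
    have h2 := ((hχs _ hq').mdifferentiableWithinAt (by simp)).hasMFDerivWithinAt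
    rw [← hχleft q hq] at h1
    have h3 := (HasMFDerivWithinAt.comp _ h1 h2 hχmaps).congr_mono (f₁ := id)
      (fun q hq => (hχright q hq).symm) (hχright _ hq').symm subset_rfl
    have hu := uniqueMDiffOn_domain hW₀s hW₁s hW _ hq'
    have h4 := h3.mfderivWithin hu
    rw [mfderivWithin_id hu] at h4
    rw [hχleft q hq] at h4
    exact ⟨_, (DFunLike.congr_fun h4 v).symm⟩
  have h1 : D t q = (canonical (e 0) (e 1) (he.develop V₀ V₁ b G t q)).comap
      (mfderivWithin SI SI (he.develop V₀ V₁ b G t) (domain V₀ V₁) q :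
        TangentSpace SI q →ₗ[ℝ] TangentSpace SI (he.develop V₀ V₁ b G t q)) := by
    ext v
    exact h.mem_iff_mfderivWithin_mem ht hq v
  rw [h1]
  exact Submodule.map_comap_eq_of_surjective hsurj _

theorem develop_zero (h : IsModel he V₀ V₁ D δ K a b F G) (hδ : 0 < δ) {q : M × Circle}
    (hq : q ∈ domain V₀ V₁) : he.develop V₀ V₁ b G 0 q = q := by
  have hs := (mem_domain_iff h.never q).1 hq
  have h0 : ((0 : ℝ), height V₀ V₁ q) ∈ Ioo (-δ) δ ×ˢ Icc (0 : ℝ) 1 := ⟨⟨by linarith, hδ⟩, hs⟩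
  rw [IsGlobalFrame.develop, h.straight.zero_right _ hs, h.direction_eq h0 (Or.inl rfl)]
  exact wedge_height h.never q

theorem leafDirection_zero (h : IsModel he V₀ V₁ D δ K a b F G) (hδ : 0 < δ) :
    he.leafDirection b F G (0, 0) = V₀ := by
  funext m
  rw [h.leafDirection_eq ⟨⟨by linarith, hδ⟩, left_mem_Icc.2 zero_le_one⟩ (Or.inl rfl)]
  simp [wedge]

theorem leafDirection_zero_one (h : IsModel he V₀ V₁ D δ K a b F G) (hδ : 0 < δ) :
    he.leafDirection b F G (0, 1) = V₁ := by
  funext m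
  rw [h.leafDirection_eq ⟨⟨by linarith, hδ⟩, right_mem_Icc.2 zero_le_one⟩ (Or.inl rfl)]
  simp [wedge, exp_angle]

/-- If the planes are canonical along the bottom, where the isotopy is the identity, then the leaves
start in the direction of the bottom. -/
theorem leafDirection_bottom (h : IsModel he V₀ V₁ D δ K a b F G) {t : ℝ} (ht : t ∈ Ioo (-δ) δ)
    (hF : ∀ m, F (t, 0) m = m)
    (hD : ∀ m, D t (wedge V₀ V₁ (m, 0)) = canonical (e 0) (e 1) (wedge V₀ V₁ (m, 0))) :
    he.leafDirection b F G (t, 0) = V₀ := by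
  have hτ : (t, (0 : ℝ)) ∈ Ioo (-δ) δ ×ˢ Icc (0 : ℝ) 1 := ⟨ht, left_mem_Icc.2 zero_le_one⟩
  funext m
  have hG : G (t, 0) = id := by
    funext m
    have := h.straight.left_inv (t, 0) hτ m
    rwa [hF] at this
  have hb := fun k => (h.plane.eq_of_canonical (t, 0) hτ m (hD m) k).2
  have hu : ∀ k, he.pushComp b G k (t, 0) m = rayComp V₀ V₁ k (t, 0) m := by
    intro k
    rw [IsGlobalFrame.pushComp, hG, mfderiv_id]
    exact (he.coframe_sum (m := m) (fun j => b j (t, 0) m) k).trans (hb k)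
  rw [IsGlobalFrame.leafDirection, hF, IsGlobalFrame.direction, hu, hu]
  have h1 := toCircle_coe (wedge V₀ V₁ (m, 0)).2
  simp only [rayComp, Matrix.cons_val]
  rw [Complex.eta]
  rw [h1]
  simp [wedge]

theorem isPullback (h : IsModel he V₀ V₁ D δ K a b F G) {t : ℝ} (ht : t ∈ Ioo (-δ) δ)
    (hD : ∀ m, D t (wedge V₀ V₁ (m, 1)) = canonical (e 0) (e 1) (wedge V₀ V₁ (m, 1))) :
    IsPullback (e 0) (e 1) (F (t, 1)) V₁ (he.leafDirection b F G (t, 1)) := by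
  have hτ : (t, (1 : ℝ)) ∈ Ioo (-δ) δ ×ˢ Icc (0 : ℝ) 1 := ⟨ht, right_mem_Icc.2 zero_le_one⟩
  intro m
  obtain ⟨c, hc, h1⟩ := h.mfderiv_eq_smul_rayVec hτ (F (t, 1) m)
  have hb := fun k => (h.plane.eq_of_canonical (t, 1) hτ (F (t, 1) m) (hD _) k).2
  have h2 : ∑ k, b k (t, 1) (F (t, 1) m) • e k (F (t, 1) m) =
      rayVec (e 0) (e 1) (F (t, 1) m, V₁ (F (t, 1) m)) := by
    simp only [Fin.sum_univ_three, hb, rayComp, Matrix.cons_val, zero_smul, add_zero, rayVec]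
    simp [wedge, exp_angle]
  have h3 := h.straight.toIsIsotopy.mfderiv_right_inv hτ m
    (∑ k, b k (t, 1) (F (t, 1) m) • e k (F (t, 1) m))
  rw [h1] at h3
  have h4 : (rayVec (e 0) (e 1) (G (t, 1) (F (t, 1) m), he.direction b G (t, 1) (F (t, 1) m)) : E3)
      = rayVec (e 0) (e 1) (m, he.leafDirection b F G (t, 1) m) := by
    rw [h.straight.left_inv (t, 1) hτ]
    rfl
  refine ⟨c⁻¹, inv_pos.2 hc, ?_⟩
  rw [← h2, ← h3]
  have h5 : ∀ (L : TangentSpace (𝓡 3) m →L[ℝ] TangentSpace (𝓡 3) (F (t, 1) m)) (x y : E3), x = y →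
      L y = c⁻¹ • L ((c • x : E3)) := by
    rintro L x _ rfl
    rw [show L ((c • x : E3)) = c • L x from map_smul L c x, smul_smul, inv_mul_cancel₀ hc.ne', one_smul]
  exact h5 _ _ _ h4

end IsModel

end Iso
end Engel

namespace Engel

open Set Filter VectorField

section VectorSpace

variable {E : Type*} [NormedAddCommGroup E] [NormedSpace ℝ E]
  {E₁ : Type*} [NormedAddCommGroup E₁] [NormedSpace ℝ E₁] {ι : Type*} [Fintype ι]

/-- The image of a Lie bracket under the differential of a map, in terms of the components of the
images of the vector fields with respect to a frame. -/
theorem apply_lieBracketWithin_eq_sum {S : Set E} {x : E} (hS : UniqueDiffWithinAt ℝ S x)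
    (hx : x ∈ S) {p : E → E₁} {P : E → E →L[ℝ] E₁} {P' : E →L[ℝ] E →L[ℝ] E₁}
    (hp : HasFDerivWithinAt p (P x) S x) (hP : HasFDerivWithinAt P P' S x)
    (hsymm : ∀ v w, P' v w = P' w v) {A B : E → E} (hA : DifferentiableWithinAt ℝ A S x)
    (hB : DifferentiableWithinAt ℝ B S x) {f : ι → E₁ → E₁}
    (hf : ∀ k, DifferentiableAt ℝ (f k) (p x)) {a b : ι → E → ℝ}
    (ha : ∀ k, DifferentiableWithinAt ℝ (a k) S x) (hb : ∀ k, DifferentiableWithinAt ℝ (b k) S x)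
    (hPA : ∀ᶠ y in 𝓝[S] x, P y (A y) = ∑ k, a k y • f k (p y))
    (hPB : ∀ᶠ y in 𝓝[S] x, P y (B y) = ∑ k, b k y • f k (p y)) :
    P x (lieBracketWithin ℝ A B S x) =
      ∑ k, (fderivWithin ℝ (b k) S x (A x) - fderivWithin ℝ (a k) S x (B x)) • f k (p x) +
      ∑ i, ∑ j, (a i x * b j x) • lieBracket ℝ (f i) (f j) (p x) := by
  have key : ∀ (C : E → E) (c : ι → E → ℝ), DifferentiableWithinAt ℝ C S x →
      (∀ k, DifferentiableWithinAt ℝ (c k) S x) →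
      (∀ᶠ y in 𝓝[S] x, P y (C y) = ∑ k, c k y • f k (p y)) → ∀ v,
      P x (fderivWithin ℝ C S x v) + P' v (C x) =
        ∑ k, (c k x • fderiv ℝ (f k) (p x) (P x v) + fderivWithin ℝ (c k) S x v • f k (p x)) := by
    intro C c hC hc hPC v
    have h1 := hP.clm_apply hC.hasFDerivWithinAt
    have h2 : HasFDerivWithinAt (fun y => ∑ k, c k y • f k (p y)) _ S x :=
      HasFDerivWithinAt.fun_sum (u := Finset.univ) fun k _ => (hc k).hasFDerivWithinAt.smul
        ((hf k).hasFDerivAt.comp_hasFDerivWithinAt x hp)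
    have h3 := DFunLike.congr_fun (hS.eq h1 (h2.congr_of_eventuallyEq hPC
      (hPC.self_of_nhdsWithin hx))) v
    simpa using h3
  have hAB := key B b hB hb hPB (A x)
  have hBA := key A a hA ha hPA (B x)
  have hxA := hPA.self_of_nhdsWithin hx
  have hxB := hPB.self_of_nhdsWithin hx
  have hL : P x (lieBracketWithin ℝ A B S x) =
      ∑ k, (b k x • fderiv ℝ (f k) (p x) (P x (A x)) + fderivWithin ℝ (b k) S x (A x) • f k (p x)) -
      ∑ k, (a k x • fderiv ℝ (f k) (p x) (P x (B x)) +
        fderivWithin ℝ (a k) S x (B x) • f k (p x)) := by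
    rw [← hAB, ← hBA, lieBracketWithin, map_sub, hsymm (A x) (B x)]
    abel
  rw [hL, hxA, hxB]
  have h4 : ∑ i, ∑ j, (a i x * b j x) • lieBracket ℝ (f i) (f j) (p x) =
      ∑ k, b k x • fderiv ℝ (f k) (p x) (∑ i, a i x • f i (p x)) -
      ∑ k, a k x • fderiv ℝ (f k) (p x) (∑ j, b j x • f j (p x)) := by
    simp only [lieBracket, smul_sub, Finset.sum_sub_distrib, map_sum, map_smul, Finset.smul_sum,
      smul_smul]
    congr 1
    rw [Finset.sum_comm]
    simp only [mul_comm]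
  rw [h4]
  simp only [Finset.sum_add_distrib, sub_smul, Finset.sum_sub_distrib]
  abel

end VectorSpace

section Chart

variable {E : Type*} [NormedAddCommGroup E] [NormedSpace ℝ E] {H : Type*} [TopologicalSpace H]
  {I : ModelWithCorners ℝ E H} [I.Boundaryless] {N : Type*} [TopologicalSpace N] [ChartedSpace H N]
  [IsManifold I ∞ N]
  {E₁ : Type*} [NormedAddCommGroup E₁] [NormedSpace ℝ E₁]

theorem hasFDerivWithinAt_chart {S : Set N} {q : N} {y : E} (hy : y ∈ (extChartAt I q).target)
    {f : N → E₁} (hf : MDifferentiableWithinAt I 𝓘(ℝ, E₁) f S ((extChartAt I q).symm y)) :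
    ∃ L : E →L[ℝ] E₁, HasFDerivWithinAt (fun y => f ((extChartAt I q).symm y)) L
      ((extChartAt I q).target ∩ (extChartAt I q).symm ⁻¹' S) y ∧
      ∀ Z : ∀ p : N, TangentSpace I p, L (chartVec I q Z y) =
        mfderivWithin I 𝓘(ℝ, E₁) f S ((extChartAt I q).symm y) (Z ((extChartAt I q).symm y)) := by
  have h1 := hf.hasMFDerivWithinAt.comp y (hasMFDerivAt_chartSymm hy).hasMFDerivWithinAt
    (s := (extChartAt I q).target ∩ (extChartAt I q).symm ⁻¹' S) (fun y hy => hy.2)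
  refine ⟨_, hasMFDerivWithinAt_iff_hasFDerivWithinAt.1 h1, fun Z => ?_⟩
  have h2 := dchartSymm_dchart hy (Z ((extChartAt I q).symm y))
  exact congrArg (mfderivWithin I 𝓘(ℝ, E₁) f S ((extChartAt I q).symm y)) h2

theorem chart_preimage_eventuallyEq {S : Set N} {q : N} :
    ((extChartAt I q).symm ⁻¹' S : Set E) =ᶠ[𝓝 (extChartAt I q q)]
      ((extChartAt I q).target ∩ (extChartAt I q).symm ⁻¹' S : Set E) := by
  filter_upwards [extChartAt_target_mem_nhds (I := I) q] with y hy
  exact propext ⟨fun h => ⟨hy, h⟩, fun h => h.2⟩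

theorem mem_closure_interior_chart {S : Set N} {q : N} (hq : q ∈ closure (interior S)) :
    extChartAt I q q ∈
      closure (interior ((extChartAt I q).target ∩ (extChartAt I q).symm ⁻¹' S)) := by
  have h1 : q ∈ closure ((extChartAt I q).source ∩ interior S) :=
    (isOpen_extChartAt_source q).inter_closure ⟨mem_extChartAt_source q, hq⟩
  refine (((continuousOn_extChartAt q).continuousAt
    (extChartAt_source_mem_nhds (I := I) q)).continuousWithinAt (s :=
      (extChartAt I q).source ∩ interior S)).mem_closure h1 ?_
  rintro q' ⟨h2, h3⟩
  rw [mem_interior_iff_mem_nhds]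
  have h4 := extChartAt_target_mem_nhds' (I := I) ((extChartAt I q).map_source h2)
  have h5 := (continuousAt_extChartAt_symm'' (I := I) ((extChartAt I q).map_source h2))
  refine inter_mem h4 (h5.preimage_mem_nhds ?_)
  rw [(extChartAt I q).left_inv h2]
  exact mem_interior_iff_mem_nhds.1 h3

end Chart

section Bracket

variable {E : Type*} [NormedAddCommGroup E] [NormedSpace ℝ E] {H : Type*} [TopologicalSpace H]
  {I : ModelWithCorners ℝ E H} [I.Boundaryless] {N : Type*} [TopologicalSpace N] [ChartedSpace H N]
  [IsManifold I ∞ N]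
  {M : Type*} [TopologicalSpace M] [ChartedSpace E3 M] [IsManifold (𝓡 3) ∞ M]
  {e : Fin 3 → ∀ m : M, TangentSpace (𝓡 3) m}

/-- The derivative of a function on a subset of a manifold in the direction of a tangent vector. -/
def dir (I : ModelWithCorners ℝ E H) (S : Set N) (f : N → ℝ) (q : N) (v : TangentSpace I q) : ℝ :=
  mfderivWithin I 𝓘(ℝ, ℝ) f S q v

/-- The components of the image of a vector field under a map. -/
def IsGlobalFrame.pullComp (he : IsGlobalFrame e) (I : ModelWithCorners ℝ E H) (p : N → M)
    (S : Set N) (X : ∀ q : N, TangentSpace I q) (k : Fin 3) (q : N) : ℝ :=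
  he.coframe k (p q) (mfderivWithin I (𝓡 3) p S q (X q))

theorem IsGlobalFrame.contMDiffWithinAt_pullComp (he : IsGlobalFrame e) {S : Set N}
    (hS : UniqueMDiffOn I S) {q : N} (hq : q ∈ S) {p : N → M} (hp : ContMDiffOn I (𝓡 3) ∞ p S)
    {X : ∀ q : N, TangentSpace I q}
    (hX : ContMDiffWithinAt I I.tangent ∞ (fun q => (⟨q, X q⟩ : TangentBundle I N)) S q)
    (k : Fin 3) : ContMDiffWithinAt I 𝓘(ℝ, ℝ) ∞ (he.pullComp I p S X k) S q :=
  he.contMDiffWithinAt_coframe hq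
    (contMDiffWithinAt_mfderivWithin_apply hS hp hq (fun _ hq => hq) hX) k

theorem IsGlobalFrame.coframe_mlieBracketWithin (he : IsGlobalFrame e) {S : Set N}
    (hS : UniqueMDiffOn I S) {q : N} (hq : q ∈ S) (hcl : q ∈ closure (interior S)) {p : N → M}
    (hp : ContMDiffOn I (𝓡 3) ∞ p S) {X Y : ∀ q : N, TangentSpace I q}
    (hX : ContMDiffWithinAt I I.tangent ∞ (fun q => (⟨q, X q⟩ : TangentBundle I N)) S q)
    (hY : ContMDiffWithinAt I I.tangent ∞ (fun q => (⟨q, Y q⟩ : TangentBundle I N)) S q)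
    (k : Fin 3) :
    he.pullComp I p S (mlieBracketWithin I X Y S) k q =
      dir I S (he.pullComp I p S Y k) q (X q) -
      dir I S (he.pullComp I p S X k) q (Y q) +
      ∑ i, ∑ j, he.pullComp I p S X i q * he.pullComp I p S Y j q * he.structFun i j k (p q) := by
  set φ := extChartAt I q with hφ
  set ψ := extChartAt (𝓡 3) (p q) with hψ
  set S' := φ.target ∩ φ.symm ⁻¹' S with hS'
  set x := φ q with hx
  have hxq : φ.symm x = q := φ.left_inv (mem_extChartAt_source q)
  have hxt : x ∈ φ.target := φ.map_source (mem_extChartAt_source q)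
  have hxS : x ∈ S' := ⟨hxt, by rw [mem_preimage, hxq]; exact hq⟩
  have hu : UniqueDiffOn ℝ S' := hS.uniqueDiffOn_target_inter q
  set f : N → E3 := fun q' => ψ (p q') with hf
  set P : E → E →L[ℝ] E3 := fun y => fderivWithin ℝ (fun y => f (φ.symm y)) S' y with hP
  have hpc : ∀ᶠ y in 𝓝[S'] x, p (φ.symm y) ∈ ψ.source := by
    have h1 : ContinuousWithinAt (fun y => p (φ.symm y)) S' x := by
      refine ContinuousWithinAt.comp (t := S) (f := φ.symm) ?_
        (continuousAt_extChartAt_symm'' (I := I) hxt).continuousWithinAt (fun y hy => hy.2)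
      rw [hxq]
      exact (hp q hq).continuousWithinAt
    exact h1.preimage_mem_nhdsWithin (extChartAt_source_mem_nhds' (I := 𝓡 3) (by
      rw [hxq]
      exact mem_extChartAt_source (p q)))
  have hdf : ∀ q' ∈ S, p q' ∈ ψ.source → HasMFDerivWithinAt I 𝓘(ℝ, E3) f S q'
      ((dchart (𝓡 3) (p q) (p q')).comp (mfderivWithin I (𝓡 3) p S q')) := fun q' hq' hs =>
    (hasMFDerivAt_chart hs).comp_hasMFDerivWithinAt q'
      ((hp q' hq').mdifferentiableWithinAt (by simp)).hasMFDerivWithinAt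
  have hPZ : ∀ (Z : ∀ q : N, TangentSpace I q), ∀ y ∈ S', p (φ.symm y) ∈ ψ.source →
      P y (chartVec I q Z y) = ∑ k, he.pullComp I p S Z k (φ.symm y) •
        chartVec (𝓡 3) (p q) (e k) (f (φ.symm y)) := by
    intro Z y hy hs
    have h1 := hdf _ hy.2 hs
    obtain ⟨L, hL, hLZ⟩ := hasFDerivWithinAt_chart hy.1 h1.mdifferentiableWithinAt
    have h3 : P y = L := hL.fderivWithin (hu y hy)
    rw [h3, hLZ Z, h1.mfderivWithin (hS _ hy.2)]
    have h4 := he.sum_coframe (mfderivWithin I (𝓡 3) p S (φ.symm y) (Z (φ.symm y)))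
    have h5 : ψ.symm (f (φ.symm y)) = p (φ.symm y) := ψ.left_inv hs
    have h6 : ∀ k, chartVec (𝓡 3) (p q) (e k) (f (φ.symm y)) =
        dchart (𝓡 3) (p q) (p (φ.symm y)) (e k (p (φ.symm y))) := fun k =>
      congrArg (fun m => dchart (𝓡 3) (p q) m (e k m)) h5
    simp only [h6]
    refine (congrArg (dchart (𝓡 3) (p q) (p (φ.symm y))) h4.symm).trans ?_
    rw [map_sum]
    simp only [map_smul]
    rfl
  have hxs : p (φ.symm x) ∈ ψ.source := by
    rw [hxq]; exact mem_extChartAt_source (p q)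
  have hfs : ContDiffWithinAt ℝ ∞ (fun y => f (φ.symm y)) S' x := by
    have h1 : ContMDiffWithinAt I 𝓘(ℝ, E3) ∞ f S q :=
      (contMDiffAt_extChartAt (I := 𝓡 3)).comp_contMDiffWithinAt q (hp q hq)
    exact contMDiffWithinAt_iff_contDiffWithinAt.1 (ContMDiffWithinAt.comp_of_eq (f := φ.symm)
      (x := x) h1 (((contMDiffOn_extChartAt_symm (I := I) (n := ∞) q) _ hxt).mono
        inter_subset_left) (fun y hy => hy.2) hxq)
  have hsym := hfs.isSymmSndFDerivWithinAt (by
    rw [minSmoothness_of_isRCLikeNormedField]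
    exact WithTop.coe_le_coe.2 (le_top : (2 : ℕ∞) ≤ ⊤)) hu (mem_closure_interior_chart hcl) hxS
  have hPd : DifferentiableWithinAt ℝ P S' x :=
    (hfs.fderivWithin_right (m := ∞) hu (by simp) hxS).differentiableWithinAt (by simp)
  have hcomp : ∀ Z : ∀ q : N, TangentSpace I q,
      ContMDiffWithinAt I I.tangent ∞ (fun q => (⟨q, Z q⟩ : TangentBundle I N)) S q → ∀ k,
      DifferentiableWithinAt ℝ (fun y => he.pullComp I p S Z k (φ.symm y)) S' x ∧
      ∀ W : ∀ q : N, TangentSpace I q,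
        fderivWithin ℝ (fun y => he.pullComp I p S Z k (φ.symm y)) S' x (chartVec I q W x) =
          dir I S (he.pullComp I p S Z k) q (W q) := by
    intro Z hZ k
    have h1 := (he.contMDiffWithinAt_pullComp hS hq hp hZ k).mdifferentiableWithinAt (by simp)
    rw [← hxq] at h1
    obtain ⟨L, hL, hLZ⟩ := hasFDerivWithinAt_chart hxt h1
    refine ⟨hL.differentiableWithinAt, fun W => ?_⟩
    rw [hL.fderivWithin (hu x hxS), hLZ W]
    exact congrArg (fun q' => dir I S (he.pullComp I p S Z k) q' (W q')) hxq
  have hfield : ∀ Z : ∀ q : N, TangentSpace I q,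
      ContMDiffWithinAt I I.tangent ∞ (fun q => (⟨q, Z q⟩ : TangentBundle I N)) S q →
      DifferentiableWithinAt ℝ (chartVec I q Z) S' x := fun Z hZ =>
    ((Engel.ContMDiffWithinAt.chartVec hq hZ).mono inter_subset_right).differentiableWithinAt
      (by simp)
  have hex : f (φ.symm x) ∈ ψ.target := ψ.map_source hxs
  have hmain := apply_lieBracketWithin_eq_sum (hu x hxS) hxS
    (p := fun y => f (φ.symm y)) (P := P)
    (hfs.differentiableWithinAt (by simp)).hasFDerivWithinAt hPd.hasFDerivWithinAt
    (fun v w => hsym v w) (hfield X hX) (hfield Y hY) (f := fun k => chartVec (𝓡 3) (p q) (e k))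
    (fun k => (((he.smooth k).contDiffOn (p q)).contDiffAt
      (extChartAt_target_mem_nhds' (I := 𝓡 3) hex)).differentiableAt (by simp))
    (fun k => (hcomp X hX k).1) (fun k => (hcomp Y hY k).1)
    (by filter_upwards [hpc, self_mem_nhdsWithin] with y h1 h2 using hPZ X y h2 h1)
    (by filter_upwards [hpc, self_mem_nhdsWithin] with y h1 h2 using hPZ Y y h2 h1)
  have hbr : lieBracketWithin ℝ (chartVec I q X) (chartVec I q Y) S' x =
      chartVec I q (mlieBracketWithin I X Y S) x := by
    rw [chartVec_self, mlieBracketWithin_eq_chart]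
    exact (lieBracketWithin_congr_set (𝕜 := ℝ) chart_preimage_eventuallyEq).symm
  rw [hbr, hPZ _ x hxS hxs] at hmain
  have hbr2 : ∀ i j, lieBracket ℝ (chartVec (𝓡 3) (p q) (e i)) (chartVec (𝓡 3) (p q) (e j))
      (f (φ.symm x)) = ∑ k, he.structFun i j k (p q) •
        chartVec (𝓡 3) (p q) (e k) (f (φ.symm x)) := by
    intro i j
    rw [← chartVec_mlieBracket (he.smooth i) (he.smooth j) hex]
    have h5 : ψ.symm (f (φ.symm x)) = p q := (ψ.left_inv hxs).trans (congrArg p hxq)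
    have h6 : ∀ V : ∀ m : M, TangentSpace (𝓡 3) m, chartVec (𝓡 3) (p q) V (f (φ.symm x)) =
        dchart (𝓡 3) (p q) (p q) (V (p q)) := fun V =>
      congrArg (fun m => dchart (𝓡 3) (p q) m (V m)) h5
    simp only [h6]
    refine (congrArg (dchart (𝓡 3) (p q) (p q)) (he.sum_coframe
      (VectorField.mlieBracket (𝓡 3) (e i) (e j) (p q))).symm).trans ?_
    rw [map_sum]
    simp only [map_smul]
    rfl
  simp only [hbr2] at hmain
  have hli : ∀ c c' : Fin 3 → ℝ, ∑ k, c k • chartVec (𝓡 3) (p q) (e k) (f (φ.symm x)) =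
      ∑ k, c' k • chartVec (𝓡 3) (p q) (e k) (f (φ.symm x)) → ∀ k, c k = c' k := by
    intro c c' h k
    have h7 := (frameMap_apply (e := e) (p q) (f (φ.symm x)) c).trans
      (h.trans (frameMap_apply (e := e) (p q) (f (φ.symm x)) c').symm)
    obtain ⟨L, hL⟩ := he.exists_equiv hex
    rw [← hL] at h7
    exact congrFun (L.injective h7) k
  have hfin := hli _ (fun k => dir I S (he.pullComp I p S Y k) q (X q) -
      dir I S (he.pullComp I p S X k) q (Y q) +
      ∑ i, ∑ j, he.pullComp I p S X i q * he.pullComp I p S Y j q * he.structFun i j k (p q)) (by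
    rw [hmain]
    simp only [add_smul, Finset.sum_add_distrib]
    congr 1
    · refine Finset.sum_congr rfl fun k _ => ?_
      rw [(hcomp Y hY k).2 X, (hcomp X hX k).2 Y]
    · simp only [Finset.smul_sum, smul_smul, Finset.sum_smul, hxq]
      rw [Finset.sum_comm]
      exact (Finset.sum_congr rfl fun i _ => Finset.sum_comm).trans
        (Finset.sum_comm.trans (Finset.sum_congr rfl fun k _ => Finset.sum_comm))) k
  rw [hxq] at hfin
  exact hfin

end Bracket
end Engel

namespace Engel

open Set Filter VectorField

section

variable {E : Type*} [NormedAddCommGroup E] [NormedSpace ℝ E] {H : Type*} [TopologicalSpace H]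
  {I : ModelWithCorners ℝ E H} {N : Type*} [TopologicalSpace N] [ChartedSpace H N]

theorem dir_eq_zero {S : Set N} {f : N → ℝ} {q : N} (hq : q ∈ S) (hf : ∀ᶠ q' in 𝓝[S] q, f q' = 0)
    (v : TangentSpace I q) : dir I S f q v = 0 := by
  have h1 : f =ᶠ[𝓝[S] q] fun _ => (0 : ℝ) := hf
  have h2 := h1.mfderivWithin_eq (I := I) (I' := 𝓘(ℝ, ℝ)) (h1.self_of_nhdsWithin hq)
  rw [dir, h2, mfderivWithin_const]
  rfl

theorem dir_congr {S : Set N} {f g : N → ℝ} {q : N} (hq : q ∈ S) (hf : ∀ q' ∈ S, f q' = g q')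
    (v : TangentSpace I q) : dir I S f q v = dir I S g q v := by
  have h1 : f =ᶠ[𝓝[S] q] g := eventually_mem_nhdsWithin.mono hf
  have h2 := h1.mfderivWithin_eq (I := I) (I' := 𝓘(ℝ, ℝ)) (hf q hq)
  rw [dir, h2]
  rfl

theorem IsLocalSection.eventually {S : Set N} {D : ∀ q : N, Submodule ℝ (TangentSpace I q)} {q : N}
    {X : ∀ q : N, TangentSpace I q} [IsManifold I ∞ N] (h : IsLocalSection I S D q X) (hq : q ∈ S) :
    ContMDiffWithinAt I I.tangent ∞ (fun q => (⟨q, X q⟩ : TangentBundle I N)) S q ∧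
      ∀ᶠ q' in 𝓝[S] q, X q' ∈ D q' := by
  obtain ⟨U, hU, hX, hD⟩ := h
  refine ⟨(hX q ⟨mem_of_mem_nhds hU, hq⟩).mono_of_mem_nhdsWithin ?_, ?_⟩
  · exact inter_mem (mem_nhdsWithin_of_mem_nhds hU) self_mem_nhdsWithin
  · filter_upwards [mem_nhdsWithin_of_mem_nhds hU, self_mem_nhdsWithin] with q' h1 h2
      using hD q' ⟨h1, h2⟩

end

section CharLine

variable {E : Type*} [NormedAddCommGroup E] [NormedSpace ℝ E] [CompleteSpace E]
  {H : Type*} [TopologicalSpace H]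
  {I : ModelWithCorners ℝ E H} [I.Boundaryless] {N : Type*} [TopologicalSpace N] [ChartedSpace H N]
  [IsManifold I ∞ N]
  {M : Type*} [TopologicalSpace M] [ChartedSpace E3 M] [IsManifold (𝓡 3) ∞ M]
  {e : Fin 3 → ∀ m : M, TangentSpace (𝓡 3) m}

theorem IsGlobalFrame.sum_structFun_two (he : IsGlobalFrame e)
    (hc : ∀ m, he.structFun 0 1 2 m = 1) (m : M) {x y : Fin 3 → ℝ} (hx : x 2 = 0) (hy : y 2 = 0) :
    ∑ i, ∑ j, x i * y j * he.structFun i j 2 m = x 0 * y 1 - x 1 * y 0 := by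
  have h0 := he.structFun_swap 0 0 2 m
  have h1 := he.structFun_swap 1 1 2 m
  have h2 := he.structFun_swap 1 0 2 m
  rw [hc] at h2
  have h0' : he.structFun 0 0 2 m = 0 := by linarith
  have h1' : he.structFun 1 1 2 m = 0 := by linarith
  simp only [Fin.sum_univ_three, hx, hy, hc, h0', h1', h2]
  ring

/-- The characteristic line field of the pull-back of a line field `u` in a contact plane by a
submersion `p` with one-dimensional kernel is the kernel of the differential of `p`, provided that
`u` turns along the fibres of `p`. -/
theorem IsGlobalFrame.charLine_eq (he : IsGlobalFrame e) (hc : ∀ m, he.structFun 0 1 2 m = 1)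
    {S : Set N} (hS : UniqueMDiffOn I S) (hcl : ∀ q ∈ S, q ∈ closure (interior S)) {p : N → M}
    (hp : ContMDiffOn I (𝓡 3) ∞ p S) {D : ∀ q : N, Submodule ℝ (TangentSpace I q)}
    {u : Fin 3 → N → ℝ} (hu2 : ∀ q ∈ S, u 2 q = 0) {A B : ∀ q : N, TangentSpace I q}
    (hA : ContMDiffOn I I.tangent ∞ (fun q => (⟨q, A q⟩ : TangentBundle I N)) S)
    (hB : ContMDiffOn I I.tangent ∞ (fun q => (⟨q, B q⟩ : TangentBundle I N)) S)
    (hpA : ∀ q ∈ S, ∀ k, he.pullComp I p S A k q = 0)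
    (hpB : ∀ q ∈ S, ∀ k, he.pullComp I p S B k q = u k q)
    (hker : ∀ q ∈ S, ∀ v : TangentSpace I q, mfderivWithin I (𝓡 3) p S q v = 0 → ∃ c : ℝ, v = c • A q)
    (hD : ∀ q ∈ S, ∀ v : TangentSpace I q, v ∈ D q ↔
      ∃ r : ℝ, ∀ k, he.coframe k (p q) (mfderivWithin I (𝓡 3) p S q v) = r * u k q)
    (hΔ : ∀ q ∈ S, u 0 q * dir I S (u 1) q (A q) - u 1 q * dir I S (u 0) q (A q) ≠ 0)
    {q : N} (hq : q ∈ S) :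
    charLine I S D q = {v | mfderivWithin I (𝓡 3) p S q v = 0} := by
  have hbr := fun (q : N) (hq : q ∈ S) (X Y : ∀ q : N, TangentSpace I q)
    (hX : ContMDiffWithinAt I I.tangent ∞ (fun q => (⟨q, X q⟩ : TangentBundle I N)) S q)
    (hY : ContMDiffWithinAt I I.tangent ∞ (fun q => (⟨q, Y q⟩ : TangentBundle I N)) S q) =>
    he.coframe_mlieBracketWithin hS hq (hcl q hq) hp hX hY
  set η : ∀ (k : Fin 3) (q : N), TangentSpace I q → ℝ := fun k q v =>
    he.coframe k (p q) (mfderivWithin I (𝓡 3) p S q v) with hη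
  have hηp : ∀ X k q, he.pullComp I p S X k q = η k q (X q) := fun X k q => rfl
  have hηadd : ∀ k q (v w : TangentSpace I q), η k q (v + w) = η k q v + η k q w := by
    intro k q v w
    simp only [hη, map_add]
  have hηsmul : ∀ k q (c : ℝ) (v : TangentSpace I q), η k q (c • v) = c * η k q v := by
    intro k q c v
    simp only [hη, map_smul, smul_eq_mul]
  have hη0 : ∀ q (v : TangentSpace I q), mfderivWithin I (𝓡 3) p S q v = 0 ↔
      ∀ k, η k q v = 0 := by
    intro q v
    refine ⟨fun h k => by simp only [hη, h, map_zero], fun h => ?_⟩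
    rw [← he.sum_coframe (mfderivWithin I (𝓡 3) p S q v)]
    exact Finset.sum_eq_zero fun k _ => by
      rw [show he.coframe k (p q) (mfderivWithin I (𝓡 3) p S q v) = 0 from h k, zero_smul]
  set C : ∀ q : N, TangentSpace I q := mlieBracketWithin I A B S with hC
  have hA2 : ∀ q ∈ S, A q ∈ D q := fun q hq => (hD q hq _).2 ⟨0, fun k => by
    rw [zero_mul]; exact hpA q hq k⟩
  have hB2 : ∀ q ∈ S, B q ∈ D q := fun q hq => (hD q hq _).2 ⟨1, fun k => by
    rw [one_mul]; exact hpB q hq k⟩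
  have hA3 : ∀ q, IsLocalSection I S D q A := fun q =>
    ⟨univ, univ_mem, hA.mono inter_subset_right, fun q hq => hA2 q hq.2⟩
  have hB3 : ∀ q, IsLocalSection I S D q B := fun q =>
    ⟨univ, univ_mem, hB.mono inter_subset_right, fun q hq => hB2 q hq.2⟩
  have hCk : ∀ q ∈ S, ∀ k, η k q (C q) = dir I S (u k) q (A q) := by
    intro q hq k
    rw [← hηp, hC, hbr q hq A B (hA q hq) (hB q hq) k]
    simp only [hpA q hq, zero_mul, Finset.sum_const_zero]
    rw [dir_congr hq (fun q hq => hpB q hq k), dir_eq_zero (f := he.pullComp I p S A k) hq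
      (eventually_mem_nhdsWithin.mono fun q hq => hpA q hq k)]
    ring
  have hC2 : ∀ q ∈ S, η 2 q (C q) = 0 := fun q hq => by
    rw [hCk q hq, dir_eq_zero hq (eventually_mem_nhdsWithin.mono hu2)]
  have hD2 : ∀ q ∈ S, ∀ v ∈ D q, η 2 q v = 0 := by
    intro q hq v hv
    obtain ⟨r, hr⟩ := (hD q hq v).1 hv
    rw [show η 2 q v = _ from hr 2, hu2 q hq, mul_zero]
  have hbr2 : ∀ q ∈ S, ∀ X Y,
      ContMDiffWithinAt I I.tangent ∞ (fun q => (⟨q, X q⟩ : TangentBundle I N)) S q →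
      ContMDiffWithinAt I I.tangent ∞ (fun q => (⟨q, Y q⟩ : TangentBundle I N)) S q →
      (∀ᶠ q' in 𝓝[S] q, η 2 q' (X q') = 0) → (∀ᶠ q' in 𝓝[S] q, η 2 q' (Y q') = 0) →
      η 2 q (mlieBracketWithin I X Y S q) =
        η 0 q (X q) * η 1 q (Y q) - η 1 q (X q) * η 0 q (Y q) := by
    intro q hq X Y hX hY hX2 hY2
    rw [← hηp, hbr q hq X Y hX hY 2, dir_eq_zero (f := he.pullComp I p S X 2) hq hX2,
      dir_eq_zero (f := he.pullComp I p S Y 2) hq hY2,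
      he.sum_structFun_two hc (p q) (x := fun i => he.pullComp I p S X i q)
        (y := fun i => he.pullComp I p S Y i q) (hX2.self_of_nhdsWithin hq)
        (hY2.self_of_nhdsWithin hq)]
    simp only [hηp]
    ring
  have hsq : ∀ q ∈ S, ∀ v, v ∈ sq I S D q ↔ η 2 q v = 0 := by
    intro q hq v
    constructor
    · intro hv
      set W : Submodule ℝ (TangentSpace I q) :=
        { carrier := {v | η 2 q v = 0}
          add_mem' := fun {v w} hv hw => by
            rw [mem_ofPred_eq] at *
            rw [hηadd, hv, hw, add_zero]
          zero_mem' := by simp [hη]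
          smul_mem' := fun c v hv => by
            rw [mem_ofPred_eq] at *
            rw [hηsmul, hv, mul_zero] } with hW
      have hle : sq I S D q ≤ W := by
        refine sup_le (sup_le (hD2 q hq) (hD2 q hq)) (Submodule.span_le.2 ?_)
        rintro _ ⟨X, Y, hX, hY, rfl⟩
        obtain ⟨hX1, hX2⟩ := hX.eventually hq
        obtain ⟨hY1, hY2⟩ := hY.eventually hq
        obtain ⟨r, hr⟩ := (hD q hq _).1 (hX2.self_of_nhdsWithin hq)
        obtain ⟨r', hr'⟩ := (hD q hq _).1 (hY2.self_of_nhdsWithin hq)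
        have h3 := hbr2 q hq X Y hX1 hY1
          (by filter_upwards [hX2, self_mem_nhdsWithin] with q' h1 h2 using hD2 q' h2 _ h1)
          (by filter_upwards [hY2, self_mem_nhdsWithin] with q' h1 h2 using hD2 q' h2 _ h1)
        refine h3.trans ?_
        rw [show η 0 q (X q) = _ from hr 0, show η 1 q (X q) = _ from hr 1,
          show η 0 q (Y q) = _ from hr' 0, show η 1 q (Y q) = _ from hr' 1]
        ring
      exact hle hv
    · intro hv
      have hd := hΔ q hq
      rw [← hCk q hq, ← hCk q hq] at hd
      set d := u 0 q * η 1 q (C q) - u 1 q * η 0 q (C q) with hd'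
      set x := (η 0 q v * η 1 q (C q) - η 1 q v * η 0 q (C q)) / d with hx
      set y := (u 0 q * η 1 q v - u 1 q * η 0 q v) / d with hy
      have hBk : ∀ k, η k q (B q) = u k q := fun k => hpB q hq k
      obtain ⟨c, hcv⟩ := hker q hq (v + (-x) • B q + (-y) • C q) ((hη0 q _).2 (by
        intro k
        rw [hηadd, hηadd, hηsmul, hηsmul, hBk]
        fin_cases k
        · simp only [Fin.zero_eta]
          rw [hx, hy]
          field_simp
          rw [hd']
          ring
        · simp only [Fin.mk_one]
          rw [hx, hy]
          field_simp
          rw [hd']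
          ring
        · simp only [Fin.reduceFinMk]
          rw [hv, hu2 q hq, hC2 q hq]
          ring))
      have hv' : v = c • A q + x • B q + y • C q := by
        rw [← hcv]
        simp only [neg_smul]
        abel
      rw [hv']
      refine add_mem (add_mem ?_ ?_) ?_
      · exact Submodule.smul_mem _ _ ((le_sup_left.trans le_sup_left : D q ≤ sq I S D q) (hA2 q hq))
      · exact Submodule.smul_mem _ _ ((le_sup_left.trans le_sup_left : D q ≤ sq I S D q) (hB2 q hq))
      · exact Submodule.smul_mem _ _ ((le_sup_right : _ ≤ sq I S D q)
          (Submodule.subset_span ⟨A, B, hA3 q, hB3 q, rfl⟩))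
  ext v
  constructor
  · rintro ⟨X, hX, rfl, hXY⟩
    have hI2 : IsManifold I (minSmoothness ℝ 2) N := by
      rw [minSmoothness_of_isRCLikeNormedField]
      exact IsManifold.of_le (n := ∞) (WithTop.coe_le_coe.2 le_top)
    have hI3 : IsManifold I (minSmoothness ℝ 3) N := by
      rw [minSmoothness_of_isRCLikeNormedField]
      exact IsManifold.of_le (n := ∞) (WithTop.coe_le_coe.2 le_top)
    have hI4 : IsManifold I (∞ + 1) N := ‹IsManifold I ∞ N›
    have hCs : ContMDiffOn I I.tangent ∞ (fun q => (⟨q, C q⟩ : TangentBundle I N)) S := fun q hq =>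
      (hA q hq).mlieBracketWithin_vectorField (n := ∞) (m := ∞) (hB q hq) hS hq (by simp)
    have h1 := hXY C ⟨univ, univ_mem, hCs.mono inter_subset_right, fun q hq =>
      (hsq q hq.2 _).2 (hC2 q hq.2)⟩
    obtain ⟨hX1, hX2⟩ := hX.eventually hq
    obtain ⟨r, hr⟩ := (hD q hq _).1 (hX2.self_of_nhdsWithin hq)
    rw [hsq q hq, hbr2 q hq X C hX1 (hCs q hq)
      (by filter_upwards [hX2, self_mem_nhdsWithin] with q' h1 h2 using hD2 q' h2 _ h1)
      (eventually_mem_nhdsWithin.mono hC2), show η 0 q (X q) = _ from hr 0,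
      show η 1 q (X q) = _ from hr 1, hCk q hq, hCk q hq] at h1
    have h2 : r * (u 0 q * dir I S (u 1) q (A q) - u 1 q * dir I S (u 0) q (A q)) = 0 := by
      rw [← h1]; ring
    have h3 := (mul_eq_zero.1 h2).resolve_right (hΔ q hq)
    refine (hη0 q _).2 fun k => ?_
    rw [show η k q (X q) = _ from hr k, h3, zero_mul]
  · intro hv
    obtain ⟨c, rfl⟩ := hker q hq v hv
    have hcA : ContMDiffOn I I.tangent ∞ (fun q => (⟨q, c • A q⟩ : TangentBundle I N)) S :=
      ContMDiffOn.const_smul_section hA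
    have hcA0 : ∀ q ∈ S, ∀ k, η k q (c • A q) = 0 := fun q hq k => by
      rw [hηsmul, show η k q (A q) = 0 from hpA q hq k, mul_zero]
    refine ⟨fun q => c • A q, ⟨univ, univ_mem, hcA.mono inter_subset_right, fun q hq =>
      Submodule.smul_mem _ _ (hA2 q hq.2)⟩, rfl, fun Y hY => ?_⟩
    obtain ⟨hY1, hY2⟩ := hY.eventually hq
    rw [hsq q hq, hbr2 q hq (fun q => c • A q) Y (hcA q hq) hY1
      (eventually_mem_nhdsWithin.mono fun q hq => hcA0 q hq 2)
      (by filter_upwards [hY2, self_mem_nhdsWithin] with q' h1 h2 using (hsq q' h2 _).1 h1),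
      hcA0 q hq, hcA0 q hq]
    ring

end CharLine

end Engel

namespace Engel

open Set Filter

section Leaves

variable {M : Type*} [TopologicalSpace M] [ChartedSpace E3 M] [IsManifold (𝓡 3) ∞ M] [T2Space M]
  {V₀ V₁ : M → Circle} {e : Fin 3 → ∀ m : M, TangentSpace (𝓡 3) m}

/-- The vector field on the domain with horizontal components `c` and vertical component `r`. -/
def liftField (e : Fin 3 → ∀ m : M, TangentSpace (𝓡 3) m) (V₀ V₁ : M → Circle)
    (c : Fin 3 → ℝ × ℝ → M → ℝ) (t r : ℝ) (q : M × Circle) : TangentSpace SI q :=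
  dwedge V₀ V₁ q.1 (height V₀ V₁ q) (∑ k, c k (t, height V₀ V₁ q) q.1 • e k q.1) r

theorem liftField_wedge (hV : NeverCollinear V₀ V₁) (c : Fin 3 → ℝ × ℝ → M → ℝ) (t r : ℝ) {s : ℝ}
    (hs : s ∈ Icc (0 : ℝ) 1) (m : M) :
    liftField e V₀ V₁ c t r (wedge V₀ V₁ (m, s)) =
      dwedge V₀ V₁ m s (∑ k, c k (t, s) m • e k m) r :=
  congrArg (fun s' => (dwedge V₀ V₁ m s' (∑ k, c k (t, s') m • e k m) r :
    EuclideanSpace ℝ (Fin 3) × EuclideanSpace ℝ (Fin 1)))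
    (height_wedge hV (abs_mul_angle_lt hV hs m))

theorem dwedge_smul (m : M) (s c r : ℝ) (u : TangentSpace (𝓡 3) m) :
    dwedge V₀ V₁ m s (c • u) (c * r) = c • dwedge V₀ V₁ m s u r :=
  (mfderiv ((𝓡 3).prod 𝓘(ℝ, ℝ)) SI (wedge V₀ V₁) (m, s)).map_smul c ((u, r) : E3 × ℝ)

/-- The composition of a smooth family with the coordinates of the domain. -/
theorem SmoothFamily.contMDiffOn_domain {δ : ℝ} {g : ℝ × ℝ → M → ℝ} (hg : SmoothFamily δ g)
    (hV₀ : ContMDiff (𝓡 3) (𝓡 1) ∞ V₀) (hV₁ : ContMDiff (𝓡 3) (𝓡 1) ∞ V₁)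
    (hV : NeverCollinear V₀ V₁) {t : ℝ} (ht : t ∈ Ioo (-δ) δ) :
    ContMDiffOn SI 𝓘(ℝ, ℝ) ∞ (fun q : M × Circle => g (t, height V₀ V₁ q) q.1) (domain V₀ V₁) :=
  ContMDiffOn.comp (g := fun x : ℝ × M => g (t, x.1) x.2)
    (f := fun q : M × Circle => (height V₀ V₁ q, q.1)) (hg.contMDiffOn_slice_prod ht)
    (fun _ hq => (contMDiffAt_height hV₀ hV₁ hV
      (div_ne_neg_one_of_mem_domain hV hq)).contMDiffWithinAt.prodMk contMDiffWithinAt_fst)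
    (fun q hq => ⟨(mem_domain_iff hV q).1 hq, trivial⟩)

theorem contMDiffOn_liftField (he : IsGlobalFrame e) (hV₀ : ContMDiff (𝓡 3) (𝓡 1) ∞ V₀)
    (hV₁ : ContMDiff (𝓡 3) (𝓡 1) ∞ V₁) (hV : NeverCollinear V₀ V₁) {δ : ℝ}
    {c : Fin 3 → ℝ × ℝ → M → ℝ} (hc : ∀ k, SmoothFamily δ (c k)) {t : ℝ} (ht : t ∈ Ioo (-δ) δ)
    (r : ℝ) :
    ContMDiffOn SI SI.tangent ∞
      (fun q => (⟨q, liftField e V₀ V₁ c t r q⟩ : TangentBundle SI (M × Circle)))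
      (domain V₀ V₁) := by
  intro q hq
  have h1 : ContMDiffWithinAt SI (𝓡 3).tangent ∞ (fun q : M × Circle =>
      (⟨q.1, ∑ k, c k (t, height V₀ V₁ q) q.1 • e k q.1⟩ : TangentBundle (𝓡 3) M))
      (domain V₀ V₁) q :=
    he.contMDiffWithinAt_sum (g := fun q : M × Circle => q.1)
      (c := fun k q => c k (t, height V₀ V₁ q) q.1) hq contMDiffWithinAt_fst
      (fun k => (hc k).contMDiffOn_domain hV₀ hV₁ hV ht q hq)
  have h2 := contMDiffWithinAt_section_prod h1 (contMDiffWithinAt_section_vector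
    (contMDiffAt_height hV₀ hV₁ hV (div_ne_neg_one_of_mem_domain hV hq)).contMDiffWithinAt
    (contMDiffWithinAt_const (c := r)) hq)
  have h3 := contMDiffWithinAt_mfderiv_apply isOpen_univ (contMDiff_wedge hV₀ hV₁ hV).contMDiffOn hq
    (fun q _ => mem_univ _) h2
  have key : ∀ (q q' : M × Circle) (v : EuclideanSpace ℝ (Fin 3) × EuclideanSpace ℝ (Fin 1)),
      q' = q → (⟨q, v⟩ : TangentBundle SI (M × Circle)) = ⟨q', v⟩ := by
    rintro q _ v rfl
    rfl
  exact h3.congr (fun q' _ => key _ _ _ (wedge_height hV q')) (key _ _ _ (wedge_height hV q))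

namespace IsModel

variable {he : IsGlobalFrame e} {D : ℝ → ∀ q : M × Circle, Submodule ℝ (TangentSpace SI q)} {δ : ℝ}
  {K : Set M} {a b : Fin 3 → ℝ × ℝ → M → ℝ} {F G : ℝ × ℝ → M → M} {w : Fin 3 → ℝ × ℝ → M → ℝ}
  {t : ℝ}

theorem mfderivWithin_develop_fst (h : IsModel he V₀ V₁ D δ K a b F G) (ht : t ∈ Ioo (-δ) δ)
    (hw : ∀ m, IsSol (fun s m => ∑ k, w k (t, s) m • e k m) (fun s => F (t, s) m)) {s : ℝ}
    (hs : s ∈ Icc (0 : ℝ) 1) (m : M) (v : TangentSpace SI (wedge V₀ V₁ (m, s))) :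
    (mfderivWithin SI (𝓡 3) (fun q => (he.develop V₀ V₁ b G t q).1) (domain V₀ V₁)
      (wedge V₀ V₁ (m, s)) v : E3) = mfderiv (𝓡 3) (𝓡 3) (G (t, s)) m
        (dbaseAt V₀ V₁ m _ v - dheight V₀ V₁ _ v • ∑ k, w k (t, s) m • e k m) := by
  obtain ⟨p', hp', hp⟩ := h.hasMFDerivWithinAt_develop_fst ht hw hs m
  rw [← hp v]
  exact DFunLike.congr_fun (hp'.mfderivWithin
    (uniqueMDiffOn_domain h.smooth_bottom h.smooth_top h.never _ (wedge_mem_domain h.never hs))) v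

theorem mfderivWithin_develop_fst_liftField (h : IsModel he V₀ V₁ D δ K a b F G)
    (ht : t ∈ Ioo (-δ) δ)
    (hw : ∀ m, IsSol (fun s m => ∑ k, w k (t, s) m • e k m) (fun s => F (t, s) m)) {s : ℝ}
    (hs : s ∈ Icc (0 : ℝ) 1) (m : M) (c : Fin 3 → ℝ × ℝ → M → ℝ) (r : ℝ) :
    (mfderivWithin SI (𝓡 3) (fun q => (he.develop V₀ V₁ b G t q).1) (domain V₀ V₁)
      (wedge V₀ V₁ (m, s)) (liftField e V₀ V₁ c t r (wedge V₀ V₁ (m, s))) : E3) =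
      mfderiv (𝓡 3) (𝓡 3) (G (t, s)) m
        (∑ k, c k (t, s) m • e k m - r • ∑ k, w k (t, s) m • e k m) := by
  rw [liftField_wedge h.never c t r hs, h.mfderivWithin_develop_fst ht hw hs,
    dheight_dwedge h.smooth_bottom h.smooth_top h.never hs, dbaseAt,
    dbase_dwedge h.smooth_bottom h.smooth_top h.never]

/-- The leaf labelled by `m`, with its velocity. -/
theorem hasMFDerivWithinAt_leaf (h : IsModel he V₀ V₁ D δ K a b F G)
    (hw : ∀ m, IsSol (fun s m => ∑ k, w k (t, s) m • e k m) (fun s => F (t, s) m)) {s : ℝ}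
    (hs : s ∈ Icc (0 : ℝ) 1) (m : M) :
    HasMFDerivWithinAt 𝓘(ℝ, ℝ) SI (fun s => wedge V₀ V₁ (F (t, s) m, s)) (Icc 0 1) s
      ((1 : ℝ →L[ℝ] ℝ).smulRight (liftField e V₀ V₁ w t 1 (wedge V₀ V₁ (F (t, s) m, s)))) := by
  have h1 := (hw m s hs).prodMk ((hasMFDerivAt_id s).hasMFDerivWithinAt (s := Icc 0 1))
  have h2 := HasMFDerivAt.comp_hasMFDerivWithinAt (f := fun s => (F (t, s) m, s)) s
    ((contMDiff_wedge h.smooth_bottom h.smooth_top h.never).mdifferentiable (by simp)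
      (F (t, s) m, s)).hasMFDerivAt h1
  have key : ∀ (L : E3 × ℝ →L[ℝ] E3 × EuclideanSpace ℝ (Fin 1)) (u : E3),
      L.comp (((1 : ℝ →L[ℝ] ℝ).smulRight u).prod (ContinuousLinearMap.id ℝ ℝ)) =
        (1 : ℝ →L[ℝ] ℝ).smulRight (L (u, 1)) := by
    intro L u
    ext <;> simp
  refine h2.congr_mfderiv ((key _ _).trans ?_)
  exact congrArg (fun v : E3 × EuclideanSpace ℝ (Fin 1) => (1 : ℝ →L[ℝ] ℝ).smulRight v)
    (liftField_wedge h.never w t 1 hs (F (t, s) m)).symm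

/-- The turning of the directions along the leaves. -/
theorem turning_determinant (h : IsModel he V₀ V₁ D δ K a b F G) (hT : IsTurning he V₀ V₁ δ b F G)
    (ht : t ∈ Ioo (-δ) δ) {s : ℝ} (hs : s ∈ Icc (0 : ℝ) 1) (m : M) {u' : Fin 3 → ℝ}
    (hu : ∀ k, HasDerivWithinAt (fun s => he.pushComp b G k (t, s) (F (t, s) m)) (u' k)
      (Icc 0 1) s) :
    he.pushComp b G 0 (t, s) (F (t, s) m) * u' 1 - he.pushComp b G 1 (t, s) (F (t, s) m) * u' 0
      ≠ 0 := by
  set z := he.leafDirection b F G (t, 0) m with hz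
  set θ := fun s => he.turning b F G (t, s) m with hθ
  set θ' := dS (he.turning b F G) (t, s) m with hθ'
  set ν := Complex.arg (z : ℂ) with hν
  have hθd : HasDerivWithinAt θ θ' (Icc 0 1) s := hT.hasDerivWithinAt ht hs m
  have hθ0 : θ' ≠ 0 := fun h0 => by
    have := hT.pos (t, s) ⟨ht, hs⟩ m
    rw [← hθ', h0, zero_mul] at this
    exact lt_irrefl _ this
  set u : Fin 3 → ℝ → ℝ := fun k s => he.pushComp b G k (t, s) (F (t, s) m) with hu'
  have hpol : ∀ s, ∃ ρ : ℝ, ρ = ‖(⟨u 0 s, u 1 s⟩ : ℂ)‖ ∧ u 0 s = ρ * Real.cos (ν + θ s) ∧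
      u 1 s = ρ * Real.sin (ν + θ s) := by
    intro s
    have h1 := coe_toCircle (u := (⟨u 0 s, u 1 s⟩ : ℂ))
    have h2 : toCircle (⟨u 0 s, u 1 s⟩ : ℂ) = Circle.exp (ν + θ s) := by
      have h3 := IsTurning.leafDirection_eq_mul_exp (he := he) (b := b) (F := F) (G := G) (t, s) m
      rw [← hz, ← Circle.exp_arg z, ← Circle.exp_add] at h3
      exact h3
    rw [h2, Circle.coe_exp] at h1
    refine ⟨_, rfl, ?_, ?_⟩
    · have := congrArg Complex.re h1
      rw [Complex.re_ofReal_mul, Complex.exp_ofReal_mul_I_re] at this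
      exact this.symm
    · have := congrArg Complex.im h1
      rw [Complex.im_ofReal_mul, Complex.exp_ofReal_mul_I_im] at this
      exact this.symm
  have hzero : ∀ s, u 0 s * Real.sin (ν + θ s) - u 1 s * Real.cos (ν + θ s) = 0 := by
    intro s
    obtain ⟨ρ, -, h0, h1⟩ := hpol s
    rw [h0, h1]
    ring
  have hθν : HasDerivWithinAt (fun s => ν + θ s) θ' (Icc 0 1) s := hθd.const_add ν
  have hd := ((hu 0).mul hθν.sin).sub ((hu 1).mul hθν.cos)
  have hd0 : HasDerivWithinAt (fun _ : ℝ => (0 : ℝ)) 0 (Icc 0 1) s := hasDerivWithinAt_const _ _ _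
  have hun := uniqueDiffOn_Icc (zero_lt_one' ℝ) s hs
  have heq := hun.eq_deriv _ (hd0.congr (fun s _ => hzero s) (hzero s)) hd
  obtain ⟨ρ, hρ, h0, h1⟩ := hpol s
  have hρ0 : ρ ≠ 0 := by
    rw [hρ]
    exact norm_ne_zero_iff.2 (h.pushComp_ne_zero (τ := (t, s)) ⟨ht, hs⟩ (F (t, s) m))
  have hcs := Real.sin_sq_add_cos_sq (ν + θ s)
  intro hcon
  change u 0 s * u' 1 - u 1 s * u' 0 = 0 at hcon
  have heq' : u' 0 * Real.sin (ν + θ s) - u' 1 * Real.cos (ν + θ s) +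
      (u 0 s * Real.cos (ν + θ s) + u 1 s * Real.sin (ν + θ s)) * θ' = 0 := by
    rw [heq]
    simp only [hu']
    ring
  rw [h0, h1] at heq' hcon
  refine mul_ne_zero hρ0 hθ0 ?_
  have h5 : u' 1 * Real.cos (ν + θ s) - u' 0 * Real.sin (ν + θ s) = 0 :=
    (mul_eq_zero.1 (show ρ * (u' 1 * Real.cos (ν + θ s) - u' 0 * Real.sin (ν + θ s)) = 0 by
      linear_combination hcon)).resolve_left hρ0
  linear_combination heq' + h5 - ρ * θ' * hcs

theorem charLine_eq (h : IsModel he V₀ V₁ D δ K a b F G) (hT : IsTurning he V₀ V₁ δ b F G)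
    (hc : ∀ m, he.structFun 0 1 2 m = 1) (ht : t ∈ Ioo (-δ) δ) {q : M × Circle}
    (hq : q ∈ domain V₀ V₁) : charLine SI (domain V₀ V₁) (D t) q =
      {v | mfderivWithin SI (𝓡 3) (fun q => (he.develop V₀ V₁ b G t q).1) (domain V₀ V₁) q v = 0} := by
  have hS := uniqueMDiffOn_domain h.smooth_bottom h.smooth_top h.never
  obtain ⟨w, hws, hw, hwa⟩ := h.straight.exists_velocity
  set u : Fin 3 → M × Circle → ℝ := fun k q => he.pushComp b G k (t, height V₀ V₁ q) q.1 with hu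
  have hus : ∀ k, ContMDiffOn SI 𝓘(ℝ, ℝ) ∞ (u k) (domain V₀ V₁) := fun k =>
    (h.smooth_pushComp k).contMDiffOn_domain h.smooth_bottom h.smooth_top h.never ht
  have hpt : ∀ q ∈ domain V₀ V₁, ∃ m, ∃ s ∈ Icc (0 : ℝ) 1, q = wedge V₀ V₁ (m, s) := fun q hq =>
    ⟨q.1, height V₀ V₁ q, (mem_domain_iff h.never q).1 hq, (wedge_height h.never q).symm⟩
  have huw : ∀ k m, ∀ s ∈ Icc (0 : ℝ) 1, u k (wedge V₀ V₁ (m, s)) = he.pushComp b G k (t, s) m :=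
    fun k m s hs => by
      simp only [hu]
      rw [height_wedge h.never (abs_mul_angle_lt h.never hs m)]
      rfl
  have hfst : ContMDiffOn SI (𝓡 3) ∞ (fun q => (he.develop V₀ V₁ b G t q).1) (domain V₀ V₁) :=
    contMDiff_fst.comp_contMDiffOn (h.contMDiffOn_develop_slice ht)
  have hpw : ∀ m, ∀ s ∈ Icc (0 : ℝ) 1,
      (he.develop V₀ V₁ b G t (wedge V₀ V₁ (m, s))).1 = G (t, s) m := fun m s hs => by
    rw [h.develop_wedge t hs]
  refine he.charLine_eq hc hS
    (fun q hq => mem_closure_interior_domain h.smooth_bottom h.smooth_top h.never hq) hfst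
    (u := u) (A := liftField e V₀ V₁ w t 1) (B := liftField e V₀ V₁ b t 0) ?_
    (contMDiffOn_liftField he h.smooth_bottom h.smooth_top h.never hws ht 1)
    (contMDiffOn_liftField he h.smooth_bottom h.smooth_top h.never h.smooth_b ht 0)
    ?_ ?_ ?_ ?_ ?_ hq
  · intro q hq
    obtain ⟨m, s, hs, rfl⟩ := hpt q hq
    rw [huw 2 m s hs, h.pushComp_two ⟨ht, hs⟩]
  · intro q hq k
    obtain ⟨m, s, hs, rfl⟩ := hpt q hq
    rw [IsGlobalFrame.pullComp, h.mfderivWithin_develop_fst_liftField ht (hw t ht) hs m w 1, one_smul,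
      sub_self, map_zero]
    exact map_zero _
  · intro q hq k
    obtain ⟨m, s, hs, rfl⟩ := hpt q hq
    rw [IsGlobalFrame.pullComp, h.mfderivWithin_develop_fst_liftField ht (hw t ht) hs m b 0, zero_smul,
      sub_zero, huw k m s hs, hpw m s hs]
    rfl
  · intro q hq v hv
    obtain ⟨m, s, hs, rfl⟩ := hpt q hq
    rw [h.mfderivWithin_develop_fst ht (hw t ht) hs m v] at hv
    have h1 := sub_eq_zero.1 (h.mfderiv_injective ⟨ht, hs⟩ m hv)
    refine ⟨dheight V₀ V₁ _ v, ?_⟩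
    rw [liftField_wedge h.never w t 1 hs]
    have h2 := dwedge_dbase h.smooth_bottom h.smooth_top h.never hs v
    have h3 : dbase _ v = dheight V₀ V₁ _ v • ∑ k, w k (t, s) m • e k m := h1
    rw [h3] at h2
    refine h2.symm.trans ?_
    have h4 := dwedge_smul (V₀ := V₀) (V₁ := V₁) m s (dheight V₀ V₁ _ v) 1 (∑ k, w k (t, s) m • e k m)
    rw [mul_one] at h4
    exact h4
  · intro q hq v
    obtain ⟨m, s, hs, rfl⟩ := hpt q hq
    refine (h.mem_plane_iff hwa (τ := (t, s)) ⟨ht, hs⟩ m v).trans ?_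
    rw [← h.mfderivWithin_develop_fst ht (hw t ht) hs m v]
    obtain ⟨ρ, hρ, hray⟩ := h.mfderiv_eq_smul_rayVec (τ := (t, s)) ⟨ht, hs⟩ m
    have gen : ∀ (m' : M) (x y : TangentSpace (𝓡 3) m'), (∃ r : ℝ, x = r • y) ↔
        ∃ r : ℝ, ∀ k, he.coframe k m' x = r * he.coframe k m' (ρ • y) := by
      intro m' x y
      constructor
      · rintro ⟨r, rfl⟩
        refine ⟨r / ρ, fun k => ?_⟩
        rw [map_smul, map_smul, smul_eq_mul, smul_eq_mul, ← mul_assoc, div_mul_cancel₀ _ hρ.ne']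
      · rintro ⟨r, hr⟩
        refine ⟨r * ρ, he.ext_coframe fun k => ?_⟩
        rw [hr, mul_smul, map_smul _ r, smul_eq_mul]
    refine (gen (G (t, s) m) _ _).trans (exists_congr fun r => forall_congr' fun k => ?_)
    rw [huw k m s hs, hpw m s hs, ← hray]
    rfl
  · intro q hq
    obtain ⟨m, s, hs, rfl⟩ : ∃ m, ∃ s ∈ Icc (0 : ℝ) 1, q = wedge V₀ V₁ (F (t, s) m, s) :=
      h.exists_leaf ht hq
    have hl := h.hasMFDerivWithinAt_leaf (hw t ht) hs m
    have hmaps : MapsTo (fun s => wedge V₀ V₁ (F (t, s) m, s)) (Icc (0 : ℝ) 1) (domain V₀ V₁) :=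
      fun s hs => wedge_mem_domain h.never hs
    have hd : ∀ k, HasDerivWithinAt (fun s => he.pushComp b G k (t, s) (F (t, s) m))
        (dir SI (domain V₀ V₁) (u k) (wedge V₀ V₁ (F (t, s) m, s))
          (liftField e V₀ V₁ w t 1 (wedge V₀ V₁ (F (t, s) m, s)))) (Icc 0 1) s := by
      intro k
      have h1 := (((hus k) _ hq).mdifferentiableWithinAt (by simp)).hasMFDerivWithinAt
      have h2 : HasFDerivWithinAt (fun s => u k (wedge V₀ V₁ (F (t, s) m, s)))
          ((mfderivWithin SI 𝓘(ℝ, ℝ) (u k) (domain V₀ V₁) (wedge V₀ V₁ (F (t, s) m, s)) :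
            E3 × EuclideanSpace ℝ (Fin 1) →L[ℝ] ℝ).comp ((1 : ℝ →L[ℝ] ℝ).smulRight
            (liftField e V₀ V₁ w t 1 (wedge V₀ V₁ (F (t, s) m, s)) :
              E3 × EuclideanSpace ℝ (Fin 1)))) (Icc 0 1) s :=
        hasMFDerivWithinAt_iff_hasFDerivWithinAt.1 (HasMFDerivWithinAt.comp
          (g := u k) (f := fun s => wedge V₀ V₁ (F (t, s) m, s)) s h1 hl
          (show Icc (0 : ℝ) 1 ⊆ (fun s => wedge V₀ V₁ (F (t, s) m, s)) ⁻¹' domain V₀ V₁ from hmaps))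
      have h3 : ∀ (f : ℝ → ℝ) (L : E3 × EuclideanSpace ℝ (Fin 1) →L[ℝ] ℝ)
          (v : E3 × EuclideanSpace ℝ (Fin 1)),
          HasFDerivWithinAt f (L.comp ((1 : ℝ →L[ℝ] ℝ).smulRight v)) (Icc 0 1) s →
          HasDerivWithinAt f (L v) (Icc 0 1) s := fun f L v h =>
        h.hasDerivWithinAt.congr_deriv (by simp)
      exact (h3 _ _ _ h2).congr (fun s hs => (huw k (F (t, s) m) s hs).symm) (huw k _ s hs).symm
    rw [huw 0 _ s hs, huw 1 _ s hs]
    exact h.turning_determinant hT ht hs m (u' := fun k => dir SI (domain V₀ V₁) (u k)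
      (wedge V₀ V₁ (F (t, s) m, s)) (liftField e V₀ V₁ w t 1 (wedge V₀ V₁ (F (t, s) m, s)))) hd

end IsModel

end Leaves
end Engel

namespace Engel

open Set Filter

section Bottom

variable {M : Type*} [TopologicalSpace M] [ChartedSpace E3 M] [IsManifold (𝓡 3) ∞ M] [T2Space M]
  {V₀ V₁ : M → Circle} {e : Fin 3 → ∀ m : M, TangentSpace (𝓡 3) m}
  {he : IsGlobalFrame e} {D : ℝ → ∀ q : M × Circle, Submodule ℝ (TangentSpace SI q)} {δ : ℝ}
  {K : Set M} {a b : Fin 3 → ℝ × ℝ → M → ℝ} {F G : ℝ × ℝ → M → M} {t : ℝ}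

theorem wedge_zero (m : M) : wedge V₀ V₁ (m, 0) = (m, V₀ m) := by simp [wedge]

theorem wedge_one (m : M) : wedge V₀ V₁ (m, 1) = (m, V₁ m) := by simp [wedge, exp_angle]

namespace IsModel

theorem right_zero (h : IsModel he V₀ V₁ D δ K a b F G) (ht : t ∈ Ioo (-δ) δ)
    (hF : ∀ m, F (t, 0) m = m) (m : M) : G (t, 0) m = m := by
  have := h.straight.left_inv (t, 0) ⟨ht, left_mem_Icc.2 zero_le_one⟩ m
  rwa [hF] at this

theorem isBottomToTop (h : IsModel he V₀ V₁ D δ K a b F G) (hT : IsTurning he V₀ V₁ δ b F G)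
    (hc : ∀ m, he.structFun 0 1 2 m = 1) (ht : t ∈ Ioo (-δ) δ) (hF : ∀ m, F (t, 0) m = m) :
    IsBottomToTop V₀ V₁ (D t) (F (t, 1)) := by
  have hz : (0 : ℝ) ∈ Icc (0 : ℝ) 1 := left_mem_Icc.2 zero_le_one
  have ho : (1 : ℝ) ∈ Icc (0 : ℝ) 1 := right_mem_Icc.2 zero_le_one
  have hun : UniqueMDiffOn 𝓘(ℝ, ℝ) (Icc (0 : ℝ) 1) :=
    (uniqueDiffOn_Icc (zero_lt_one' ℝ)).uniqueMDiffOn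
  intro m m'
  constructor
  · rintro ⟨γ, hγ, hγ0, hγ1, hγD⟩
    set p : M × Circle → M := fun q => (he.develop V₀ V₁ b G t q).1 with hp
    have hps : ContMDiffOn SI (𝓡 3) ∞ p (domain V₀ V₁) :=
      contMDiff_fst.comp_contMDiffOn (h.contMDiffOn_develop_slice ht)
    have hsol : IsSol (fun _ _ => 0) (fun s => p (γ s)) := by
      intro s hs
      obtain ⟨h1, h2⟩ := hγD s hs
      rw [h.charLine_eq hT hc ht h1] at h2
      have h3 := HasMFDerivWithinAt.comp (g := p) (f := γ) s
        (((hps _ h1).mdifferentiableWithinAt (by simp)).hasMFDerivWithinAt)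
        (((hγ s hs).mdifferentiableWithinAt (by simp)).hasMFDerivWithinAt)
        (show Icc (0 : ℝ) 1 ⊆ γ ⁻¹' domain V₀ V₁ from fun s hs => (hγD s hs).1)
      have key : ∀ L : ℝ →L[ℝ] E3, L 1 = 0 → L = (1 : ℝ →L[ℝ] ℝ).smulRight 0 := by
        intro L hL
        ext1
        rw [hL]
        simp
      exact h3.congr_mfderiv (key _ h2)
    have hconst : IsSol (fun _ _ => 0) (fun _ : ℝ => p (γ 0)) := by
      intro s hs
      have h3 := (hasMFDerivAt_const (I := 𝓘(ℝ, ℝ)) (I' := 𝓡 3) (p (γ 0)) s).hasMFDerivWithinAt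
        (s := Icc (0 : ℝ) 1)
      have key : (0 : ℝ →L[ℝ] E3) = (1 : ℝ →L[ℝ] ℝ).smulRight 0 := by
        ext1
        simp
      exact h3.congr_mfderiv key
    have h4 : p (γ 1) = p (γ 0) := IsSol.eqOn (w := fun _ _ => 0) (fun x hx => contMDiffWithinAt_section_const
      contMDiffWithinAt_snd) hsol hconst hz rfl ho
    rw [hγ0, hγ1, ← wedge_zero (V₀ := V₀) (V₁ := V₁) m, ← wedge_one (V₀ := V₀) (V₁ := V₁) m'] at h4
    simp only [hp, h.develop_wedge t hz, h.develop_wedge t ho, h.right_zero ht hF] at h4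
    rw [← h4, h.straight.right_inv (t, 1) ⟨ht, ho⟩]
  · rintro rfl
    obtain ⟨w, -, hw, -⟩ := h.straight.exists_velocity
    refine ⟨fun s => wedge V₀ V₁ (F (t, s) m, s), ?_, ?_, ?_, fun s hs =>
      ⟨wedge_mem_domain h.never hs, ?_⟩⟩
    · refine (contMDiff_wedge h.smooth_bottom h.smooth_top h.never).comp_contMDiffOn
        (ContMDiffOn.prodMk ?_ contMDiffOn_id)
      exact ContMDiffOn.comp (g := fun x : ℝ × M => F (t, x.1) x.2) (f := fun s => (s, m))
        (h.straight.smooth_left.contMDiffOn_slice ht)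
        (contMDiff_id.prodMk contMDiff_const).contMDiffOn (fun s hs => ⟨hs, trivial⟩)
    · simp only [hF, wedge_zero]
    · simp only [wedge_one]
    · have h1 := (h.hasMFDerivWithinAt_leaf (hw t ht) hs m).mfderivWithin (hun s hs)
      rw [h1, h.charLine_eq hT hc ht (wedge_mem_domain h.never hs)]
      have h2 := h.mfderivWithin_develop_fst_liftField ht (hw t ht) hs (F (t, s) m) w 1
      rw [one_smul, sub_self, map_zero] at h2
      have key : ∀ (L : E3 × EuclideanSpace ℝ (Fin 1) →L[ℝ] E3)
          (v : E3 × EuclideanSpace ℝ (Fin 1)), L v = 0 →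
          L ((1 : ℝ →L[ℝ] ℝ).smulRight v 1) = 0 := by
        intro L v hv
        simp [hv]
      exact key _ _ h2

end IsModel

/-- The third component of the commutator vanishes on the bottom and on the top, if the planes are
canonical nearby. -/
theorem IsPlaneData.commutator_eq_zero (h : IsPlaneData he V₀ V₁ D δ K a b)
    (ht : t ∈ Ioo (-δ) δ) {s : ℝ} (hs : s ∈ Icc (0 : ℝ) 1)
    (hD : ∀ m, D t (wedge V₀ V₁ (m, s)) = canonical (e 0) (e 1) (wedge V₀ V₁ (m, s))) {m : M}
    (hm : ∀ᶠ s' in 𝓝[Icc 0 1] s,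
      D t (wedge V₀ V₁ (m, s')) = canonical (e 0) (e 1) (wedge V₀ V₁ (m, s'))) :
    b 2 (t, s) m = 0 ∧ he.commutator a b 2 (t, s) m = 0 := by
  have ha : ∀ k m, a k (t, s) m = 0 := fun k m => (h.eq_of_canonical (t, s) ⟨ht, hs⟩ m (hD m) k).1
  have hb : ∀ᶠ s' in 𝓝[Icc 0 1] s, b 2 (t, s') m = 0 := by
    filter_upwards [hm, self_mem_nhdsWithin] with s' h1 h2
    exact (h.eq_of_canonical (t, s') ⟨ht, h2⟩ m h1 2).2
  refine ⟨hb.self_of_nhdsWithin hs, ?_⟩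
  have h1 : dS (b 2) (t, s) m = 0 := by
    have h2 : (fun s' => b 2 (t, s') m) =ᶠ[𝓝[Icc 0 1] s] fun _ => 0 := hb
    rw [dS, h2.derivWithin_eq (h2.self_of_nhdsWithin hs)]
    simp
  rw [IsGlobalFrame.commutator, h1]
  simp only [ha, zero_mul, Finset.sum_const_zero, add_zero, zero_add, zero_sub]
  refine Finset.sum_eq_zero fun i _ => ?_
  rw [dX_const (c := 0) (fun m => ha 2 m), mul_zero, neg_zero]

end Bottom

section Existence

variable {M : Type*} [TopologicalSpace M] [ChartedSpace E3 M] [IsManifold (𝓡 3) ∞ M] [T2Space M]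
  {V₀ V₁ : M → Circle} {e : Fin 3 → ∀ m : M, TangentSpace (𝓡 3) m}

theorem exists_isModel (he : IsGlobalFrame e) (hc : ∀ m, he.structFun 0 1 2 m = 1)
    (hV₀ : ContMDiff (𝓡 3) (𝓡 1) ∞ V₀) (hV₁ : ContMDiff (𝓡 3) (𝓡 1) ∞ V₁)
    (hV : NeverCollinear V₀ V₁) {ε : ℝ} (hε : 0 < ε)
    {D : ℝ → ∀ q : M × Circle, Submodule ℝ (TangentSpace SI q)}
    (hD : IsSmoothFamily SI (Ioo (-ε) ε) (domain V₀ V₁) 2 D)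
    (hD0 : ∀ q ∈ domain V₀ V₁, D 0 q = canonical (e 0) (e 1) q) {K : Set M} (hK : IsCompact K)
    (hDK : ∀ t ∈ Ioo (-ε) ε, ∀ q ∈ domain V₀ V₁, q.1 ∉ K → D t q = canonical (e 0) (e 1) q) :
    ∃ δ > 0, δ ≤ ε ∧ ∃ a b F G, IsModel he V₀ V₁ D δ K a b F G ∧ IsTurning he V₀ V₁ δ b F G := by
  obtain ⟨δ₁, hδ₁, hδ₁ε, a, b, hab⟩ := exists_isPlaneData he hV₀ hV₁ hV hε hD hD0 hK hDK
  obtain ⟨δ₂, hδ₂, hδ₂₁, α, h0, h1, h2, hαb, hαC, -⟩ := exists_form he hV₀ hV₁ hV hδ₁ hK hab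
  obtain ⟨δ₃, hδ₃, hδ₃₂, f, g, hfg, hfs, hfα⟩ := exists_gray_isotopy he hc hδ₂ hK h0 h1 h2
  have hab₃ := hab.mono (hδ₃₂.trans hδ₂₁)
  have hs : Ioo (-δ₃) δ₃ ×ˢ Icc (0 : ℝ) 1 ⊆ Ioo (-δ₂) δ₂ ×ˢ Icc (0 : ℝ) 1 :=
    prod_mono_left (Ioo_subset_Ioo (by linarith) hδ₃₂)
  obtain ⟨δ₄, hδ₄, hδ₄₃, F, G, hFG, -⟩ := exists_isStraightening_of_isotopy he hc hδ₃ hK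
    (h0.mono hδ₃₂) (h1.mono hδ₃₂) h2 hab₃.small_left
    (fun k => hab₃.smooth_right hV₀ hV₁ hV k) hab₃.ne_zero (fun τ hτ => hαb τ (hs hτ))
    (fun τ hτ => hαC τ (hs hτ)) hfg hfs hfα
  have hmodel : IsModel he V₀ V₁ D δ₄ K a b F G := ⟨hV₀, hV₁, hV, hab₃.mono hδ₄₃, hFG, hK⟩
  obtain ⟨δ, hδ, hδ₄', hT⟩ := hmodel.exists_isTurning hδ₄
  exact ⟨δ, hδ, by linarith, a, b, F, G, hmodel.mono hδ₄', hT⟩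

/-- If the planes are canonical near the bottom and the top, then the isotopy can be chosen as the
identity at the bottom, and it then preserves the contact planes at the top. -/
theorem exists_isModel_of_canonical (he : IsGlobalFrame e) (hc : ∀ m, he.structFun 0 1 2 m = 1)
    (hV₀ : ContMDiff (𝓡 3) (𝓡 1) ∞ V₀) (hV₁ : ContMDiff (𝓡 3) (𝓡 1) ∞ V₁)
    (hV : NeverCollinear V₀ V₁) {ε : ℝ} (hε : 0 < ε)
    {D : ℝ → ∀ q : M × Circle, Submodule ℝ (TangentSpace SI q)}
    (hD : IsSmoothFamily SI (Ioo (-ε) ε) (domain V₀ V₁) 2 D)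
    (hD0 : ∀ q ∈ domain V₀ V₁, D 0 q = canonical (e 0) (e 1) q) {K : Set M} (hK : IsCompact K)
    (hDK : ∀ t ∈ Ioo (-ε) ε, ∀ q ∈ domain V₀ V₁, q.1 ∉ K → D t q = canonical (e 0) (e 1) q)
    {U : Set (M × Circle)} (hU : IsOpen U) (hUV : ∀ m, (m, V₀ m) ∈ U ∧ (m, V₁ m) ∈ U)
    (hDU : ∀ t ∈ Ioo (-ε) ε, ∀ q ∈ U ∩ domain V₀ V₁, D t q = canonical (e 0) (e 1) q) :
    ∃ δ > 0, δ ≤ ε ∧ ∃ a b F G, IsModel he V₀ V₁ D δ K a b F G ∧ IsTurning he V₀ V₁ δ b F G ∧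
      (∀ t ∈ Ioo (-δ) δ, ∀ m, F (t, 0) m = m) ∧
      ∀ t ∈ Ioo (-δ) δ, ∀ m (v : TangentSpace (𝓡 3) m),
        he.coframe 2 (F (t, 1) m) (mfderiv (𝓡 3) (𝓡 3) (F (t, 1)) m v) = 0 ↔
          he.coframe 2 m v = 0 := by
  have hz : (0 : ℝ) ∈ Icc (0 : ℝ) 1 := left_mem_Icc.2 zero_le_one
  have ho : (1 : ℝ) ∈ Icc (0 : ℝ) 1 := right_mem_Icc.2 zero_le_one
  obtain ⟨δ₁, hδ₁, hδ₁ε, a, b, hab⟩ := exists_isPlaneData he hV₀ hV₁ hV hε hD hD0 hK hDK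
  obtain ⟨δ₂, hδ₂, hδ₂₁, α, h0, h1, h2, hαb, hαC, hα0⟩ := exists_form he hV₀ hV₁ hV hδ₁ hK hab
  have hα : ∀ t ∈ Ioo (-δ₂) δ₂, ∀ s ∈ Icc (0 : ℝ) 1, (∀ m, wedge V₀ V₁ (m, s) ∈ U) →
      ∀ m, α 0 (t, s) m = 0 ∧ α 1 (t, s) m = 0 := by
    intro t ht s hs hsU m
    have ht₁ : t ∈ Ioo (-δ₁) δ₁ := Ioo_subset_Ioo (by linarith) hδ₂₁ ht
    have htε : t ∈ Ioo (-ε) ε := Ioo_subset_Ioo (by linarith) hδ₁ε ht₁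
    have h3 := hab.commutator_eq_zero ht₁ hs
      (fun m => hDU t htε _ ⟨hsU m, wedge_mem_domain hV hs⟩) (m := m) (by
        have h4 : Continuous fun s : ℝ => wedge V₀ V₁ (m, s) :=
          (contMDiff_wedge hV₀ hV₁ hV).continuous.comp (by fun_prop)
        filter_upwards [mem_nhdsWithin_of_mem_nhds ((hU.preimage h4).mem_nhds (hsU m)),
          self_mem_nhdsWithin] with s' h5 h6
        exact hDU t htε _ ⟨h5, wedge_mem_domain hV h6⟩)
    exact hα0 (t, s) ⟨ht, hs⟩ m h3.1 h3.2
  have hαz := fun t ht => hα t ht 0 hz fun m => by rw [wedge_zero]; exact (hUV m).1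
  have hαo := fun t ht => hα t ht 1 ho fun m => by rw [wedge_one]; exact (hUV m).2
  have hid : IsIsotopy δ₂ K (fun _ m => m) (fun _ m => m) :=
    ⟨contMDiffOn_snd, contMDiffOn_snd, fun _ _ _ => rfl, fun _ _ _ => rfl, fun _ _ _ => rfl,
      fun _ _ _ => rfl, fun _ _ _ _ => rfl, fun _ _ _ _ => rfl⟩
  have hab₂ := hab.mono hδ₂₁
  obtain ⟨δ₄, hδ₄, hδ₄₂, F, G, hFG, hF0, hFα⟩ := exists_isStraightening_of_isotopy he hc hδ₂ hK
    h0 h1 h2 hab₂.small_left (fun k => hab₂.smooth_right hV₀ hV₁ hV k) hab₂.ne_zero hαb hαC hid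
    (fun _ _ _ _ => rfl) (fun τ hτ m v => by
      rw [Fin.sum_univ_three, (hαz τ.1 hτ.1 m).1, (hαz τ.1 hτ.1 m).2, h2, zero_mul, zero_mul,
        one_mul, zero_add, zero_add]
      have h3 : mfderiv (𝓡 3) (𝓡 3) (fun m : M => m) m = ContinuousLinearMap.id ℝ _ := mfderiv_id
      rw [h3]
      rfl)
  have hmodel : IsModel he V₀ V₁ D δ₄ K a b F G := ⟨hV₀, hV₁, hV, hab₂.mono hδ₄₂, hFG, hK⟩
  obtain ⟨δ, hδ, hδ₄', hT⟩ := hmodel.exists_isTurning hδ₄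
  have hs : Ioo (-δ) δ ⊆ Ioo (-δ₄) δ₄ := Ioo_subset_Ioo (by linarith) hδ₄'
  refine ⟨δ, hδ, by linarith, a, b, F, G, hmodel.mono hδ₄', hT, fun t ht => hF0 t (hs ht),
    fun t ht m v => ?_⟩
  have h3 := hFα (t, 1) ⟨hs ht, ho⟩ m v
  have h4 := hαo t (Ioo_subset_Ioo (by linarith) hδ₄₂ (hs ht)) (F (t, 1) m)
  rw [Fin.sum_univ_three, h4.1, h4.2, h2, zero_mul, zero_mul, one_mul, zero_add, zero_add] at h3
  exact h3

variable {ξ : ∀ m : M, Submodule ℝ (TangentSpace (𝓡 3) m)} {X Y : ∀ m : M, TangentSpace (𝓡 3) m}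

theorem IsFrame.mem_iff_coframe (h : IsFrame ξ X Y) (he : IsGlobalFrame (contactFrame X Y)) {m : M}
    (v : TangentSpace (𝓡 3) m) : v ∈ ξ m ↔ he.coframe 2 m v = 0 := by
  rw [h.span_eq, Submodule.mem_span_pair]
  have h0 : X m = contactFrame X Y 0 m := rfl
  have h1 : Y m = contactFrame X Y 1 m := rfl
  constructor
  · rintro ⟨x, y, rfl⟩
    rw [map_add, map_smul, map_smul, h0, h1, he.coframe_frame, he.coframe_frame]
    simp
  · intro hv
    refine ⟨he.coframe 0 m v, he.coframe 1 m v, ?_⟩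
    conv_rhs => rw [← he.sum_coframe v, Fin.sum_univ_three, hv, zero_smul, add_zero]
    rfl

theorem IsIsotopy.isDistIso {δ : ℝ} {K : Set M} {F G : ℝ × ℝ → M → M} (h : IsIsotopy δ K F G)
    {τ : ℝ × ℝ} (hτ : τ ∈ Ioo (-δ) δ ×ˢ Icc (0 : ℝ) 1)
    (hξ : ∀ m (v : TangentSpace (𝓡 3) m), mfderiv (𝓡 3) (𝓡 3) (F τ) m v ∈ ξ (F τ m) ↔ v ∈ ξ m) :
    IsDistIso (𝓡 3) univ ξ univ ξ (F τ) := by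
  have hs : ∀ {f : ℝ × ℝ → M → M}, SmoothMapFamily δ f → ContMDiffOn (𝓡 3) (𝓡 3) ∞ (f τ) univ :=
    fun {f} hf => ContMDiffOn.comp (g := fun p : (ℝ × ℝ) × M => f p.1 p.2) (f := fun m => (τ, m)) hf
      (contMDiff_const.prodMk contMDiff_id).contMDiffOn (fun m _ => ⟨hτ, trivial⟩)
  refine ⟨mapsTo_univ _ _, hs h.smooth_left, ⟨G τ, mapsTo_univ _ _, hs h.smooth_right,
    fun m _ => h.left_inv τ hτ m, fun m _ => h.right_inv τ hτ m⟩, fun m _ => ?_⟩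
  rw [mfderivWithin_univ]
  have h1 : ξ m = (ξ (F τ m)).comap
      (mfderiv (𝓡 3) (𝓡 3) (F τ) m : TangentSpace (𝓡 3) m →ₗ[ℝ] TangentSpace (𝓡 3) (F τ m)) := by
    ext v
    exact (hξ m v).symm
  rw [h1]
  exact Submodule.map_comap_eq_of_surjective
    (fun v => ⟨_, h.mfderiv_right_inv hτ m v⟩) _

end Existence

end Engel

theorem theorem1 {M : Type*} [TopologicalSpace M] [T2Space M] [SecondCountableTopology M]
    [ChartedSpace (EuclideanSpace ℝ (Fin 3)) M] [IsManifold (𝓡 3) ∞ M]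
    (ξ : ∀ m : M, Submodule ℝ (TangentSpace (𝓡 3) m)) (hξ : Engel.IsContact (𝓡 3) ξ)
    (X Y : ∀ m : M, TangentSpace (𝓡 3) m) (hXY : Engel.IsFrame ξ X Y)
    (V₀ V₁ : M → Circle) (hV₀ : ContMDiff (𝓡 3) (𝓡 1) ∞ V₀) (hV₁ : ContMDiff (𝓡 3) (𝓡 1) ∞ V₁)
    (hV : Engel.NeverCollinear V₀ V₁)
    (ε : ℝ) (hε : 0 < ε)
    (D : ℝ → ∀ q : M × Circle, Submodule ℝ (TangentSpace Engel.SI q))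
    (hD : Engel.IsDeformation X Y V₀ V₁ ε D) :
    (∃ δ : ℝ, 0 < δ ∧ δ ≤ ε ∧
      ∃ (W₀ W₁ : ℝ → M → Circle) (ψ : ℝ → M × Circle → M × Circle),
        ContMDiffOn (𝓘(ℝ, ℝ).prod (𝓡 3)) (𝓡 1) ∞ (fun x : ℝ × M => W₀ x.1 x.2)
          (Set.Ioo (-δ) δ ×ˢ Set.univ) ∧
        ContMDiffOn (𝓘(ℝ, ℝ).prod (𝓡 3)) (𝓡 1) ∞ (fun x : ℝ × M => W₁ x.1 x.2)
          (Set.Ioo (-δ) δ ×ˢ Set.univ) ∧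
        ContMDiffOn (𝓘(ℝ, ℝ).prod Engel.SI) Engel.SI ∞ (fun x : ℝ × (M × Circle) => ψ x.1 x.2)
          (Set.Ioo (-δ) δ ×ˢ Engel.domain V₀ V₁) ∧
        W₀ 0 = V₀ ∧ W₁ 0 = V₁ ∧ (∀ q ∈ Engel.domain V₀ V₁, ψ 0 q = q) ∧
        ∀ t ∈ Set.Ioo (-δ) δ,
          Engel.NeverCollinear (W₀ t) (W₁ t) ∧
          Engel.IsDistIso Engel.SI (Engel.domain V₀ V₁) (D t)
            (Engel.domain (W₀ t) (W₁ t)) (Engel.canonical X Y) (ψ t)) ∧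
    ((∃ U : Set (M × Circle), IsOpen U ∧ (∀ m, (m, V₀ m) ∈ U ∧ (m, V₁ m) ∈ U) ∧
        ∀ t ∈ Set.Ioo (-ε) ε, ∀ q ∈ U ∩ Engel.domain V₀ V₁, D t q = Engel.canonical X Y q) →
      ∃ δ : ℝ, 0 < δ ∧ δ ≤ ε ∧
        ∃ (φ : ℝ → M → M) (W₁ : ℝ → M → Circle) (ψ : ℝ → M × Circle → M × Circle),
          ContMDiffOn (𝓘(ℝ, ℝ).prod (𝓡 3)) (𝓡 3) ∞ (fun x : ℝ × M => φ x.1 x.2)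
            (Set.Ioo (-δ) δ ×ˢ Set.univ) ∧
          ContMDiffOn (𝓘(ℝ, ℝ).prod (𝓡 3)) (𝓡 1) ∞ (fun x : ℝ × M => W₁ x.1 x.2)
            (Set.Ioo (-δ) δ ×ˢ Set.univ) ∧
          ContMDiffOn (𝓘(ℝ, ℝ).prod Engel.SI) Engel.SI ∞ (fun x : ℝ × (M × Circle) => ψ x.1 x.2)
            (Set.Ioo (-δ) δ ×ˢ Engel.domain V₀ V₁) ∧
          φ 0 = id ∧ W₁ 0 = V₁ ∧ (∀ q ∈ Engel.domain V₀ V₁, ψ 0 q = q) ∧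
          ∀ t ∈ Set.Ioo (-δ) δ,
            Engel.IsDistIso (𝓡 3) Set.univ ξ Set.univ ξ (φ t) ∧
            Engel.IsBottomToTop V₀ V₁ (D t) (φ t) ∧
            Engel.IsPullback X Y (φ t) V₁ (W₁ t) ∧
            Engel.NeverCollinear V₀ (W₁ t) ∧
            Engel.IsDistIso Engel.SI (Engel.domain V₀ V₁) (D t)
              (Engel.domain V₀ (W₁ t)) (Engel.canonical X Y) (ψ t)) := by
  have he := hXY.isGlobalFrame hξ
  have hc := fun m => hXY.structFun_eq_one hξ m
  obtain ⟨K', hK', hDK'⟩ := hD.compact_support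
  have hK : IsCompact (Prod.fst '' K') := hK'.image continuous_fst
  have hDK : ∀ t ∈ Set.Ioo (-ε) ε, ∀ q ∈ Engel.domain V₀ V₁, q.1 ∉ Prod.fst '' K' →
      D t q = Engel.canonical X Y q := fun t ht q hq hqK =>
    hDK' t ht q hq fun h => hqK ⟨q, h, rfl⟩
  have hz : (0 : ℝ) ∈ Set.Icc (0 : ℝ) 1 := Set.left_mem_Icc.2 zero_le_one
  have ho : (1 : ℝ) ∈ Set.Icc (0 : ℝ) 1 := Set.right_mem_Icc.2 zero_le_one
  refine ⟨?_, ?_⟩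
  · obtain ⟨δ, hδ, hδε, a, b, F, G, h, hT⟩ :=
      Engel.exists_isModel he hc hV₀ hV₁ hV hε hD.smooth hD.zero hK hDK
    exact ⟨δ, hδ, hδε, fun t => he.leafDirection b F G (t, 0), fun t => he.leafDirection b F G (t, 1),
      he.develop V₀ V₁ b G, h.contMDiffOn_edge hz, h.contMDiffOn_edge ho, h.contMDiffOn_develop,
      h.leafDirection_zero hδ, h.leafDirection_zero_one hδ, fun q hq => h.develop_zero hδ hq,
      fun t ht => ⟨hT.neverCollinear ht, h.isDistIso_develop hT ht⟩⟩
  · rintro ⟨U, hU, hUV, hDU⟩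
    obtain ⟨δ, hδ, hδε, a, b, F, G, h, hT, hF0, hFξ⟩ :=
      Engel.exists_isModel_of_canonical he hc hV₀ hV₁ hV hε hD.smooth hD.zero hK hDK hU hUV hDU
    have hcan : ∀ t ∈ Set.Ioo (-δ) δ, ∀ q ∈ U ∩ Engel.domain V₀ V₁, D t q = Engel.canonical X Y q :=
      fun t ht => hDU t (Set.Ioo_subset_Ioo (by linarith) hδε ht)
    have hbottom : ∀ t ∈ Set.Ioo (-δ) δ, he.leafDirection b F G (t, 0) = V₀ := fun t ht =>
      h.leafDirection_bottom ht (hF0 t ht) fun m => hcan t ht _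
        ⟨by rw [Engel.wedge_zero]; exact (hUV m).1, Engel.wedge_mem_domain hV hz⟩
    refine ⟨δ, hδ, hδε, fun t => F (t, 1), fun t => he.leafDirection b F G (t, 1),
      he.develop V₀ V₁ b G, ?_, h.contMDiffOn_edge ho, h.contMDiffOn_develop, ?_,
      h.leafDirection_zero_one hδ, fun q hq => h.develop_zero hδ hq, fun t ht => ⟨?_, ?_, ?_, ?_, ?_⟩⟩
    · refine ContMDiffOn.comp (g := fun p : (ℝ × ℝ) × M => F p.1 p.2)
        (f := fun x : ℝ × M => ((x.1, (1 : ℝ)), x.2)) h.straight.smooth_left ?_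
        (fun x hx => ⟨⟨hx.1, ho⟩, trivial⟩)
      refine ContMDiff.contMDiffOn (ContMDiff.prodMk ?_ contMDiff_snd)
      exact (contDiff_id.prodMk contDiff_const).contMDiff.comp contMDiff_fst
    · funext m
      exact h.straight.zero_left 1 ho m
    · exact h.straight.toIsIsotopy.isDistIso ⟨ht, ho⟩ fun m v => by
        rw [hXY.mem_iff_coframe he, hXY.mem_iff_coframe he]
        exact hFξ t ht m v
    · exact h.isBottomToTop hT hc ht (hF0 t ht)
    · exact h.isPullback ht fun m => hcan t ht _
        ⟨by rw [Engel.wedge_one]; exact (hUV m).2, Engel.wedge_mem_domain hV ho⟩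
    · have := hT.neverCollinear ht
      rwa [hbottom t ht] at this
    · have := h.isDistIso_develop hT ht
      rwa [hbottom t ht] at this

end
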